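/- **Setting.** Let $\mathcal I$ be the set of nontrivial bounded open intervals $I\subset\mathbb R$, $|I|:=\sup\{|x|:x\in I\}$, and let $\mathcal H$ be an infinite-dimensional separable complex Hilbert space. A *graded translation-covariant net* consists of von Neumann algebras $\mathcal A(I)\subset B(\mathcal H)$ $(I\in\mathcal I)$, increasing in $I$; a selfadjoint unitary $\Gamma\neq\mathbf 1$ with $\gamma(\mathcal A(I))=\mathcal A(I)$ for $\gamma:=\operatorname{Ad}\Gamma$; and a strongly continuous unitary representation $t\mapsto e^{itP}$ of $\mathbb R$ commuting with $\Gamma$, with $P\ge 0$, such that $\alpha_t:=\operatorname{Ad}e^{itP}$ satisfies $\alpha_t(\mathcal A(I))=\mathcal A(t+I)$ and $\lim_{t\to\infty}[x,\alpha_t(y)]=0$ in norm for $x,y\in\mathcal A(I)$, where $[\cdot,\cdot]$ is the graded commutator ($[x,y]=xy-(-1)^{|x||y|}yx$ on homogeneous elements). Let $\mathfrak A$ be the norm closure of $\bigcup_I\mathcal A(I)$. For a set $D\subset\mathfrak A$ put $D_I:=D\cap\mathcal A(I)$ and $D_c:=\bigcup_I D_I$. A *graded quantum dynamical system* $(\mathfrak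 A,\gamma,\alpha,\delta)$ is given by such a net and a linear map $\delta:\operatorname{dom}(\delta)\subset\mathfrak A\to\mathfrak A$ such that $\operatorname{dom}(\delta)$ is a unital $*$-subalgebra, globally invariant under all $\alpha_t$ and $\gamma$; $\alpha_t\delta=\delta\alpha_t$, $\gamma\delta=-\delta\gamma$, $\delta(x^*)=\gamma(\delta(x)^*)$ and $\delta(xy)=\delta(x)y+\gamma(x)\delta(y)$ on $\operatorname{dom}(\delta)$; and, for every $I$, the restriction $\delta_I$ of $\delta$ to $\operatorname{dom}(\delta)_I$ has image in $\mathcal A(I)$, is $\sigma$-weakly densely defined in $\mathcal A(I)$ and ($\sigma$-weakly)-($\sigma$-weakly) closed, and $C^\infty(\delta)_I$ is $\sigma$-weakly dense in $\mathcal A(I)$, where $C^\infty(\delta):=\bigcap_n\operatorname{dom}(\delta^n)$. A *super-KMS (sKMS) functional* is a linear functional $\phi$ on a unital $*$-subalgebra $\operatorname{dom}(\phi)\subset\mathfrak A$ such that: - $(S_0)$ $\phi(x^*)=\overline{\phi(x)}$; $\operatorname{dom}(\phi)_I$ is $\sigma$-weakly dense in $\mathcal A(I)$ for every $I$; $\operatorname{dom}(\phi)$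 is globally invariant under all $\alpha_t$ and $\gamma$. - $(S_1)$ For every $I$, the restriction of $\phi$ to $\operatorname{dom}(\phi)_I$ is bounded and extends to a $\sigma$-weakly continuous linear functional on $\mathcal A(I)$. - $(S_2)$ For all $x,y\in\operatorname{dom}(\phi)$ there is a continuous function $F$ on $\mathcal T^1=\{z\in\mathbb C:0\le\operatorname{Im}z\le1\}$, analytic in the interior, with $F(t)=\phi(x\alpha_t(y))$ and $F(t+i)=\phi(\alpha_t(y)\gamma(x))$ for $t\in\mathbb R$, and with $|F(z)|\le C_0(1+|\operatorname{Re}z|)^{p_0}$ on $\mathcal T^1$ for some $C_0>0$, $p_0\in2\mathbb N$. - $(S_3)$ $\phi(\mathbf 1)=1$. - $(S_4)$ $\delta(\operatorname{dom}(\delta)_I)\subset\operatorname{dom}(\phi)_I$ for every $I$, and $\phi\circ\delta=0$ on $C^\infty(\delta)_c$. - $(S_5)$ $C^\infty(\delta)_c\subset\operatorname{dom}(\phi)$, and for $x,z\in\operatorname{dom}(\phi)_c$, $y\in C^\infty(\delta)_c$ the function $t\mapsto\phi(x\alpha_t(y)z)$ is differentiable at $0$ with $-i\frac{d}{dt}\phi(x\alpha_t(y)z)|_{t=0}=\phi(x\delta^2(y)z)$.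 It is *local-exponentially bounded* if moreover $(S_6)$: there are $C_1,C_2>0$ with $|\phi(x)|\le C_1e^{C_2|I|^2}\|x\|$ for all $I\in\mathcal I$ and $x\in\operatorname{dom}(\phi)_I$. **Proposition.** Let $\phi$ be a local-exponentially bounded sKMS functional on a graded quantum dynamical system $(\mathfrak A,\gamma,\alpha,\delta)$, let $Q\in C^\infty(\delta)_c$ be selfadjoint and odd ($\gamma(Q)=-Q$), and let $r\in[0,1]$. Put $\delta_r:=\delta+r[Q,\cdot]$ on $\operatorname{dom}(\delta_r):=\operatorname{dom}(\delta)$, $a_r:=r\delta(Q)+r^2Q^2$, $\Delta_n:=\{s\in\mathbb R^n:0\le s_1\le\dots\le s_n\le1\}$, and, for $x\in\operatorname{dom}(\phi)_c$, $t\in\mathbb R$, $$\alpha^r_t(x):=\sum_{n\ge0}(it)^n\int_{\Delta_n}\operatorname{ad}(\alpha_{s_1t}(a_r))\cdots\operatorname{ad}(\alpha_{s_nt}(a_r))(\alpha_t(x))\,d^ns,\qquad \gamma^r_t(x):=\sum_{n\ge0}(it)^n\int_{\Delta_n}\alpha_{s_1t}(a_r)\cdots\alpha_{s_nt}(a_r)\,\alpha_t(x)\,d^ns,$$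 with $\operatorname{ad}(y)(z)=yz-zy$ and the integrals taken in the strong sense. Then: 1. These integrals exist as bounded operators and both series converge in norm. 2. For every $x\in\operatorname{dom}(\phi)_c$ we have $x\gamma^r_t(\mathbf 1)\in\operatorname{dom}(\phi)$ for all $t\in\mathbb R$, and $t\mapsto\phi(x\gamma^r_t(\mathbf 1))$ has exactly one extension to a continuous function on $\mathcal T^1$ that is analytic in the interior. Denote its value at $i$ by $\phi^r(x)=\phi(x\gamma^r_i(\mathbf 1))$. Then $\phi^r$ is a well-defined linear functional on $\operatorname{dom}(\phi^r):=\operatorname{dom}(\phi)_c$. 3. $\phi^r$ is locally bounded: for every $I$ there is $C$ with $|\phi^r(x)|\le C\|x\|$ for $x\in\operatorname{dom}(\phi^r)_I$. 4. $\phi^r$ is an sKMS functional for the perturbed system $(\mathfrak A,\gamma,\alpha^r,\delta_r)$, apart from the growth bound in $(S_2)$ and local normality $(S_1)$. That is, with $\phi,\alpha,\delta$ replaced by $\phi^r,\alpha^r,\delta_r$: $(S_0)$ holds; $(S_2)$ holds without the growth bound; $(S_3)$ holds, i.e. $\phi^r(\mathbf 1)=1$; $(S_4)$ holds in the form that $\phi^r\circ\delta_r=0$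 on $C^\infty(\delta_r)_c$ and that $\delta_r$ maps $\operatorname{dom}(\delta_r)_I\cap\operatorname{dom}(\phi^r)$ into $\operatorname{dom}(\phi^r)_I$ for every $I$ with $Q\in\mathcal A(I)$; and $(S_5)$ holds. Nothing is claimed for $\phi^r$ about the growth bound in $(S_2)$, the bound $(S_6)$, or local normality. -/

import Mathlib

open Set Filter Topology MeasureTheory

noncomputable section

/-- Bounded operators on `H`. -/
abbrev BoundedOp (H : Type*) [NormedAddCommGroup H] [InnerProductSpace ℂ H] : Type _ :=
  H →L[ℂ] H

/-- A nontrivial bounded open interval of the real line, given by its end points. -/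
structure BddInterval where
  lo : ℝ
  hi : ℝ
  lo_lt_hi : lo < hi

namespace BddInterval

/-- The set of points of the interval. -/
def toSet (I : BddInterval) : Set ℝ := Ioo I.lo I.hi

/-- The translated interval `t + I`. -/
def translate (t : ℝ) (I : BddInterval) : BddInterval :=
  ⟨t + I.lo, t + I.hi, by linarith [I.lo_lt_hi]⟩

/-- `|I| = sup {|x| : x ∈ I}`. -/
def size (I : BddInterval) : ℝ := sSup ((fun x : ℝ => |x|) '' I.toSet)

end BddInterval

section Operators

variable {H : Type*} [NormedAddCommGroup H] [InnerProductSpace ℂ H]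

/-- The `σ`-weak (ultraweak) topology on the bounded operators: the coarsest topology for which all
functionals `T ↦ ∑ₙ ⟪ξₙ, T ηₙ⟫`, with `ξ, η` square-summable sequences in `H`, are continuous. -/
@[reducible]
def sigmaWeak (H : Type*) [NormedAddCommGroup H] [InnerProductSpace ℂ H] :
    TopologicalSpace (BoundedOp H) :=
  ⨅ p : lp (fun _ : ℕ => H) 2 × lp (fun _ : ℕ => H) 2,
    TopologicalSpace.induced
      (fun T : BoundedOp H => ∑' n, inner ℂ (p.1 n) (T (p.2 n))) inferInstance

/-- `S` is `σ`-weakly dense in `A` (for `S ⊆ A`). -/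
def SigmaWeaklyDenseIn (S A : Set (BoundedOp H)) : Prop :=
  S ⊆ A ∧ A ⊆ @closure _ (sigmaWeak H) S

/-- `T` is the strong integral of the operator-valued function `f`:
`T ξ = ∫ f(s) ξ dμ(s)` for all vectors `ξ`. Such a `T` is unique. -/
def HasStrongIntegral {X : Type*} [MeasurableSpace X] (μ : Measure X) (f : X → BoundedOp H)
    (T : BoundedOp H) : Prop :=
  ∀ ξ : H, Integrable (fun s => f s ξ) μ ∧ T ξ = ∫ s, f s ξ ∂μ

/-- The graded commutator of `x` and `y` with respect to the grading `γ = Ad Γ`: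
`xy + ¼ (y-γ(y))(x-γ(x)) - ¼ (y+γ(y))(x-γ(x)) - ¼ (y-γ(y))(x+γ(x)) - ¼ (y+γ(y))(x+γ(x))`. -/
def gradedCommutator (Γ x y : BoundedOp H) : BoundedOp H :=
  x * y + (1 / 4 : ℂ) • ((y - Γ * y * Γ) * (x - Γ * x * Γ))
    - (1 / 4 : ℂ) • ((y + Γ * y * Γ) * (x - Γ * x * Γ))
    - (1 / 4 : ℂ) • ((y - Γ * y * Γ) * (x + Γ * x * Γ))
    - (1 / 4 : ℂ) • ((y + Γ * y * Γ) * (x + Γ * x * Γ))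

open Classical in
/-- The strong integral of `f` (by convention `0` if it does not exist). -/
def strongIntegral {X : Type*} [MeasurableSpace X] (μ : Measure X) (f : X → BoundedOp H) :
    BoundedOp H :=
  if h : ∃ T, HasStrongIntegral μ f T then h.choose else 0

open Classical in
/-- The value at `x` of a partially defined linear map (by convention `0` off its domain). -/
def pval {V W : Type*} [AddCommGroup V] [Module ℂ V] [AddCommGroup W] [Module ℂ W]
    (f : V →ₗ.[ℂ] W) (x : V) : W :=
  if h : x ∈ f.domain then f ⟨x, h⟩ else 0

/-- The domain of the `n`-th power of a partially defined linear map. -/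
def powDomain {V : Type*} [AddCommGroup V] [Module ℂ V] (f : V →ₗ.[ℂ] V) : ℕ → Set V
  | 0 => univ
  | n + 1 => {x | x ∈ f.domain ∧ pval f x ∈ powDomain f n}

/-- `C^∞(f) = ⋂ₙ dom(fⁿ)`. -/
def smoothDomain {V : Type*} [AddCommGroup V] [Module ℂ V] (f : V →ₗ.[ℂ] V) : Set V :=
  {x | ∀ n, x ∈ powDomain f n}

/-- The domain of a partially defined linear map on operators is a unital `*`-subalgebra. -/
structure IsUnitalStarDomain (D : Submodule ℂ (BoundedOp H)) [CompleteSpace H] : Prop where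
  one_mem : (1 : BoundedOp H) ∈ D
  mul_mem : ∀ x ∈ D, ∀ y ∈ D, x * y ∈ D
  star_mem : ∀ x ∈ D, star x ∈ D

/-- The simplex `Δₙ = {s ∈ ℝⁿ : 0 ≤ s₁ ≤ ⋯ ≤ sₙ ≤ 1}`. -/
def timeSimplex (n : ℕ) : Set (Fin n → ℝ) :=
  {s | Monotone s ∧ ∀ i, s i ∈ Icc (0 : ℝ) 1}

/-- For a binary operation `op`, the integrand
`s ↦ op (α_{s₁t}(a)) (op (α_{s₂t}(a)) (⋯ (op (α_{sₙt}(a)) (α_t(x)))))`. -/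
def dysonIntegrand (op : BoundedOp H → BoundedOp H → BoundedOp H)
    (α : ℝ → BoundedOp H → BoundedOp H) (a : BoundedOp H) (t : ℝ) (x : BoundedOp H) (n : ℕ)
    (s : Fin n → ℝ) : BoundedOp H :=
  (List.ofFn fun i => α (s i * t) a).foldr op (α t x)

/-- The `n`-th Dyson term `(it)ⁿ ∫_{Δₙ} op (α_{s₁t}(a)) (⋯ (α_t(x))) dⁿs`. -/
def dysonTerm (op : BoundedOp H → BoundedOp H → BoundedOp H)
    (α : ℝ → BoundedOp H → BoundedOp H) (a : BoundedOp H) (t : ℝ) (x : BoundedOp H) (n : ℕ) :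
    BoundedOp H :=
  (Complex.I * (t : ℂ)) ^ n •
    strongIntegral (volume.restrict (timeSimplex n)) (dysonIntegrand op α a t x n)

/-- All integrals in the Dyson series exist (as bounded operators) and the series converges in
norm. -/
def DysonConverges (op : BoundedOp H → BoundedOp H → BoundedOp H)
    (α : ℝ → BoundedOp H → BoundedOp H) (a : BoundedOp H) (t : ℝ) (x : BoundedOp H) : Prop :=
  (∀ n, ∃ T, HasStrongIntegral (volume.restrict (timeSimplex n)) (dysonIntegrand op α a t x n) T) ∧
    Summable (dysonTerm op α a t x)

/-- `α^a_t(x) = ∑ₙ (it)ⁿ ∫_{Δₙ} ad(α_{s₁t}(a)) ⋯ ad(α_{sₙt}(a)) (α_t(x)) dⁿs`, with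
`ad(y)(z) = yz - zy`. -/
def perturbedFlow (α : ℝ → BoundedOp H → BoundedOp H) (a : BoundedOp H) (t : ℝ)
    (x : BoundedOp H) : BoundedOp H :=
  ∑' n, dysonTerm (fun y z => y * z - z * y) α a t x n

/-- `γ^a_t(x) = ∑ₙ (it)ⁿ ∫_{Δₙ} α_{s₁t}(a) ⋯ α_{sₙt}(a) α_t(x) dⁿs`. -/
def perturbedCocycle (α : ℝ → BoundedOp H → BoundedOp H) (a : BoundedOp H) (t : ℝ)
    (x : BoundedOp H) : BoundedOp H :=
  ∑' n, dysonTerm (fun y z => y * z) α a t x n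

/-- `a_r = r δ(Q) + r² Q²`. -/
def perturbingElement (δ : BoundedOp H →ₗ.[ℂ] BoundedOp H) (Q : BoundedOp H) (r : ℝ) :
    BoundedOp H :=
  (r : ℂ) • pval δ Q + ((r : ℂ) ^ 2) • (Q * Q)

end Operators

/-- The closed strip `{z : 0 ≤ Im z ≤ 1}`. -/
def closedStrip : Set ℂ := {z | 0 ≤ z.im ∧ z.im ≤ 1}

/-- The open strip `{z : 0 < Im z < 1}`. -/
def openStrip : Set ℂ := {z | 0 < z.im ∧ z.im < 1}

/-- `F` is continuous on the closed strip and analytic in its interior. -/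
def IsStripAnalytic (F : ℂ → ℂ) : Prop :=
  ContinuousOn F closedStrip ∧ DifferentiableOn ℂ F openStrip

/-- `F` is an analytic continuation to the strip of the function `f` on the real line. -/
def IsStripContinuation (f : ℝ → ℂ) (F : ℂ → ℂ) : Prop :=
  IsStripAnalytic F ∧ ∀ t : ℝ, F t = f t

/-- A graded translation-covariant net of von Neumann algebras over the real line. -/
structure GradedNet (H : Type*) [NormedAddCommGroup H] [InnerProductSpace ℂ H]
    [CompleteSpace H] where
  /-- the local von Neumann algebras -/
  alg : BddInterval → VonNeumannAlgebra H
  isotony : ∀ I J : BddInterval, I.toSet ⊆ J.toSet →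
    (alg I : Set (BoundedOp H)) ⊆ (alg J : Set (BoundedOp H))
  /-- the grading unitary -/
  Γ : BoundedOp H
  Γ_selfAdjoint : IsSelfAdjoint Γ
  Γ_unitary : Γ ∈ unitary (BoundedOp H)
  Γ_ne_one : Γ ≠ 1
  grading : ∀ I, (fun x => Γ * x * Γ) '' (alg I : Set (BoundedOp H)) = alg I
  /-- the unitary representation `t ↦ e^{itP}` of the translation group -/
  U : ℝ → BoundedOp H
  U_unitary : ∀ t, U t ∈ unitary (BoundedOp H)
  U_zero : U 0 = 1
  U_add : ∀ s t, U (s + t) = U s * U t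
  U_continuous : ∀ ξ : H, Continuous fun t => U t ξ
  U_comm_Γ : ∀ t, U t * Γ = Γ * U t
  covariance : ∀ t I, (fun x => U t * x * U (-t)) '' (alg I : Set (BoundedOp H)) =
    alg (I.translate t)
  /-- the translations are asymptotically graded-abelian -/
  asymptotic : ∀ I, ∀ x ∈ alg I, ∀ y ∈ alg I,
    Tendsto (fun t : ℝ => gradedCommutator Γ x (U t * y * U (-t))) atTop (𝓝 0)
  /-- positivity of the generator `P`: `η = P ξ` means that `t ↦ U t ξ` has derivative `i η`
  at `0` -/
  positivity : ∀ ξ η : H, HasDerivAt (fun t => U t ξ) (Complex.I • η) 0 →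
    0 ≤ (inner ℂ ξ η : ℂ).re

namespace GradedNet

variable {H : Type*} [NormedAddCommGroup H] [InnerProductSpace ℂ H] [CompleteSpace H]
  (N : GradedNet H)

/-- The grading automorphism `γ = Ad Γ`. -/
def γ (x : BoundedOp H) : BoundedOp H := N.Γ * x * N.Γ

/-- The translation automorphisms `α_t = Ad e^{itP}`. -/
def α (t : ℝ) (x : BoundedOp H) : BoundedOp H := N.U t * x * N.U (-t)

/-- The union of the local algebras. -/
def localPart : Set (BoundedOp H) := ⋃ I, (N.alg I : Set (BoundedOp H))

/-- The quasi-local C*-algebra `𝔄` (the C*-inductive limit of the local algebras, realized on `H`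
as the norm closure of their union). -/
def quasiLocal : Set (BoundedOp H) := closure N.localPart

/-- The graded commutator `[x, y]`. -/
def gradedComm (x y : BoundedOp H) : BoundedOp H := gradedCommutator N.Γ x y

/-- `y ↦ [x, y]` as a linear map. -/
def gradedAd (x : BoundedOp H) : BoundedOp H →ₗ[ℂ] BoundedOp H where
  toFun y := N.gradedComm x y
  map_add' y z := by
    simp only [gradedComm, gradedCommutator, mul_add, add_mul, mul_sub, sub_mul, smul_add, smul_sub]
    abel
  map_smul' c y := by
    simp only [gradedComm, gradedCommutator, mul_add, add_mul, mul_sub, sub_mul, smul_add, smul_sub,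
      RingHom.id_apply, mul_smul_comm, smul_mul_assoc, smul_comm c (1 / 4 : ℂ)]

/-- `C^∞(δ)_c`: the localized elements of `C^∞(δ)`. -/
def smoothLocal (δ : BoundedOp H →ₗ.[ℂ] BoundedOp H) : Set (BoundedOp H) :=
  smoothDomain δ ∩ N.localPart

/-- `δ` is a superderivation on `𝔄` with respect to the grading and the translations; thus
`(𝔄, γ, α, δ)` is a graded quantum dynamical system. -/
structure IsSuperderivation (δ : BoundedOp H →ₗ.[ℂ] BoundedOp H) : Prop where
  domain_subset : (δ.domain : Set (BoundedOp H)) ⊆ N.quasiLocal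
  map_mem : ∀ x ∈ δ.domain, pval δ x ∈ N.quasiLocal
  domain_algebra : IsUnitalStarDomain δ.domain
  domain_α : ∀ t, N.α t '' (δ.domain : Set (BoundedOp H)) = δ.domain
  domain_γ : N.γ '' (δ.domain : Set (BoundedOp H)) = δ.domain
  comm_α : ∀ t, ∀ x ∈ δ.domain, N.α t (pval δ x) = pval δ (N.α t x)
  comm_γ : ∀ x ∈ δ.domain, N.γ (pval δ x) = -pval δ (N.γ x)
  map_star : ∀ x ∈ δ.domain, pval δ (star x) = N.γ (star (pval δ x))
  leibniz : ∀ x ∈ δ.domain, ∀ y ∈ δ.domain,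
    pval δ (x * y) = pval δ x * y + N.γ x * pval δ y
  /-- `δ_I` has image in `A(I)` -/
  map_local : ∀ I, ∀ x ∈ δ.domain, x ∈ N.alg I → pval δ x ∈ N.alg I
  /-- `δ_I` is `σ`-weakly densely defined -/
  domain_dense : ∀ I, SigmaWeaklyDenseIn ((δ.domain : Set (BoundedOp H)) ∩ N.alg I) (N.alg I)
  /-- the graph of `δ_I` is closed for the product of the `σ`-weak topologies -/
  closed : ∀ I, @IsClosed (BoundedOp H × BoundedOp H)
    (@instTopologicalSpaceProd _ _ (sigmaWeak H) (sigmaWeak H))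
    {p | p.1 ∈ δ.domain ∧ p.1 ∈ N.alg I ∧ p.2 = pval δ p.1}
  smooth_dense : ∀ I, SigmaWeaklyDenseIn (smoothDomain δ ∩ N.alg I) (N.alg I)

/-! ### The conditions on a functional `φ`, relative to a flow `α` and a partially defined map `δ`.
The flow is the translation flow or a perturbation of it. -/

/-- Domain properties: `dom(φ)` is a (unital) `*`-subalgebra of `𝔄`, locally `σ`-weakly dense and
globally invariant under the flow and the grading, and `φ` is Hermitian. -/
structure DomainProperties (α : ℝ → BoundedOp H → BoundedOp H) (φ : BoundedOp H →ₗ.[ℂ] ℂ) :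
    Prop where
  domain_subset : (φ.domain : Set (BoundedOp H)) ⊆ N.quasiLocal
  domain_algebra : IsUnitalStarDomain φ.domain
  hermitian : ∀ x ∈ φ.domain, pval φ (star x) = star (pval φ x)
  domain_dense : ∀ I, SigmaWeaklyDenseIn ((φ.domain : Set (BoundedOp H)) ∩ N.alg I) (N.alg I)
  domain_flow : ∀ t, α t '' (φ.domain : Set (BoundedOp H)) = φ.domain
  domain_γ : N.γ '' (φ.domain : Set (BoundedOp H)) = φ.domain

/-- Local boundedness: each restriction `φ_I` of `φ` to `dom(φ) ∩ A(I)` is bounded. -/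
def LocallyBounded (φ : BoundedOp H →ₗ.[ℂ] ℂ) : Prop :=
  ∀ I, ∃ C : ℝ, ∀ x ∈ φ.domain, x ∈ N.alg I → ‖pval φ x‖ ≤ C * ‖x‖

/-- Local normality: each `φ_I` is bounded and extends to a `σ`-weakly continuous linear functional
on `A(I)`. -/
def LocallyNormal (φ : BoundedOp H →ₗ.[ℂ] ℂ) : Prop :=
  N.LocallyBounded φ ∧
  ∀ I, ∃ ω : (N.alg I).toStarSubalgebra →ₗ[ℂ] ℂ,
    @Continuous _ _ (TopologicalSpace.induced
      (fun x : (N.alg I).toStarSubalgebra => (x : BoundedOp H)) (sigmaWeak H)) inferInstance ω ∧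
    ∀ x : (N.alg I).toStarSubalgebra, (x : BoundedOp H) ∈ φ.domain → ω x = pval φ x

/-- The boundary values required of the function `F_{x,y}` in the super-KMS property:
`F(t) = φ(x α_t(y))` and `F(t + i) = φ(α_t(y) γ(x))`. -/
def IsKMSFunction (α : ℝ → BoundedOp H → BoundedOp H) (φ : BoundedOp H →ₗ.[ℂ] ℂ)
    (x y : BoundedOp H) (F : ℂ → ℂ) : Prop :=
  IsStripAnalytic F ∧
  (∀ t : ℝ, F t = pval φ (x * α t y)) ∧
  ∀ t : ℝ, F (t + Complex.I) = pval φ (α t y * N.γ x)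

/-- The super-KMS property without a growth condition. -/
def SuperKMSWithoutGrowth (α : ℝ → BoundedOp H → BoundedOp H) (φ : BoundedOp H →ₗ.[ℂ] ℂ) : Prop :=
  ∀ x ∈ φ.domain, ∀ y ∈ φ.domain, ∃ F : ℂ → ℂ, N.IsKMSFunction α φ x y F

/-- The super-KMS property, with polynomial growth in the strip. -/
def SuperKMS (α : ℝ → BoundedOp H → BoundedOp H) (φ : BoundedOp H →ₗ.[ℂ] ℂ) : Prop :=
  ∀ x ∈ φ.domain, ∀ y ∈ φ.domain, ∃ F : ℂ → ℂ, N.IsKMSFunction α φ x y F ∧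
    ∃ C₀ > (0 : ℝ), ∃ p₀ : ℕ, Even p₀ ∧ ∀ z ∈ closedStrip, ‖F z‖ ≤ C₀ * (1 + |z.re|) ^ p₀

/-- `φ ∘ δ = 0` on `C^∞(δ)_c`. -/
def VanishesOnDerivatives (δ : BoundedOp H →ₗ.[ℂ] BoundedOp H) (φ : BoundedOp H →ₗ.[ℂ] ℂ) : Prop :=
  ∀ x ∈ N.smoothLocal δ, pval φ (pval δ x) = 0

/-- Derivation invariance: `im(δ_I) ⊆ dom(φ_I)` for all `I`, and `φ ∘ δ = 0` on `C^∞(δ)_c`. -/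
def DerivationInvariant (δ : BoundedOp H →ₗ.[ℂ] BoundedOp H) (φ : BoundedOp H →ₗ.[ℂ] ℂ) : Prop :=
  (∀ I, ∀ x ∈ δ.domain, x ∈ N.alg I → pval δ x ∈ φ.domain ∧ pval δ x ∈ N.alg I) ∧
    N.VanishesOnDerivatives δ φ

/-- Weak supersymmetry: for `x, z ∈ dom(φ)_c` and `y ∈ C^∞(δ)_c`, the function `t ↦ φ(x α_t(y) z)`
is defined and differentiable at `0`, with `-i d/dt φ(x α_t(y) z)|_{t=0} = φ(x δ²(y) z)`. That it is
defined is the first clause (take `x = z = 1`, `t = 0`). -/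
def WeakSupersymmetry (α : ℝ → BoundedOp H → BoundedOp H) (δ : BoundedOp H →ₗ.[ℂ] BoundedOp H)
    (φ : BoundedOp H →ₗ.[ℂ] ℂ) : Prop :=
  N.smoothLocal δ ⊆ φ.domain ∧
  ∀ x ∈ (φ.domain : Set (BoundedOp H)) ∩ N.localPart,
  ∀ z ∈ (φ.domain : Set (BoundedOp H)) ∩ N.localPart, ∀ y ∈ N.smoothLocal δ,
    HasDerivAt (fun t : ℝ => pval φ (x * α t y * z))
      (Complex.I * pval φ (x * pval δ (pval δ y) * z)) 0

/-- Local-exponential boundedness. -/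
def LocallyExpBounded (φ : BoundedOp H →ₗ.[ℂ] ℂ) : Prop :=
  ∃ C₁ > (0 : ℝ), ∃ C₂ > (0 : ℝ), ∀ I, ∀ x ∈ φ.domain, x ∈ N.alg I →
    ‖pval φ x‖ ≤ C₁ * Real.exp (C₂ * I.size ^ 2) * ‖x‖

/-- `φ` is a super-KMS functional on the graded quantum dynamical system `(𝔄, γ, α, δ)`. -/
structure IsSKMS (δ : BoundedOp H →ₗ.[ℂ] BoundedOp H) (φ : BoundedOp H →ₗ.[ℂ] ℂ) : Prop where
  domainProperties : N.DomainProperties N.α φ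
  locallyNormal : N.LocallyNormal φ
  superKMS : N.SuperKMS N.α φ
  normalized : pval φ 1 = 1
  derivationInvariant : N.DerivationInvariant δ φ
  weakSupersymmetry : N.WeakSupersymmetry N.α δ φ

/-! ### Perturbations -/

/-- `δ_r = δ + r [Q, ·]` with domain `dom(δ)`. -/
def perturbedDerivation (δ : BoundedOp H →ₗ.[ℂ] BoundedOp H) (Q : BoundedOp H) (r : ℝ) :
    BoundedOp H →ₗ.[ℂ] BoundedOp H where
  domain := δ.domain
  toFun := δ.toFun + (r : ℂ) • (N.gradedAd Q).comp δ.domain.subtype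

/-- The perturbed flow `α^r_t`. -/
def αr (δ : BoundedOp H →ₗ.[ℂ] BoundedOp H) (Q : BoundedOp H) (r t : ℝ) (x : BoundedOp H) :
    BoundedOp H :=
  perturbedFlow N.α (perturbingElement δ Q r) t x

/-- The perturbed group `γ^r_t`. -/
def γr (δ : BoundedOp H →ₗ.[ℂ] BoundedOp H) (Q : BoundedOp H) (r t : ℝ) (x : BoundedOp H) :
    BoundedOp H :=
  perturbedCocycle N.α (perturbingElement δ Q r) t x

/-- `φr` is the perturbed functional `φ^r(x) = φ(x γ^r_i(1))` with domain `dom(φ)_c`, where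
`φ(x γ^r_i(1))` stands for the value at `i` of the analytic continuation to the strip of
`t ↦ φ(x γ^r_t(1))`. -/
def IsPerturbedFunctional (δ : BoundedOp H →ₗ.[ℂ] BoundedOp H) (φ : BoundedOp H →ₗ.[ℂ] ℂ)
    (Q : BoundedOp H) (r : ℝ) (φr : BoundedOp H →ₗ.[ℂ] ℂ) : Prop :=
  (φr.domain : Set (BoundedOp H)) = (φ.domain : Set (BoundedOp H)) ∩ N.localPart ∧
  ∀ x ∈ φr.domain, ∃ F : ℂ → ℂ,
    IsStripContinuation (fun t => pval φ (x * N.γr δ Q r t 1)) F ∧ pval φr x = F Complex.I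

end GradedNet

end

set_option linter.unusedSectionVars false

noncomputable section

/-! ### Analytic functions on the strip -/

/-! Write a = a_r and W_t = γ^r_t(1) (`GradedNet.cocycle`). As a is selfadjoint, W is a unitary
cocycle, W_{t+s} = W_t α_t(W_s), and α^r_t(x) = W_t α_t(x) W_t^*. The functional φ^r is a value of
an analytic continuation, so the proof has two halves: constructing strip continuations with good
bounds, and carrying identities from the real line to i by uniqueness of continuation
(`IsStripAnalytic.eqOn`).

Existence. The n-th Dyson term integrates φ(X α_{s₁t}(a) ⋯ α_{sₙt}(a)), and the factors are
continued one at a time. If t ↦ φ(Y Z(t)) continues for every Y, then φ(α_{-y}(b) γ(X) Z(x))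
continues in x by assumption and in y by the KMS condition. It therefore extends to a tube over a
triangle (`exists_isTubeFunction`), and the third edge of the triangle carries the continuation of t
↦ φ(X Z(t) α_t(b)) (`edgeCont_third`, `GoodFamily.edgeCont_mul_orbit`). All factors of a word have
times between 0 and t, so they share one local algebra and (S6) costs a Gaussian that does not
depend on n. Phragmén–Lindelöf with a matching Gaussian weight gives a bound qⁿ
(`norm_ext_word_mul_weight_le`), and the volume 1/n! of the simplex makes the series converge.
Translation invariance of φ, which follows from the KMS condition and its polynomial growth (`φ_α`),
improves the growth of the sum to Gaussian (`norm_ext_cocycle_le`). Hence W may itself play the role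
of Z.

KMS and supersymmetry. A second tube argument yields the KMS property of φ^r (`edgeCont_flow`). Weak
derivatives along the perturbed flow are those of y ↦ δ²(y) + [a, y] = δ_r²(y), and they pass to φ^r
after integration in time (`hasDerivAt_pert`, `pertδ_pertδ`). Weakly one has δ(W_t) = r (W_t α_t(Q)
- Q W_t) (`φ_mul_δ_cocycle_mul`); inserting this into φ(δ(x W_t)) = 0 and continuing to i gives φ^r
∘ δ_r = 0 (`pert_pertδ`).

Normalization. Duhamel's formula, continued to i, expresses φ^{s'}(1) - φ^s(1) through b = a_{s'} -
a_s (`norm_pert_one_sub_le`). Since b = (s' - s)(δ_s(Q) + (s' - s) Q²), invariance under δ_s removes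
the first-order part, so the difference is O(|s' - s|²). A function with this property is constant,
and its value at s = 0 is 1 (`pert_one`). -/

lemma isOpen_openStrip : IsOpen openStrip :=
  (isOpen_lt continuous_const Complex.continuous_im).inter
    (isOpen_lt Complex.continuous_im continuous_const)

lemma openStrip_subset : openStrip ⊆ closedStrip := fun _ h => ⟨h.1.le, h.2.le⟩

lemma openStrip_eq : openStrip = Complex.im ⁻¹' Ioo 0 1 := rfl

lemma closure_openStrip : closure openStrip = closedStrip := by
  rw [openStrip_eq, Complex.closure_preimage_im, closure_Ioo zero_ne_one]; rfl

lemma ofReal_mem_closedStrip (t : ℝ) : (t : ℂ) ∈ closedStrip := by simp [closedStrip]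

lemma ofReal_add_I_mem_closedStrip (t : ℝ) : (t : ℂ) + Complex.I ∈ closedStrip := by
  simp [closedStrip]

lemma I_mem_closedStrip : Complex.I ∈ closedStrip := by simp [closedStrip]

lemma IsStripAnalytic.diffContOnCl {F : ℂ → ℂ} (h : IsStripAnalytic F) :
    DiffContOnCl ℂ F (Complex.im ⁻¹' Ioo 0 1) := by
  refine ⟨h.2, ?_⟩
  rw [← openStrip_eq, closure_openStrip]; exact h.1

lemma eq_ofReal_of_im {z : ℂ} (h : z.im = 0) : z = ((z.re : ℝ) : ℂ) := by
  apply Complex.ext <;> simp [h]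

lemma eq_ofReal_add_I_of_im {z : ℂ} (h : z.im = 1) : z = ((z.re : ℝ) : ℂ) + Complex.I := by
  apply Complex.ext <;> simp [h]

lemma IsStripAnalytic.add {F G : ℂ → ℂ} (hF : IsStripAnalytic F) (hG : IsStripAnalytic G) :
    IsStripAnalytic (fun z => F z + G z) := ⟨hF.1.add hG.1, hF.2.add hG.2⟩

lemma IsStripAnalytic.sub {F G : ℂ → ℂ} (hF : IsStripAnalytic F) (hG : IsStripAnalytic G) :
    IsStripAnalytic (fun z => F z - G z) := ⟨hF.1.sub hG.1, hF.2.sub hG.2⟩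

lemma IsStripAnalytic.mul {F G : ℂ → ℂ} (hF : IsStripAnalytic F) (hG : IsStripAnalytic G) :
    IsStripAnalytic (fun z => F z * G z) := ⟨hF.1.mul hG.1, hF.2.mul hG.2⟩

lemma Differentiable.isStripAnalytic {F : ℂ → ℂ} (hF : Differentiable ℂ F) : IsStripAnalytic F :=
  ⟨hF.continuous.continuousOn, hF.differentiableOn⟩

lemma IsStripAnalytic.const_mul {F : ℂ → ℂ} (hF : IsStripAnalytic F) (c : ℂ) :
    IsStripAnalytic (fun z => c * F z) := (differentiable_const c).isStripAnalytic.mul hF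

lemma IsStripAnalytic.comp_affine {F : ℂ → ℂ} (hF : IsStripAnalytic F) {ψ : ℂ → ℂ}
    (hψ : Differentiable ℂ ψ) (h1 : MapsTo ψ closedStrip closedStrip)
    (h2 : MapsTo ψ openStrip openStrip) : IsStripAnalytic (fun z => F (ψ z)) :=
  ⟨hF.1.comp hψ.continuous.continuousOn h1, hF.2.comp hψ.differentiableOn h2⟩

lemma IsStripAnalytic.reflect {F : ℂ → ℂ} (hF : IsStripAnalytic F) :
    IsStripAnalytic (fun z => F (Complex.I - z)) := by
  apply hF.comp_affine (by fun_prop)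
  · intro z hz; simp only [closedStrip, mem_ofPred_eq, Complex.sub_im, Complex.I_im] at *
    constructor <;> linarith
  · intro z hz; simp only [openStrip, mem_ofPred_eq, Complex.sub_im, Complex.I_im] at *
    constructor <;> linarith

/-- A strip function which vanishes on the real line vanishes near the real line. -/
lemma IsStripAnalytic.eq_zero_of_im_lt {F : ℂ → ℂ} (hF : IsStripAnalytic F)
    (h0 : ∀ t : ℝ, F t = 0) (z : ℂ) (hz0 : 0 < z.im) (hz : z.im < 1 / 2) : F z = 0 := by
  set R : Set ℂ := Ioo (z.re - 1) (z.re + 1) ×ℂ Ioo 0 (1 / 2) with hR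
  have hcl : closure R = Icc (z.re - 1) (z.re + 1) ×ℂ Icc 0 (1 / 2) := by
    rw [hR, Complex.closure_reProdIm, closure_Ioo (by linarith), closure_Ioo (by norm_num)]
  have hRo : R ⊆ openStrip := by
    intro w hw
    rw [hR, Complex.mem_reProdIm] at hw
    exact ⟨hw.2.1, by linarith [hw.2.2]⟩
  have hRc : closure R ⊆ closedStrip := by
    rw [hcl]; intro w hw
    rw [Complex.mem_reProdIm] at hw
    exact ⟨hw.2.1, by linarith [hw.2.2]⟩
  have hcomp : IsCompact (closure R) := by
    rw [hcl]; exact isCompact_Icc.reProdIm isCompact_Icc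
  obtain ⟨M, hM⟩ := hcomp.exists_bound_of_continuousOn (hF.1.mono hRc)
  have hzR : z ∈ R := by
    rw [hR, Complex.mem_reProdIm]; exact ⟨⟨by linarith, by linarith⟩, hz0, hz⟩
  -- With u = Re (w - z) and v = Im w one has Re p = (v - 1/2)² - u². This is positive at z and at
  -- most 0 on the three sides of the rectangle off the real line. So F e^{np} is bounded by M on
  -- the frontier for every n, while e^{n Re p(z)} → ∞ forces F z = 0.
  set p : ℂ → ℂ := fun w => -(w - z.re) ^ 2 + Complex.I * (w - z.re) + 1 / 4 with hp
  have hpre : ∀ w : ℂ, (p w).re = -(w.re - z.re) ^ 2 + w.im ^ 2 - w.im + 1 / 4 := by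
    intro w; simp [hp, pow_two]; ring
  have hbound : ∀ n : ℕ, ‖F z * Complex.exp (n * p z)‖ ≤ M := by
    intro n
    refine Complex.norm_le_of_forall_mem_frontier_norm_le (U := R) (hcomp.isBounded.subset
      subset_closure) (f := fun w => F w * Complex.exp (n * p w)) ?_ ?_ (subset_closure hzR)
    · refine ⟨(hF.2.mono hRo).mul ?_, (hF.1.mono hRc).mul ?_⟩
      · exact Differentiable.differentiableOn (by fun_prop)
      · exact Continuous.continuousOn (by fun_prop)
    · intro w hw
      have hwc : w ∈ closure R := frontier_subset_closure hw
      have hwR : w ∉ R := by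
        have : IsOpen R := isOpen_Ioo.reProdIm isOpen_Ioo
        rw [this.frontier_eq] at hw; exact hw.2
      have hwM := hM w hwc
      rw [hcl, Complex.mem_reProdIm] at hwc
      obtain ⟨⟨h1, h2⟩, h3, h4⟩ := hwc
      by_cases him : w.im = 0
      · rw [eq_ofReal_of_im him, h0]; simpa using (norm_nonneg _).trans hwM
      · have hre : (p w).re ≤ 0 := by
          rw [hpre]
          rw [hR, Complex.mem_reProdIm] at hwR
          by_cases h5 : w.im = 1 / 2
          · rw [h5]; nlinarith [sq_nonneg (w.re - z.re)]
          · have h6 : w.im ∈ Ioo (0 : ℝ) (1 / 2) :=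
              ⟨lt_of_le_of_ne h3 (Ne.symm him), lt_of_le_of_ne h4 h5⟩
            have h7 : ¬ (w.re ∈ Ioo (z.re - 1) (z.re + 1)) := fun h => hwR ⟨h, h6⟩
            have h8 : (w.re - z.re) ^ 2 = 1 := by
              rw [mem_Ioo, not_and_or, not_lt, not_lt] at h7
              rcases h7 with h7 | h7
              · rw [show w.re = z.re - 1 by linarith]; ring
              · rw [show w.re = z.re + 1 by linarith]; ring
            rw [h8]; nlinarith [h6.1, h6.2]
        rw [norm_mul, Complex.norm_exp]
        have : (↑n * p w).re ≤ 0 := by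
          have : (↑n * p w).re = n * (p w).re := by simp
          rw [this]; exact mul_nonpos_of_nonneg_of_nonpos (Nat.cast_nonneg n) hre
        calc ‖F w‖ * Real.exp (↑n * p w).re ≤ M * 1 := by
              gcongr
              · exact (norm_nonneg _).trans hwM
              · exact Real.exp_le_one_iff.2 this
          _ = M := mul_one M
  have hpz : 0 < (p z).re := by
    rw [hpre]; nlinarith [mul_pos (sub_pos.2 hz) (sub_pos.2 hz)]
  by_contra hne
  have hpos : 0 < ‖F z‖ := norm_pos_iff.2 hne
  have hlim : Tendsto (fun n : ℕ => ‖F z‖ * Real.exp (n * (p z).re)) atTop atTop := by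
    apply Tendsto.const_mul_atTop hpos
    apply Real.tendsto_exp_atTop.comp
    exact tendsto_natCast_atTop_atTop.atTop_mul_const hpz
  obtain ⟨n, hn⟩ := (hlim.eventually (eventually_gt_atTop M)).exists
  have := hbound n
  rw [norm_mul, Complex.norm_exp] at this
  have h9 : (↑n * p z).re = n * (p z).re := by simp
  rw [h9] at this
  linarith

/-- Vanishing near the real line spreads to the connected open strip by the identity theorem, and to
its closure by continuity. -/
lemma IsStripAnalytic.eq_zero {F : ℂ → ℂ} (hF : IsStripAnalytic F)
    (h0 : ∀ t : ℝ, F t = 0) : EqOn F 0 closedStrip := by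
  have han : AnalyticOnNhd ℂ F openStrip := hF.2.analyticOnNhd isOpen_openStrip
  have hconn : IsPreconnected openStrip := by
    have : Convex ℝ openStrip :=
      (convex_halfSpace_im_gt 0).inter (convex_halfSpace_im_lt 1)
    exact this.isPreconnected
  have hz1 : (Complex.I / 4) ∈ openStrip := by
    constructor <;> norm_num
  have hev : F =ᶠ[𝓝 (Complex.I / 4)] 0 := by
    have hU : IsOpen {z : ℂ | 0 < z.im ∧ z.im < 1 / 2} :=
      (isOpen_lt continuous_const Complex.continuous_im).inter
        (isOpen_lt Complex.continuous_im continuous_const)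
    filter_upwards [hU.mem_nhds (show Complex.I / 4 ∈ _ by constructor <;> norm_num)] with w hw
    exact hF.eq_zero_of_im_lt h0 w hw.1 hw.2
  have hopen : EqOn F 0 openStrip := han.eqOn_zero_of_preconnected_of_eventuallyEq_zero hconn hz1 hev
  have := hopen.of_subset_closure (t := closedStrip) hF.1 continuousOn_const openStrip_subset
    closure_openStrip.ge
  exact this

/-- Analytic continuations to the strip are unique. -/
lemma IsStripAnalytic.eqOn {F G : ℂ → ℂ} (hF : IsStripAnalytic F) (hG : IsStripAnalytic G)
    (h : ∀ t : ℝ, F t = G t) : EqOn F G closedStrip := by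
  intro z hz
  have := (hF.sub hG).eq_zero (fun t => by simp [h t]) hz
  exact sub_eq_zero.1 this

lemma IsStripContinuation.eqOn {f : ℝ → ℂ} {F G : ℂ → ℂ} (hF : IsStripContinuation f F)
    (hG : IsStripContinuation f G) : EqOn F G closedStrip :=
  hF.1.eqOn hG.1 fun t => (hF.2 t).trans (hG.2 t).symm

/-- Gaussian growth on the strip. -/
def GaussGrowth (F : ℂ → ℂ) : Prop :=
  ∃ K Λ : ℝ, ∀ z ∈ closedStrip, ‖F z‖ ≤ K * Real.exp (Λ * z.re ^ 2)

lemma gaussGrowth_mono {K Λ K' Λ' x : ℝ} (hK : K ≤ K') (hK' : 0 ≤ K') (hΛ : Λ ≤ Λ') :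
    K * Real.exp (Λ * x ^ 2) ≤ K' * Real.exp (Λ' * x ^ 2) := by
  have : Λ * x ^ 2 ≤ Λ' * x ^ 2 := mul_le_mul_of_nonneg_right hΛ (sq_nonneg x)
  gcongr

lemma GaussGrowth.exists_pos {F : ℂ → ℂ} (h : GaussGrowth F) :
    ∃ K > 0, ∃ Λ > 0, ∀ z ∈ closedStrip, ‖F z‖ ≤ K * Real.exp (Λ * z.re ^ 2) := by
  obtain ⟨K, Λ, h⟩ := h
  refine ⟨|K| + 1, by positivity, |Λ| + 1, by positivity, fun z hz => (h z hz).trans ?_⟩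
  exact gaussGrowth_mono (by linarith [le_abs_self K]) (by positivity) (by linarith [le_abs_self Λ])

lemma GaussGrowth.add {F G : ℂ → ℂ} (hF : GaussGrowth F) (hG : GaussGrowth G) :
    GaussGrowth (fun z => F z + G z) := by
  obtain ⟨K, hK, Λ, hΛ, h⟩ := hF.exists_pos
  obtain ⟨K', hK', Λ', hΛ', h'⟩ := hG.exists_pos
  refine ⟨K + K', Λ + Λ', fun z hz => (norm_add_le _ _).trans ?_⟩
  have h1 := (h z hz).trans (gaussGrowth_mono (x := z.re) le_rfl hK.le (show Λ ≤ Λ + Λ' by linarith))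
  have h2 := (h' z hz).trans
    (gaussGrowth_mono (x := z.re) le_rfl hK'.le (show Λ' ≤ Λ + Λ' by linarith))
  rw [add_mul]; exact add_le_add h1 h2

lemma GaussGrowth.const_mul {F : ℂ → ℂ} (hF : GaussGrowth F) (c : ℂ) :
    GaussGrowth (fun z => c * F z) := by
  obtain ⟨K, Λ, h⟩ := hF
  refine ⟨‖c‖ * K, Λ, fun z hz => ?_⟩
  rw [norm_mul, mul_assoc]; exact mul_le_mul_of_nonneg_left (h z hz) (norm_nonneg c)

lemma GaussGrowth.sub {F G : ℂ → ℂ} (hF : GaussGrowth F) (hG : GaussGrowth G) :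
    GaussGrowth (fun z => F z - G z) := by
  have := hF.add (hG.const_mul (-1))
  simpa [sub_eq_add_neg] using this

lemma GaussGrowth.mul {F G : ℂ → ℂ} (hF : GaussGrowth F) (hG : GaussGrowth G) :
    GaussGrowth (fun z => F z * G z) := by
  obtain ⟨K, hK, Λ, hΛ, h⟩ := hF.exists_pos
  obtain ⟨K', hK', Λ', hΛ', h'⟩ := hG.exists_pos
  refine ⟨K * K', Λ + Λ', fun z hz => ?_⟩
  rw [norm_mul]
  calc ‖F z‖ * ‖G z‖ ≤ (K * Real.exp (Λ * z.re ^ 2)) * (K' * Real.exp (Λ' * z.re ^ 2)) :=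
        mul_le_mul (h z hz) (h' z hz) (norm_nonneg _) (by positivity)
    _ = _ := by rw [add_mul, Real.exp_add]; ring

lemma GaussGrowth.reflect {F : ℂ → ℂ} (hF : GaussGrowth F) :
    GaussGrowth (fun z => F (Complex.I - z)) := by
  obtain ⟨K, Λ, h⟩ := hF
  refine ⟨K, Λ, fun z hz => ?_⟩
  have := h (Complex.I - z) ?_
  · simpa using this
  · simp only [closedStrip, mem_ofPred_eq, Complex.sub_im, Complex.I_im] at *
    constructor <;> linarith

lemma norm_exp_mul_sq (Λ : ℝ) (z : ℂ) :
    ‖Complex.exp (Λ * z ^ 2)‖ = Real.exp (Λ * (z.re ^ 2 - z.im ^ 2)) := by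
  rw [Complex.norm_exp]; congr 1
  simp [pow_two]

lemma gaussGrowth_exp (Λ : ℝ) : GaussGrowth (fun z => Complex.exp (Λ * z ^ 2)) := by
  refine ⟨Real.exp |Λ|, Λ, fun z hz => ?_⟩
  rw [norm_exp_mul_sq, ← Real.exp_add]
  apply Real.exp_le_exp.2
  have h1 : z.im ^ 2 ≤ 1 := by nlinarith [hz.1, hz.2]
  have h2 : -Λ * z.im ^ 2 ≤ |Λ| * 1 :=
    mul_le_mul (neg_le_abs Λ) h1 (sq_nonneg _) (abs_nonneg _)
  linarith

/-- Phragmén–Lindelöf principle on the strip, for functions of Gaussian growth. -/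
lemma IsStripAnalytic.norm_le {F : ℂ → ℂ} (hF : IsStripAnalytic F) (hg : GaussGrowth F) {M : ℝ}
    (h0 : ∀ t : ℝ, ‖F t‖ ≤ M) (h1 : ∀ t : ℝ, ‖F (t + Complex.I)‖ ≤ M) :
    ∀ z ∈ closedStrip, ‖F z‖ ≤ M := by
  intro z hz
  refine PhragmenLindelof.horizontal_strip hF.diffContOnCl ?_ ?_ ?_ hz.1 hz.2
  · obtain ⟨K, hK, Λ, hΛ, h⟩ := hg.exists_pos
    -- On a strip of width 1 the principle admits growth exp(B e^{c|x|}) with c < π. Gaussian growth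
    -- fits with c = 1 and B = 2Λ because x²/2 ≤ e^{|x|}.
    refine ⟨1, by rw [sub_zero, div_one]; linarith [Real.pi_gt_three], 2 * Λ, ?_⟩
    refine Asymptotics.IsBigO.of_bound K ?_
    rw [eventually_inf_principal]
    refine Eventually.of_forall fun w hw => ?_
    have := h w ⟨hw.1.le, hw.2.le⟩
    refine this.trans ?_
    rw [Real.norm_eq_abs, abs_of_pos (Real.exp_pos _)]
    gcongr K * ?_
    apply Real.exp_le_exp.2
    have h2 := Real.quadratic_le_exp_of_nonneg (abs_nonneg w.re)
    rw [one_mul]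
    have h3 : w.re ^ 2 = |w.re| ^ 2 := (sq_abs _).symm
    rw [h3]
    nlinarith [abs_nonneg w.re]
  · intro w hw; rw [eq_ofReal_of_im hw]; exact h0 _
  · intro w hw; rw [eq_ofReal_add_I_of_im hw]; exact h1 _

lemma isStripAnalytic_exp (Λ : ℝ) : IsStripAnalytic (fun z => Complex.exp (Λ * z ^ 2)) :=
  Differentiable.isStripAnalytic (by fun_prop)

/-- Phragmén–Lindelöf principle for functions with Gaussian bounds on the boundary. -/
lemma IsStripAnalytic.norm_le_exp {F : ℂ → ℂ} (hF : IsStripAnalytic F) (hg : GaussGrowth F)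
    {M Λ : ℝ} (hΛ : 0 ≤ Λ) (h0 : ∀ t : ℝ, ‖F t‖ ≤ M * Real.exp (Λ * t ^ 2))
    (h1 : ∀ t : ℝ, ‖F (t + Complex.I)‖ ≤ M * Real.exp (Λ * t ^ 2)) :
    ∀ z ∈ closedStrip, ‖F z‖ ≤ M * Real.exp Λ * Real.exp (Λ * z.re ^ 2) := by
  intro z hz
  have hM : 0 ≤ M := by simpa using (norm_nonneg _).trans (h0 0)
  -- Multiplying by e^{-Λz²} makes both boundary functions bounded. Since |e^{-Λz²}| = e^{-Λ(x² -
  -- y²)}, the line Im z = 1 contributes the extra factor e^Λ.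
  have key := (hF.mul (isStripAnalytic_exp (-Λ))).norm_le (hg.mul (gaussGrowth_exp (-Λ)))
    (M := M * Real.exp Λ) ?_ ?_ z hz
  · rw [norm_mul, norm_exp_mul_sq] at key
    have h2 : ‖F z‖ = ‖F z‖ * Real.exp (-Λ * (z.re ^ 2 - z.im ^ 2)) *
        Real.exp (Λ * (z.re ^ 2 - z.im ^ 2)) := by
      rw [mul_assoc, ← Real.exp_add]; simp
    rw [h2]
    have h3 : Λ * (z.re ^ 2 - z.im ^ 2) ≤ Λ * z.re ^ 2 := by
      nlinarith [mul_nonneg hΛ (sq_nonneg z.im)]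
    gcongr
  · intro t
    rw [norm_mul, norm_exp_mul_sq]
    calc _ ≤ (M * Real.exp (Λ * t ^ 2)) *
          Real.exp (-Λ * ((t : ℂ).re ^ 2 - (t : ℂ).im ^ 2)) := by gcongr; exact h0 t
      _ = M * 1 := by rw [mul_assoc, ← Real.exp_add]; simp
      _ ≤ _ := by gcongr; exact Real.one_le_exp hΛ
  · intro t
    rw [norm_mul, norm_exp_mul_sq]
    calc _ ≤ (M * Real.exp (Λ * t ^ 2)) *
          Real.exp (-Λ * (((t : ℂ) + Complex.I).re ^ 2 - ((t : ℂ) + Complex.I).im ^ 2)) := by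
            gcongr; exact h1 t
      _ = M * Real.exp Λ := by rw [mul_assoc, ← Real.exp_add]; congr 2; simp; ring
      _ ≤ _ := le_rfl

/-- If `h` is jointly continuous and `K` compact, `h θ` is uniformly close to `h θ₀` on `K` for `θ`
close to `θ₀`. -/
lemma eventually_forall_norm_sub_lt {Θ X : Type*} [TopologicalSpace Θ] [TopologicalSpace X]
    {h : Θ → X → ℂ} (hh : Continuous fun p : Θ × X => h p.1 p.2) {K : Set X} (hK : IsCompact K)
    (θ₀ : Θ) {ε : ℝ} (hε : 0 < ε) :
    ∀ᶠ θ in 𝓝 θ₀, ∀ x ∈ K, ‖h θ x - h θ₀ x‖ < ε := by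
  have h1 : Continuous fun p : Θ × X => ‖h p.1 p.2 - h θ₀ p.2‖ := by
    have : Continuous fun p : Θ × X => h θ₀ p.2 :=
      hh.comp (continuous_const.prodMk continuous_snd)
    exact (hh.sub this).norm
  have := hK.eventually_forall_of_forall_eventually (x₀ := θ₀)
    (P := fun θ x => ‖h θ x - h θ₀ x‖ < ε) ?_
  · exact this
  · intro x _
    have h2 : Tendsto (fun p : Θ × X => ‖h p.1 p.2 - h θ₀ p.2‖) (𝓝 (θ₀, x)) (𝓝 0) := by
      have := h1.tendsto (θ₀, x); simpa using this
    exact h2.eventually (gt_mem_nhds hε)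

/-- A weighted version on the whole line, for functions of bounded Gaussian growth. -/
lemma eventually_forall_norm_sub_lt_exp {Θ E : Type*} [TopologicalSpace Θ] [NormedAddCommGroup E]
    [ProperSpace E]
    {h : Θ → E → ℂ} (hh : Continuous fun p : Θ × E => h p.1 p.2) (θ₀ : Θ) {M Λ : ℝ}
    (hb : ∀ᶠ θ in 𝓝 θ₀, ∀ t, ‖h θ t‖ ≤ M * Real.exp (Λ * ‖t‖ ^ 2)) {ε : ℝ} (hε : 0 < ε) :
    ∀ᶠ θ in 𝓝 θ₀, ∀ t : E, ‖h θ t - h θ₀ t‖ ≤ ε * Real.exp ((Λ + 1) * ‖t‖ ^ 2) := by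
  have hlim : Tendsto (fun T : ℝ => 2 * M * Real.exp (-T ^ 2)) atTop (𝓝 0) := by
    have : Tendsto (fun T : ℝ => Real.exp (-T ^ 2)) atTop (𝓝 0) :=
      Real.tendsto_exp_atBot.comp (tendsto_neg_atTop_atBot.comp (tendsto_pow_atTop two_ne_zero))
    simpa using this.const_mul (2 * M)
  -- Beyond radius T the trivial bound 2M e^{Λ|t|²} is absorbed by the additional weight e^{|t|²};
  -- inside it compactness gives uniform closeness.
  obtain ⟨T, hT, hT0⟩ := ((hlim.eventually (gt_mem_nhds hε)).and (eventually_ge_atTop 0)).exists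
  set ε' := ε * Real.exp (-|Λ + 1| * T ^ 2)
  have hε' : 0 < ε' := by positivity
  filter_upwards [hb, eventually_forall_norm_sub_lt hh
    (isCompact_closedBall (0 : E) T) θ₀ hε'] with θ hθ hK t
  have hM : 0 ≤ M := by
    have := (norm_nonneg _).trans (hθ 0); simpa using this
  by_cases ht : ‖t‖ ≤ T
  · refine (hK t (by simpa using ht)).le.trans ?_
    have hts : ‖t‖ ^ 2 ≤ T ^ 2 := by gcongr
    apply mul_le_mul_of_nonneg_left _ hε.le
    apply Real.exp_le_exp.2
    have : -(Λ + 1) * ‖t‖ ^ 2 ≤ |Λ + 1| * T ^ 2 :=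
      mul_le_mul (neg_le_abs _) hts (sq_nonneg _) (abs_nonneg _)
    linarith
  · push Not at ht
    have hts : T ^ 2 ≤ ‖t‖ ^ 2 := by gcongr
    calc ‖h θ t - h θ₀ t‖ ≤ M * Real.exp (Λ * ‖t‖ ^ 2) + M * Real.exp (Λ * ‖t‖ ^ 2) :=
          (norm_sub_le _ _).trans (add_le_add (hθ t) (hb.self_of_nhds t))
      _ = (2 * M * Real.exp (-‖t‖ ^ 2)) * Real.exp ((Λ + 1) * ‖t‖ ^ 2) := by
          rw [mul_assoc, ← Real.exp_add]; ring_nf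
      _ ≤ (2 * M * Real.exp (-T ^ 2)) * Real.exp ((Λ + 1) * ‖t‖ ^ 2) := by gcongr
      _ ≤ ε * Real.exp ((Λ + 1) * ‖t‖ ^ 2) := by gcongr

/-- Strip functions depend continuously on parameters if their boundary values do. -/
lemma continuousOn_strip_family {Θ : Type*} [TopologicalSpace Θ] {F : Θ → ℂ → ℂ}
    (hF : ∀ θ, IsStripAnalytic (F θ))
    (hb : ∀ θ₀, ∃ M Λ : ℝ, ∀ᶠ θ in 𝓝 θ₀, ∀ z ∈ closedStrip,
      ‖F θ z‖ ≤ M * Real.exp (Λ * z.re ^ 2))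
    (h0 : Continuous fun p : Θ × ℝ => F p.1 p.2)
    (h1 : Continuous fun p : Θ × ℝ => F p.1 (p.2 + Complex.I)) :
    ContinuousOn (fun p : Θ × ℂ => F p.1 p.2) (univ ×ˢ closedStrip) := by
  rintro ⟨θ₀, z₀⟩ ⟨-, hz₀⟩
  obtain ⟨M, Λ', hb⟩ := hb θ₀
  set Λ := |Λ'| with hΛ
  replace hb : ∀ᶠ θ in 𝓝 θ₀, ∀ z ∈ closedStrip, ‖F θ z‖ ≤ M * Real.exp (Λ * z.re ^ 2) := by
    filter_upwards [hb] with θ h z hz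
    have hM : 0 ≤ M := by
      have := (norm_nonneg _).trans (h 0 (by simp [closedStrip])); simpa using this
    exact (h z hz).trans (gaussGrowth_mono le_rfl hM (le_abs_self _))
  have hΛ0 : 0 ≤ Λ := abs_nonneg _
  rw [ContinuousWithinAt, Metric.tendsto_nhds]
  intro ε hε
  set c := Real.exp (Λ + 1) * Real.exp ((Λ + 1) * (|z₀.re| + 1) ^ 2) with hc
  have hcpos : 0 < c := by positivity
  have hε' : 0 < ε / (2 * c) := by positivity
  have e0 := eventually_forall_norm_sub_lt_exp (E := ℝ) (h := fun θ t => F θ t) h0 θ₀ (M := M) (Λ := Λ)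
    (by filter_upwards [hb] with θ h t
        simpa using h t (by simp [closedStrip])) hε'
  have e1 := eventually_forall_norm_sub_lt_exp (E := ℝ) (h := fun θ t => F θ (t + Complex.I)) h1 θ₀ (M := M)
    (Λ := Λ) (by filter_upwards [hb] with θ h t
                 simpa using h (t + Complex.I) (by simp [closedStrip])) hε'
  have e2 : ∀ᶠ z in 𝓝[closedStrip] z₀, dist (F θ₀ z) (F θ₀ z₀) < ε / 2 :=
    ((hF θ₀).1 z₀ hz₀).eventually (Metric.ball_mem_nhds _ (half_pos hε))
  have e3 : ∀ᶠ z in 𝓝[closedStrip] z₀, |z.re| ≤ |z₀.re| + 1 := by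
    have : ∀ᶠ z in 𝓝 z₀, |z.re| < |z₀.re| + 1 :=
      (Complex.continuous_re.abs.tendsto z₀).eventually (gt_mem_nhds (by linarith))
    exact (this.filter_mono nhdsWithin_le_nhds).mono fun _ h => h.le
  rw [nhdsWithin_prod_eq, nhdsWithin_univ]
  have e4 : ∀ᶠ z in 𝓝[closedStrip] z₀, z ∈ closedStrip := self_mem_nhdsWithin
  filter_upwards [((e0.and e1).and hb).prod_mk ((e2.and e3).and e4)]
  rintro ⟨θ, z⟩ ⟨⟨⟨a0, a1⟩, a2⟩, ⟨b2, b3⟩, b4⟩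
  simp only at *
  have hg : GaussGrowth (fun z => F θ z - F θ₀ z) :=
    GaussGrowth.sub ⟨M, Λ, a2⟩ ⟨M, Λ, hb.self_of_nhds⟩
  -- Weighted closeness on the two boundary lines propagates to the interior by Phragmén–Lindelöf
  -- applied to the difference. The constant c was chosen so that the resulting bound is ε/2 for z
  -- near z₀.
  have key := ((hF θ).sub (hF θ₀)).norm_le_exp hg (M := ε / (2 * c)) (Λ := Λ + 1) (by linarith)
    (fun t => by simpa using a0 t) (fun t => by simpa using a1 t) z b4
  have : ‖F θ z - F θ₀ z‖ ≤ ε / 2 := by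
    refine key.trans ?_
    have h5 : Real.exp ((Λ + 1) * z.re ^ 2) ≤ Real.exp ((Λ + 1) * (|z₀.re| + 1) ^ 2) := by
      apply Real.exp_le_exp.2
      apply mul_le_mul_of_nonneg_left _ (by linarith)
      rw [← sq_abs z.re]; gcongr
    calc _ ≤ ε / (2 * c) * Real.exp (Λ + 1) * Real.exp ((Λ + 1) * (|z₀.re| + 1) ^ 2) := by gcongr
      _ = ε / (2 * c) * c := by rw [hc]; ring
      _ = ε / 2 := by field_simp
  calc dist (F θ z) (F θ₀ z₀) ≤ dist (F θ z) (F θ₀ z) + dist (F θ₀ z) (F θ₀ z₀) :=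
        dist_triangle _ _ _
    _ < ε / 2 + ε / 2 := by rw [dist_eq_norm]; exact add_lt_add_of_le_of_lt this b2
    _ = ε := by ring

/-- Integrals of analytic functions depending on a parameter are analytic. -/
lemma differentiableOn_integral_of_bound {X : Type*} [MeasurableSpace X] {μ : Measure X}
    {U : Set ℂ} (hU : IsOpen U) {f : ℂ → X → ℂ}
    (hm : ∀ z ∈ U, AEStronglyMeasurable (f z) μ)
    (hd : ∀ᵐ x ∂μ, DifferentiableOn ℂ (fun z => f z x) U)
    (hb : ∀ z₀ ∈ U, ∃ b : X → ℝ, Integrable b μ ∧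
      ∃ r > 0, ∀ᵐ x ∂μ, ∀ z ∈ Metric.ball z₀ r, ‖f z x‖ ≤ b x) :
    DifferentiableOn ℂ (fun z => ∫ x, f z x ∂μ) U := by
  intro z₀ hz₀
  obtain ⟨b, hbi, r', hr', hb⟩ := hb z₀ hz₀
  obtain ⟨r'', hr'', hrU⟩ := Metric.isOpen_iff.1 hU z₀ hz₀
  set r := min r' r'' with hr
  have hr0 : 0 < r := lt_min hr' hr''
  have hball : Metric.ball z₀ r ⊆ U := (Metric.ball_subset_ball (min_le_right _ _)).trans hrU
  have hsub : ∀ w ∈ Metric.ball z₀ (r / 2), Metric.closedBall w (r / 3) ⊆ Metric.ball z₀ r := by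
    intro w hw v hv
    rw [Metric.mem_ball] at *; rw [Metric.mem_closedBall] at hv
    linarith [dist_triangle v w z₀]
  refine DifferentiableAt.differentiableWithinAt ?_
  -- The derivative is measurable in x as the limit of difference quotients along the sequence `u`
  -- tending to z₀.
  have hmeas : AEStronglyMeasurable (fun x => deriv (fun z => f z x) z₀) μ := by
    set u : ℕ → ℂ := fun n => z₀ + ((r / 2) / (n + 1) : ℝ) with hu
    have hu0 : Tendsto (fun n : ℕ => ((r / 2) / (n + 1) : ℝ)) atTop (𝓝 0) :=
      tendsto_const_div_atTop_nhds_zero_nat (r / 2) |>.comp (tendsto_add_atTop_nat 1) |>.congr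
        fun n => by simp
    have hupos : ∀ n : ℕ, 0 < ((r / 2) / (n + 1) : ℝ) := fun n => by positivity
    have hule : ∀ n : ℕ, ((r / 2) / (n + 1) : ℝ) < r := fun n => by
      have : (r / 2) / (n + 1) ≤ r / 2 := div_le_self (by positivity) (by simp)
      linarith
    have hune : ∀ n, u n ≠ z₀ := fun n h => by
      have : (((r / 2) / (n + 1) : ℝ) : ℂ) = 0 := by simpa [hu] using h
      exact (hupos n).ne' (by exact_mod_cast this)
    have huU : ∀ n, u n ∈ U := fun n => hball <| by
      rw [Metric.mem_ball, dist_eq_norm, hu]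
      simp only [add_sub_cancel_left, Complex.norm_real, Real.norm_eq_abs, abs_of_pos (hupos n)]
      exact hule n
    refine aestronglyMeasurable_of_tendsto_ae atTop
      (f := fun n x => (u n - z₀)⁻¹ * (f (u n) x - f z₀ x)) ?_ ?_
    · intro n; exact ((hm _ (huU n)).sub (hm _ hz₀)).const_mul _
    · filter_upwards [hd] with x hx
      have h1 := (hx.differentiableAt (hU.mem_nhds hz₀)).hasDerivAt.tendsto_slope
      have h2 : Tendsto u atTop (𝓝[≠] z₀) := by
        refine tendsto_nhdsWithin_iff.2 ⟨?_, Eventually.of_forall hune⟩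
        have : Tendsto (fun n : ℕ => (((r / 2) / (n + 1) : ℝ) : ℂ)) atTop (𝓝 ((0 : ℝ) : ℂ)) :=
          (Complex.continuous_ofReal.tendsto 0).comp hu0
        simpa [hu] using this.const_add z₀
      have h3 := h1.comp h2
      refine h3.congr fun n => ?_
      simp [slope, smul_eq_mul]
  refine (hasDerivAt_integral_of_dominated_loc_of_deriv_le (μ := μ) (F := f)
    (F' := fun z x => deriv (fun z => f z x) z) (bound := fun x => b x / (r / 3))
    (Metric.ball_mem_nhds z₀ (half_pos hr0)) ?_ ?_ hmeas ?_ (hbi.div_const _) ?_).2.differentiableAt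
  · filter_upwards [hU.mem_nhds hz₀] with z hz using hm z hz
  · refine hbi.mono' (hm z₀ hz₀) ?_
    filter_upwards [hb] with x hx using hx z₀ (Metric.mem_ball_self hr')
  -- Cauchy's estimate on circles of radius r/3 turns the bound on f into the bound b/(r/3) on its
  -- derivative.
  · filter_upwards [hd, hb] with x hx hbx w hw
    refine Complex.norm_deriv_le_of_forall_mem_sphere_norm_le (by positivity) ?_ ?_
    · refine ⟨hx.mono ((Metric.ball_subset_closedBall.trans (hsub w hw)).trans hball), ?_⟩
      exact hx.continuousOn.mono
        ((Metric.closure_ball_subset_closedBall.trans (hsub w hw)).trans hball)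
    · intro v hv
      exact hbx v (Metric.ball_subset_ball (min_le_left _ _)
        (hsub w hw (Metric.sphere_subset_closedBall hv)))
  · filter_upwards [hd] with x hx w hw
    have : w ∈ U := hball (Metric.ball_subset_ball (by linarith) hw)
    exact (hx.differentiableAt (hU.mem_nhds this)).hasDerivAt

/-! ### Gaussian regularization -/

/-- The Gaussian kernel `√(b/π) e^{-b w²}`. -/
def gaussKernel (b : ℝ) (w : ℂ) : ℂ := (Real.sqrt (b / Real.pi) : ℂ) * Complex.exp (-b * w ^ 2)

lemma norm_gaussKernel (b : ℝ) (w : ℂ) : ‖gaussKernel b w‖ =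
    Real.sqrt (b / Real.pi) * Real.exp (-b * (w.re ^ 2 - w.im ^ 2)) := by
  rw [gaussKernel, norm_mul, Complex.norm_real, Real.norm_eq_abs, abs_of_nonneg (Real.sqrt_nonneg _)]
  have := norm_exp_mul_sq (-b) w
  push_cast at this
  rw [this]

lemma continuous_gaussKernel (b : ℝ) : Continuous (gaussKernel b) := by
  unfold gaussKernel; fun_prop

lemma differentiable_gaussKernel (b : ℝ) : Differentiable ℂ (gaussKernel b) := by
  unfold gaussKernel; fun_prop

lemma norm_gaussKernel_sub (b : ℝ) (w : ℂ) (q : ℝ) : ‖gaussKernel b (w - q)‖ =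
    Real.exp (b * w.im ^ 2) * (Real.sqrt (b / Real.pi) * Real.exp (-b * (q - w.re) ^ 2)) := by
  rw [norm_gaussKernel, mul_left_comm, ← Real.exp_add]
  simp only [Complex.sub_re, Complex.ofReal_re, Complex.sub_im, Complex.ofReal_im, sub_zero]
  ring_nf

lemma integrable_exp_neg_mul_sub_sq {b : ℝ} (hb : 0 < b) (x : ℝ) :
    Integrable (fun q : ℝ => Real.exp (-b * (q - x) ^ 2)) :=
  (integrable_exp_neg_mul_sq hb).comp_sub_right x

lemma integral_norm_gaussKernel_sub {b : ℝ} (hb : 0 < b) (w : ℂ) :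
    ∫ q : ℝ, ‖gaussKernel b (w - q)‖ = Real.exp (b * w.im ^ 2) := by
  simp_rw [norm_gaussKernel_sub]
  rw [integral_const_mul, integral_const_mul,
    integral_sub_right_eq_self (fun q : ℝ => Real.exp (-b * q ^ 2)) w.re, integral_gaussian,
    ← Real.sqrt_mul (by positivity)]
  have : b / Real.pi * (Real.pi / b) = 1 := by field_simp
  rw [this]; simp

lemma integrable_gaussKernel_sub {b : ℝ} (hb : 0 < b) (w : ℂ) :
    Integrable (fun q : ℝ => gaussKernel b (w - q)) := by
  have hc : Continuous fun q : ℝ => gaussKernel b (w - q) :=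
    (continuous_gaussKernel b).comp (by fun_prop)
  rw [← integrable_norm_iff hc.aestronglyMeasurable]
  simp_rw [norm_gaussKernel_sub]
  exact ((integrable_exp_neg_mul_sub_sq hb w.re).const_mul _).const_mul _

/-- Halving the exponent absorbs a shift of the centre by at most 1, which gives a single integrable
majorant for all w in a unit ball. -/
lemma norm_gaussKernel_sub_le {b : ℝ} (hb : 0 < b) {w w₀ : ℂ} (hw : ‖w - w₀‖ ≤ 1) (q : ℝ) :
    ‖gaussKernel b (w - q)‖ ≤ Real.sqrt (b / Real.pi) * Real.exp (b * (1 + (|w₀.im| + 1) ^ 2)) *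
      Real.exp (-(b / 2) * (q - w₀.re) ^ 2) := by
  rw [norm_gaussKernel_sub, mul_left_comm, ← Real.exp_add, mul_assoc, ← Real.exp_add]
  apply mul_le_mul_of_nonneg_left _ (Real.sqrt_nonneg _)
  apply Real.exp_le_exp.2
  have h1 : |w.re - w₀.re| ≤ 1 := by
    rw [← Complex.sub_re]; exact (Complex.abs_re_le_norm _).trans hw
  have h2 : |w.im - w₀.im| ≤ 1 := by
    rw [← Complex.sub_im]; exact (Complex.abs_im_le_norm _).trans hw
  have h3 : w.im ^ 2 ≤ (|w₀.im| + 1) ^ 2 := by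
    rw [← sq_abs w.im]
    have : |w.im| ≤ |w₀.im| + 1 := by
      have := abs_sub_abs_le_abs_sub w.im w₀.im; linarith
    gcongr
  have h4 : (w.re - w₀.re) ^ 2 ≤ 1 := by
    rw [← sq_abs]; nlinarith [abs_nonneg (w.re - w₀.re)]
  have h5 : (q - w₀.re) ^ 2 ≤ 2 * (q - w.re) ^ 2 + 2 * (w.re - w₀.re) ^ 2 := by
    nlinarith [sq_nonneg ((q - w.re) - (w.re - w₀.re))]
  nlinarith

/-- Contour shift by `i` for rapidly decreasing functions on the strip. -/
lemma IsStripAnalytic.integral_eq {h : ℂ → ℂ} (hh : IsStripAnalytic h) {K η : ℝ} (hη : 0 < η)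
    (hb : ∀ z ∈ closedStrip, ‖h z‖ ≤ K * Real.exp (-η * z.re ^ 2)) :
    ∫ t : ℝ, h t = ∫ t : ℝ, h (t + Complex.I) := by
  have hK : 0 ≤ K := by
    have := (norm_nonneg _).trans (hb 0 (by simp [closedStrip])); simpa using this
  have hi : Integrable (fun t : ℝ => K * Real.exp (-η * t ^ 2)) :=
    (integrable_exp_neg_mul_sq hη).const_mul K
  have c0 : Continuous fun t : ℝ => h t :=
    hh.1.comp_continuous Complex.continuous_ofReal ofReal_mem_closedStrip
  have c1 : Continuous fun t : ℝ => h (t + Complex.I) :=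
    hh.1.comp_continuous (by fun_prop) ofReal_add_I_mem_closedStrip
  have i0 : Integrable fun t : ℝ => h t := hi.mono' c0.aestronglyMeasurable
    (Eventually.of_forall fun t => by simpa using hb t (ofReal_mem_closedStrip t))
  have i1 : Integrable fun t : ℝ => h (t + Complex.I) := hi.mono' c1.aestronglyMeasurable
    (Eventually.of_forall fun t => by simpa using hb _ (ofReal_add_I_mem_closedStrip t))
  have l0 := intervalIntegral_tendsto_integral i0 tendsto_neg_atTop_atBot tendsto_id
  have l1 := intervalIntegral_tendsto_integral i1 tendsto_neg_atTop_atBot tendsto_id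
  have hd : Tendsto (fun R : ℝ => 2 * (K * Real.exp (-η * R ^ 2))) atTop (𝓝 0) := by
    have : Tendsto (fun R : ℝ => Real.exp (-η * R ^ 2)) atTop (𝓝 0) := by
      apply Real.tendsto_exp_atBot.comp
      exact (tendsto_pow_atTop two_ne_zero).const_mul_atTop_of_neg (by linarith)
    simpa using (this.const_mul K).const_mul 2
  have hdiff : Tendsto (fun R : ℝ => (∫ t in (-R)..R, h t) - ∫ t in (-R)..R, h (t + Complex.I))
      atTop (𝓝 0) := by
    refine squeeze_zero_norm' ?_ hd
    filter_upwards [eventually_ge_atTop 0] with R hR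
    have rect := Complex.integral_boundary_rect_eq_zero_of_continuousOn_of_differentiableOn h
      (-R : ℂ) (R + Complex.I) ?_ ?_
    · simp only [Complex.neg_re, Complex.ofReal_re, Complex.neg_im, Complex.ofReal_im, neg_zero,
        Complex.add_re, Complex.I_re, add_zero, Complex.add_im, Complex.I_im, zero_add,
        Complex.ofReal_zero, zero_mul, Complex.ofReal_one, one_mul, smul_eq_mul] at rect
      have hv : ∀ S : ℝ, S ^ 2 = R ^ 2 →
          ‖∫ y in (0 : ℝ)..1, h (S + y * Complex.I)‖ ≤ K * Real.exp (-η * R ^ 2) := by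
        intro S hS
        have := intervalIntegral.norm_integral_le_of_norm_le_const (a := (0 : ℝ)) (b := 1)
          (f := fun y : ℝ => h (S + y * Complex.I)) (C := K * Real.exp (-η * R ^ 2)) ?_
        · simpa using this
        · intro y hy
          rw [uIoc_of_le zero_le_one] at hy
          have := hb (S + y * Complex.I) (by simp [closedStrip, hy.1.le, hy.2])
          simpa [hS] using this
      have e : (∫ t in (-R)..R, h t) - (∫ t in (-R)..R, h (t + Complex.I)) =
          Complex.I * (∫ y in (0 : ℝ)..1, h (((-R : ℝ) : ℂ) + y * Complex.I)) -
          Complex.I * (∫ y in (0 : ℝ)..1, h (R + y * Complex.I)) := by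
        linear_combination rect
      rw [e]
      refine (norm_sub_le _ _).trans ?_
      rw [norm_mul, norm_mul, Complex.norm_I, one_mul, one_mul, two_mul]
      exact add_le_add (hv (-R) (by ring)) (hv R rfl)
    · refine hh.1.mono fun z hz => ?_
      have := hz.2
      simp only [mem_preimage, Complex.neg_im, Complex.ofReal_im, neg_zero, Complex.add_im,
        Complex.I_im, zero_add, uIcc_of_le (zero_le_one (α := ℝ))] at this
      exact this
    · refine hh.2.mono fun z hz => ?_
      have := hz.2
      simp only [mem_preimage, Complex.neg_im, Complex.ofReal_im, neg_zero, Complex.add_im,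
        Complex.I_im, zero_add] at this
      simpa [openStrip] using this
  have := tendsto_nhds_unique hdiff (l0.sub l1)
  exact (sub_eq_zero.1 this.symm)

/-- Contour shift for the Gaussian regularization of a strip function. -/
lemma IsStripAnalytic.integral_gaussKernel_add_I {F : ℂ → ℂ} (hF : IsStripAnalytic F) {K Λ b : ℝ}
    (hb : ∀ z ∈ closedStrip, ‖F z‖ ≤ K * Real.exp (Λ * z.re ^ 2)) (hb0 : 0 < b) (hΛ : Λ < b)
    (w : ℂ) : ∫ t : ℝ, F t * gaussKernel b (w + Complex.I - t) =
      ∫ t : ℝ, F (t + Complex.I) * gaussKernel b (w - t) := by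
  have hK : 0 ≤ K := by
    have := (norm_nonneg _).trans (hb 0 (by simp [closedStrip])); simpa using this
  have hh : IsStripAnalytic (fun z => F z * gaussKernel b (w + Complex.I - z)) :=
    hF.mul (Differentiable.isStripAnalytic
      ((differentiable_gaussKernel b).comp (by fun_prop)))
  set β := b - Λ with hβ
  have hβ0 : 0 < β := sub_pos.2 hΛ
  -- With β = b - Λ > 0, completing the square gives Λx² - b(Re w - x)² ≤ 2b²(Re w)²/β - βx²/2. The
  -- integrand thus decays at rate β/2 and the contour may be moved.
  have key := hh.integral_eq (K := K * (Real.sqrt (b / Real.pi) *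
    Real.exp (b * (|w.im| + 1) ^ 2 + 2 * b ^ 2 * w.re ^ 2 / β))) (η := β / 2) (by positivity) ?_
  · rw [key]
    congr 1; ext t; congr 2; ring
  · intro z hz
    rw [norm_mul, norm_gaussKernel]
    calc _ ≤ (K * Real.exp (Λ * z.re ^ 2)) * (Real.sqrt (b / Real.pi) * Real.exp (-b *
          ((w + Complex.I - z).re ^ 2 - (w + Complex.I - z).im ^ 2))) := by gcongr; exact hb z hz
      _ = K * (Real.sqrt (b / Real.pi) * Real.exp (Λ * z.re ^ 2 + -b *
          ((w + Complex.I - z).re ^ 2 - (w + Complex.I - z).im ^ 2))) := by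
          rw [Real.exp_add]; ring
      _ ≤ K * (Real.sqrt (b / Real.pi) * Real.exp ((b * (|w.im| + 1) ^ 2 +
          2 * b ^ 2 * w.re ^ 2 / β) + -(β / 2) * z.re ^ 2)) := by
        apply mul_le_mul_of_nonneg_left _ hK
        apply mul_le_mul_of_nonneg_left _ (Real.sqrt_nonneg _)
        apply Real.exp_le_exp.2
        simp only [Complex.sub_re, Complex.add_re, Complex.I_re, add_zero, Complex.sub_im,
          Complex.add_im, Complex.I_im]
        have h1 : (w.im + 1 - z.im) ^ 2 ≤ (|w.im| + 1) ^ 2 := by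
          apply sq_le_sq'
          · linarith [neg_abs_le w.im, hz.1, hz.2]
          · linarith [le_abs_self w.im, hz.1, hz.2]
        have h2 : Λ * z.re ^ 2 - b * (w.re - z.re) ^ 2 ≤
            2 * b ^ 2 * w.re ^ 2 / β - β / 2 * z.re ^ 2 := by
          have e1 : 2 * b ^ 2 * w.re ^ 2 / β - β / 2 * z.re ^ 2 - (Λ * z.re ^ 2 -
            b * (w.re - z.re) ^ 2) = (2 * b * w.re - β * z.re) ^ 2 / (2 * β) + b * w.re ^ 2 := by
            rw [show Λ = b - β by rw [hβ]; ring]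
            field_simp
            ring
          have e2 : 0 ≤ (2 * b * w.re - β * z.re) ^ 2 / (2 * β) + b * w.re ^ 2 := by positivity
          linarith
        nlinarith [mul_le_mul_of_nonneg_left h1 hb0.le]
      _ = _ := by rw [Real.exp_add]; ring

/-- The Gaussian regularization of a function on the plane. -/
def gaussReg (b : ℝ) (h : ℝ → ℝ → ℂ) (p : ℂ × ℂ) : ℂ :=
  ∫ q : ℝ × ℝ, h q.1 q.2 * (gaussKernel b (p.1 - q.1) * gaussKernel b (p.2 - q.2))

section Reg

variable {b : ℝ} {h : ℝ → ℝ → ℂ} {M : ℝ}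

lemma gaussReg_norm_integrand_le (hM : ∀ x y, ‖h x y‖ ≤ M) (p : ℂ × ℂ) (q : ℝ × ℝ) :
    ‖h q.1 q.2 * (gaussKernel b (p.1 - q.1) * gaussKernel b (p.2 - q.2))‖ ≤
      M * (‖gaussKernel b (p.1 - q.1)‖ * ‖gaussKernel b (p.2 - q.2)‖) := by
  rw [norm_mul, norm_mul]
  gcongr
  exact hM _ _

lemma gaussReg_integrable_bound (hb : 0 < b) (p : ℂ × ℂ) : Integrable (fun q : ℝ × ℝ =>
    M * (‖gaussKernel b (p.1 - q.1)‖ * ‖gaussKernel b (p.2 - q.2)‖)) :=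
  ((integrable_gaussKernel_sub hb p.1).norm.mul_prod
    (integrable_gaussKernel_sub hb p.2).norm).const_mul M

lemma gaussReg_continuous_integrand (hh : Continuous fun q : ℝ × ℝ => h q.1 q.2) (p : ℂ × ℂ) :
    Continuous fun q : ℝ × ℝ =>
      h q.1 q.2 * (gaussKernel b (p.1 - q.1) * gaussKernel b (p.2 - q.2)) := by
  have := continuous_gaussKernel b
  fun_prop

lemma gaussReg_integrable (hb : 0 < b) (hh : Continuous fun q : ℝ × ℝ => h q.1 q.2)
    (hM : ∀ x y, ‖h x y‖ ≤ M) (p : ℂ × ℂ) : Integrable fun q : ℝ × ℝ =>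
      h q.1 q.2 * (gaussKernel b (p.1 - q.1) * gaussKernel b (p.2 - q.2)) :=
  (gaussReg_integrable_bound hb p).mono' (gaussReg_continuous_integrand hh p).aestronglyMeasurable
    (Eventually.of_forall (gaussReg_norm_integrand_le hM p))

lemma norm_gaussReg_le (hb : 0 < b) (hM : ∀ x y, ‖h x y‖ ≤ M) (p : ℂ × ℂ) :
    ‖gaussReg b h p‖ ≤ M * (Real.exp (b * p.1.im ^ 2) * Real.exp (b * p.2.im ^ 2)) := by
  refine (norm_integral_le_of_norm_le (gaussReg_integrable_bound (M := M) hb p)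
    (Eventually.of_forall (gaussReg_norm_integrand_le hM p))).trans_eq ?_
  rw [integral_const_mul]
  congr 1
  rw [Measure.volume_eq_prod, integral_prod_mul (fun x : ℝ => ‖gaussKernel b (p.1 - x)‖)
    (fun y : ℝ => ‖gaussKernel b (p.2 - y)‖), integral_norm_gaussKernel_sub hb,
    integral_norm_gaussKernel_sub hb]

lemma differentiable_gaussReg_line (hb : 0 < b) (hh : Continuous fun q : ℝ × ℝ => h q.1 q.2)
    (hM : ∀ x y, ‖h x y‖ ≤ M) (p v : ℂ × ℂ) :
    Differentiable ℂ fun z : ℂ => gaussReg b h (p + z • v) := by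
  rw [← differentiableOn_univ]
  refine differentiableOn_integral_of_bound isOpen_univ ?_ ?_ ?_
  · intro z _; exact (gaussReg_continuous_integrand hh _).aestronglyMeasurable
  · refine Eventually.of_forall fun q => ?_
    have := differentiable_gaussKernel b
    apply Differentiable.differentiableOn
    simp only [Prod.fst_add, Prod.smul_fst, Prod.snd_add, Prod.smul_snd]
    fun_prop
  · intro z₀ _
    set w := p + z₀ • v with hw
    set C : ℂ → ℝ := fun w => Real.sqrt (b / Real.pi) * Real.exp (b * (1 + (|w.im| + 1) ^ 2))
    refine ⟨fun q => M * ((C w.1 * Real.exp (-(b / 2) * (q.1 - w.1.re) ^ 2)) *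
      (C w.2 * Real.exp (-(b / 2) * (q.2 - w.2.re) ^ 2))), ?_, 1 / (1 + ‖v‖), by positivity, ?_⟩
    · exact (((integrable_exp_neg_mul_sub_sq (half_pos hb) w.1.re).const_mul _).mul_prod
        ((integrable_exp_neg_mul_sub_sq (half_pos hb) w.2.re).const_mul _)).const_mul M
    · refine Eventually.of_forall fun q z hz => ?_
      refine (gaussReg_norm_integrand_le hM _ q).trans ?_
      have hM0 : 0 ≤ M := (norm_nonneg _).trans (hM 0 0)
      have hd : ‖(p + z • v) - w‖ ≤ 1 := by
        have e : (p + z • v) - w = (z - z₀) • v := by rw [hw, sub_smul]; abel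
        rw [e, norm_smul]
        rw [Metric.mem_ball, dist_eq_norm] at hz
        calc ‖z - z₀‖ * ‖v‖ ≤ 1 / (1 + ‖v‖) * (1 + ‖v‖) := by
              gcongr; linarith
          _ = 1 := by field_simp
      have h1 : ‖(p + z • v).1 - w.1‖ ≤ 1 := (norm_fst_le ((p + z • v) - w)).trans hd
      have h2 : ‖(p + z • v).2 - w.2‖ ≤ 1 := (norm_snd_le ((p + z • v) - w)).trans hd
      exact mul_le_mul_of_nonneg_left (mul_le_mul (norm_gaussKernel_sub_le hb h1 q.1)
        (norm_gaussKernel_sub_le hb h2 q.2) (norm_nonneg _) (by positivity)) hM0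

end Reg

/-- `f₀` and `f₁` are the boundary values of an analytic function on the strip. -/
def EdgeCont (f₀ f₁ : ℝ → ℂ) : Prop :=
  ∃ F : ℂ → ℂ, IsStripAnalytic F ∧ GaussGrowth F ∧ (∀ t : ℝ, F t = f₀ t) ∧
    ∀ t : ℝ, F (t + Complex.I) = f₁ t

/-- The regularization is entire in its first variable, so it can be evaluated at a point moved by
i. The contour shift through the continuation for fixed y replaces g by its upper boundary function
A; this identifies the regularization over a vertex of the triangle. -/
lemma gaussReg_add_I_left {b : ℝ} (hb : 0 < b) {g A : ℝ → ℝ → ℂ} {M : ℝ}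
    (hg : Continuous fun q : ℝ × ℝ => g q.1 q.2) (hA : Continuous fun q : ℝ × ℝ => A q.1 q.2)
    (hgM : ∀ x y, ‖g x y‖ ≤ M) (hAM : ∀ x y, ‖A x y‖ ≤ M)
    (hE : ∀ y, EdgeCont (fun x => g x y) (fun x => A x y)) (p : ℂ × ℂ) :
    gaussReg b g (p.1 + Complex.I, p.2) = gaussReg b A p := by
  unfold gaussReg
  rw [Measure.volume_eq_prod, integral_prod_symm _ (gaussReg_integrable hb hg hgM _),
    integral_prod_symm _ (gaussReg_integrable hb hA hAM _)]
  congr 1; ext y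
  obtain ⟨F, hF, hFg, h0, h1⟩ := hE y
  have hFM := hF.norm_le hFg (M := M) (fun t => by rw [h0]; exact hgM _ _)
    (fun t => by rw [h1]; exact hAM _ _)
  have := hF.integral_gaussKernel_add_I (K := M) (Λ := 0) (b := b) (by simpa using hFM) hb hb p.1
  simp_rw [h0, h1] at this
  simp_rw [← mul_assoc]
  rw [integral_mul_const, integral_mul_const, this]

lemma gaussReg_add_I_right {b : ℝ} (hb : 0 < b) {g B : ℝ → ℝ → ℂ} {M : ℝ}
    (hg : Continuous fun q : ℝ × ℝ => g q.1 q.2) (hB : Continuous fun q : ℝ × ℝ => B q.1 q.2)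
    (hgM : ∀ x y, ‖g x y‖ ≤ M) (hBM : ∀ x y, ‖B x y‖ ≤ M)
    (hE : ∀ x, EdgeCont (fun y => g x y) (fun y => B x y)) (p : ℂ × ℂ) :
    gaussReg b g (p.1, p.2 + Complex.I) = gaussReg b B p := by
  unfold gaussReg
  rw [Measure.volume_eq_prod, integral_prod _ (gaussReg_integrable hb hg hgM _),
    integral_prod _ (gaussReg_integrable hb hB hBM _)]
  congr 1; ext x
  obtain ⟨F, hF, hFg, h0, h1⟩ := hE x
  have hFM := hF.norm_le hFg (M := M) (fun t => by rw [h0]; exact hgM _ _)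
    (fun t => by rw [h1]; exact hBM _ _)
  have := hF.integral_gaussKernel_add_I (K := M) (Λ := 0) (b := b) (by simpa using hFM) hb hb p.2
  simp_rw [h0, h1] at this
  simp_rw [mul_left_comm _ (gaussKernel b (p.1 - _))]
  rw [integral_const_mul, integral_const_mul, this]

/-- The Gaussian regularization at real points, with the width as a parameter. -/
def gaussAvg (h : ℝ → ℝ → ℂ) (c : ℝ) (p : ℝ × ℝ) : ℂ :=
  ∫ q : ℝ × ℝ, h (p.1 - c * q.1) (p.2 - c * q.2) *
    (gaussKernel 1 ((0 : ℂ) - q.1) * gaussKernel 1 ((0 : ℂ) - q.2))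

/-- The width c = 0 is included, so convergence of the regularizations becomes continuity at c = 0.
-/
lemma continuous_gaussAvg {h : ℝ → ℝ → ℂ} {M : ℝ} (hh : Continuous fun q : ℝ × ℝ => h q.1 q.2)
    (hM : ∀ x y, ‖h x y‖ ≤ M) : Continuous fun p : ℝ × (ℝ × ℝ) => gaussAvg h p.1 p.2 := by
  have hk := continuous_gaussKernel 1
  refine continuous_of_dominated (bound := fun q : ℝ × ℝ => M * (‖gaussKernel 1 ((0 : ℂ) - q.1)‖ *
    ‖gaussKernel 1 ((0 : ℂ) - q.2)‖)) ?_ ?_ ?_ ?_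
  · intro p
    apply Continuous.aestronglyMeasurable
    have : Continuous fun q : ℝ × ℝ => h (p.2.1 - p.1 * q.1) (p.2.2 - p.1 * q.2) :=
      hh.comp (by fun_prop : Continuous fun q : ℝ × ℝ => (p.2.1 - p.1 * q.1, p.2.2 - p.1 * q.2))
    fun_prop
  · intro p
    refine Eventually.of_forall fun q => ?_
    rw [norm_mul, norm_mul]
    gcongr
    exact hM _ _
  · exact gaussReg_integrable_bound (p := (0, 0)) one_pos
  · refine Eventually.of_forall fun q => ?_
    have : Continuous fun p : ℝ × (ℝ × ℝ) => h (p.2.1 - p.1 * q.1) (p.2.2 - p.1 * q.2) :=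
      hh.comp (by fun_prop : Continuous fun p : ℝ × (ℝ × ℝ) =>
        (p.2.1 - p.1 * q.1, p.2.2 - p.1 * q.2))
    fun_prop

lemma integral_gaussKernel_neg : ∫ q : ℝ, gaussKernel 1 ((0 : ℂ) - q) = 1 := by
  have : ∀ q : ℝ, gaussKernel 1 ((0 : ℂ) - q) =
      ((Real.sqrt (1 / Real.pi) * Real.exp (-1 * q ^ 2) : ℝ) : ℂ) := by
    intro q; simp [gaussKernel]
  simp_rw [this]
  rw [integral_complex_ofReal, integral_const_mul, integral_gaussian, ← Real.sqrt_mul (by positivity)]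
  have : 1 / Real.pi * (Real.pi / 1) = 1 := by field_simp
  rw [this]; simp

lemma gaussAvg_zero (h : ℝ → ℝ → ℂ) (p : ℝ × ℝ) : gaussAvg h 0 p = h p.1 p.2 := by
  unfold gaussAvg
  simp only [zero_mul, sub_zero]
  rw [integral_const_mul, Measure.volume_eq_prod,
    integral_prod_mul (fun x : ℝ => gaussKernel 1 ((0 : ℂ) - x))
    (fun y : ℝ => gaussKernel 1 ((0 : ℂ) - y)), integral_gaussKernel_neg]
  simp

lemma norm_gaussAvg_le {h : ℝ → ℝ → ℂ} {M : ℝ} (hM : ∀ x y, ‖h x y‖ ≤ M) (c : ℝ) (p : ℝ × ℝ) :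
    ‖gaussAvg h c p‖ ≤ M := by
  have := norm_gaussReg_le (b := 1) one_pos (h := fun x y => h (p.1 - c * x) (p.2 - c * y))
    (fun x y => hM _ _) (0, 0)
  simpa [gaussReg, gaussAvg] using this

/-- Substitution q ↦ (x, y) - c q, with b = c⁻²; the Jacobian c² is absorbed by the two kernels. -/
lemma gaussReg_eq_gaussAvg {h : ℝ → ℝ → ℂ} {c : ℝ} (hc : 0 < c) (x y : ℝ) :
    gaussReg (c⁻¹ ^ 2) h ((x : ℂ), (y : ℂ)) = gaussAvg h c (x, y) := by
  unfold gaussReg gaussAvg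
  set f : ℝ × ℝ → ℂ := fun q => h q.1 q.2 *
    (gaussKernel (c⁻¹ ^ 2) (x - q.1) * gaussKernel (c⁻¹ ^ 2) (y - q.2)) with hf
  have e1 : ∫ q, f q = ∫ q, f ((x, y) - q) := (integral_sub_left_eq_self f volume (x, y)).symm
  have e2 : ∫ q : ℝ × ℝ, f ((x, y) - c • q) = |(c ^ Module.finrank ℝ (ℝ × ℝ))⁻¹| •
      ∫ q, f ((x, y) - q) := Measure.integral_comp_smul volume (fun q => f ((x, y) - q)) c
  have e3 : Module.finrank ℝ (ℝ × ℝ) = 2 := by simp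
  rw [e3, abs_of_pos (by positivity)] at e2
  have hker : ∀ q : ℝ, gaussKernel 1 ((0 : ℂ) - q) = c * gaussKernel (c⁻¹ ^ 2) (c * q) := by
    intro q
    unfold gaussKernel
    have h1 : Real.sqrt (c⁻¹ ^ 2 / Real.pi) = c⁻¹ * Real.sqrt (1 / Real.pi) := by
      rw [show c⁻¹ ^ 2 / Real.pi = c⁻¹ ^ 2 * (1 / Real.pi) by ring, Real.sqrt_mul (by positivity),
        Real.sqrt_sq (by positivity)]
    rw [h1]
    have hc' : (c : ℂ) ≠ 0 := by exact_mod_cast hc.ne'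
    have h2 : -((c⁻¹ ^ 2 : ℝ) : ℂ) * (c * q) ^ 2 = -((1 : ℝ) : ℂ) * ((0 : ℂ) - q) ^ 2 := by
      push_cast; field_simp; ring
    rw [h2]
    push_cast
    field_simp
  rw [e1]
  have e4 : ∫ q, f ((x, y) - q) = (c ^ 2 : ℝ) • ∫ q : ℝ × ℝ, f ((x, y) - c • q) := by
    rw [e2, smul_smul, mul_inv_cancel₀ (by positivity), one_smul]
  rw [e4, ← integral_smul]
  congr 1; ext q
  rw [hker, hker, hf]
  simp only [Prod.fst_sub, Prod.smul_fst, Prod.snd_sub, Prod.smul_snd, smul_eq_mul,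
    Complex.real_smul]
  push_cast
  rw [sub_sub_cancel, sub_sub_cancel]
  ring

/-! ### Analytic functions on a tube with triangular base -/

/-- The closed tube in `ℂ²` over the triangle with vertices `(0,0)`, `(1,0)`, `(0,1)`. -/
def triTube : Set (ℂ × ℂ) := {p | 0 ≤ p.1.im ∧ 0 ≤ p.2.im ∧ p.1.im + p.2.im ≤ 1}

/-- Continuous functions of Gaussian growth on the tube which are analytic along complex lines. -/
structure IsTubeFunction (G : ℂ × ℂ → ℂ) : Prop where
  cont : ContinuousOn G triTube
  diff : ∀ (p v : ℂ × ℂ) (U : Set ℂ), IsOpen U → (∀ z ∈ U, p + z • v ∈ triTube) →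
    DifferentiableOn ℂ (fun z => G (p + z • v)) U
  growth : ∃ M Λ : ℝ, 0 ≤ Λ ∧ ∀ p ∈ triTube,
    ‖G p‖ ≤ M * Real.exp (Λ * (p.1.re ^ 2 + p.2.re ^ 2))

/-- A maximum principle by two applications of the one-dimensional one. The line in direction (-1,
1) joins the two imaginary vertices and controls the third edge; every other point lies on a line in
a direction (l, 1 - l) from a real point to that edge. The bound `C₀` only supplies the a priori
growth. -/
lemma norm_le_of_triTube_vertices {E : ℂ × ℂ → ℂ}
    (hE : ∀ p v : ℂ × ℂ, Differentiable ℂ fun z : ℂ => E (p + z • v)) {C₀ M : ℝ}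
    (hC : ∀ p ∈ triTube, ‖E p‖ ≤ C₀) (h0 : ∀ x y : ℝ, ‖E (x, y)‖ ≤ M)
    (h1 : ∀ x y : ℝ, ‖E (x + Complex.I, y)‖ ≤ M) (h2 : ∀ x y : ℝ, ‖E (x, y + Complex.I)‖ ≤ M) :
    ∀ p ∈ triTube, ‖E p‖ ≤ M := by
  have third : ∀ p : ℂ × ℂ, 0 ≤ p.1.im → 0 ≤ p.2.im → p.1.im + p.2.im = 1 → ‖E p‖ ≤ M := by
    intro p hp1 hp2 hp
    have key := (hE ((p.1.re : ℂ) + Complex.I, (p.2.re : ℂ)) (-1, 1)).isStripAnalytic.norm_le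
      (M := M) ⟨C₀, 0, ?_⟩ ?_ ?_ (p.2.im * Complex.I) ?_
    · convert key using 3
      apply Prod.ext
      · apply Complex.ext <;> simp; linarith
      · apply Complex.ext <;> simp
    · intro z hz
      simp only [zero_mul, Real.exp_zero, mul_one]
      apply hC
      simp only [triTube, mem_ofPred_eq, Prod.smul_mk, smul_eq_mul, Prod.mk_add_mk]
      simp only [Complex.add_im, Complex.ofReal_im, Complex.I_im, mul_neg, mul_one, Complex.neg_im]
      refine ⟨by linarith [hz.2], by linarith [hz.1], by linarith⟩
    · intro t
      have := h1 (p.1.re - t) (p.2.re + t)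
      convert this using 3
      apply Prod.ext
      · simp; ring
      · simp
    · intro t
      have := h2 (p.1.re - t) (p.2.re + t)
      convert this using 3
      apply Prod.ext
      · simp; ring
      · simp; ring
    · simp only [closedStrip, mem_ofPred_eq]
      simp
      exact ⟨hp2, by linarith⟩
  rintro p ⟨hp1, hp2, hp⟩
  set s := p.1.im + p.2.im with hs
  have hs0 : 0 ≤ s := by positivity
  obtain ⟨l, hl0, hl1, hl⟩ : ∃ l : ℝ, 0 ≤ l ∧ l ≤ 1 ∧ l * s = p.1.im := by
    by_cases h : s = 0
    · exact ⟨0, le_rfl, zero_le_one, by rw [zero_mul]; linarith⟩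
    · refine ⟨p.1.im / s, by positivity, div_le_one_of_le₀ (by linarith) hs0, by field_simp⟩
  have key := (hE ((p.1.re : ℂ), (p.2.re : ℂ)) (l, 1 - l)).isStripAnalytic.norm_le
    (M := M) ⟨C₀, 0, ?_⟩ ?_ ?_ (s * Complex.I) ?_
  · convert key using 3
    apply Prod.ext
    · apply Complex.ext <;> simp; linarith
    · apply Complex.ext <;> simp; linarith
  · intro z hz
    simp only [zero_mul, Real.exp_zero, mul_one]
    apply hC
    simp only [triTube, mem_ofPred_eq, Prod.smul_mk, smul_eq_mul, Prod.mk_add_mk]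
    simp only [Complex.add_im, Complex.ofReal_im, Complex.mul_im, Complex.ofReal_re, Complex.sub_re,
      Complex.sub_im, Complex.one_re, Complex.one_im, mul_zero, sub_zero, zero_add]
    refine ⟨mul_nonneg hz.1 hl0, mul_nonneg hz.1 (by linarith), by nlinarith [hz.2]⟩
  · intro t
    have := h0 (p.1.re + t * l) (p.2.re + t * (1 - l))
    convert this using 3
    apply Prod.ext <;> simp
  · intro t
    apply third
    · simpa using hl0
    · simpa using hl1
    · simp
  · simp only [closedStrip, mem_ofPred_eq]
    simp
    exact ⟨hs0, hp⟩

lemma continuous_gaussReg {b M : ℝ} {h : ℝ → ℝ → ℂ} (hb : 0 < b)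
    (hh : Continuous fun q : ℝ × ℝ => h q.1 q.2) (hM : ∀ x y, ‖h x y‖ ≤ M) :
    Continuous (gaussReg b h) := by
  rw [continuous_iff_continuousAt]
  intro w
  set C : ℂ → ℝ := fun w => Real.sqrt (b / Real.pi) * Real.exp (b * (1 + (|w.im| + 1) ^ 2))
  refine continuousAt_of_dominated (bound := fun q : ℝ × ℝ =>
    M * ((C w.1 * Real.exp (-(b / 2) * (q.1 - w.1.re) ^ 2)) *
      (C w.2 * Real.exp (-(b / 2) * (q.2 - w.2.re) ^ 2)))) ?_ ?_ ?_ ?_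
  · exact Eventually.of_forall fun p => (gaussReg_continuous_integrand hh p).aestronglyMeasurable
  · filter_upwards [Metric.closedBall_mem_nhds w one_pos] with p hp
    refine Eventually.of_forall fun q => ?_
    refine (gaussReg_norm_integrand_le hM _ q).trans ?_
    have hM0 : 0 ≤ M := (norm_nonneg _).trans (hM 0 0)
    rw [Metric.mem_closedBall, dist_eq_norm] at hp
    have h1 : ‖p.1 - w.1‖ ≤ 1 := (norm_fst_le (p - w)).trans hp
    have h2 : ‖p.2 - w.2‖ ≤ 1 := (norm_snd_le (p - w)).trans hp
    exact mul_le_mul_of_nonneg_left (mul_le_mul (norm_gaussKernel_sub_le hb h1 q.1)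
      (norm_gaussKernel_sub_le hb h2 q.2) (norm_nonneg _) (by positivity)) hM0
  · exact (((integrable_exp_neg_mul_sub_sq (half_pos hb) w.1.re).const_mul _).mul_prod
        ((integrable_exp_neg_mul_sub_sq (half_pos hb) w.2.re).const_mul _)).const_mul M
  · refine Eventually.of_forall fun q => ?_
    have := continuous_gaussKernel b
    apply Continuous.continuousAt
    fun_prop

/-- The weight `e^{Λ(p₁² + p₂²)}`. -/
def gaussWeight (Λ : ℝ) (p : ℂ × ℂ) : ℂ := Complex.exp (Λ * (p.1 ^ 2 + p.2 ^ 2))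

lemma norm_gaussWeight (Λ : ℝ) (p : ℂ × ℂ) : ‖gaussWeight Λ p‖ =
    Real.exp (Λ * ((p.1.re ^ 2 - p.1.im ^ 2) + (p.2.re ^ 2 - p.2.im ^ 2))) := by
  rw [gaussWeight, mul_add, Complex.exp_add, norm_mul, norm_exp_mul_sq, norm_exp_mul_sq,
    ← Real.exp_add]; ring_nf

lemma continuous_gaussWeight (Λ : ℝ) : Continuous (gaussWeight Λ) := by
  unfold gaussWeight; fun_prop

lemma differentiable_gaussWeight_line (Λ : ℝ) (p v : ℂ × ℂ) :
    Differentiable ℂ fun z : ℂ => gaussWeight Λ (p + z • v) := by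
  unfold gaussWeight
  simp only [Prod.fst_add, Prod.smul_fst, Prod.snd_add, Prod.smul_snd]
  fun_prop

lemma triTube_im_sq {p : ℂ × ℂ} (hp : p ∈ triTube) : p.1.im ^ 2 + p.2.im ^ 2 ≤ 1 := by
  obtain ⟨h1, h2, h3⟩ := hp
  nlinarith [mul_nonneg h1 h2]

lemma norm_gaussWeight_le_exp {Λ : ℝ} (hΛ : 0 ≤ Λ) (p : ℂ × ℂ) :
    ‖gaussWeight Λ p‖ ≤ Real.exp (Λ * (p.1.re ^ 2 + p.2.re ^ 2)) := by
  rw [norm_gaussWeight]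
  apply Real.exp_le_exp.2
  apply mul_le_mul_of_nonneg_left _ hΛ
  nlinarith [sq_nonneg p.1.im, sq_nonneg p.2.im]

lemma norm_gaussWeight_neg_le {Λ : ℝ} (hΛ : 0 ≤ Λ) {p : ℂ × ℂ} (hp : p ∈ triTube) :
    ‖gaussWeight (-Λ) p‖ ≤ Real.exp Λ * Real.exp (-Λ * (p.1.re ^ 2 + p.2.re ^ 2)) := by
  rw [norm_gaussWeight, ← Real.exp_add]
  apply Real.exp_le_exp.2
  nlinarith [triTube_im_sq hp]

lemma gaussWeight_neg_mul (Λ : ℝ) (p : ℂ × ℂ) : gaussWeight (-Λ) p * gaussWeight Λ p = 1 := by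
  rw [gaussWeight, gaussWeight, ← Complex.exp_add]; simp

lemma real_mem_triTube (x y : ℝ) : ((x : ℂ), (y : ℂ)) ∈ triTube := by simp [triTube]

lemma left_mem_triTube (x y : ℝ) : ((x : ℂ) + Complex.I, (y : ℂ)) ∈ triTube := by simp [triTube]

lemma right_mem_triTube (x y : ℝ) : ((x : ℂ), (y : ℂ) + Complex.I) ∈ triTube := by simp [triTube]

lemma prod_norm_sq_le (x y : ℝ) : ‖((x, y) : ℝ × ℝ)‖ ^ 2 ≤ x ^ 2 + y ^ 2 := by
  rw [Prod.norm_def]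
  rcases max_cases ‖((x, y) : ℝ × ℝ).1‖ ‖((x, y) : ℝ × ℝ).2‖ with ⟨h, -⟩ | ⟨h, -⟩ <;> rw [h] <;>
    simp [sq_nonneg]

/-- The Gaussian averages of bounded continuous functions converge, uniformly with weight. -/
lemma exists_gaussAvg_close {h : ℝ → ℝ → ℂ} {M : ℝ} (hh : Continuous fun q : ℝ × ℝ => h q.1 q.2)
    (hM : ∀ x y, ‖h x y‖ ≤ M) {ε : ℝ} (hε : 0 < ε) :
    ∀ᶠ c in 𝓝 (0 : ℝ), ∀ x y : ℝ, ‖gaussAvg h c (x, y) - h x y‖ ≤ ε * Real.exp (x ^ 2 + y ^ 2) := by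
  have := eventually_forall_norm_sub_lt_exp (E := ℝ × ℝ) (h := fun c p => gaussAvg h c p)
    (continuous_gaussAvg hh hM) 0 (M := M) (Λ := 0)
    (Eventually.of_forall fun c p => by simpa using norm_gaussAvg_le hM c p) hε
  filter_upwards [this] with c hc x y
  have h1 := hc (x, y)
  rw [gaussAvg_zero] at h1
  refine h1.trans ?_
  gcongr
  simpa using prod_norm_sq_le x y

/-- A bounded function with two bounded analytic continuations in the imaginary directions extends
to the tube. -/
lemma exists_isTubeFunction_of_bounded {g A B : ℝ → ℝ → ℂ} {M : ℝ}
    (hg : Continuous fun q : ℝ × ℝ => g q.1 q.2) (hA : Continuous fun q : ℝ × ℝ => A q.1 q.2)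
    (hB : Continuous fun q : ℝ × ℝ => B q.1 q.2) (hgM : ∀ x y, ‖g x y‖ ≤ M)
    (hAM : ∀ x y, ‖A x y‖ ≤ M) (hBM : ∀ x y, ‖B x y‖ ≤ M)
    (hEA : ∀ y, EdgeCont (fun x => g x y) (fun x => A x y))
    (hEB : ∀ x, EdgeCont (fun y => g x y) (fun y => B x y)) :
    ∃ G : ℂ × ℂ → ℂ, IsTubeFunction G ∧ (∀ x y : ℝ, G (x, y) = g x y) ∧
      (∀ x y : ℝ, G (x + Complex.I, y) = A x y) ∧ ∀ x y : ℝ, G (x, y + Complex.I) = B x y := by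
  have hM0 : 0 ≤ M := (norm_nonneg _).trans (hgM 0 0)
  set c : ℕ → ℝ := fun n => 1 / ((n : ℝ) + 1) with hc
  have hc0 : ∀ n, 0 < c n := fun n => by positivity
  have hclim : Tendsto c atTop (𝓝 0) := tendsto_one_div_add_atTop_nhds_zero_nat
  set b : ℕ → ℝ := fun n => (c n)⁻¹ ^ 2 with hb
  have hb0 : ∀ n, 0 < b n := fun n => by have := hc0 n; positivity
  set H : ℕ → ℂ × ℂ → ℂ := fun n => gaussReg (b n) g with hH
  -- Gaussian averages converge uniformly only up to a factor e^{x² + y²}. The weight e^{-(p₁² +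
  -- p₂²)} compensates it and is divided out at the end.
  set K : ℕ → ℂ × ℂ → ℂ := fun n p => H n p * gaussWeight (-1) p with hK
  have H0 : ∀ n (x y : ℝ), H n (x, y) = gaussAvg g (c n) (x, y) :=
    fun n x y => gaussReg_eq_gaussAvg (hc0 n) x y
  have H1 : ∀ n (x y : ℝ), H n (x + Complex.I, y) = gaussAvg A (c n) (x, y) := fun n x y =>
    (gaussReg_add_I_left (hb0 n) hg hA hgM hAM hEA (x, y)).trans (gaussReg_eq_gaussAvg (hc0 n) x y)
  have H2 : ∀ n (x y : ℝ), H n (x, y + Complex.I) = gaussAvg B (c n) (x, y) := fun n x y =>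
    (gaussReg_add_I_right (hb0 n) hg hB hgM hBM hEB (x, y)).trans (gaussReg_eq_gaussAvg (hc0 n) x y)
  have Hdiff : ∀ n (p v : ℂ × ℂ), Differentiable ℂ fun z : ℂ => H n (p + z • v) :=
    fun n => differentiable_gaussReg_line (hb0 n) hg hgM
  have Kdiff : ∀ n (p v : ℂ × ℂ), Differentiable ℂ fun z : ℂ => K n (p + z • v) :=
    fun n p v => (Hdiff n p v).mul (differentiable_gaussWeight_line _ p v)
  have Kbd : ∀ n, ∀ p ∈ triTube, ‖K n p‖ ≤ M * (Real.exp (b n) * Real.exp (b n)) * Real.exp 1 := by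
    intro n p hp
    rw [hK]; simp only
    rw [norm_mul]
    have h3 := triTube_im_sq hp
    have i1 : b n * p.1.im ^ 2 ≤ b n := mul_le_of_le_one_right (hb0 n).le (by nlinarith [sq_nonneg p.2.im])
    have i2 : b n * p.2.im ^ 2 ≤ b n := mul_le_of_le_one_right (hb0 n).le (by nlinarith [sq_nonneg p.1.im])
    have j1 : ‖H n p‖ ≤ M * (Real.exp (b n) * Real.exp (b n)) :=
      (norm_gaussReg_le (hb0 n) hgM p).trans (by gcongr)
    have j2 : ‖gaussWeight (-1) p‖ ≤ Real.exp 1 := by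
      refine (norm_gaussWeight_neg_le zero_le_one hp).trans ?_
      apply mul_le_of_le_one_right (Real.exp_pos _).le
      apply Real.exp_le_one_iff.2
      nlinarith [sq_nonneg p.1.re, sq_nonneg p.2.re]
    gcongr
  -- Over the three vertices the functions H n are Gaussian averages of g, A and B, which converge.
  -- The vertex bound carries this to the whole tube; `Kbd`, which degenerates as n grows, serves
  -- only as its a priori hypothesis.
  have cauchy : ∀ ε > 0, ∃ N, ∀ m ≥ N, ∀ n ≥ N, ∀ p ∈ triTube, ‖K m p - K n p‖ ≤ ε := by
    intro ε hε
    -- The 2 counts the errors of the indices m and n. The e bounds the loss in |e^{-(p₁² + p₂²)}| ≤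
    -- e · e^{-(x² + y²)} on the tube.
    set ε' := ε / (2 * Real.exp 1) with hε'
    have hε0 : 0 < ε' := by positivity
    obtain ⟨N, hN⟩ := eventually_atTop.1 (hclim.eventually ((exists_gaussAvg_close hg hgM hε0).and
      ((exists_gaussAvg_close hA hAM hε0).and (exists_gaussAvg_close hB hBM hε0))))
    refine ⟨N, fun m hm n hn => ?_⟩
    have dist2 : ∀ {u v w : ℂ} {e : ℝ}, ‖u - w‖ ≤ ε' * e → ‖v - w‖ ≤ ε' * e →
        ‖u - v‖ ≤ 2 * ε' * e := by
      intro u v w e hu hv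
      calc ‖u - v‖ = ‖(u - w) - (v - w)‖ := by congr 1; ring
        _ ≤ ε' * e + ε' * e := (norm_sub_le _ _).trans (add_le_add hu hv)
        _ = 2 * ε' * e := by ring
    refine norm_le_of_triTube_vertices (E := fun p => K m p - K n p)
      (fun p v => (Kdiff m p v).sub (Kdiff n p v)) (C₀ := _) (fun p hp =>
        (norm_sub_le _ _).trans (add_le_add (Kbd m p hp) (Kbd n p hp))) ?_ ?_ ?_
    all_goals
      intro x y
      have e : ∀ p, K m p - K n p = (H m p - H n p) * gaussWeight (-1) p := fun p => by
        rw [hK]; ring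
      rw [e, norm_mul]
    · have := dist2 ((hN m hm).1 x y) ((hN n hn).1 x y)
      rw [H0, H0]
      calc _ ≤ 2 * ε' * Real.exp (x ^ 2 + y ^ 2) * (Real.exp 1 * Real.exp (-1 * (x ^ 2 + y ^ 2))) := by
            gcongr
            exact norm_gaussWeight_neg_le zero_le_one (real_mem_triTube x y)
        _ = 2 * ε' * Real.exp 1 * (Real.exp (x ^ 2 + y ^ 2) * Real.exp (-1 * (x ^ 2 + y ^ 2))) := by ring
        _ = ε := by rw [← Real.exp_add]; simp [hε']; field_simp
    · have := dist2 ((hN m hm).2.1 x y) ((hN n hn).2.1 x y)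
      rw [H1, H1]
      calc _ ≤ 2 * ε' * Real.exp (x ^ 2 + y ^ 2) * (Real.exp 1 * Real.exp (-1 * (x ^ 2 + y ^ 2))) := by
            gcongr
            simpa using norm_gaussWeight_neg_le zero_le_one (left_mem_triTube x y)
        _ = 2 * ε' * Real.exp 1 * (Real.exp (x ^ 2 + y ^ 2) * Real.exp (-1 * (x ^ 2 + y ^ 2))) := by ring
        _ = ε := by rw [← Real.exp_add]; simp [hε']; field_simp
    · have := dist2 ((hN m hm).2.2 x y) ((hN n hn).2.2 x y)
      rw [H2, H2]
      calc _ ≤ 2 * ε' * Real.exp (x ^ 2 + y ^ 2) * (Real.exp 1 * Real.exp (-1 * (x ^ 2 + y ^ 2))) := by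
            gcongr
            simpa using norm_gaussWeight_neg_le zero_le_one (right_mem_triTube x y)
        _ = 2 * ε' * Real.exp 1 * (Real.exp (x ^ 2 + y ^ 2) * Real.exp (-1 * (x ^ 2 + y ^ 2))) := by ring
        _ = ε := by rw [← Real.exp_add]; simp [hε']; field_simp
  have ucauchy : UniformCauchySeqOn K atTop triTube := by
    rw [Metric.uniformCauchySeqOn_iff]
    intro ε hε
    obtain ⟨N, hN⟩ := cauchy (ε / 2) (half_pos hε)
    exact ⟨N, fun m hm n hn p hp => by
      rw [dist_eq_norm]; exact (hN m hm n hn p hp).trans_lt (half_lt_self hε)⟩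
  have hptw : ∀ p ∈ triTube, ∃ L, Tendsto (fun n => K n p) atTop (𝓝 L) := fun p hp =>
    cauchySeq_tendsto_of_complete (ucauchy.cauchySeq hp)
  choose! L hL using hptw
  have hunif : TendstoUniformlyOn K L atTop triTube :=
    ucauchy.tendstoUniformlyOn_of_tendsto hL
  have Kcont : ∀ n, ContinuousOn (K n) triTube := by
    intro n
    apply Continuous.continuousOn
    exact (continuous_gaussReg (hb0 n) hg hgM).mul (continuous_gaussWeight _)
  have Lcont : ContinuousOn L triTube := hunif.continuousOn (Eventually.of_forall Kcont).frequently
  have Ldiff : ∀ (p v : ℂ × ℂ) (U : Set ℂ), IsOpen U → (∀ z ∈ U, p + z • v ∈ triTube) →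
      DifferentiableOn ℂ (fun z => L (p + z • v)) U := by
    intro p v U hU hUt
    have h1 : TendstoUniformlyOn (fun n z => K n (p + z • v)) (fun z => L (p + z • v)) atTop U :=
      (hunif.comp (fun z : ℂ => p + z • v)).mono hUt
    exact h1.tendstoLocallyUniformlyOn.differentiableOn
      (Eventually.of_forall fun n => (Kdiff n p v).differentiableOn) hU
  obtain ⟨C, hC⟩ : ∃ C, ∀ p ∈ triTube, ‖L p‖ ≤ C := by
    obtain ⟨N, hN⟩ := cauchy 1 one_pos
    refine ⟨1 + M * (Real.exp (b N) * Real.exp (b N)) * Real.exp 1, fun p hp => ?_⟩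
    have h1 : ∀ n ≥ N, ‖K n p‖ ≤ 1 + M * (Real.exp (b N) * Real.exp (b N)) * Real.exp 1 := by
      intro n hn
      calc ‖K n p‖ = ‖(K n p - K N p) + K N p‖ := by congr 1; ring
        _ ≤ _ := (norm_add_le _ _).trans (add_le_add (hN n hn N le_rfl p hp) (Kbd N p hp))
    exact le_of_tendsto (hL p hp).norm (eventually_atTop.2 ⟨N, h1⟩)
  -- The limit at a point over a vertex is the average of width 0, that is, the function itself.
  have vertex : ∀ (h : ℝ → ℝ → ℂ) (p : ℂ × ℂ) (x y : ℝ), p ∈ triTube →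
      (Continuous fun q : ℝ × ℝ => h q.1 q.2) → (∀ x y, ‖h x y‖ ≤ M) →
      (∀ n, H n p = gaussAvg h (c n) (x, y)) → L p * gaussWeight 1 p = h x y := by
    intro h p x y hp hh hhM hHn
    have l1 : Tendsto (fun n => K n p * gaussWeight 1 p) atTop (𝓝 (L p * gaussWeight 1 p)) :=
      (hL p hp).mul_const _
    have l2 : Tendsto (fun n => gaussAvg h (c n) (x, y)) atTop (𝓝 (gaussAvg h 0 (x, y))) := by
      have : Continuous fun s : ℝ => gaussAvg h s (x, y) :=
        (continuous_gaussAvg hh hhM).comp (by fun_prop : Continuous fun s : ℝ => (s, ((x, y) : ℝ × ℝ)))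
      exact (this.tendsto 0).comp hclim
    rw [gaussAvg_zero] at l2
    refine tendsto_nhds_unique l1 (l2.congr fun n => ?_)
    rw [hK]; simp only
    rw [mul_assoc, gaussWeight_neg_mul, mul_one, hHn]
  refine ⟨fun p => L p * gaussWeight 1 p, ⟨?_, ?_, C, 1, zero_le_one, ?_⟩, ?_, ?_, ?_⟩
  · exact Lcont.mul (continuous_gaussWeight 1).continuousOn
  · intro p v U hU hUt
    exact (Ldiff p v U hU hUt).mul (differentiable_gaussWeight_line 1 p v).differentiableOn
  · intro p hp
    rw [norm_mul]
    exact mul_le_mul (hC p hp) (norm_gaussWeight_le_exp zero_le_one p) (norm_nonneg _)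
      ((norm_nonneg _).trans (hC p hp))
  · intro x y; exact vertex g _ x y (real_mem_triTube x y) hg hgM (fun n => H0 n x y)
  · intro x y; exact vertex A _ x y (left_mem_triTube x y) hA hAM (fun n => H1 n x y)
  · intro x y; exact vertex B _ x y (right_mem_triTube x y) hB hBM (fun n => H2 n x y)

/-- Gaussian bounds for functions on the plane. -/
def GaussBounded (f : ℝ → ℝ → ℂ) : Prop :=
  ∃ M Λ : ℝ, ∀ x y, ‖f x y‖ ≤ M * Real.exp (Λ * (x ^ 2 + y ^ 2))

lemma GaussBounded.exists_common {f g h : ℝ → ℝ → ℂ} (hf : GaussBounded f) (hg : GaussBounded g)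
    (hh : GaussBounded h) : ∃ M Λ : ℝ, 0 ≤ M ∧ 0 ≤ Λ ∧ ∀ x y,
      ‖f x y‖ ≤ M * Real.exp (Λ * (x ^ 2 + y ^ 2)) ∧ ‖g x y‖ ≤ M * Real.exp (Λ * (x ^ 2 + y ^ 2)) ∧
      ‖h x y‖ ≤ M * Real.exp (Λ * (x ^ 2 + y ^ 2)) := by
  obtain ⟨M₁, Λ₁, h₁⟩ := hf
  obtain ⟨M₂, Λ₂, h₂⟩ := hg
  obtain ⟨M₃, Λ₃, h₃⟩ := hh
  have key : ∀ M Λ M' Λ' s : ℝ, M ≤ M' → 0 ≤ M' → Λ ≤ Λ' → 0 ≤ s →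
      M * Real.exp (Λ * s) ≤ M' * Real.exp (Λ' * s) := by
    intro M Λ M' Λ' s h1 h2 h3 h4
    have : Λ * s ≤ Λ' * s := mul_le_mul_of_nonneg_right h3 h4
    gcongr
  have p1 := abs_nonneg M₁
  have p2 := abs_nonneg M₂
  have p3 := abs_nonneg M₃
  have q1 := abs_nonneg Λ₁
  have q2 := abs_nonneg Λ₂
  have q3 := abs_nonneg Λ₃
  refine ⟨|M₁| + |M₂| + |M₃|, |Λ₁| + |Λ₂| + |Λ₃|, by positivity, by positivity,
    fun x y => ⟨?_, ?_, ?_⟩⟩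
  · exact (h₁ x y).trans (key _ _ _ _ _ (by linarith [le_abs_self M₁]) (by positivity)
      (by linarith [le_abs_self Λ₁]) (by positivity))
  · exact (h₂ x y).trans (key _ _ _ _ _ (by linarith [le_abs_self M₂]) (by positivity)
      (by linarith [le_abs_self Λ₂]) (by positivity))
  · exact (h₃ x y).trans (key _ _ _ _ _ (by linarith [le_abs_self M₃]) (by positivity)
      (by linarith [le_abs_self Λ₃]) (by positivity))

lemma isStripAnalytic_and_growth_weight (Λ : ℝ) (y : ℂ) :
    IsStripAnalytic (fun z => Complex.exp (Λ * (z ^ 2 + y ^ 2))) ∧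
      GaussGrowth (fun z => Complex.exp (Λ * (z ^ 2 + y ^ 2))) := by
  refine ⟨Differentiable.isStripAnalytic (by fun_prop), ?_⟩
  have := (gaussGrowth_exp Λ).const_mul (Complex.exp (Λ * y ^ 2))
  simp_rw [← Complex.exp_add] at this
  convert this using 3; ring

/-- A function of Gaussian growth with analytic continuations in the two imaginary directions
extends to the tube. -/
theorem exists_isTubeFunction {g A B : ℝ → ℝ → ℂ}
    (hg : Continuous fun q : ℝ × ℝ => g q.1 q.2) (hA : Continuous fun q : ℝ × ℝ => A q.1 q.2)
    (hB : Continuous fun q : ℝ × ℝ => B q.1 q.2) (hgM : GaussBounded g) (hAM : GaussBounded A)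
    (hBM : GaussBounded B)
    (hEA : ∀ y, EdgeCont (fun x => g x y) (fun x => A x y))
    (hEB : ∀ x, EdgeCont (fun y => g x y) (fun y => B x y)) :
    ∃ G : ℂ × ℂ → ℂ, IsTubeFunction G ∧ (∀ x y : ℝ, G (x, y) = g x y) ∧
      (∀ x y : ℝ, G (x + Complex.I, y) = A x y) ∧ ∀ x y : ℝ, G (x, y + Complex.I) = B x y := by
  obtain ⟨M, Λ, hM, hΛ, hb⟩ := hgM.exists_common hAM hBM
  -- Multiplication by e^{-Λ(p₁² + p₂²)} reduces Gaussian growth to the bounded case. The weight has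
  -- no zeros and is analytic, so it also transports the edge continuations.
  have wle : ∀ (f : ℂ) (x y : ℝ) (p : ℂ × ℂ), p ∈ triTube → p.1.re = x → p.2.re = y →
      ‖f‖ ≤ M * Real.exp (Λ * (x ^ 2 + y ^ 2)) → ‖f * gaussWeight (-Λ) p‖ ≤ M * Real.exp Λ := by
    intro f x y p hp hx hy hf
    rw [norm_mul]
    have := norm_gaussWeight_neg_le hΛ hp
    rw [hx, hy] at this
    calc _ ≤ (M * Real.exp (Λ * (x ^ 2 + y ^ 2))) *
          (Real.exp Λ * Real.exp (-Λ * (x ^ 2 + y ^ 2))) := by gcongr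
      _ = M * Real.exp Λ * (Real.exp (Λ * (x ^ 2 + y ^ 2)) * Real.exp (-Λ * (x ^ 2 + y ^ 2))) := by
        ring
      _ = _ := by rw [← Real.exp_add]; simp
  have wc := continuous_gaussWeight (-Λ)
  obtain ⟨G, hG, G0, G1, G2⟩ := exists_isTubeFunction_of_bounded (M := M * Real.exp Λ)
    (g := fun x y => g x y * gaussWeight (-Λ) (x, y))
    (A := fun x y => A x y * gaussWeight (-Λ) (x + Complex.I, y))
    (B := fun x y => B x y * gaussWeight (-Λ) (x, y + Complex.I))
    (by fun_prop) (by fun_prop) (by fun_prop)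
    (fun x y => wle _ x y _ (real_mem_triTube x y) (by simp) (by simp) (hb x y).1)
    (fun x y => wle _ x y _ (left_mem_triTube x y) (by simp) (by simp) (hb x y).2.1)
    (fun x y => wle _ x y _ (right_mem_triTube x y) (by simp) (by simp) (hb x y).2.2)
    (fun y => by
      obtain ⟨F, h1, h2, h3, h4⟩ := hEA y
      obtain ⟨w1, w2⟩ := isStripAnalytic_and_growth_weight (-Λ) y
      refine ⟨_, h1.mul w1, h2.mul w2, fun t => ?_, fun t => ?_⟩
      · simp only [h3, gaussWeight]
      · simp only [h4, gaussWeight])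
    (fun x => by
      obtain ⟨F, h1, h2, h3, h4⟩ := hEB x
      obtain ⟨w1, w2⟩ := isStripAnalytic_and_growth_weight (-Λ) x
      refine ⟨_, h1.mul w1, h2.mul w2, fun t => ?_, fun t => ?_⟩
      · simp only [h3, gaussWeight]; rw [add_comm ((x : ℂ) ^ 2)]
      · simp only [h4, gaussWeight]; rw [add_comm ((x : ℂ) ^ 2)])
  obtain ⟨C, L, hL, hC⟩ := hG.growth
  refine ⟨fun p => G p * gaussWeight Λ p, ⟨?_, ?_, C, L + Λ, by positivity, ?_⟩, ?_, ?_, ?_⟩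
  · exact hG.cont.mul (continuous_gaussWeight Λ).continuousOn
  · intro p v U hU hUt
    exact (hG.diff p v U hU hUt).mul (differentiable_gaussWeight_line Λ p v).differentiableOn
  · intro p hp
    rw [norm_mul, add_mul, Real.exp_add, ← mul_assoc]
    exact mul_le_mul (hC p hp) (norm_gaussWeight_le_exp hΛ p) (norm_nonneg _)
      ((norm_nonneg _).trans (hC p hp))
  · intro x y; beta_reduce; rw [G0, mul_assoc, gaussWeight_neg_mul, mul_one]
  · intro x y; beta_reduce; rw [G1, mul_assoc, gaussWeight_neg_mul, mul_one]
  · intro x y; beta_reduce; rw [G2, mul_assoc, gaussWeight_neg_mul, mul_one]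

/-- The restriction of a tube function to a complex line. -/
lemma IsTubeFunction.line {G : ℂ × ℂ → ℂ} (hG : IsTubeFunction G) {p v : ℂ × ℂ}
    (h : ∀ z ∈ closedStrip, p + z • v ∈ triTube) (hv : v.1.im = 0 ∧ v.2.im = 0) :
    IsStripAnalytic (fun z => G (p + z • v)) ∧ GaussGrowth (fun z => G (p + z • v)) := by
  refine ⟨⟨hG.cont.comp (by fun_prop) h, hG.diff p v openStrip isOpen_openStrip
    fun z hz => h z (openStrip_subset hz)⟩, ?_⟩
  obtain ⟨M, Λ, hΛ, hM⟩ := hG.growth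
  have hM0 : 0 ≤ M := by
    have := (norm_nonneg _).trans (hM (0, 0) (by simp [triTube])); simpa using this
  refine ⟨M * Real.exp (Λ * (2 * p.1.re ^ 2 + 2 * p.2.re ^ 2)),
    Λ * (2 * v.1.re ^ 2 + 2 * v.2.re ^ 2), fun z hz => (hM _ (h z hz)).trans ?_⟩
  rw [mul_assoc, ← Real.exp_add]
  apply mul_le_mul_of_nonneg_left _ hM0
  apply Real.exp_le_exp.2
  simp only [Prod.fst_add, Prod.smul_fst, smul_eq_mul, Complex.add_re, Complex.mul_re, hv.1, hv.2,
    mul_zero, sub_zero, Prod.snd_add, Prod.smul_snd]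
  have e : (p.1.re + z.re * v.1.re) ^ 2 + (p.2.re + z.re * v.2.re) ^ 2 ≤
      (2 * p.1.re ^ 2 + 2 * p.2.re ^ 2) + (2 * v.1.re ^ 2 + 2 * v.2.re ^ 2) * z.re ^ 2 := by
    nlinarith [sq_nonneg (p.1.re - z.re * v.1.re), sq_nonneg (p.2.re - z.re * v.2.re)]
  nlinarith [mul_le_mul_of_nonneg_left e hΛ]

/-- The restriction of a tube function to the third edge. -/
lemma IsTubeFunction.third_edge {G : ℂ × ℂ → ℂ} (hG : IsTubeFunction G) :
    IsStripAnalytic (fun z => G (Complex.I - z, z)) ∧ GaussGrowth (fun z => G (Complex.I - z, z)) := by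
  have := hG.line (p := (Complex.I, 0)) (v := (-1, 1)) ?_ (by simp)
  · simpa [sub_eq_add_neg] using this
  · intro z hz
    simp only [triTube, mem_ofPred_eq, Prod.smul_mk, smul_eq_mul, Prod.mk_add_mk]
    simp only [Complex.add_im, Complex.I_im, mul_neg, mul_one, Complex.neg_im, zero_add]
    exact ⟨by linarith [hz.2], hz.1, by linarith⟩

/-- Two continuations with a common real boundary produce a third one: restrict the tube function to
the complex line z ↦ (i - z, z), whose boundary lines lie over the two imaginary vertices. Every new
continuation in the operator-algebraic part is obtained in this way. -/
theorem edgeCont_third {g A B : ℝ → ℝ → ℂ}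
    (hg : Continuous fun q : ℝ × ℝ => g q.1 q.2) (hA : Continuous fun q : ℝ × ℝ => A q.1 q.2)
    (hB : Continuous fun q : ℝ × ℝ => B q.1 q.2) (hgM : GaussBounded g) (hAM : GaussBounded A)
    (hBM : GaussBounded B)
    (hEA : ∀ y, EdgeCont (fun x => g x y) (fun x => A x y))
    (hEB : ∀ x, EdgeCont (fun y => g x y) (fun y => B x y)) :
    EdgeCont (fun t => A (-t) t) (fun t => B (-t) t) := by
  obtain ⟨G, hG, -, G1, G2⟩ := exists_isTubeFunction hg hA hB hgM hAM hBM hEA hEB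
  refine ⟨_, hG.third_edge.1, hG.third_edge.2, fun t => ?_, fun t => ?_⟩
  · beta_reduce; rw [← G1]; congr 2 <;> push_cast <;> ring
  · beta_reduce; rw [← G2]; congr 2 <;> push_cast <;> ring

lemma EdgeCont.reflect {f₀ f₁ : ℝ → ℂ} (h : EdgeCont f₀ f₁) :
    EdgeCont (fun t => f₁ (-t)) (fun t => f₀ (-t)) := by
  obtain ⟨F, h1, h2, h3, h4⟩ := h
  refine ⟨_, h1.reflect, h2.reflect, fun t => ?_, fun t => ?_⟩
  · beta_reduce; rw [← h4]; congr 1; push_cast; ring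
  · beta_reduce; rw [← h3]; congr 1; push_cast; ring

/-- A strip function of polynomial growth which takes the same values on both boundary lines is
constant on the real line. -/
lemma IsStripAnalytic.eq_of_periodic {F : ℂ → ℂ} (hF : IsStripAnalytic F)
    (hper : ∀ t : ℝ, F (t + Complex.I) = F t) {C : ℝ} {m : ℕ}
    (hb : ∀ z ∈ closedStrip, ‖F z‖ ≤ C * (1 + |z.re|) ^ m) (t : ℝ) : F t = F 0 := by
  have hC : 0 ≤ C := by
    have := (norm_nonneg _).trans (hb 0 (by simp [closedStrip])); simpa using this
  have e_per : ∀ (k : ℤ) (z : ℂ), Complex.exp (-(2 * Real.pi * k) * (z + Complex.I)) =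
      Complex.exp (-(2 * Real.pi * k) * z) := by
    intro k z
    rw [mul_add, Complex.exp_add]
    have : Complex.exp (-(2 * Real.pi * k) * Complex.I) = 1 := by
      have := Complex.exp_int_mul_two_pi_mul_I (-k)
      rw [← this]; congr 1; push_cast; ring
    rw [this, mul_one]
  -- J k s is e^{-2πks} times the k-th Fourier coefficient of v ↦ F(s + iv). By Cauchy's theorem it
  -- does not depend on s, because the horizontal sides cancel by periodicity.
  set J : ℤ → ℝ → ℂ := fun k s => ∫ v in (0 : ℝ)..1,
    F (s + v * Complex.I) * Complex.exp (-(2 * Real.pi * k) * (s + v * Complex.I)) with hJ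
  have Jconst : ∀ k s s', J k s = J k s' := by
    intro k s s'
    have rect := Complex.integral_boundary_rect_eq_zero_of_continuousOn_of_differentiableOn
      (fun z => F z * Complex.exp (-(2 * Real.pi * k) * z)) (s : ℂ) (s' + Complex.I) ?_ ?_
    · simp only [Complex.ofReal_re, Complex.ofReal_im, Complex.add_re, Complex.I_re, add_zero,
        Complex.add_im, Complex.I_im, zero_add, Complex.ofReal_zero, zero_mul, Complex.ofReal_one,
        one_mul, smul_eq_mul, hper, e_per, sub_self] at rect
      rw [← mul_sub] at rect
      have := (mul_eq_zero.1 rect).resolve_left Complex.I_ne_zero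
      exact (sub_eq_zero.1 this).symm
    · refine ContinuousOn.mul (hF.1.mono fun z hz => ?_) (Continuous.continuousOn (by fun_prop))
      have := hz.2
      simp only [mem_preimage, Complex.ofReal_im, Complex.add_im,
        Complex.I_im, zero_add, uIcc_of_le (zero_le_one (α := ℝ))] at this
      exact this
    · refine DifferentiableOn.mul (hF.2.mono fun z hz => ?_)
        (Differentiable.differentiableOn (by fun_prop))
      have := hz.2
      simp only [mem_preimage, Complex.ofReal_im, Complex.add_im,
        Complex.I_im, zero_add] at this
      simpa [openStrip] using this
  have Jb : ∀ k s, ‖J k s‖ ≤ C * (1 + |s|) ^ m * Real.exp (-(2 * Real.pi * k) * s) := by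
    intro k s
    have := intervalIntegral.norm_integral_le_of_norm_le_const (a := (0 : ℝ)) (b := 1)
      (f := fun v : ℝ => F (s + v * Complex.I) *
        Complex.exp (-(2 * Real.pi * k) * (s + v * Complex.I)))
      (C := C * (1 + |s|) ^ m * Real.exp (-(2 * Real.pi * k) * s)) ?_
    · rw [hJ]; simpa using this
    · intro v hv
      rw [uIoc_of_le zero_le_one] at hv
      have h1 := hb (s + v * Complex.I) (by simp [closedStrip, hv.1.le, hv.2])
      rw [norm_mul, Complex.norm_exp]
      simp only [Complex.add_re, Complex.ofReal_re, Complex.mul_re, Complex.I_re, mul_zero,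
        Complex.ofReal_im, Complex.I_im, mul_one, sub_self, add_zero] at h1
      gcongr
      simp
  -- Let s → +∞ for k > 0 and s → -∞ for k < 0: the exponential beats the polynomial bound.
  have Jzero : ∀ k : ℤ, k ≠ 0 → ∀ s, J k s = 0 := by
    intro k hk s
    have hlim : Tendsto (fun x : ℝ => C * (1 + x) ^ m * Real.exp (-(2 * Real.pi) * x)) atTop
        (𝓝 0) := by
      have h1 := (Real.tendsto_pow_mul_exp_neg_atTop_nhds_zero m).comp
        (tendsto_atTop_add_const_left atTop (1 : ℝ) tendsto_id)
      have h3 := h1.const_mul (C * Real.exp 1)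
      rw [mul_zero] at h3
      refine squeeze_zero' (eventually_atTop.2 ⟨0, fun x hx => by positivity⟩)
        (eventually_atTop.2 ⟨0, fun x hx => ?_⟩) h3
      have : Real.exp (-(2 * Real.pi) * x) ≤ Real.exp 1 * Real.exp (-(1 + x)) := by
        rw [← Real.exp_add]
        exact Real.exp_le_exp.2 (by nlinarith [Real.pi_gt_three])
      calc C * (1 + x) ^ m * Real.exp (-(2 * Real.pi) * x)
          ≤ C * (1 + x) ^ m * (Real.exp 1 * Real.exp (-(1 + x))) :=
            mul_le_mul_of_nonneg_left this (by positivity)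
        _ = _ := by simp only [Function.comp_apply, id]; ring
    have h2 : ∀ x : ℝ, 0 ≤ x → ‖J k s‖ ≤ C * (1 + x) ^ m * Real.exp (-(2 * Real.pi) * x) := by
      intro x hx
      rcases lt_or_gt_of_ne hk with h | h
      · rw [Jconst k s (-x)]
        refine (Jb k (-x)).trans ?_
        rw [abs_neg, abs_of_nonneg hx]
        refine mul_le_mul_of_nonneg_left (Real.exp_le_exp.2 ?_) (by positivity)
        have : (k : ℝ) ≤ -1 := by exact_mod_cast (by omega : k ≤ -1)
        nlinarith [mul_nonneg Real.pi_pos.le hx]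
      · rw [Jconst k s x]
        refine (Jb k x).trans ?_
        rw [abs_of_nonneg hx]
        refine mul_le_mul_of_nonneg_left (Real.exp_le_exp.2 ?_) (by positivity)
        have : (1 : ℝ) ≤ k := by exact_mod_cast (by omega : 1 ≤ k)
        nlinarith [mul_nonneg Real.pi_pos.le hx]
    have := ge_of_tendsto hlim (eventually_atTop.2 ⟨0, h2⟩)
    exact norm_le_zero_iff.1 this
  -- Only the zeroth Fourier coefficient of the continuous periodic function v ↦ F(s + iv) survives,
  -- so the function equals this coefficient, which is the same for all s.
  have hval : ∀ s : ℝ, F s = J 0 s := by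
    intro s
    have : Fact ((0 : ℝ) < 1) := ⟨one_pos⟩
    set f : ℝ → ℂ := fun v => F (s + v * Complex.I) with hf
    have hfc : ContinuousOn f (Icc 0 (0 + 1)) := by
      refine hF.1.comp (by fun_prop) fun v hv => ?_
      simpa [closedStrip] using hv
    have hf01 : f 0 = f (0 + 1) := by simp [f, hper]
    set g : C(AddCircle (1 : ℝ), ℂ) := ⟨AddCircle.liftIco 1 0 f,
      AddCircle.liftIco_continuous hf01 hfc⟩ with hg
    have hco : ∀ k : ℤ, fourierCoeff g k = Complex.exp (2 * Real.pi * k * s) * J k s := by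
      intro k
      have h1 : fourierCoeff g k = _ := fourierCoeff_liftIco_eq (T := 1) (a := 0) f k
      rw [h1, fourierCoeffOn_eq_integral, hJ]
      simp only [zero_add, sub_zero, div_one, one_smul, smul_eq_mul]
      rw [← intervalIntegral.integral_const_mul]
      refine intervalIntegral.integral_congr fun v _ => ?_
      simp only [fourier_coe_apply, hf]
      rw [mul_left_comm, ← Complex.exp_add, mul_comm]
      congr 2
      push_cast
      ring
    have hz : ∀ k : ℤ, k ≠ 0 → fourierCoeff g k = 0 := fun k hk => by
      rw [hco, Jzero k hk, mul_zero]
    have hsum : Summable (fourierCoeff g) :=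
      summable_of_ne_finset_zero (s := {0}) fun k hk => hz k (by simpa using hk)
    have h2 := has_pointwise_sum_fourier_series_of_summable hsum ((0 : ℝ) : AddCircle (1 : ℝ))
    have h3 := h2.unique (hasSum_single 0 fun k hk => by rw [hz k hk, zero_smul])
    have h4 : g ((0 : ℝ) : AddCircle (1 : ℝ)) = f 0 :=
      AddCircle.liftIco_coe_apply (p := (1 : ℝ)) (a := 0) (f := f) (by simp)
    rw [h4, hco] at h3
    simpa [hf] using h3
  rw [hval t, Jconst 0 t 0, ← hval 0, Complex.ofReal_zero]

/-! ### Strongly continuous operator-valued functions -/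

section StrongContinuity

variable {H : Type*} [NormedAddCommGroup H] [InnerProductSpace ℂ H] [CompleteSpace H]
  {X : Type*} [TopologicalSpace X]

/-- Strong continuity of an operator-valued function. -/
def StrongCont (f : X → BoundedOp H) : Prop := ∀ ξ : H, Continuous fun s => f s ξ

lemma Continuous.strongCont {f : X → BoundedOp H} (hf : Continuous f) : StrongCont f :=
  fun _ => hf.clm_apply continuous_const

lemma strongCont_const (a : BoundedOp H) : StrongCont fun _ : X => a :=
  continuous_const.strongCont

namespace StrongCont

/-- Banach–Steinhaus on compact sets. Local boundedness is what makes products of strongly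
continuous families strongly continuous over a locally compact space. -/
lemma exists_bound {f : X → BoundedOp H} (hf : StrongCont f) {K : Set X} (hK : IsCompact K) :
    ∃ C : ℝ, 0 ≤ C ∧ ∀ s ∈ K, ‖f s‖ ≤ C := by
  obtain ⟨C, hC⟩ := banach_steinhaus (g := fun s : K => f s) fun ξ => by
    obtain ⟨C, hC⟩ := hK.exists_bound_of_continuousOn (hf ξ).continuousOn
    exact ⟨C, fun s => hC s s.2⟩
  exact ⟨max C 0, le_max_right _ _, fun s hs => (hC ⟨s, hs⟩).trans (le_max_left _ _)⟩

lemma comp {Y : Type*} [TopologicalSpace Y] {f : X → BoundedOp H} (hf : StrongCont f) {g : Y → X}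
    (hg : Continuous g) : StrongCont fun s => f (g s) := fun ξ => (hf ξ).comp hg

lemma add {f g : X → BoundedOp H} (hf : StrongCont f) (hg : StrongCont g) :
    StrongCont fun s => f s + g s := fun ξ => (hf ξ).add (hg ξ)

lemma sub {f g : X → BoundedOp H} (hf : StrongCont f) (hg : StrongCont g) :
    StrongCont fun s => f s - g s := fun ξ => (hf ξ).sub (hg ξ)

lemma neg {f : X → BoundedOp H} (hf : StrongCont f) : StrongCont fun s => -f s :=
  fun ξ => (hf ξ).neg

lemma smul {f : X → BoundedOp H} (hf : StrongCont f) {c : X → ℂ} (hc : Continuous c) :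
    StrongCont fun s => c s • f s := fun ξ => hc.smul (hf ξ)

lemma const_mul (a : BoundedOp H) {f : X → BoundedOp H} (hf : StrongCont f) :
    StrongCont fun s => a * f s := fun ξ => a.continuous.comp (hf ξ)

lemma mul_const {f : X → BoundedOp H} (hf : StrongCont f) (a : BoundedOp H) :
    StrongCont fun s => f s * a := fun ξ => hf (a ξ)

lemma sum {ι : Type*} {f : ι → X → BoundedOp H} {s : Finset ι} (hf : ∀ i ∈ s, StrongCont (f i)) :
    StrongCont fun x => ∑ i ∈ s, f i x := fun ξ => by
  simp only [sum_apply]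
  exact continuous_finsetSum _ fun i hi => hf i hi ξ

variable [WeaklyLocallyCompactSpace X]

/-- The action of a strongly continuous family on a continuous family of vectors. -/
lemma apply {f : X → BoundedOp H} (hf : StrongCont f) {v : X → H} (hv : Continuous v) :
    Continuous fun s => f s (v s) := by
  refine continuous_iff_continuousAt.2 fun x => ?_
  obtain ⟨K, hK, hKx⟩ := exists_compact_mem_nhds x
  obtain ⟨C, hC0, hC⟩ := hf.exists_bound hK
  have h1 : Tendsto (fun s => f s (v s - v x)) (𝓝 x) (𝓝 0) := by
    have h2 : Tendsto (fun s => C * ‖v s - v x‖) (𝓝 x) (𝓝 0) := by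
      have := ((hv.sub (continuous_const (y := v x))).norm.const_mul C).tendsto x
      simpa using this
    refine squeeze_zero_norm' ?_ h2
    filter_upwards [hKx] with s hs
    exact (f s).le_of_opNorm_le (hC s hs) _
  have h3 := h1.add ((hf (v x)).tendsto x)
  simpa [ContinuousAt] using h3

lemma mul {f g : X → BoundedOp H} (hf : StrongCont f) (hg : StrongCont g) :
    StrongCont fun s => f s * g s := fun ξ => hf.apply (hg ξ)

end StrongCont

/-! ### Strong integrals over intervals -/

lemma norm_le_of_forall_le {T : BoundedOp H} {C : ℝ} (hC : 0 ≤ C) (h : ∀ ξ, ‖T ξ‖ ≤ C * ‖ξ‖) :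
    ‖T‖ ≤ C := T.opNorm_le_bound hC h

/-- A strongly continuous function on a compact set has a strong integral. -/
lemma exists_hasStrongIntegral [MeasurableSpace X] [OpensMeasurableSpace X]
    {μ : Measure X} [IsFiniteMeasureOnCompacts μ] {K : Set X}
    (hK : IsCompact K) (hKm : MeasurableSet K) {f : X → BoundedOp H} (hf : StrongCont f) :
    ∃ T, HasStrongIntegral (μ.restrict K) f T := by
  obtain ⟨C, hC0, hC⟩ := hf.exists_bound hK
  have hint : ∀ ξ, Integrable (fun s => f s ξ) (μ.restrict K) := fun ξ =>
    (hf ξ).continuousOn.integrableOn_compact' hK hKm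
  refine ⟨LinearMap.mkContinuous
    { toFun := fun ξ => ∫ s in K, f s ξ ∂μ
      map_add' := fun ξ η => by simp only [map_add]; exact integral_add (hint ξ) (hint η)
      map_smul' := fun c ξ => by
        simp only [map_smul, RingHom.id_apply]; exact integral_smul c _ }
    (C * μ.real K) fun ξ => ?_, fun ξ => ⟨hint ξ, rfl⟩⟩
  have := norm_setIntegral_le_of_norm_le_const (μ := μ) (s := K) (f := fun s => f s ξ)
    (C := C * ‖ξ‖) hK.measure_lt_top fun s hs => (f s).le_of_opNorm_le (hC s hs) ξ
  simp only [LinearMap.coe_mk, AddHom.coe_mk]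
  linarith

lemma HasStrongIntegral.unique {X : Type*} [MeasurableSpace X] {μ : Measure X}
    {f : X → BoundedOp H} {T S : BoundedOp H}
    (hT : HasStrongIntegral μ f T) (hS : HasStrongIntegral μ f S) : T = S := by
  ext ξ; rw [(hT ξ).2, (hS ξ).2]

lemma HasStrongIntegral.strongIntegral_eq {X : Type*} [MeasurableSpace X] {μ : Measure X}
    {f : X → BoundedOp H} {T : BoundedOp H}
    (hT : HasStrongIntegral μ f T) : strongIntegral μ f = T := by
  have h : ∃ T, HasStrongIntegral μ f T := ⟨T, hT⟩
  rw [strongIntegral, dif_pos h]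
  exact h.choose_spec.unique hT

/-- The strong integral of a strongly continuous function over an interval. -/
def sint (f : ℝ → BoundedOp H) (a b : ℝ) : BoundedOp H :=
  strongIntegral (volume.restrict (Icc a b)) f - strongIntegral (volume.restrict (Icc b a)) f

section

variable {f g : ℝ → BoundedOp H}

lemma sint_apply (hf : StrongCont f) (a b : ℝ) (ξ : H) : sint f a b ξ = ∫ s in a..b, f s ξ := by
  obtain ⟨T, hT⟩ := exists_hasStrongIntegral (μ := volume) (isCompact_Icc (a := a) (b := b))
    measurableSet_Icc hf
  obtain ⟨S, hS⟩ := exists_hasStrongIntegral (μ := volume) (isCompact_Icc (a := b) (b := a))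
    measurableSet_Icc hf
  rw [sint, hT.strongIntegral_eq, hS.strongIntegral_eq, sub_apply, (hT ξ).2,
    (hS ξ).2, integral_Icc_eq_integral_Ioc, integral_Icc_eq_integral_Ioc, intervalIntegral]

lemma StrongCont.intervalIntegrable (hf : StrongCont f) (a b : ℝ) (ξ : H) :
    IntervalIntegrable (fun s => f s ξ) volume a b := (hf ξ).intervalIntegrable a b

lemma sint_eq_of_apply (hf : StrongCont f) {a b : ℝ} {T : BoundedOp H}
    (h : ∀ ξ, T ξ = ∫ s in a..b, f s ξ) : T = sint f a b := by
  ext ξ; rw [h, sint_apply hf]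

lemma norm_sint_le (hf : StrongCont f) {a b C : ℝ} (h : ∀ s ∈ uIcc a b, ‖f s‖ ≤ C) :
    ‖sint f a b‖ ≤ C * |b - a| := by
  have hC : 0 ≤ C := (norm_nonneg _).trans (h a left_mem_uIcc)
  refine norm_le_of_forall_le (by positivity) fun ξ => ?_
  rw [sint_apply hf]
  refine (intervalIntegral.norm_integral_le_of_norm_le_const (C := C * ‖ξ‖) fun s hs =>
    (f s).le_of_opNorm_le (h s (uIoc_subset_uIcc hs)) ξ).trans (by linarith)

lemma mul_sint (hf : StrongCont f) (x : BoundedOp H) (a b : ℝ) :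
    x * sint f a b = sint (fun s => x * f s) a b := by
  refine sint_eq_of_apply (hf.const_mul x) fun ξ => ?_
  change x (sint f a b ξ) = _
  rw [sint_apply hf,
    ← x.intervalIntegral_comp_comm (hf.intervalIntegrable a b ξ)]
  rfl

lemma sint_mul (hf : StrongCont f) (x : BoundedOp H) (a b : ℝ) :
    sint f a b * x = sint (fun s => f s * x) a b := by
  refine sint_eq_of_apply (hf.mul_const x) fun ξ => ?_
  change sint f a b (x ξ) = _
  rw [sint_apply hf]
  rfl

lemma sint_same (hf : StrongCont f) (a : ℝ) : sint f a a = 0 := by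
  ext ξ; rw [sint_apply hf]; simp

lemma sint_sub_sint (hf : StrongCont f) (a b c : ℝ) : sint f a c - sint f a b = sint f b c := by
  ext ξ
  rw [sub_apply, sint_apply hf, sint_apply hf, sint_apply hf,
    intervalIntegral.integral_interval_sub_left (hf.intervalIntegrable _ _ ξ)
      (hf.intervalIntegrable _ _ ξ)]

lemma hasDerivAt_sint (hf : StrongCont f) (a t : ℝ) (ξ : H) :
    HasDerivAt (fun t => sint f a t ξ) (f t ξ) t := by
  simp only [sint_apply hf]
  exact (hf ξ).integral_hasStrictDerivAt a t |>.hasDerivAt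

lemma continuous_sint (hf : StrongCont f) (a : ℝ) : Continuous fun t => sint f a t := by
  refine continuous_iff_continuousAt.2 fun t => ?_
  obtain ⟨C, hC0, hC⟩ := hf.exists_bound (isCompact_Icc (a := t - 1) (b := t + 1))
  have h1 : Tendsto (fun s => C * |s - t|) (𝓝 t) (𝓝 0) := by
    have : Continuous fun s : ℝ => C * |s - t| := by fun_prop
    simpa using this.tendsto t
  rw [ContinuousAt, tendsto_iff_norm_sub_tendsto_zero]
  refine squeeze_zero' (Eventually.of_forall fun _ => norm_nonneg _) ?_ h1
  filter_upwards [Icc_mem_nhds (by linarith : t - 1 < t) (by linarith : t < t + 1)] with s hs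
  rw [sint_sub_sint hf]
  refine norm_sint_le hf fun u hu => hC u ?_
  exact (uIcc_subset_Icc ⟨by linarith, by linarith⟩ hs) hu

lemma star_sint (hf : StrongCont f) (hf' : StrongCont fun s => star (f s)) (a b : ℝ) :
    star (sint f a b) = sint (fun s => star (f s)) a b := by
  refine sint_eq_of_apply hf' fun ξ => ext_inner_left ℂ fun η => ?_
  rw [ContinuousLinearMap.star_eq_adjoint, ContinuousLinearMap.adjoint_inner_right, sint_apply hf]
  have h1 := (innerSL ℂ η).intervalIntegral_comp_comm (hf'.intervalIntegrable a b ξ)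
  have h2 := (innerSL ℂ ξ).intervalIntegral_comp_comm (hf.intervalIntegrable a b η)
  simp only [innerSL_apply_apply] at h1 h2
  rw [← h1, ← inner_conj_symm, ← h2, ← intervalIntegral.intervalIntegral_conj]
  refine intervalIntegral.integral_congr fun s _ => ?_
  simp only [inner_conj_symm, ContinuousLinearMap.star_eq_adjoint,
    ContinuousLinearMap.adjoint_inner_right]

/-- Change of variables: `∫_0^t f = t ∫_0^1 f(λt) dλ`. -/
lemma sint_eq_smul_integral (hf : StrongCont f) (t : ℝ) (ξ : H) :
    sint f 0 t ξ = t • ∫ l in (0 : ℝ)..1, f (l * t) ξ := by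
  rw [sint_apply hf]
  have := intervalIntegral.smul_integral_comp_mul_right (a := 0) (b := 1) (fun s => f s ξ) t
  rw [this]; simp

end

end StrongContinuity

/-! ### Dyson series of a strongly continuous bounded family and their unitarity. -/

section DysonSeries

variable {H : Type*} [NormedAddCommGroup H] [InnerProductSpace ℂ H] [CompleteSpace H]

lemma norm_sint_le_pow {f : ℝ → BoundedOp H} (hf : StrongCont f) {c : ℝ} (hc : 0 ≤ c) {n : ℕ}
    (h : ∀ s, ‖f s‖ ≤ c * |s| ^ n) (t : ℝ) : ‖sint f 0 t‖ ≤ c * (|t| ^ (n + 1) / (n + 1)) := by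
  refine norm_le_of_forall_le (by positivity) fun ξ => ?_
  rw [sint_apply hf]
  refine intervalIntegral.norm_integral_le_integral_norm_uIoc.trans ?_
  have hi : ∀ g : ℝ → ℝ, Continuous g → IntegrableOn g (uIoc 0 t) := fun g hg =>
    (hg.continuousOn.integrableOn_compact isCompact_uIcc).mono_set uIoc_subset_uIcc
  have h1 : ∫ s in uIoc 0 t, ‖f s ξ‖ ≤ ∫ s in uIoc 0 t, c * ‖ξ‖ * |s - 0| ^ n := by
    refine integral_mono (hi _ (hf ξ).norm) (hi _ (by fun_prop)) fun s => ?_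
    have := (f s).le_of_opNorm_le (h s) ξ
    simp only [sub_zero]; linarith
  rw [integral_const_mul, integral_pow_abs_sub_uIoc, sub_zero] at h1
  linarith

/-- The terms of the Dyson series `W' = i W A`, `W 0 = 1`. -/
def dysonW (A : ℝ → BoundedOp H) : ℕ → ℝ → BoundedOp H
  | 0 => fun _ => 1
  | n + 1 => fun t => Complex.I • sint (fun u => dysonW A n u * A u) 0 t

/-- The terms of the Dyson series `V' = -i A V`, `V 0 = 1`. -/
def dysonV (A : ℝ → BoundedOp H) : ℕ → ℝ → BoundedOp H
  | 0 => fun _ => 1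
  | n + 1 => fun t => -Complex.I • sint (fun u => A u * dysonV A n u) 0 t

/-- The Dyson series `W' = i W A`, `W 0 = 1`. -/
def dysonSeries (A : ℝ → BoundedOp H) (t : ℝ) : BoundedOp H := ∑' n, dysonW A n t

variable {A : ℝ → BoundedOp H} (hA : StrongCont A)

include hA

lemma continuous_dysonW (n : ℕ) : Continuous (dysonW A n) := by
  induction n with
  | zero => exact continuous_const
  | succ n ih => exact (continuous_sint (ih.strongCont.mul hA) 0).const_smul Complex.I

lemma continuous_dysonV (n : ℕ) : Continuous (dysonV A n) := by
  induction n with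
  | zero => exact continuous_const
  | succ n ih => exact (continuous_sint (hA.mul ih.strongCont) 0).const_smul (-Complex.I)

lemma star_dysonW (hsa : ∀ u, star (A u) = A u) (n : ℕ) (t : ℝ) :
    star (dysonW A n t) = dysonV A n t := by
  induction n generalizing t with
  | zero => simp [dysonW, dysonV]
  | succ n ih =>
    have h1 := (continuous_dysonW hA n).strongCont.mul hA
    have h2 := hA.mul (continuous_dysonV hA n).strongCont
    have e : (fun u => star (dysonW A n u * A u)) = fun u => A u * dysonV A n u := by
      ext1 u; rw [star_mul, hsa, ih]
    rw [dysonW, dysonV, star_smul, star_sint h1 (by rw [e]; exact h2), e]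
    simp

lemma hasDerivAt_dysonW (n : ℕ) (t : ℝ) (ξ : H) :
    HasDerivAt (fun t => dysonW A (n + 1) t ξ) (Complex.I • dysonW A n t (A t ξ)) t := by
  have := (hasDerivAt_sint ((continuous_dysonW hA n).strongCont.mul hA) 0 t ξ).const_smul Complex.I
  exact this

lemma hasDerivAt_dysonV (n : ℕ) (t : ℝ) (ξ : H) :
    HasDerivAt (fun t => dysonV A (n + 1) t ξ) (-Complex.I • A t (dysonV A n t ξ)) t := by
  have := (hasDerivAt_sint (hA.mul (continuous_dysonV hA n).strongCont) 0 t ξ).const_smul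
    (-Complex.I)
  exact this

lemma dysonW_zero_right (n : ℕ) : dysonW A (n + 1) 0 = 0 := by
  simp only [dysonW]
  rw [sint_same ((continuous_dysonW hA n).strongCont.mul hA), smul_zero]

lemma dysonV_zero_right (n : ℕ) : dysonV A (n + 1) 0 = 0 := by
  simp only [dysonV]
  rw [sint_same (hA.mul (continuous_dysonV hA n).strongCont), smul_zero]

variable {M : ℝ} (hM : ∀ u, ‖A u‖ ≤ M)

include hM

lemma norm_dysonW_le (n : ℕ) (t : ℝ) : ‖dysonW A n t‖ ≤ (M * |t|) ^ n / n.factorial := by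
  have hM0 : 0 ≤ M := (norm_nonneg _).trans (hM 0)
  induction n generalizing t with
  | zero =>
    rw [pow_zero, Nat.factorial_zero, Nat.cast_one, div_one]
    exact ContinuousLinearMap.norm_id_le
  | succ n ih =>
    rw [dysonW, norm_smul, Complex.norm_I, one_mul]
    refine (norm_sint_le_pow ((continuous_dysonW hA n).strongCont.mul hA) (n := n)
      (c := M ^ (n + 1) / n.factorial) (by positivity) (fun s => ?_) t).trans (le_of_eq ?_)
    · calc _ ≤ ‖dysonW A n s‖ * ‖A s‖ := norm_mul_le _ _
        _ ≤ (M * |s|) ^ n / n.factorial * M :=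
          mul_le_mul (ih s) (hM s) (norm_nonneg _) (by positivity)
        _ = _ := by rw [mul_pow]; ring
    · rw [Nat.factorial_succ, mul_pow]
      push_cast
      field_simp

lemma summable_norm_dysonW (t : ℝ) : Summable fun n => ‖dysonW A n t‖ :=
  Summable.of_nonneg_of_le (fun _ => norm_nonneg _) (fun n => norm_dysonW_le hA hM n t)
    (Real.summable_pow_div_factorial _)

lemma hasSum_dysonSeries (t : ℝ) : HasSum (fun n => dysonW A n t) (dysonSeries A t) :=
  (summable_norm_dysonW hA hM t).of_norm.hasSum

lemma norm_dysonW_le_of_le {R t : ℝ} (ht : |t| ≤ R) (n : ℕ) :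
    ‖dysonW A n t‖ ≤ (M * R) ^ n / n.factorial := by
  have hM0 : 0 ≤ M := (norm_nonneg _).trans (hM 0)
  exact (norm_dysonW_le hA hM n t).trans (by gcongr)

lemma continuous_dysonSeries : Continuous (dysonSeries A) := by
  refine continuous_iff_continuousAt.2 fun t => ?_
  have h : ContinuousOn (dysonSeries A) (Icc (-(|t| + 1)) (|t| + 1)) :=
    continuousOn_tsum (fun n => (continuous_dysonW hA n).continuousOn)
      (Real.summable_pow_div_factorial (M * (|t| + 1)))
      fun n s hs => norm_dysonW_le_of_le hA hM (abs_le.2 hs) n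
  exact h.continuousAt (Icc_mem_nhds (by linarith [neg_abs_le t]) (by linarith [le_abs_self t]))

/-- Termwise integration, justified by the factorial majorant on [0, t]. The resulting integral
equation gives the strong derivative. -/
lemma dysonSeries_eq (t : ℝ) :
    dysonSeries A t = 1 + Complex.I • sint (fun u => dysonSeries A u * A u) 0 t := by
  have hM0 : 0 ≤ M := (norm_nonneg _).trans (hM 0)
  have hW := (continuous_dysonSeries hA hM).strongCont.mul hA
  have hsum := hasSum_dysonSeries hA hM t
  rw [dysonSeries, hsum.summable.tsum_eq_zero_add]
  congr 1
  ext ξ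
  have h1 : HasSum (fun n => ∫ u in (0 : ℝ)..t, (dysonW A n u * A u) ξ)
      (∫ u in (0 : ℝ)..t, (dysonSeries A u * A u) ξ) := by
    refine intervalIntegral.hasSum_integral_of_dominated_convergence
      (fun n _ => (M * |t|) ^ n / n.factorial * (M * ‖ξ‖)) (fun n => ?_) (fun n => ?_) ?_ ?_ ?_
    · exact (((continuous_dysonW hA n).strongCont.mul hA) ξ).aestronglyMeasurable
    · refine Eventually.of_forall fun u hu => ?_
      have hu' : |u| ≤ |t| := by
        have := abs_sub_left_of_mem_uIcc (uIoc_subset_uIcc hu); simpa using this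
      exact (dysonW A n u).le_of_opNorm_le_of_le (norm_dysonW_le_of_le hA hM hu' n)
        ((A u).le_of_opNorm_le (hM u) ξ)
    · exact Eventually.of_forall fun u _ =>
        (Real.summable_pow_div_factorial (M * |t|)).mul_right _
    · exact intervalIntegrable_const
    · refine Eventually.of_forall fun u _ => ?_
      exact (hasSum_dysonSeries hA hM u).mapL ((ContinuousLinearMap.apply ℂ H (A u ξ)))
  have h2 : HasSum (fun n => dysonW A (n + 1) t ξ) ((∑' n, dysonW A (n + 1) t) ξ) :=
    ((summable_nat_add_iff 1).2 hsum.summable).hasSum.mapL (ContinuousLinearMap.apply ℂ H ξ)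
  refine h2.unique ?_
  rw [smul_apply, sint_apply hW]
  convert h1.const_smul Complex.I using 2 with n
  rw [dysonW, smul_apply, sint_apply ((continuous_dysonW hA n).strongCont.mul hA)]

lemma hasDerivAt_dysonSeries (t : ℝ) (ξ : H) :
    HasDerivAt (fun t => dysonSeries A t ξ) (Complex.I • dysonSeries A t (A t ξ)) t := by
  have := ((hasDerivAt_sint ((continuous_dysonSeries hA hM).strongCont.mul hA) 0 t ξ).const_smul
    Complex.I).const_add ξ
  refine this.congr_of_eventuallyEq (Eventually.of_forall fun s => ?_)
  beta_reduce
  rw [dysonSeries_eq hA hM s]; rfl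

lemma dysonSeries_zero : dysonSeries A 0 = 1 := by
  rw [dysonSeries_eq hA hM, sint_same ((continuous_dysonSeries hA hM).strongCont.mul hA)]; simp

variable (hsa : ∀ u, star (A u) = A u)

include hsa

lemma hasSum_star_dysonSeries (t : ℝ) :
    HasSum (fun n => dysonV A n t) (star (dysonSeries A t)) := by
  have := (hasSum_dysonSeries hA hM t).star
  simpa only [star_dysonW hA hsa] using this

lemma star_dysonSeries_eq (t : ℝ) : star (dysonSeries A t) =
    1 - Complex.I • sint (fun u => A u * star (dysonSeries A u)) 0 t := by
  have hW := (continuous_dysonSeries hA hM).strongCont.mul hA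
  have hV := hA.mul (continuous_dysonSeries hA hM).star.strongCont
  have e : (fun u => star (dysonSeries A u * A u)) = fun u => A u * star (dysonSeries A u) := by
    ext1 u; rw [star_mul, hsa]
  conv_lhs => rw [dysonSeries_eq hA hM]
  rw [star_add, star_one, star_smul, star_sint hW (by rw [e]; exact hV), e]
  simp [sub_eq_add_neg]

lemma hasDerivAt_star_dysonSeries (t : ℝ) (ξ : H) :
    HasDerivAt (fun t => star (dysonSeries A t) ξ)
      (-Complex.I • A t (star (dysonSeries A t) ξ)) t := by
  have hV := hA.mul (continuous_dysonSeries hA hM).star.strongCont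
  have := ((hasDerivAt_sint hV 0 t ξ).const_smul Complex.I).const_sub ξ
  rw [← neg_smul] at this
  refine this.congr_of_eventuallyEq (Eventually.of_forall fun s => ?_)
  beta_reduce
  rw [star_dysonSeries_eq hA hM hsa s]; rfl

omit hA hM in
/-- Inner products of solutions of `v' = -i A v` are constant. -/
lemma inner_eq_of_hasDerivAt {v w : ℝ → H} (hv : ∀ t, HasDerivAt v (-Complex.I • A t (v t)) t)
    (hw : ∀ t, HasDerivAt w (-Complex.I • A t (w t)) t) (t : ℝ) :
    inner ℂ (v t) (w t) = inner ℂ (v 0) (w 0) := by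
  have hd : ∀ s, HasDerivAt (fun s => inner ℂ (v s) (w s)) 0 s := fun s => by
    have := (hv s).inner ℂ (hw s)
    have e : inner ℂ (A s (v s)) (w s) = inner ℂ (v s) (A s (w s)) := by
      conv_lhs => rw [← hsa s, ContinuousLinearMap.star_eq_adjoint,
        ContinuousLinearMap.adjoint_inner_left]
    have z : inner ℂ (v s) (-Complex.I • (A s) (w s)) +
        inner ℂ (-Complex.I • (A s) (v s)) (w s) = 0 := by
      rw [inner_smul_right, inner_smul_left, e]
      simp
    exact z ▸ this
  exact is_const_of_deriv_eq_zero (fun s => (hd s).differentiableAt) (fun s => (hd s).deriv) t 0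

-- Uniqueness for v' = -iAv: the difference of two solutions is again a solution, so its norm is
-- constant and equal to its initial value 0.
omit hA hM in
lemma eq_of_hasDerivAt {v w : ℝ → H} (hv : ∀ t, HasDerivAt v (-Complex.I • A t (v t)) t)
    (hw : ∀ t, HasDerivAt w (-Complex.I • A t (w t)) t) (h0 : v 0 = w 0) (t : ℝ) :
    v t = w t := by
  have hd : ∀ t, HasDerivAt (fun t => v t - w t) (-Complex.I • A t (v t - w t)) t := fun t => by
    have := (hv t).sub (hw t)
    rw [map_sub, smul_sub]; exact this
  have := inner_eq_of_hasDerivAt hsa hd hd t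
  rw [h0, sub_self, inner_zero_left, inner_self_eq_zero] at this
  exact sub_eq_zero.1 this

/-- The curves t ↦ W(t)^* ξ solve v' = -iAv, so inner products are conserved and W(t)^* is an
isometry. This gives only one half of unitarity. -/
lemma dysonSeries_mul_star (t : ℝ) : dysonSeries A t * star (dysonSeries A t) = 1 := by
  ext ξ
  refine ext_inner_right ℂ fun η => ?_
  have := inner_eq_of_hasDerivAt hsa (hasDerivAt_star_dysonSeries hA hM hsa · ξ)
    (hasDerivAt_star_dysonSeries hA hM hsa · η) t
  rw [dysonSeries_zero hA hM] at this
  simp only [star_one, one_apply_eq_self] at this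
  simp only [one_apply_eq_self]
  rw [← this, ContinuousLinearMap.star_eq_adjoint, ContinuousLinearMap.adjoint_inner_right]
  rfl

end DysonSeries

/-! ### The time simplex and integration over it. -/

section Simplex

lemma isClosed_timeSimplex (n : ℕ) : IsClosed (timeSimplex n) := by
  have h : timeSimplex n = (⋂ (i : Fin n) (j : Fin n) (_ : i ≤ j), {s | s i ≤ s j}) ∩
      ⋂ i : Fin n, {s | s i ∈ Icc (0 : ℝ) 1} := by
    ext s; simp [timeSimplex, Monotone]
  rw [h]
  refine IsClosed.inter ?_ (isClosed_iInter fun i => isClosed_Icc.preimage (continuous_apply i))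
  exact isClosed_iInter fun i => isClosed_iInter fun j => isClosed_iInter fun _ =>
    isClosed_le (continuous_apply i) (continuous_apply j)

lemma isCompact_timeSimplex (n : ℕ) : IsCompact (timeSimplex n) :=
  (isCompact_univ_pi (s := fun _ : Fin n => Icc (0 : ℝ) 1) fun _ => isCompact_Icc).of_isClosed_subset
    (isClosed_timeSimplex n) fun _ hs i _ => hs.2 i

lemma snoc_mem_timeSimplex {n : ℕ} {s : Fin n → ℝ} {l : ℝ} :
    (Fin.snoc s l : Fin (n + 1) → ℝ) ∈ timeSimplex (n + 1) ↔
      Monotone s ∧ (∀ i, s i ∈ Icc 0 l) ∧ l ∈ Icc (0 : ℝ) 1 := by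
  constructor
  · rintro ⟨h1, h2⟩
    have hl : l ∈ Icc (0 : ℝ) 1 := by simpa using h2 (Fin.last n)
    have hs : ∀ i, s i ≤ l := fun i => by simpa using h1 (Fin.le_last i.castSucc)
    exact ⟨fun i j hij => by simpa using h1 (Fin.castSucc_le_castSucc_iff.2 hij),
      fun i => ⟨by simpa using (h2 i.castSucc).1, hs i⟩, hl⟩
  · rintro ⟨h1, h2, h3⟩
    refine ⟨fun i j hij => ?_, fun i => ?_⟩
    · induction j using Fin.lastCases with
      | last =>
        induction i using Fin.lastCases with
        | last => exact le_rfl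
        | cast i => simpa using (h2 i).2
      | cast j =>
        induction i using Fin.lastCases with
        | last => exact absurd hij (by simp)
        | cast i => simpa using h1 (Fin.castSucc_le_castSucc_iff.1 hij)
    · induction i using Fin.lastCases with
      | last => simpa using h3
      | cast i => simpa using ⟨(h2 i).1, (h2 i).2.trans h3.2⟩

-- Once the largest time l is fixed, the remaining times fill a simplex scaled by l. This is the
-- source of the Jacobian lⁿ in the iterated integral.
open Pointwise in
lemma smul_timeSimplex {n : ℕ} {l : ℝ} (hl : l ∈ Ioc (0 : ℝ) 1) :
    {s : Fin n → ℝ | (Fin.snoc s l : Fin (n + 1) → ℝ) ∈ timeSimplex (n + 1)} =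
      l • timeSimplex n := by
  ext s
  rw [mem_smul_set_iff_inv_smul_mem₀ hl.1.ne', mem_ofPred_eq, snoc_mem_timeSimplex]
  have hl' : 0 < l⁻¹ := inv_pos.2 hl.1
  constructor
  · rintro ⟨h1, h2, -⟩
    refine ⟨fun i j hij => ?_, fun i => ⟨?_, ?_⟩⟩
    · exact mul_le_mul_of_nonneg_left (h1 hij) hl'.le
    · exact mul_nonneg hl'.le (h2 i).1
    · have := mul_le_mul_of_nonneg_left (h2 i).2 hl'.le
      rwa [inv_mul_cancel₀ hl.1.ne'] at this
  · rintro ⟨h1, h2⟩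
    refine ⟨fun i j hij => le_of_mul_le_mul_left (h1 hij) hl', fun i => ⟨?_, ?_⟩, hl.1.le, hl.2⟩
    · exact nonneg_of_mul_nonneg_right (h2 i).1 hl'
    · have : l⁻¹ * s i ≤ l⁻¹ * l := by rw [inv_mul_cancel₀ hl.1.ne']; exact (h2 i).2
      exact le_of_mul_le_mul_left this hl'

variable {E : Type*} [NormedAddCommGroup E] [NormedSpace ℝ E]

open Pointwise in
/-- Integrals over the time simplex as iterated integrals. -/
lemma setIntegral_timeSimplex_succ {n : ℕ} {h : (Fin (n + 1) → ℝ) → E} (hc : Continuous h) :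
    ∫ s in timeSimplex (n + 1), h s =
      ∫ l in (0 : ℝ)..1, l ^ n • ∫ s in timeSimplex n, h (Fin.snoc (l • s) l : Fin (n + 1) → ℝ) := by
  set e := MeasurableEquiv.piFinSuccAbove (fun _ : Fin (n + 1) => ℝ) (Fin.last n) with he
  have mp := (volume_preserving_piFinSuccAbove (fun _ : Fin (n + 1) => ℝ) (Fin.last n)).symm
  have hes : ∀ p : ℝ × (Fin n → ℝ), e.symm p = Fin.snoc p.2 p.1 := fun p =>
    Fin.insertNth_last' p.1 p.2
  set S := timeSimplex (n + 1)
  have hS : MeasurableSet S := (isClosed_timeSimplex _).measurableSet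
  have hT : MeasurableSet (e.symm ⁻¹' S) := e.symm.measurable hS
  have hint : IntegrableOn (fun p => h (e.symm p)) (e.symm ⁻¹' S) volume :=
    (mp.integrableOn_comp_preimage e.symm.measurableEmbedding).2
      (hc.continuousOn.integrableOn_compact (isCompact_timeSimplex _))
  rw [← mp.setIntegral_preimage_emb e.symm.measurableEmbedding]
  rw [← integral_indicator hT]
  have hint' := hint.integrable_indicator hT
  rw [Measure.volume_eq_prod] at hint' ⊢
  rw [integral_prod _ hint', intervalIntegral.integral_of_le zero_le_one,
    ← integral_indicator measurableSet_Ioc]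
  refine integral_congr_ae ?_
  have hne : ∀ᵐ l : ℝ, l ≠ 0 := by simp [ae_iff]
  filter_upwards [hne] with l hl0
  by_cases hl : l ∈ Ioc (0 : ℝ) 1
  · rw [indicator_of_mem hl]
    have h1 : (fun s => indicator (e.symm ⁻¹' S) (fun p => h (e.symm p)) (l, s)) =
        indicator (l • timeSimplex n) fun s => h (Fin.snoc s l) := by
      rw [← smul_timeSimplex hl]
      ext s
      by_cases hs : (Fin.snoc s l : Fin (n + 1) → ℝ) ∈ timeSimplex (n + 1)
      · rw [indicator_of_mem (by rwa [mem_preimage, hes]), indicator_of_mem (by exact hs), hes]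
      · rw [indicator_of_notMem (by rwa [mem_preimage, hes]), indicator_of_notMem (by exact hs)]
    rw [h1, integral_indicator ((isClosed_timeSimplex n).measurableSet.const_smul_of_ne_zero
      hl.1.ne')]
    have h2 := Measure.setIntegral_comp_smul_of_pos volume
      (fun s : Fin n → ℝ => h (Fin.snoc s l)) (timeSimplex n) hl.1
    rw [h2, smul_smul, Module.finrank_fin_fun, mul_inv_cancel₀ (pow_ne_zero _ hl.1.ne'), one_smul]
  · rw [indicator_of_notMem hl]
    refine integral_eq_zero_of_ae (Eventually.of_forall fun s => indicator_of_notMem ?_ _)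
    rw [mem_preimage, hes, snoc_mem_timeSimplex]
    rintro ⟨-, -, h3⟩
    exact hl ⟨lt_of_le_of_ne h3.1 fun h => hl0 h.symm, h3.2⟩

end Simplex

/-! ### Dyson integrals characterized by a one-step recursion. -/

section Integrand

variable {H : Type*} [NormedAddCommGroup H] [InnerProductSpace ℂ H] [CompleteSpace H]
  {op : BoundedOp H → BoundedOp H → BoundedOp H} {A : ℝ → BoundedOp H}

lemma strongCont_foldr {X : Type*} [TopologicalSpace X]
    (hop : ∀ f g : X → BoundedOp H, StrongCont f → StrongCont g → StrongCont fun s => op (f s) (g s))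
    {n : ℕ} {f : Fin n → X → BoundedOp H} (hf : ∀ i, StrongCont (f i)) (y : BoundedOp H) :
    StrongCont fun x => (List.ofFn fun i => f i x).foldr op y := by
  induction n with
  | zero => simpa using strongCont_const y
  | succ n ih =>
    simp only [List.ofFn_succ, List.foldr_cons]
    exact hop _ _ (hf 0) (ih fun i => hf i.succ)

/-- A recursion over the time simplex determines the Dyson integrals. -/
lemma smul_setIntegral_foldr_eq
    (hop : ∀ (n : ℕ) (f g : (Fin n → ℝ) → BoundedOp H), StrongCont f → StrongCont g →
      StrongCont fun s => op (f s) (g s)) (hA : StrongCont A)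
    {E : ℕ → ℝ → BoundedOp H → BoundedOp H} (hE0 : ∀ t y, E 0 t y = y)
    (hE : ∀ n t y ξ, E (n + 1) t y ξ =
      (Complex.I * t) • ∫ l in (0 : ℝ)..1, E n (l * t) (op (A (l * t)) y) ξ)
    (n : ℕ) (t : ℝ) (y : BoundedOp H) (ξ : H) :
    (Complex.I * (t : ℂ)) ^ n •
      ∫ s in timeSimplex n, (List.ofFn fun i => A (s i * t)).foldr op y ξ = E n t y ξ := by
  induction n generalizing t y with
  | zero =>
    have h0 : timeSimplex 0 = univ := by
      ext s; simp [timeSimplex, Subsingleton.monotone]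
    simp [hE0, h0, integral_unique, Measure.real, volume_pi]
  | succ n ih =>
    -- The largest time l belongs to the last factor of the list, which acts first on y. The other
    -- times are l times a point of the smaller simplex, and tⁿ⁺¹ lⁿ = t (lt)ⁿ matches the term of
    -- order n at time lt.
    rw [setIntegral_timeSimplex_succ ((strongCont_foldr (hop (n + 1))
      (fun i => hA.comp (by fun_prop)) y) ξ), hE, pow_succ', mul_smul,
      ← intervalIntegral.integral_smul]
    congr 1
    refine intervalIntegral.integral_congr fun l _ => ?_
    beta_reduce
    rw [← ih]
    simp only [List.ofFn_succ', Fin.snoc_last, Fin.snoc_castSucc, List.concat_eq_append,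
      List.foldr_append, List.foldr_cons, List.foldr_nil, Pi.smul_apply, smul_eq_mul]
    rw [← Complex.coe_smul (l ^ n), smul_smul]
    congr 1
    · push_cast; ring
    · simp only [mul_comm l, mul_assoc]

end Integrand

/-! ### Product rules for strong derivatives. -/

section ProductDerivative

variable {H : Type*} [NormedAddCommGroup H] [InnerProductSpace ℂ H] [CompleteSpace H]

lemma StrongCont.tendsto_apply {X : Type*} [TopologicalSpace X] [WeaklyLocallyCompactSpace X]
    {f : X → BoundedOp H} (hf : StrongCont f) {x : X} {l : Filter X} (hl : l ≤ 𝓝 x) {u : X → H}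
    {u₀ : H} (hu : Tendsto u l (𝓝 u₀)) : Tendsto (fun s => f s (u s)) l (𝓝 (f x u₀)) := by
  obtain ⟨K, hK, hKx⟩ := exists_compact_mem_nhds x
  obtain ⟨C, hC0, hC⟩ := hf.exists_bound hK
  have h1 : Tendsto (fun s => f s (u s - u₀)) l (𝓝 0) := by
    have h2 : Tendsto (fun s => C * ‖u s - u₀‖) l (𝓝 0) := by
      have := (hu.sub_const u₀).norm.const_mul C
      simpa using this
    refine squeeze_zero_norm' ?_ h2
    filter_upwards [hl hKx] with s hs
    exact (f s).le_of_opNorm_le (hC s hs) _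
  have h3 := h1.add (((hf u₀).tendsto x).mono_left hl)
  simpa using h3

/-- Product rule for a strongly continuous operator family acting on a differentiable curve. -/
lemma StrongCont.hasDerivAt_apply {f : ℝ → BoundedOp H} (hf : StrongCont f) {v : ℝ → H} {v' w : H}
    {t : ℝ} (hv : HasDerivAt v v' t) (hw : HasDerivAt (fun s => f s (v t)) w t) :
    HasDerivAt (fun s => f s (v s)) (w + f t v') t := by
  rw [hasDerivAt_iff_tendsto_slope] at *
  have h := hw.add (hf.tendsto_apply nhdsWithin_le_nhds hv)
  refine h.congr fun s => ?_
  simp only [slope, vsub_eq_sub, ContinuousLinearMap.map_smul_of_tower, map_sub]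
  rw [← smul_add]; congr 1; abel

end ProductDerivative

/-! ### The commutator Dyson series as a Cauchy product. -/

section AdjointSeries

variable {H : Type*} [NormedAddCommGroup H] [InnerProductSpace ℂ H] [CompleteSpace H]
  {A : ℝ → BoundedOp H}

/-- The sums of W_p y V_q over p + q = n are the homogeneous parts of W y W^*. Differentiating the
left factor yields A y and the right one -y A, so the commutator appears inside the sum of one order
less. -/
lemma hasDerivAt_dysonW_mul_dysonV (hA : StrongCont A) (y : BoundedOp H) (n : ℕ) (t : ℝ) (ξ : H) :
    HasDerivAt (fun t => (∑ p ∈ Finset.HasAntidiagonal.antidiagonal (n + 1),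
        dysonW A p.1 t * y * dysonV A p.2 t) ξ)
      (Complex.I • (∑ p ∈ Finset.HasAntidiagonal.antidiagonal n,
        dysonW A p.1 t * (A t * y - y * A t) * dysonV A p.2 t) ξ) t := by
  -- The terms of order zero are constant, hence the value 0 at index 0; the remaining derivatives
  -- lower the index by one.
  let dW : ℕ → BoundedOp H := fun k => Nat.casesOn k 0 fun k => Complex.I • (dysonW A k t * A t)
  let dV : ℕ → BoundedOp H := fun k => Nat.casesOn k 0 fun k => -Complex.I • (A t * dysonV A k t)
  have hW : ∀ k η, HasDerivAt (fun t => dysonW A k t η) (dW k η) t := by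
    rintro (_ | k) η
    · exact hasDerivAt_const t η
    · exact hasDerivAt_dysonW hA k t η
  have hV : ∀ k η, HasDerivAt (fun t => dysonV A k t η) (dV k η) t := by
    rintro (_ | k) η
    · exact hasDerivAt_const t η
    · exact hasDerivAt_dysonV hA k t η
  have hterm : ∀ p : ℕ × ℕ, HasDerivAt (fun t => (dysonW A p.1 t * y * dysonV A p.2 t) ξ)
      ((dW p.1 * y * dysonV A p.2 t + dysonW A p.1 t * y * dV p.2) ξ) t := fun p =>
    (((continuous_dysonW hA p.1).strongCont.mul_const y).hasDerivAt_apply (hV p.2 ξ)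
      (hW p.1 (y (dysonV A p.2 t ξ))))
  have hs := HasDerivAt.fun_sum (u := Finset.HasAntidiagonal.antidiagonal (n + 1)) fun p _ => hterm p
  simp only [sum_apply]
  convert hs using 1
  rw [← sum_apply, ← sum_apply, Finset.sum_add_distrib, Finset.Nat.sum_antidiagonal_succ,
    Finset.Nat.sum_antidiagonal_succ', ← smul_apply]
  congr 1
  have e1 : dW 0 = 0 := rfl
  have e2 : dV 0 = 0 := rfl
  have e3 : ∀ k, dW (k + 1) = Complex.I • (dysonW A k t * A t) := fun _ => rfl
  have e4 : ∀ k, dV (k + 1) = -Complex.I • (A t * dysonV A k t) := fun _ => rfl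
  simp only [e1, e2, e3, e4, zero_mul, mul_zero, zero_add]
  rw [← Finset.sum_add_distrib, Finset.smul_sum]
  refine Finset.sum_congr rfl fun p _ => ?_
  simp only [smul_mul_assoc, mul_smul_comm, mul_sub, sub_mul, smul_sub, neg_smul, mul_neg,
    mul_assoc]
  abel

/-- The preceding derivative integrated over [0, t] and rescaled to [0, 1], in the form of the
recursion that `smul_setIntegral_foldr_eq` asks for. At t = 0 every summand has an index of positive
order, so nothing remains. -/
lemma sum_antidiagonal_dyson_succ (hA : StrongCont A) (y : BoundedOp H) (n : ℕ) (t : ℝ) (ξ : H) :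
    (∑ p ∈ Finset.HasAntidiagonal.antidiagonal (n + 1), dysonW A p.1 t * y * dysonV A p.2 t) ξ =
      (Complex.I * t) • ∫ l in (0 : ℝ)..1, (∑ p ∈ Finset.HasAntidiagonal.antidiagonal n, dysonW A p.1 (l * t) *
        (A (l * t) * y - y * A (l * t)) * dysonV A p.2 (l * t)) ξ := by
  set f : ℝ → BoundedOp H := fun u => ∑ p ∈ Finset.HasAntidiagonal.antidiagonal n,
    dysonW A p.1 u * (A u * y - y * A u) * dysonV A p.2 u with hf
  have hfc : StrongCont f := StrongCont.sum fun p _ =>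
    ((continuous_dysonW hA p.1).strongCont.mul ((hA.mul_const y).sub (hA.const_mul y))).mul
      (continuous_dysonV hA p.2).strongCont
  have h1 := intervalIntegral.integral_eq_sub_of_hasDerivAt (a := 0) (b := t)
    (fun s _ => hasDerivAt_dysonW_mul_dysonV hA y n s ξ)
    (((hfc ξ).const_smul Complex.I).intervalIntegrable _ _)
  have h0 : (∑ p ∈ Finset.HasAntidiagonal.antidiagonal (n + 1), dysonW A p.1 0 * y * dysonV A p.2 0) = 0 := by
    refine Finset.sum_eq_zero fun p hp => ?_
    rw [Finset.HasAntidiagonal.mem_antidiagonal] at hp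
    rcases hk : p.1 with _ | k
    · obtain ⟨m, hm⟩ : ∃ m, p.2 = m + 1 := ⟨n, by omega⟩
      rw [hm, dysonV_zero_right hA, mul_zero]
    · rw [dysonW_zero_right hA, zero_mul, zero_mul]
  rw [h0, zero_apply, sub_zero, intervalIntegral.integral_smul] at h1
  rw [← h1, mul_smul]
  congr 1
  have h2 := sint_eq_smul_integral hfc t ξ
  rw [sint_apply hfc] at h2
  rw [← Complex.coe_smul] at h2
  exact h2

end AdjointSeries

/-! ### Algebraic rules for the translations and the grading. -/

namespace GradedNet

variable {H : Type*} [NormedAddCommGroup H] [InnerProductSpace ℂ H] [CompleteSpace H]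
  (N : GradedNet H)

lemma U_neg_mul (t : ℝ) : N.U (-t) * N.U t = 1 := by rw [← N.U_add, neg_add_cancel, N.U_zero]

lemma U_mul_neg (t : ℝ) : N.U t * N.U (-t) = 1 := by rw [← N.U_add, add_neg_cancel, N.U_zero]

lemma star_U (t : ℝ) : star (N.U t) = N.U (-t) := by
  have h := (Unitary.mem_iff.1 (N.U_unitary t)).1
  calc star (N.U t) = star (N.U t) * (N.U t * N.U (-t)) := by rw [U_mul_neg, mul_one]
    _ = _ := by rw [← mul_assoc, h, one_mul]

lemma strongCont_U : StrongCont N.U := N.U_continuous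

lemma α_eq (t : ℝ) (x : BoundedOp H) : N.α t x = N.U t * x * N.U (-t) := rfl

lemma α_zero (x : BoundedOp H) : N.α 0 x = x := by simp [α_eq, N.U_zero]

lemma α_α (s t : ℝ) (x : BoundedOp H) : N.α s (N.α t x) = N.α (s + t) x := by
  rw [α_eq, α_eq, α_eq, N.U_add, neg_add_rev, N.U_add]; simp only [mul_assoc]

lemma α_one (t : ℝ) : N.α t 1 = 1 := by rw [α_eq, mul_one, U_mul_neg]

lemma α_mul (t : ℝ) (x y : BoundedOp H) : N.α t (x * y) = N.α t x * N.α t y := by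
  rw [α_eq, α_eq, α_eq]
  calc _ = N.U t * x * 1 * y * N.U (-t) := by simp only [mul_assoc, mul_one]
    _ = _ := by rw [← N.U_neg_mul t]; simp only [mul_assoc]

lemma α_sub (t : ℝ) (x y : BoundedOp H) : N.α t (x - y) = N.α t x - N.α t y := by
  simp only [α_eq, mul_sub, sub_mul]

lemma α_smul (t : ℝ) (c : ℂ) (x : BoundedOp H) : N.α t (c • x) = c • N.α t x := by
  simp only [α_eq, mul_smul_comm, smul_mul_assoc]

lemma α_star (t : ℝ) (x : BoundedOp H) : N.α t (star x) = star (N.α t x) := by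
  simp only [α_eq, star_mul, star_U, neg_neg, mul_assoc]

lemma norm_U_le (t : ℝ) : ‖N.U t‖ ≤ 1 := by
  refine norm_le_of_forall_le zero_le_one fun ξ => ?_
  rw [one_mul]
  have h : inner ℂ (N.U t ξ) (N.U t ξ) = (inner ℂ ξ ξ : ℂ) := by
    rw [← ContinuousLinearMap.adjoint_inner_right, ← ContinuousLinearMap.star_eq_adjoint, star_U]
    change inner ℂ ξ ((N.U (-t) * N.U t) ξ) = _
    rw [U_neg_mul]; rfl
  rw [inner_self_eq_norm_sq_to_K, inner_self_eq_norm_sq_to_K] at h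
  exact (by exact_mod_cast h : ‖N.U t ξ‖ ^ 2 = ‖ξ‖ ^ 2) |> fun h =>
    ((sq_eq_sq₀ (norm_nonneg _) (norm_nonneg _)).1 h).le

lemma norm_α_le (t : ℝ) (x : BoundedOp H) : ‖N.α t x‖ ≤ ‖x‖ := by
  calc ‖N.α t x‖ ≤ ‖N.U t‖ * ‖x‖ * ‖N.U (-t)‖ := (norm_mul_le _ _).trans (by gcongr; exact norm_mul_le _ _)
    _ ≤ 1 * ‖x‖ * 1 := by gcongr <;> exact N.norm_U_le _
    _ = _ := by ring

lemma norm_α (t : ℝ) (x : BoundedOp H) : ‖N.α t x‖ = ‖x‖ := by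
  refine le_antisymm (N.norm_α_le t x) ?_
  have := N.norm_α_le (-t) (N.α t x)
  rwa [α_α, neg_add_cancel, α_zero] at this

lemma Γ_mul_Γ : N.Γ * N.Γ = 1 := by
  have := (Unitary.mem_iff.1 N.Γ_unitary).1
  rwa [N.Γ_selfAdjoint.star_eq] at this

lemma γ_eq (x : BoundedOp H) : N.γ x = N.Γ * x * N.Γ := rfl

lemma γ_γ (x : BoundedOp H) : N.γ (N.γ x) = x := by
  rw [γ_eq, γ_eq]
  calc _ = (N.Γ * N.Γ) * x * (N.Γ * N.Γ) := by simp only [mul_assoc]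
    _ = x := by rw [Γ_mul_Γ, one_mul, mul_one]

lemma γ_one : N.γ 1 = 1 := by rw [γ_eq, mul_one, Γ_mul_Γ]

lemma γ_mul (x y : BoundedOp H) : N.γ (x * y) = N.γ x * N.γ y := by
  rw [γ_eq, γ_eq, γ_eq]
  calc _ = N.Γ * x * 1 * y * N.Γ := by simp only [mul_assoc, mul_one]
    _ = _ := by rw [← N.Γ_mul_Γ]; simp only [mul_assoc]

lemma γ_add (x y : BoundedOp H) : N.γ (x + y) = N.γ x + N.γ y := by
  simp only [γ_eq, mul_add, add_mul]

lemma γ_sub (x y : BoundedOp H) : N.γ (x - y) = N.γ x - N.γ y := by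
  simp only [γ_eq, mul_sub, sub_mul]

lemma γ_smul (c : ℂ) (x : BoundedOp H) : N.γ (c • x) = c • N.γ x := by
  simp only [γ_eq, mul_smul_comm, smul_mul_assoc]

lemma γ_star (x : BoundedOp H) : N.γ (star x) = star (N.γ x) := by
  simp only [γ_eq, star_mul, N.Γ_selfAdjoint.star_eq, mul_assoc]

lemma γ_α (t : ℝ) (x : BoundedOp H) : N.γ (N.α t x) = N.α t (N.γ x) := by
  rw [γ_eq, γ_eq, α_eq, α_eq]
  calc _ = (N.Γ * N.U t) * x * (N.U (-t) * N.Γ) := by simp only [mul_assoc]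
    _ = _ := by rw [← N.U_comm_Γ, N.U_comm_Γ (-t)]; simp only [mul_assoc]

lemma norm_Γ_le : ‖N.Γ‖ ≤ 1 := by
  refine norm_le_of_forall_le zero_le_one fun ξ => ?_
  rw [one_mul]
  have h : inner ℂ (N.Γ ξ) (N.Γ ξ) = (inner ℂ ξ ξ : ℂ) := by
    rw [← ContinuousLinearMap.adjoint_inner_right, ← ContinuousLinearMap.star_eq_adjoint,
      N.Γ_selfAdjoint.star_eq]
    change inner ℂ ξ ((N.Γ * N.Γ) ξ) = _
    rw [Γ_mul_Γ]; rfl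
  rw [inner_self_eq_norm_sq_to_K, inner_self_eq_norm_sq_to_K] at h
  exact (by exact_mod_cast h : ‖N.Γ ξ‖ ^ 2 = ‖ξ‖ ^ 2) |> fun h =>
    ((sq_eq_sq₀ (norm_nonneg _) (norm_nonneg _)).1 h).le

lemma norm_γ (x : BoundedOp H) : ‖N.γ x‖ = ‖x‖ := by
  have key : ∀ x, ‖N.γ x‖ ≤ ‖x‖ := fun x => by
    calc ‖N.γ x‖ ≤ ‖N.Γ‖ * ‖x‖ * ‖N.Γ‖ := (norm_mul_le _ _).trans (by gcongr; exact norm_mul_le _ _)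
      _ ≤ 1 * ‖x‖ * 1 := by gcongr <;> exact N.norm_Γ_le
      _ = _ := by ring
  refine le_antisymm (key x) ?_
  have := key (N.γ x)
  rwa [γ_γ] at this

lemma strongCont_γ {X : Type*} [TopologicalSpace X] {f : X → BoundedOp H} (hf : StrongCont f) :
    StrongCont fun s => N.γ (f s) := (hf.const_mul _).mul_const _

lemma strongCont_α {X : Type*} [TopologicalSpace X] [WeaklyLocallyCompactSpace X]
    {f : X → BoundedOp H} (hf : StrongCont f) {τ : X → ℝ} (hτ : Continuous τ) :
    StrongCont fun s => N.α (τ s) (f s) :=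
  ((N.strongCont_U.comp hτ).mul hf).mul (N.strongCont_U.comp hτ.neg)

lemma strongCont_orbit (a : BoundedOp H) : StrongCont fun t => N.α t a :=
  N.strongCont_α (strongCont_const a) continuous_id

/-! ### The perturbed cocycle and the perturbed flow -/

variable (a : BoundedOp H)

/-- The cocycle `γ^a_t(1)`. -/
def cocycle (t : ℝ) : BoundedOp H := dysonSeries (fun u => N.α u a) t

lemma norm_orbit_le (u : ℝ) : ‖N.α u a‖ ≤ ‖a‖ := (N.norm_α u a).le

lemma hasStrongIntegral_dysonIntegrand {op : BoundedOp H → BoundedOp H → BoundedOp H}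
    (hop : ∀ (n : ℕ) (f g : (Fin n → ℝ) → BoundedOp H), StrongCont f → StrongCont g →
      StrongCont fun s => op (f s) (g s)) (t : ℝ) (x : BoundedOp H) (n : ℕ) :
    ∃ T, HasStrongIntegral (volume.restrict (timeSimplex n)) (dysonIntegrand op N.α a t x n) T :=
  exists_hasStrongIntegral (isCompact_timeSimplex n) (isClosed_timeSimplex n).measurableSet
    (strongCont_foldr (hop n) (fun i => (N.strongCont_orbit a).comp (by fun_prop)) _)

lemma dysonTerm_eq_of_recursion {op : BoundedOp H → BoundedOp H → BoundedOp H}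
    (hop : ∀ (n : ℕ) (f g : (Fin n → ℝ) → BoundedOp H), StrongCont f → StrongCont g →
      StrongCont fun s => op (f s) (g s))
    {E : ℕ → ℝ → BoundedOp H → BoundedOp H} (hE0 : ∀ t y, E 0 t y = y)
    (hE : ∀ n t y ξ, E (n + 1) t y ξ =
      (Complex.I * t) • ∫ l in (0 : ℝ)..1, E n (l * t) (op (N.α (l * t) a) y) ξ)
    (n : ℕ) (t : ℝ) (x : BoundedOp H) : dysonTerm op N.α a t x n = E n t (N.α t x) := by
  obtain ⟨T, hT⟩ := N.hasStrongIntegral_dysonIntegrand a hop t x n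
  rw [dysonTerm, hT.strongIntegral_eq]
  ext ξ
  rw [smul_apply, (hT ξ).2, ← smul_setIntegral_foldr_eq hop (N.strongCont_orbit a) hE0 hE]
  rfl

lemma dysonTerm_mul (t : ℝ) (x : BoundedOp H) (n : ℕ) :
    dysonTerm (fun y z => y * z) N.α a t x n = dysonW (fun u => N.α u a) n t * N.α t x := by
  refine N.dysonTerm_eq_of_recursion a (fun _ _ _ hf hg => hf.mul hg)
    (E := fun n t y => dysonW (fun u => N.α u a) n t * y) (fun t y => one_mul y) ?_ n t x
  intro n t y ξ
  have hA := N.strongCont_orbit a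
  have := sint_eq_smul_integral ((continuous_dysonW hA n).strongCont.mul hA) t (y ξ)
  rw [mul_smul, Complex.coe_smul]
  exact congrArg (Complex.I • ·) this

lemma dysonTerm_ad (t : ℝ) (x : BoundedOp H) (n : ℕ) :
    dysonTerm (fun y z => y * z - z * y) N.α a t x n = ∑ p ∈ Finset.HasAntidiagonal.antidiagonal n,
      dysonW (fun u => N.α u a) p.1 t * N.α t x * dysonV (fun u => N.α u a) p.2 t := by
  refine N.dysonTerm_eq_of_recursion a (fun _ _ _ hf hg => (hf.mul hg).sub (hg.mul hf))
    (E := fun n t y => ∑ p ∈ Finset.HasAntidiagonal.antidiagonal n,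
      dysonW (fun u => N.α u a) p.1 t * y * dysonV (fun u => N.α u a) p.2 t) (fun t y => ?_) ?_ n t x
  · simp [dysonW, dysonV]
  · intro n t y ξ
    exact sum_antidiagonal_dyson_succ (N.strongCont_orbit a) y n t ξ

lemma continuous_cocycle : Continuous (N.cocycle a) :=
  continuous_dysonSeries (N.strongCont_orbit a) (N.norm_orbit_le a)

lemma cocycle_zero : N.cocycle a 0 = 1 :=
  dysonSeries_zero (N.strongCont_orbit a) (N.norm_orbit_le a)

lemma summable_norm_cocycle (t : ℝ) : Summable fun n => ‖dysonW (fun u => N.α u a) n t‖ :=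
  summable_norm_dysonW (N.strongCont_orbit a) (N.norm_orbit_le a) t

lemma hasSum_cocycle (t : ℝ) :
    HasSum (fun n => dysonW (fun u => N.α u a) n t) (N.cocycle a t) :=
  hasSum_dysonSeries (N.strongCont_orbit a) (N.norm_orbit_le a) t

lemma dysonConverges_mul (t : ℝ) (x : BoundedOp H) :
    DysonConverges (fun y z => y * z) N.α a t x := by
  refine ⟨fun n => N.hasStrongIntegral_dysonIntegrand a (fun _ _ _ hf hg => hf.mul hg) t x n, ?_⟩
  simp only [funext (N.dysonTerm_mul a t x)]
  exact (N.summable_norm_cocycle a t).of_norm.mul_right _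

lemma perturbedCocycle_eq (t : ℝ) (x : BoundedOp H) :
    perturbedCocycle N.α a t x = N.cocycle a t * N.α t x := by
  rw [perturbedCocycle]
  simp only [funext (N.dysonTerm_mul a t x)]
  exact ((N.hasSum_cocycle a t).mul_right _).tsum_eq

variable {a} (hsa : IsSelfAdjoint a)

include hsa

lemma star_orbit (u : ℝ) : star (N.α u a) = N.α u a := by rw [← α_star, hsa.star_eq]

lemma hasSum_star_cocycle (t : ℝ) :
    HasSum (fun n => dysonV (fun u => N.α u a) n t) (star (N.cocycle a t)) :=
  hasSum_star_dysonSeries (N.strongCont_orbit a) (N.norm_orbit_le a) (N.star_orbit hsa) t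

lemma summable_norm_star_cocycle (t : ℝ) :
    Summable fun n => ‖dysonV (fun u => N.α u a) n t‖ := by
  have := N.summable_norm_cocycle a t
  simpa only [← star_dysonW (N.strongCont_orbit a) (N.star_orbit hsa), norm_star] using this

/-- The commutator series is the Cauchy product of the absolutely convergent series for W_t α_t(x)
and W_t^*. -/
lemma hasSum_perturbedFlow (t : ℝ) (x : BoundedOp H) :
    HasSum (dysonTerm (fun y z => y * z - z * y) N.α a t x)
      (N.cocycle a t * N.α t x * star (N.cocycle a t)) := by
  simp only [funext (N.dysonTerm_ad a t x)]
  have h1 : Summable fun n => ‖dysonW (fun u => N.α u a) n t * N.α t x‖ :=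
    Summable.of_nonneg_of_le (fun _ => norm_nonneg _) (fun n => norm_mul_le _ _)
      ((N.summable_norm_cocycle a t).mul_right _)
  have h2 := N.summable_norm_star_cocycle hsa t
  have h3 := (summable_norm_sum_mul_antidiagonal_of_summable_norm h1 h2).of_norm.hasSum
  rw [← tsum_mul_tsum_eq_tsum_sum_antidiagonal_of_summable_norm h1 h2,
    ((N.hasSum_cocycle a t).mul_right _).tsum_eq, (N.hasSum_star_cocycle hsa t).tsum_eq] at h3
  exact h3

lemma dysonConverges_ad (t : ℝ) (x : BoundedOp H) :
    DysonConverges (fun y z => y * z - z * y) N.α a t x :=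
  ⟨fun n => N.hasStrongIntegral_dysonIntegrand a
    (fun _ _ _ hf hg => (hf.mul hg).sub (hg.mul hf)) t x n, (N.hasSum_perturbedFlow hsa t x).summable⟩

lemma perturbedFlow_eq (t : ℝ) (x : BoundedOp H) :
    perturbedFlow N.α a t x = N.cocycle a t * N.α t x * star (N.cocycle a t) :=
  (N.hasSum_perturbedFlow hsa t x).tsum_eq

lemma cocycle_mul_star (t : ℝ) : N.cocycle a t * star (N.cocycle a t) = 1 :=
  dysonSeries_mul_star (N.strongCont_orbit a) (N.norm_orbit_le a) (N.star_orbit hsa) t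

lemma hasDerivAt_star_cocycle (t : ℝ) (ξ : H) : HasDerivAt (fun t => star (N.cocycle a t) ξ)
    (-Complex.I • N.α t a (star (N.cocycle a t) ξ)) t :=
  hasDerivAt_star_dysonSeries (N.strongCont_orbit a) (N.norm_orbit_le a) (N.star_orbit hsa) t ξ

/-- As functions of s both sides, applied to a vector, solve v' = -i α_{t+s}(a) v with the same
initial value. The adjoint form is used because uniqueness is available for this left-multiplication
equation. -/
lemma star_cocycle_add (t s : ℝ) :
    star (N.cocycle a (t + s)) = N.α t (star (N.cocycle a s)) * star (N.cocycle a t) := by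
  ext ξ
  have hA : ∀ u, star (N.α (t + u) a) = N.α (t + u) a := fun u => N.star_orbit hsa _
  refine eq_of_hasDerivAt (A := fun u => N.α (t + u) a) hA
    (v := fun s => star (N.cocycle a (t + s)) ξ)
    (w := fun s => (N.α t (star (N.cocycle a s)) * star (N.cocycle a t)) ξ) (fun u => ?_)
    (fun u => ?_) ?_ s
  · exact (N.hasDerivAt_star_cocycle hsa (t + u) ξ).comp_const_add t u
  · have h := (N.hasDerivAt_star_cocycle hsa u (N.U (-t) (star (N.cocycle a t) ξ)))
    have h2 := (N.U t).hasFDerivAt.restrictScalars ℝ |>.comp_hasDerivAt u h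
    refine HasDerivAt.congr_deriv (f := fun s => (N.α t (star (N.cocycle a s)) *
      star (N.cocycle a t)) ξ) h2 ?_
    rw [← α_α]
    symm
    change _ = N.U t (-Complex.I • N.α u a (star (N.cocycle a u) (N.U (-t) (star (N.cocycle a t) ξ))))
    rw [map_smul]
    congr 1
    change N.U t (N.α u a (N.U (-t) (N.U t _))) = _
    have e : ∀ η, N.U (-t) (N.U t η) = η := fun η => by
      change (N.U (-t) * N.U t) η = η
      rw [U_neg_mul]; rfl
    rw [e]; rfl
  · simp [cocycle_zero, α_one]

lemma cocycle_add (t s : ℝ) :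
    N.cocycle a (t + s) = N.cocycle a t * N.α t (N.cocycle a s) := by
  have := congrArg star (N.star_cocycle_add hsa t s)
  rwa [star_star, star_mul, ← α_star, star_star, star_star] at this

/-- The cocycle identity with times -t and t gives W_t the left inverse α_t(W_{-t}). Together with
the right inverse W_t^* this shows that W_t is unitary and that both inverses agree. -/
lemma star_mul_cocycle (t : ℝ) : star (N.cocycle a t) * N.cocycle a t = 1 := by
  have h1 : N.α t (N.cocycle a (-t)) * N.cocycle a t = 1 := by
    have := congrArg (N.α t) (N.cocycle_add hsa (-t) t)
    rw [neg_add_cancel, cocycle_zero, α_one, α_mul, α_α, add_neg_cancel, α_zero] at this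
    exact this.symm
  have h2 := N.cocycle_mul_star hsa t
  have : star (N.cocycle a t) = N.α t (N.cocycle a (-t)) := by
    calc star (N.cocycle a t) = (N.α t (N.cocycle a (-t)) * N.cocycle a t) * star (N.cocycle a t) := by
          rw [h1, one_mul]
      _ = _ := by rw [mul_assoc, h2, mul_one]
  rw [this, h1]

lemma star_cocycle_eq (t : ℝ) : star (N.cocycle a t) = N.α t (N.cocycle a (-t)) := by
  have h1 := N.cocycle_add hsa t (-t)
  rw [add_neg_cancel, cocycle_zero] at h1
  calc star (N.cocycle a t) = star (N.cocycle a t) * (N.cocycle a t * N.α t (N.cocycle a (-t))) := by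
        rw [← h1, mul_one]
    _ = _ := by rw [← mul_assoc, N.star_mul_cocycle hsa, one_mul]

lemma norm_cocycle_le (t : ℝ) : ‖N.cocycle a t‖ ≤ 1 := by
  have h := CStarRing.norm_star_mul_self (x := N.cocycle a t)
  rw [N.star_mul_cocycle hsa] at h
  have h1 : ‖(1 : BoundedOp H)‖ ≤ 1 := ContinuousLinearMap.norm_id_le
  nlinarith [norm_nonneg (N.cocycle a t)]

end GradedNet

/-- The symmetric interval `(-(1+ρ), 1+ρ)`, where `ρ` is replaced by `0` if it is negative. -/
def BddInterval.symm (ρ : ℝ) : BddInterval :=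
  ⟨-(1 + max ρ 0), 1 + max ρ 0, by linarith [le_max_right ρ 0]⟩

/-! ### Strong limits, von Neumann algebras and the σ-weak topology. -/

section Limits

variable {H : Type*} [NormedAddCommGroup H] [InnerProductSpace ℂ H] [CompleteSpace H]

/-- A von Neumann algebra is closed under strong limits. -/
lemma VonNeumannAlgebra.mem_of_tendsto (S : VonNeumannAlgebra H) {ι : Type*} {l : Filter ι}
    [l.NeBot] {x : ι → BoundedOp H} {y : BoundedOp H} (hx : ∀ᶠ i in l, x i ∈ S)
    (h : ∀ ξ, Tendsto (fun i => x i ξ) l (𝓝 (y ξ))) : y ∈ S := by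
  rw [← S.commutant_commutant, VonNeumannAlgebra.mem_commutant_iff]
  intro g hg
  ext ξ
  have h1 : Tendsto (fun i => g (x i ξ)) l (𝓝 (g (y ξ))) := (g.continuous.tendsto _).comp (h ξ)
  refine tendsto_nhds_unique h1 ((h (g ξ)).congr' ?_)
  filter_upwards [hx] with i hi
  rw [VonNeumannAlgebra.mem_commutant_iff] at hg
  exact congrArg (fun T : BoundedOp H => T ξ) (hg _ hi)

/-- On norm-bounded families strong convergence implies σ-weak convergence, by dominated convergence
in the sum defining the functional. It makes closedness of δ and normality of φ, which are σ-weak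
hypotheses, applicable to strong integrals and Dyson series. -/
lemma tendsto_sigmaWeak {ι : Type*} {l : Filter ι} {x : ι → BoundedOp H} {y : BoundedOp H} {C : ℝ}
    (hC : ∀ᶠ i in l, ‖x i‖ ≤ C) (h : ∀ ξ, Tendsto (fun i => x i ξ) l (𝓝 (y ξ))) :
    Tendsto x l (@nhds _ (sigmaWeak H) y) := by
  rw [sigmaWeak, nhds_iInf, tendsto_iInf]
  intro p
  rw [nhds_induced, tendsto_comap_iff]
  have h2 : ∀ f : lp (fun _ : ℕ => H) 2, Summable fun n => ‖f n‖ ^ (2 : ℝ) := fun f => by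
    have := lp.memℓp f
    rw [memℓp_gen_iff (by norm_num)] at this
    simpa using this
  have hs : Summable fun n => ‖p.1 n‖ * ‖p.2 n‖ := by
    refine Summable.of_nonneg_of_le (fun n => by positivity) (fun n => ?_) ((h2 p.1).add (h2 p.2))
    simp only [Real.rpow_two]
    nlinarith [sq_nonneg (‖p.1 n‖ - ‖p.2 n‖), sq_nonneg (‖p.1 n‖), sq_nonneg (‖p.2 n‖)]
  refine tendsto_tsum_of_dominated_convergence (bound := fun n => |C| * (‖p.1 n‖ * ‖p.2 n‖))
    (hs.mul_left _) (fun n => ?_) ?_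
  · exact tendsto_const_nhds.inner (h _)
  · filter_upwards [hC] with i hi n
    refine (norm_inner_le_norm _ _).trans ?_
    have := (x i).le_of_opNorm_le (hi.trans (le_abs_self C)) (p.2 n)
    nlinarith [norm_nonneg (p.1 n)]

end Limits

section RiemannSums

/-- Riemann sums of continuous functions converge. -/
lemma tendsto_riemann_sum {E : Type*} [NormedAddCommGroup E] [NormedSpace ℝ E] [CompleteSpace E]
    {g : ℝ → E}
    (hg : Continuous g) :
    Tendsto (fun n : ℕ => ∑ k ∈ Finset.range (n + 1), ((n : ℝ) + 1)⁻¹ • g (k / ((n : ℝ) + 1)))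
      atTop (𝓝 (∫ s in (0 : ℝ)..1, g s)) := by
  rw [Metric.tendsto_atTop]
  intro ε hε
  have huc := isCompact_Icc.uniformContinuousOn_of_continuous
    (hg.continuousOn (s := Icc (0 : ℝ) 1))
  obtain ⟨η, hη, hη'⟩ := Metric.uniformContinuousOn_iff.1 huc (ε / 2) (by positivity)
  obtain ⟨n₀, hn₀⟩ := exists_nat_one_div_lt hη
  refine ⟨n₀, fun n hn => ?_⟩
  set c : ℝ := (n : ℝ) + 1
  have hc : 0 < c := by positivity
  have hcη : 1 / c < η := lt_of_le_of_lt (by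
    have : (n₀ : ℝ) ≤ n := by exact_mod_cast hn
    exact one_div_le_one_div_of_le (by positivity) (by simpa [c] using this)) hn₀
  have hsplit : ∫ s in (0 : ℝ)..1, g s =
      ∑ k ∈ Finset.range (n + 1), ∫ s in ((k : ℕ) / c : ℝ)..((k + 1 : ℕ) / c : ℝ), g s := by
    rw [intervalIntegral.sum_integral_adjacent_intervals fun k _ => hg.intervalIntegrable _ _]
    have : ((n + 1 : ℕ) : ℝ) / c = 1 := by simp only [c]; push_cast; field_simp
    rw [this]; simp
  rw [hsplit, dist_eq_norm, ← Finset.sum_sub_distrib]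
  refine lt_of_le_of_lt (norm_sum_le _ _) ?_
  have hterm : ∀ k ∈ Finset.range (n + 1), ‖c⁻¹ • g (k / c) -
      ∫ s in ((k : ℕ) / c : ℝ)..((k + 1 : ℕ) / c : ℝ), g s‖ ≤ ε / 2 * c⁻¹ := by
    intro k hk
    have hkn : ((k : ℝ) + 1) / c ≤ 1 := by
      rw [div_le_one hc]
      have := Finset.mem_range.1 hk
      have : (k : ℝ) + 1 ≤ n + 1 := by exact_mod_cast this
      exact this
    have hlen : ((k + 1 : ℕ) / c : ℝ) - k / c = c⁻¹ := by push_cast; field_simp; ring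
    have h1 : c⁻¹ • g (k / c) = ∫ s in ((k : ℕ) / c : ℝ)..((k + 1 : ℕ) / c : ℝ), g (k / c) := by
      rw [intervalIntegral.integral_const, hlen]
    rw [h1, ← intervalIntegral.integral_sub (continuous_const.intervalIntegrable _ _)
      (hg.intervalIntegrable _ _)]
    refine (intervalIntegral.norm_integral_le_of_norm_le_const (C := ε / 2) fun s hs => ?_).trans ?_
    · have hle : (k / c : ℝ) ≤ (k + 1 : ℕ) / c := by push_cast; gcongr; linarith
      rw [uIoc_of_le hle] at hs
      push_cast at hs
      have hk0 : 0 ≤ (k : ℝ) / c := by positivity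
      rw [← dist_eq_norm]
      refine (hη' _ ⟨hk0, ?_⟩ _ ⟨hk0.trans hs.1.le, hs.2.trans hkn⟩ ?_).le
      · exact (hs.1.le.trans hs.2).trans hkn
      · rw [Real.dist_eq, abs_lt]
        have : ((k : ℝ) + 1) / c = k / c + 1 / c := by ring
        constructor <;> [linarith [hs.2]; linarith [hs.1]]
    · rw [hlen, abs_of_pos (inv_pos.2 hc)]
  refine lt_of_le_of_lt (Finset.sum_le_sum hterm) ?_
  rw [Finset.sum_const, Finset.card_range, nsmul_eq_mul]
  have : ((n + 1 : ℕ) : ℝ) = c := by simp [c]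
  rw [this]
  field_simp
  linarith

end RiemannSums

/-! ### Local algebras of symmetric intervals, as a scale indexed by a radius. -/

namespace GradedNet

variable {H : Type*} [NormedAddCommGroup H] [InnerProductSpace ℂ H] [CompleteSpace H]
  (N : GradedNet H)

/-- The local algebra of the symmetric interval `(-(1+ρ), 1+ρ)`. -/
def loc (ρ : ℝ) : StarSubalgebra ℂ (BoundedOp H) := (N.alg (BddInterval.symm ρ)).toStarSubalgebra

lemma loc_mono {ρ ρ' : ℝ} (h : ρ ≤ ρ') {x : BoundedOp H} (hx : x ∈ N.loc ρ) : x ∈ N.loc ρ' := by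
  refine N.isotony (BddInterval.symm ρ) (BddInterval.symm ρ') (Ioo_subset_Ioo ?_ ?_) hx <;>
  · simp only [BddInterval.symm]; linarith [max_le_max_right 0 h]

lemma loc_closed {ρ : ℝ} {ι : Type*} {l : Filter ι} [l.NeBot] {x : ι → BoundedOp H}
    {y : BoundedOp H} (hx : ∀ᶠ i in l, x i ∈ N.loc ρ)
    (h : ∀ ξ, Tendsto (fun i => x i ξ) l (𝓝 (y ξ))) : y ∈ N.loc ρ :=
  (N.alg _).mem_of_tendsto hx h

lemma exists_alg_subset_loc (I : BddInterval) : ∃ ρ, 0 ≤ ρ ∧ ∀ x ∈ N.alg I, x ∈ N.loc ρ := by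
  refine ⟨max |I.lo| |I.hi|, by positivity, N.isotony I _ (Ioo_subset_Ioo ?_ ?_)⟩
  all_goals
    simp only [BddInterval.symm]
    have h1 := le_max_left |I.lo| |I.hi|
    have h2 := le_max_right |I.lo| |I.hi|
    have h3 := le_max_left (max |I.lo| |I.hi|) 0
  · linarith [neg_abs_le I.lo]
  · linarith [le_abs_self I.hi]

lemma exists_loc_of_mem {I : BddInterval} {x : BoundedOp H} (hx : x ∈ N.alg I) :
    ∃ ρ, 0 ≤ ρ ∧ x ∈ N.loc ρ :=
  let ⟨ρ, hρ, h⟩ := N.exists_alg_subset_loc I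
  ⟨ρ, hρ, h x hx⟩

lemma mem_localPart_iff {x : BoundedOp H} : x ∈ N.localPart ↔ ∃ ρ, 0 ≤ ρ ∧ x ∈ N.loc ρ := by
  constructor
  · intro hx
    obtain ⟨I, hI⟩ := mem_iUnion.1 hx
    exact N.exists_loc_of_mem hI
  · rintro ⟨ρ, -, hx⟩
    exact mem_iUnion.2 ⟨_, hx⟩

lemma α_mem_alg {I : BddInterval} {x : BoundedOp H} (hx : x ∈ N.alg I) (t : ℝ) :
    N.α t x ∈ N.alg (I.translate t) := by
  have := N.covariance t I
  rw [← SetLike.mem_coe, ← this]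
  exact ⟨x, hx, rfl⟩

lemma γ_mem_alg {I : BddInterval} {x : BoundedOp H} (hx : x ∈ N.alg I) : N.γ x ∈ N.alg I := by
  have := N.grading I
  rw [← SetLike.mem_coe, ← this]
  exact ⟨x, hx, rfl⟩

lemma γ_mem_loc {ρ : ℝ} {x : BoundedOp H} (hx : x ∈ N.loc ρ) : N.γ x ∈ N.loc ρ := N.γ_mem_alg hx

lemma α_mem_loc {ρ : ℝ} (hρ : 0 ≤ ρ) {x : BoundedOp H} (hx : x ∈ N.loc ρ) (t : ℝ) :
    N.α t x ∈ N.loc (ρ + |t|) := by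
  refine N.isotony _ _ (Ioo_subset_Ioo ?_ ?_) (N.α_mem_alg hx t)
  all_goals
    simp only [BddInterval.symm, BddInterval.translate]
    rw [max_eq_left hρ, max_eq_left (by positivity)]
  · linarith [neg_abs_le t]
  · linarith [le_abs_self t]

end GradedNet

/-! ### Local data of the functional and the superderivation; smooth curves. -/

/-- The local data of a super-KMS functional on a graded quantum dynamical system: the localized
domain of `φ`, the localized smooth elements for `δ`, and everywhere defined linear extensions of
`φ` and `δ`. -/
structure LocalSystem {H : Type*} [NormedAddCommGroup H] [InnerProductSpace ℂ H] [CompleteSpace H]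
    (N : GradedNet H) where
  dom : StarSubalgebra ℂ (BoundedOp H)
  smooth : StarSubalgebra ℂ (BoundedOp H)
  φ : BoundedOp H →ₗ[ℂ] ℂ
  δ : BoundedOp H →ₗ[ℂ] BoundedOp H
  smooth_le : smooth ≤ dom
  exists_loc : ∀ x ∈ dom, ∃ ρ, 0 ≤ ρ ∧ x ∈ N.loc ρ
  α_dom : ∀ t, ∀ x ∈ dom, N.α t x ∈ dom
  γ_dom : ∀ x ∈ dom, N.γ x ∈ dom
  α_smooth : ∀ t, ∀ x ∈ smooth, N.α t x ∈ smooth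
  γ_smooth : ∀ x ∈ smooth, N.γ x ∈ smooth
  δ_smooth : ∀ x ∈ smooth, δ x ∈ smooth
  δ_loc : ∀ ρ, ∀ x ∈ smooth, x ∈ N.loc ρ → δ x ∈ N.loc ρ
  leibniz : ∀ x ∈ smooth, ∀ y ∈ smooth, δ (x * y) = δ x * y + N.γ x * δ y
  δ_α : ∀ t, ∀ x ∈ smooth, δ (N.α t x) = N.α t (δ x)
  δ_γ : ∀ x ∈ smooth, δ (N.γ x) = -N.γ (δ x)
  closed : ∀ (ρ : ℝ) (x y : ℕ → BoundedOp H), (∀ n, x n ∈ smooth ∧ x n ∈ N.loc ρ) →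
    (∀ m, ∃ C, ∀ n, ‖(δ ^ m) (x n)‖ ≤ C) →
    (∀ m ξ, Tendsto (fun n => (δ ^ m) (x n) ξ) atTop (𝓝 (y m ξ))) →
    y 0 ∈ smooth ∧ ∀ m, (δ ^ m) (y 0) = y m
  φ_bound : ∃ C c : ℝ, 0 ≤ C ∧ 0 ≤ c ∧ ∀ ρ, 0 ≤ ρ → ∀ x ∈ dom, x ∈ N.loc ρ →
    ‖φ x‖ ≤ C * Real.exp (c * ρ ^ 2) * ‖x‖
  φ_tendsto : ∀ {ι : Type} (l : Filter ι) (ρ C : ℝ) (x : ι → BoundedOp H) (y : BoundedOp H),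
    (∀ᶠ i in l, x i ∈ dom ∧ x i ∈ N.loc ρ) → y ∈ dom → y ∈ N.loc ρ → (∀ᶠ i in l, ‖x i‖ ≤ C) →
    (∀ ξ, Tendsto (fun i => x i ξ) l (𝓝 (y ξ))) → Tendsto (fun i => φ (x i)) l (𝓝 (φ y))
  φ_star : ∀ x ∈ dom, φ (star x) = star (φ x)
  φ_one : φ 1 = 1
  kms : ∀ x ∈ dom, ∀ y ∈ dom, ∃ F : ℂ → ℂ, IsStripAnalytic F ∧
    (∃ (C : ℝ) (p : ℕ), ∀ z ∈ closedStrip, ‖F z‖ ≤ C * (1 + |z.re|) ^ p) ∧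
    (∀ t : ℝ, F t = φ (x * N.α t y)) ∧ ∀ t : ℝ, F (t + Complex.I) = φ (N.α t y * N.γ x)
  φ_δ : ∀ x ∈ smooth, φ (δ x) = 0
  susy : ∀ x ∈ dom, ∀ z ∈ dom, ∀ y ∈ smooth,
    HasDerivAt (fun t : ℝ => φ (x * N.α t y * z)) (Complex.I * φ (x * δ (δ y) * z)) 0

namespace LocalSystem

variable {H : Type*} [NormedAddCommGroup H] [InnerProductSpace ℂ H] [CompleteSpace H]
  {N : GradedNet H} (𝒮 : LocalSystem N)

lemma δ_pow_succ (m : ℕ) (x : BoundedOp H) : (𝒮.δ ^ (m + 1)) x = (𝒮.δ ^ m) (𝒮.δ x) := by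
  rw [pow_succ]; rfl

lemma δ_pow_α (m : ℕ) (t : ℝ) {x : BoundedOp H} (hx : x ∈ 𝒮.smooth) :
    (𝒮.δ ^ m) (N.α t x) = N.α t ((𝒮.δ ^ m) x) := by
  induction m generalizing x with
  | zero => simp
  | succ m ih => rw [δ_pow_succ, δ_pow_succ, 𝒮.δ_α t x hx, ih (𝒮.δ_smooth x hx)]

lemma norm_δ_pow_γ (m : ℕ) {x : BoundedOp H} (hx : x ∈ 𝒮.smooth) :
    ‖(𝒮.δ ^ m) (N.γ x)‖ = ‖(𝒮.δ ^ m) x‖ := by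
  have key : ∀ x ∈ 𝒮.smooth, (𝒮.δ ^ m) (N.γ x) = N.γ ((𝒮.δ ^ m) x) ∨
      (𝒮.δ ^ m) (N.γ x) = -N.γ ((𝒮.δ ^ m) x) := by
    clear hx x
    intro x hx
    induction m generalizing x with
    | zero => left; simp
    | succ m ih =>
      rw [δ_pow_succ, δ_pow_succ, 𝒮.δ_γ x hx, map_neg]
      rcases ih (𝒮.δ x) (𝒮.δ_smooth x hx) with h | h <;> rw [h] <;> simp
  rcases key x hx with h | h <;> rw [h] <;> simp [N.norm_γ]

lemma δ_one : 𝒮.δ 1 = 0 := by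
  have := 𝒮.leibniz 1 (one_mem _) 1 (one_mem _)
  rw [N.γ_one, one_mul, one_mul, mul_one] at this
  exact left_eq_add.1 this

/-! ### Norm bounds for iterated derivatives -/

/-- All derivatives of `x` of order at most `m` are bounded by `c`. -/
def DerivBound (m : ℕ) (x : BoundedOp H) (c : ℝ) : Prop := ∀ k ≤ m, ‖(𝒮.δ ^ k) x‖ ≤ c

variable {𝒮}

lemma DerivBound.mono {m k : ℕ} (hk : k ≤ m) {x : BoundedOp H} {c d : ℝ}
    (h : 𝒮.DerivBound m x c) (hcd : c ≤ d) : 𝒮.DerivBound k x d :=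
  fun j hj => (h j (hj.trans hk)).trans hcd

lemma DerivBound.δ {m : ℕ} {x : BoundedOp H} {c : ℝ} (h : 𝒮.DerivBound (m + 1) x c) :
    𝒮.DerivBound m (𝒮.δ x) c := fun k hk => by
  rw [← δ_pow_succ]; exact h (k + 1) (by omega)

lemma DerivBound.γ {m : ℕ} {x : BoundedOp H} (hx : x ∈ 𝒮.smooth) {c : ℝ}
    (h : 𝒮.DerivBound m x c) : 𝒮.DerivBound m (N.γ x) c := fun k hk => by
  rw [𝒮.norm_δ_pow_γ k hx]; exact h k hk

lemma DerivBound.α {m : ℕ} {x : BoundedOp H} (hx : x ∈ 𝒮.smooth) {c : ℝ}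
    (h : 𝒮.DerivBound m x c) (t : ℝ) : 𝒮.DerivBound m (N.α t x) c := fun k hk => by
  rw [𝒮.δ_pow_α k t hx, N.norm_α]; exact h k hk

lemma DerivBound.nonneg {m : ℕ} {x : BoundedOp H} {c : ℝ} (h : 𝒮.DerivBound m x c) : 0 ≤ c :=
  (norm_nonneg _).trans (h 0 (Nat.zero_le _))

/-- The factor 2 per derivative comes from the two terms of the graded Leibniz rule; the grading
preserves the norms of all derivatives. -/
lemma DerivBound.norm_δ_pow_mul_le {m : ℕ} {x y : BoundedOp H} (hx : x ∈ 𝒮.smooth)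
    (hy : y ∈ 𝒮.smooth) {c d : ℝ} (h : 𝒮.DerivBound m x c) (h' : 𝒮.DerivBound m y d) :
    ‖(𝒮.δ ^ m) (x * y)‖ ≤ 2 ^ m * (c * d) := by
  induction m generalizing x y with
  | zero =>
    rw [pow_zero (2 : ℝ), one_mul]
    have h1 := h 0 le_rfl
    have h2 := h' 0 le_rfl
    rw [pow_zero] at h1 h2 ⊢
    exact (norm_mul_le _ _).trans (mul_le_mul h1 h2 (norm_nonneg _) h.nonneg)
  | succ m ih =>
    rw [δ_pow_succ, 𝒮.leibniz x hx y hy, map_add]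
    have h1 := ih (𝒮.δ_smooth x hx) hy h.δ (h'.mono (Nat.le_succ m) le_rfl)
    have h2 := ih (𝒮.γ_smooth x hx) (𝒮.δ_smooth y hy)
      ((h.γ hx).mono (Nat.le_succ m) le_rfl) h'.δ
    refine (norm_add_le _ _).trans ?_
    rw [pow_succ]; linarith

lemma DerivBound.mul {m : ℕ} {x y : BoundedOp H} (hx : x ∈ 𝒮.smooth)
    (hy : y ∈ 𝒮.smooth) {c d : ℝ} (h : 𝒮.DerivBound m x c) (h' : 𝒮.DerivBound m y d) :
    𝒮.DerivBound m (x * y) (2 ^ m * (c * d)) := fun k hk => by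
  refine ((h.mono hk le_rfl).norm_δ_pow_mul_le hx hy (h'.mono hk le_rfl)).trans ?_
  have := mul_nonneg h.nonneg h'.nonneg
  gcongr
  norm_num

variable (𝒮) in
lemma exists_derivBound (m : ℕ) (x : BoundedOp H) : ∃ c, 1 ≤ c ∧ 𝒮.DerivBound m x c := by
  refine ⟨1 + ∑ k ∈ Finset.range (m + 1), ‖(𝒮.δ ^ k) x‖, ?_, fun k hk => ?_⟩
  · have := Finset.sum_nonneg (s := Finset.range (m + 1)) (f := fun k => ‖(𝒮.δ ^ k) x‖)
      fun _ _ => norm_nonneg _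
    linarith
  · have := Finset.single_le_sum (f := fun k => ‖(𝒮.δ ^ k) x‖) (fun _ _ => norm_nonneg _)
      (Finset.mem_range.2 (Nat.lt_succ_of_le hk))
    linarith

/-! ### Smooth curves -/

variable (𝒮)

/-- Curves of smooth local elements, all of whose derivations are strongly continuous. -/
structure SmoothCurve (f : ℝ → BoundedOp H) : Prop where
  mem : ∀ t, f t ∈ 𝒮.smooth
  cont : ∀ m, StrongCont fun t => (𝒮.δ ^ m) (f t)
  loc : ∃ R, 0 ≤ R ∧ ∀ t, f t ∈ N.loc (R + |t|)

variable {𝒮}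

namespace SmoothCurve

variable {f g : ℝ → BoundedOp H}

lemma strongCont (hf : 𝒮.SmoothCurve f) : StrongCont f := by simpa using hf.cont 0

lemma δ (hf : 𝒮.SmoothCurve f) : 𝒮.SmoothCurve fun t => 𝒮.δ (f t) := by
  obtain ⟨R, hR, h⟩ := hf.loc
  refine ⟨fun t => 𝒮.δ_smooth _ (hf.mem t), fun m => ?_, R, hR,
    fun t => 𝒮.δ_loc _ _ (hf.mem t) (h t)⟩
  simp only [← δ_pow_succ]; exact hf.cont (m + 1)

lemma smul (hf : 𝒮.SmoothCurve f) (c : ℂ) : 𝒮.SmoothCurve fun t => c • f t := by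
  obtain ⟨R, hR, h⟩ := hf.loc
  refine ⟨fun t => SMulMemClass.smul_mem c (hf.mem t), fun m => ?_, R, hR,
    fun t => SMulMemClass.smul_mem c (h t)⟩
  simp only [map_smul]; exact (hf.cont m).smul continuous_const

lemma γ (hf : 𝒮.SmoothCurve f) : 𝒮.SmoothCurve fun t => N.γ (f t) := by
  obtain ⟨R, hR, h⟩ := hf.loc
  refine ⟨fun t => 𝒮.γ_smooth _ (hf.mem t), fun m => ?_, R, hR, fun t => N.γ_mem_loc (h t)⟩
  clear h
  induction m generalizing f with
  | zero => simpa using N.strongCont_γ hf.strongCont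
  | succ m ih =>
    have e : (fun t => (𝒮.δ ^ (m + 1)) (N.γ (f t))) = fun t => -(𝒮.δ ^ m) (N.γ (𝒮.δ (f t))) := by
      ext1 t; rw [δ_pow_succ, 𝒮.δ_γ _ (hf.mem t), map_neg]
    rw [e]
    exact (ih hf.δ).neg

lemma exists_common_loc (hf : 𝒮.SmoothCurve f) (hg : 𝒮.SmoothCurve g) :
    ∃ R, 0 ≤ R ∧ ∀ t, f t ∈ N.loc (R + |t|) ∧ g t ∈ N.loc (R + |t|) := by
  obtain ⟨R, hR, h⟩ := hf.loc
  obtain ⟨R', hR', h'⟩ := hg.loc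
  exact ⟨R + R', by positivity, fun t => ⟨N.loc_mono (by linarith) (h t),
    N.loc_mono (by linarith) (h' t)⟩⟩

lemma mul (hf : 𝒮.SmoothCurve f) (hg : 𝒮.SmoothCurve g) :
    𝒮.SmoothCurve fun t => f t * g t := by
  obtain ⟨R, hR, h⟩ := hf.exists_common_loc hg
  refine ⟨fun t => mul_mem (hf.mem t) (hg.mem t), fun m => ?_, R, hR,
    fun t => mul_mem (h t).1 (h t).2⟩
  clear h
  induction m generalizing f g with
  | zero => simpa using hf.strongCont.mul hg.strongCont
  | succ m ih =>
    have e : (fun t => (𝒮.δ ^ (m + 1)) (f t * g t)) = fun t =>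
        (𝒮.δ ^ m) (𝒮.δ (f t) * g t) + (𝒮.δ ^ m) (N.γ (f t) * 𝒮.δ (g t)) := by
      ext1 t; rw [δ_pow_succ, 𝒮.leibniz _ (hf.mem t) _ (hg.mem t), map_add]
    rw [e]
    exact (ih hf.δ hg).add (ih hf.γ hg.δ)

lemma const {x : BoundedOp H} (hx : x ∈ 𝒮.smooth) : 𝒮.SmoothCurve fun _ => x := by
  obtain ⟨ρ, hρ, h⟩ := 𝒮.exists_loc x (𝒮.smooth_le hx)
  exact ⟨fun _ => hx, fun m => strongCont_const _, ρ, hρ,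
    fun t => N.loc_mono (by linarith [abs_nonneg t]) h⟩

lemma orbit {x : BoundedOp H} (hx : x ∈ 𝒮.smooth) : 𝒮.SmoothCurve fun t => N.α t x := by
  obtain ⟨ρ, hρ, h⟩ := 𝒮.exists_loc x (𝒮.smooth_le hx)
  refine ⟨fun t => 𝒮.α_smooth t x hx, fun m => ?_, ρ, hρ, N.α_mem_loc hρ h⟩
  simp only [𝒮.δ_pow_α m _ hx]
  exact N.strongCont_orbit _

/-- Strong integrals of smooth curves are smooth. -/
lemma sint_aux (hf : 𝒮.SmoothCurve f) {R : ℝ} (hR : ∀ t, f t ∈ N.loc (R + |t|)) (t : ℝ) :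
    sint f 0 t ∈ 𝒮.smooth ∧ sint f 0 t ∈ N.loc (R + |t|) ∧
      ∀ m, (𝒮.δ ^ m) (sint f 0 t) = sint (fun u => (𝒮.δ ^ m) (f u)) 0 t := by
  set c : ℕ → ℝ := fun n => (n : ℝ) + 1 with hc
  have hc0 : ∀ n, 0 < c n := fun n => by positivity
  -- Riemann sums of the integral. They are smooth, and all their derivatives are bounded and
  -- converge strongly, so closedness of δ applies to all powers at once.
  set x : ℕ → BoundedOp H := fun n => (t : ℂ) • ∑ k ∈ Finset.range (n + 1),
    ((c n)⁻¹ : ℂ) • f (k / c n * t) with hx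
  have hδx : ∀ m n, (𝒮.δ ^ m) (x n) = (t : ℂ) • ∑ k ∈ Finset.range (n + 1),
      ((c n)⁻¹ : ℂ) • (𝒮.δ ^ m) (f (k / c n * t)) := fun m n => by
    simp only [hx, map_smul, map_sum]
  have hle : ∀ n, ∀ k ∈ Finset.range (n + 1), |(k / c n * t : ℝ)| ≤ |t| := fun n k hk => by
    rw [abs_mul, abs_of_nonneg (by have := (hc0 n).le; positivity)]
    have : (k : ℝ) / c n ≤ 1 := by
      rw [div_le_one (hc0 n)]
      have : (k : ℝ) ≤ n := by exact_mod_cast Nat.lt_succ_iff.1 (Finset.mem_range.1 hk)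
      linarith
    exact mul_le_of_le_one_left (abs_nonneg t) this
  have hmem : ∀ n, x n ∈ 𝒮.smooth ∧ x n ∈ N.loc (R + |t|) := fun n =>
    ⟨SMulMemClass.smul_mem _ (sum_mem fun k _ => SMulMemClass.smul_mem _ (hf.mem _)),
      SMulMemClass.smul_mem _ (sum_mem fun k hk => SMulMemClass.smul_mem _
        (N.loc_mono (by linarith [hle n k hk]) (hR _)))⟩
  have hlim : ∀ m ξ, Tendsto (fun n => (𝒮.δ ^ m) (x n) ξ) atTop
      (𝓝 (sint (fun u => (𝒮.δ ^ m) (f u)) 0 t ξ)) := fun m ξ => by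
    rw [sint_eq_smul_integral (hf.cont m)]
    have h1 := (tendsto_riemann_sum ((hf.cont m ξ).comp (continuous_mul_const t))).const_smul t
    refine h1.congr fun n => ?_
    rw [hδx, smul_apply, sum_apply, Complex.coe_smul]
    congr 1
    refine Finset.sum_congr rfl fun k _ => ?_
    rw [smul_apply, ← Complex.ofReal_inv, Complex.coe_smul]
    rfl
  have hbd : ∀ m, ∃ C, ∀ n, ‖(𝒮.δ ^ m) (x n)‖ ≤ C := fun m => by
    obtain ⟨C, hC0, hC⟩ := (hf.cont m).exists_bound (isCompact_Icc (a := -|t|) (b := |t|))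
    refine ⟨|t| * C, fun n => ?_⟩
    rw [hδx, norm_smul, Complex.norm_real, Real.norm_eq_abs]
    gcongr
    refine (norm_sum_le_of_le (f := fun k : ℕ => ((c n)⁻¹ : ℂ) • (𝒮.δ ^ m) (f (k / c n * t)))
      (n := fun _ => (c n)⁻¹ * C) _ fun k hk => ?_).trans ?_
    · rw [norm_smul, ← Complex.ofReal_inv, Complex.norm_real, Real.norm_eq_abs,
        abs_of_pos (inv_pos.2 (hc0 n))]
      exact mul_le_mul_of_nonneg_left (hC _ (abs_le.1 (hle n k hk))) (inv_pos.2 (hc0 n)).le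
    · rw [Finset.sum_const, Finset.card_range, nsmul_eq_mul, ← mul_assoc]
      have : ((n + 1 : ℕ) : ℝ) * (c n)⁻¹ = 1 := by
        simp only [hc]; push_cast; exact mul_inv_cancel₀ (hc0 n).ne'
      rw [this, one_mul]
  obtain ⟨h1, h2⟩ := 𝒮.closed (R + |t|) x (fun m => sint (fun u => (𝒮.δ ^ m) (f u)) 0 t) hmem hbd hlim
  simp only [pow_zero, Module.End.one_apply] at h1 h2
  refine ⟨h1, N.loc_closed (l := atTop) (Eventually.of_forall fun n => (hmem n).2) fun ξ => ?_, h2⟩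
  simpa using hlim 0 ξ

lemma δ_pow_sint (hf : 𝒮.SmoothCurve f) (m : ℕ) (t : ℝ) :
    (𝒮.δ ^ m) (sint f 0 t) = sint (fun u => (𝒮.δ ^ m) (f u)) 0 t := by
  obtain ⟨R, -, hR⟩ := hf.loc
  exact (hf.sint_aux hR t).2.2 m

lemma sint (hf : 𝒮.SmoothCurve f) : 𝒮.SmoothCurve fun t => sint f 0 t := by
  obtain ⟨R, hR0, hR⟩ := hf.loc
  refine ⟨fun t => (hf.sint_aux hR t).1, fun m => ?_, R, hR0, fun t => (hf.sint_aux hR t).2.1⟩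
  simp only [hf.δ_pow_sint]
  exact (continuous_sint (hf.cont m) 0).strongCont

end SmoothCurve

/-- Norm convergent series of smooth elements. -/
lemma tsum_smooth (𝒮 : LocalSystem N) {ρ : ℝ} {x : ℕ → BoundedOp H}
    (hx : ∀ n, x n ∈ 𝒮.smooth ∧ x n ∈ N.loc ρ)
    (hs : ∀ m, Summable fun n => ‖(𝒮.δ ^ m) (x n)‖) :
    ∑' n, x n ∈ 𝒮.smooth ∧ ∑' n, x n ∈ N.loc ρ ∧
      ∀ m, (𝒮.δ ^ m) (∑' n, x n) = ∑' n, (𝒮.δ ^ m) (x n) := by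
  have hlim : ∀ m, Tendsto (fun n => (𝒮.δ ^ m) (∑ k ∈ Finset.range n, x k)) atTop
      (𝓝 (∑' n, (𝒮.δ ^ m) (x n))) := fun m => by
    simp only [map_sum]
    exact (hs m).of_norm.hasSum.tendsto_sum_nat
  have hlim' : ∀ m ξ, Tendsto (fun n => (𝒮.δ ^ m) (∑ k ∈ Finset.range n, x k) ξ) atTop
      (𝓝 ((∑' n, (𝒮.δ ^ m) (x n)) ξ)) := fun m ξ =>
    ((ContinuousLinearMap.apply ℂ H ξ).continuous.tendsto _).comp (hlim m)
  have hmem : ∀ n, ∑ k ∈ Finset.range n, x k ∈ 𝒮.smooth ∧ ∑ k ∈ Finset.range n, x k ∈ N.loc ρ :=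
    fun n => ⟨sum_mem fun k _ => (hx k).1, sum_mem fun k _ => (hx k).2⟩
  have hbd : ∀ m, ∃ C, ∀ n, ‖(𝒮.δ ^ m) (∑ k ∈ Finset.range n, x k)‖ ≤ C := fun m =>
    ⟨∑' n, ‖(𝒮.δ ^ m) (x n)‖, fun n => by
      rw [map_sum]
      exact (norm_sum_le _ _).trans ((hs m).sum_le_tsum _ fun _ _ => norm_nonneg _)⟩
  obtain ⟨h1, h2⟩ := 𝒮.closed ρ _ (fun m => ∑' n, (𝒮.δ ^ m) (x n)) hmem hbd hlim'
  simp only [pow_zero, Module.End.one_apply] at h1 h2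
  refine ⟨h1, N.loc_closed (l := atTop) (Eventually.of_forall fun n => (hmem n).2) fun ξ => ?_, h2⟩
  simpa using hlim' 0 ξ

/-! ### The cocycle of a smooth perturbation -/

variable {a : BoundedOp H} (ha : a ∈ 𝒮.smooth)

include ha

lemma smoothCurve_dysonW (n : ℕ) : 𝒮.SmoothCurve (dysonW (fun u => N.α u a) n) := by
  induction n with
  | zero => exact SmoothCurve.const (one_mem _)
  | succ n ih => exact ((ih.mul (SmoothCurve.orbit ha)).sint).smul Complex.I

lemma dysonW_mem_loc {ρ : ℝ} (hρ : 0 ≤ ρ) (haρ : a ∈ N.loc ρ) (n : ℕ) (t : ℝ) :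
    dysonW (fun u => N.α u a) n t ∈ N.loc (ρ + |t|) := by
  induction n generalizing t with
  | zero => exact one_mem _
  | succ n ih =>
    have h := (smoothCurve_dysonW ha n).mul (SmoothCurve.orbit ha)
    exact SMulMemClass.smul_mem _
      (h.sint_aux (R := ρ) (fun t => mul_mem (ih t) (N.α_mem_loc hρ haρ t)) t).2.1

/-- For fixed m each multiplication by an orbit of a costs at most 2^m κ, while the iterated
integrals supply the factorial. So the series of m-th derivatives converges absolutely and the
cocycle is smooth. -/
lemma exists_norm_δ_pow_dysonW_le (m : ℕ) :
    ∃ κ, 0 ≤ κ ∧ ∀ n t, ‖(𝒮.δ ^ m) (dysonW (fun u => N.α u a) n t)‖ ≤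
      (κ * |t|) ^ n / n.factorial := by
  obtain ⟨κ, hκ, hκa⟩ := 𝒮.exists_derivBound m a
  have key : ∀ n t, 𝒮.DerivBound m (dysonW (fun u => N.α u a) n t)
      ((2 ^ m * κ * |t|) ^ n / n.factorial) := by
    intro n
    induction n with
    | zero =>
      rintro t (_ | k) -
      · rw [pow_zero, pow_zero, Nat.factorial_zero, Nat.cast_one, div_one]
        exact ContinuousLinearMap.norm_id_le
      · change ‖(𝒮.δ ^ (k + 1)) 1‖ ≤ _
        rw [δ_pow_succ, δ_one, map_zero, norm_zero]; positivity
    | succ n ih =>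
      intro t k hk
      have h := (smoothCurve_dysonW ha n).mul (SmoothCurve.orbit ha)
      rw [dysonW, map_smul, norm_smul, Complex.norm_I, one_mul, h.δ_pow_sint]
      refine (norm_sint_le_pow (h.cont k) (n := n)
        (c := (2 ^ m * κ) ^ (n + 1) / n.factorial) (by positivity) (fun s => ?_) t).trans
        (le_of_eq ?_)
      · have := ((ih s).mul ((smoothCurve_dysonW ha n).mem s) (𝒮.α_smooth s a ha)
          (hκa.α ha s)) k hk
        refine this.trans (le_of_eq ?_)
        rw [mul_pow]; ring
      · rw [Nat.factorial_succ, mul_pow]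
        push_cast
        field_simp
        ring
  exact ⟨2 ^ m * κ, by positivity, fun n t => key n t m le_rfl⟩

lemma cocycle_aux {ρ : ℝ} (hρ : 0 ≤ ρ) (haρ : a ∈ N.loc ρ) (t : ℝ) :
    N.cocycle a t ∈ 𝒮.smooth ∧ N.cocycle a t ∈ N.loc (ρ + |t|) ∧
      ∀ m, (𝒮.δ ^ m) (N.cocycle a t) = ∑' n, (𝒮.δ ^ m) (dysonW (fun u => N.α u a) n t) := by
  refine 𝒮.tsum_smooth (fun n => ⟨(smoothCurve_dysonW ha n).mem t,
    dysonW_mem_loc ha hρ haρ n t⟩) fun m => ?_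
  obtain ⟨κ, hκ, h⟩ := exists_norm_δ_pow_dysonW_le (𝒮 := 𝒮) ha m
  exact Summable.of_nonneg_of_le (fun _ => norm_nonneg _) (fun n => h n t)
    (Real.summable_pow_div_factorial _)

lemma cocycle_mem_loc {ρ : ℝ} (hρ : 0 ≤ ρ) (haρ : a ∈ N.loc ρ) (t : ℝ) :
    N.cocycle a t ∈ N.loc (ρ + |t|) := (cocycle_aux ha hρ haρ t).2.1

lemma smoothCurve_cocycle : 𝒮.SmoothCurve (N.cocycle a) := by
  obtain ⟨ρ, hρ, haρ⟩ := 𝒮.exists_loc a (𝒮.smooth_le ha)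
  refine ⟨fun t => (cocycle_aux ha hρ haρ t).1, fun m => ?_, ρ, hρ, cocycle_mem_loc ha hρ haρ⟩
  simp only [(cocycle_aux ha hρ haρ _).2.2 m]
  obtain ⟨κ, hκ, hb⟩ := exists_norm_δ_pow_dysonW_le (𝒮 := 𝒮) ha m
  intro ξ
  have hs : ∀ t, (∑' n, (𝒮.δ ^ m) (dysonW (fun u => N.α u a) n t)) ξ =
      ∑' n, (𝒮.δ ^ m) (dysonW (fun u => N.α u a) n t) ξ := fun t =>
    (ContinuousLinearMap.apply ℂ H ξ).map_tsum (Summable.of_norm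
      (Summable.of_nonneg_of_le (fun _ => norm_nonneg _) (fun n => hb n t)
        (Real.summable_pow_div_factorial _)))
  simp only [hs]
  refine continuous_iff_continuousAt.2 fun t => ?_
  have h : ContinuousOn (fun t => ∑' n, (𝒮.δ ^ m) (dysonW (fun u => N.α u a) n t) ξ)
      (Icc (-(|t| + 1)) (|t| + 1)) := by
    refine continuousOn_tsum (fun n => ((smoothCurve_dysonW ha n).cont m ξ).continuousOn)
      ((Real.summable_pow_div_factorial (κ * (|t| + 1))).mul_right ‖ξ‖) fun n s hs => ?_
    refine ((𝒮.δ ^ m) (dysonW (fun u => N.α u a) n s)).le_of_opNorm_le ((hb n s).trans ?_) ξ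
    have := abs_le.2 hs
    gcongr
  exact h.continuousAt (Icc_mem_nhds (by linarith [neg_abs_le t]) (by linarith [le_abs_self t]))

/-- The derivative of the derivation of the cocycle. -/
lemma hasDerivAt_δ_cocycle (t : ℝ) (ξ : H) : HasDerivAt (fun t => 𝒮.δ (N.cocycle a t) ξ)
    (Complex.I • 𝒮.δ (N.cocycle a t * N.α t a) ξ) t := by
  have h := (smoothCurve_cocycle ha).mul (SmoothCurve.orbit ha)
  have h1 := (hasDerivAt_sint (h.cont 1) 0 t ξ).const_smul Complex.I
  refine HasDerivAt.congr_of_eventuallyEq (by simpa using h1) (Eventually.of_forall fun s => ?_)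
  have h2 : N.cocycle a s = 1 + Complex.I • _root_.sint (fun u => N.cocycle a u * N.α u a) 0 s :=
    dysonSeries_eq (N.strongCont_orbit a) (N.norm_orbit_le a) s
  have h3 := h.δ_pow_sint 1 s
  simp only [pow_one] at h3
  beta_reduce
  rw [h2, map_add, map_smul, δ_one, zero_add, h3]
  simp

end LocalSystem

lemma one_add_pow_le_exp_sq (p : ℕ) (x : ℝ) :
    (1 + |x|) ^ p ≤ p.factorial * Real.exp 2 * Real.exp (1 * x ^ 2) := by
  have h := Real.pow_div_factorial_le_exp (1 + |x|) (by positivity) p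
  rw [div_le_iff₀ (by positivity)] at h
  have h2 : Real.exp (1 + |x|) ≤ Real.exp 2 * Real.exp (1 * x ^ 2) := by
    rw [← Real.exp_add]
    refine Real.exp_le_exp.2 ?_
    nlinarith [sq_abs x, sq_nonneg (|x| - 1), abs_nonneg x]
  calc (1 + |x|) ^ p ≤ Real.exp (1 + |x|) * p.factorial := h
    _ ≤ (Real.exp 2 * Real.exp (1 * x ^ 2)) * p.factorial := by gcongr
    _ = _ := by ring

/-! ### Operator difference quotients. -/

section Dslope

variable {H : Type*} [NormedAddCommGroup H] [InnerProductSpace ℂ H] [CompleteSpace H]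

open Classical in
/-- The operator-valued difference quotient, completed by the strong derivative. -/
def opSlope (f : ℝ → BoundedOp H) (f' : BoundedOp H) (t s : ℝ) : BoundedOp H :=
  if s = t then f' else ((s - t)⁻¹ : ℂ) • (f s - f t)

lemma opSlope_self (f : ℝ → BoundedOp H) (f' : BoundedOp H) (t : ℝ) : opSlope f f' t t = f' :=
  if_pos rfl

lemma opSlope_of_ne (f : ℝ → BoundedOp H) (f' : BoundedOp H) {t s : ℝ} (h : s ≠ t) :
    opSlope f f' t s = ((s - t)⁻¹ : ℂ) • (f s - f t) := if_neg h

lemma strongCont_opSlope {f : ℝ → BoundedOp H} (hf : StrongCont f) {f' : BoundedOp H} {t : ℝ}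
    (hd : ∀ ξ, HasDerivAt (fun s => f s ξ) (f' ξ) t) : StrongCont (opSlope f f' t) := by
  intro ξ
  have e : (fun s => opSlope f f' t s ξ) = dslope (fun s => f s ξ) t := by
    ext1 s
    by_cases h : s = t
    · rw [h, opSlope_self, dslope_same, (hd ξ).deriv]
    · rw [opSlope_of_ne f f' h, dslope_of_ne _ h, slope, smul_apply, sub_apply, ← Complex.ofReal_sub,
        ← Complex.ofReal_inv, Complex.coe_smul]
      rfl
  rw [e, ← continuousOn_univ]
  exact (continuousOn_dslope univ_mem).2 ⟨(hf ξ).continuousOn, (hd ξ).differentiableAt⟩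

end Dslope

namespace LocalSystem

variable {H : Type*} [NormedAddCommGroup H] [InnerProductSpace ℂ H] [CompleteSpace H]
  {N : GradedNet H} (𝒮 : LocalSystem N)

/-! ### Strongly continuous families in the domain -/

/-- A strongly continuous family in the domain of `φ`, locally contained in a local algebra. -/
structure DomFamily {Θ : Type*} [TopologicalSpace Θ] (X : Θ → BoundedOp H) : Prop where
  mem : ∀ θ, X θ ∈ 𝒮.dom
  cont : StrongCont X
  loc : ∀ θ, ∃ ρ, 0 ≤ ρ ∧ ∀ᶠ θ' in 𝓝 θ, X θ' ∈ N.loc ρ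

variable {𝒮}

namespace DomFamily

variable {Θ : Type*} [TopologicalSpace Θ] {X Y : Θ → BoundedOp H}

lemma const {x : BoundedOp H} (hx : x ∈ 𝒮.dom) : 𝒮.DomFamily fun _ : Θ => x := by
  obtain ⟨ρ, hρ, h⟩ := 𝒮.exists_loc x hx
  exact ⟨fun _ => hx, strongCont_const x, fun _ => ⟨ρ, hρ, Eventually.of_forall fun _ => h⟩⟩

lemma comp (hX : 𝒮.DomFamily X) {Ω : Type*} [TopologicalSpace Ω] {g : Ω → Θ} (hg : Continuous g) :
    𝒮.DomFamily fun ω => X (g ω) := by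
  refine ⟨fun ω => hX.mem _, hX.cont.comp hg, fun ω => ?_⟩
  obtain ⟨ρ, hρ, h⟩ := hX.loc (g ω)
  exact ⟨ρ, hρ, hg.continuousAt.eventually h⟩

lemma γ (hX : 𝒮.DomFamily X) : 𝒮.DomFamily fun θ => N.γ (X θ) := by
  refine ⟨fun θ => 𝒮.γ_dom _ (hX.mem θ), N.strongCont_γ hX.cont, fun θ => ?_⟩
  obtain ⟨ρ, hρ, h⟩ := hX.loc θ
  exact ⟨ρ, hρ, h.mono fun _ h => N.γ_mem_loc h⟩

lemma smul (hX : 𝒮.DomFamily X) {c : Θ → ℂ} (hc : Continuous c) :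
    𝒮.DomFamily fun θ => c θ • X θ := by
  refine ⟨fun θ => SMulMemClass.smul_mem _ (hX.mem θ), hX.cont.smul hc, fun θ => ?_⟩
  obtain ⟨ρ, hρ, h⟩ := hX.loc θ
  exact ⟨ρ, hρ, h.mono fun _ h => SMulMemClass.smul_mem _ h⟩

lemma exists_common_loc (hX : 𝒮.DomFamily X) (hY : 𝒮.DomFamily Y) (θ : Θ) :
    ∃ ρ, 0 ≤ ρ ∧ ∀ᶠ θ' in 𝓝 θ, X θ' ∈ N.loc ρ ∧ Y θ' ∈ N.loc ρ := by
  obtain ⟨ρ, hρ, h⟩ := hX.loc θ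
  obtain ⟨ρ', hρ', h'⟩ := hY.loc θ
  refine ⟨max ρ ρ', le_max_of_le_left hρ, ?_⟩
  filter_upwards [h, h'] with θ' h1 h2
  exact ⟨N.loc_mono (le_max_left _ _) h1, N.loc_mono (le_max_right _ _) h2⟩

lemma sub (hX : 𝒮.DomFamily X) (hY : 𝒮.DomFamily Y) : 𝒮.DomFamily fun θ => X θ - Y θ := by
  refine ⟨fun θ => sub_mem (hX.mem θ) (hY.mem θ), hX.cont.sub hY.cont, fun θ => ?_⟩
  obtain ⟨ρ, hρ, h⟩ := hX.exists_common_loc hY θ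
  exact ⟨ρ, hρ, h.mono fun _ h => sub_mem h.1 h.2⟩

variable [WeaklyLocallyCompactSpace Θ]

lemma mul (hX : 𝒮.DomFamily X) (hY : 𝒮.DomFamily Y) : 𝒮.DomFamily fun θ => X θ * Y θ := by
  refine ⟨fun θ => mul_mem (hX.mem θ) (hY.mem θ), hX.cont.mul hY.cont, fun θ => ?_⟩
  obtain ⟨ρ, hρ, h⟩ := hX.exists_common_loc hY θ
  exact ⟨ρ, hρ, h.mono fun _ h => mul_mem h.1 h.2⟩

lemma α (hX : 𝒮.DomFamily X) {τ : Θ → ℝ} (hτ : Continuous τ) :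
    𝒮.DomFamily fun θ => N.α (τ θ) (X θ) := by
  refine ⟨fun θ => 𝒮.α_dom _ _ (hX.mem θ), N.strongCont_α hX.cont hτ, fun θ => ?_⟩
  obtain ⟨ρ, hρ, h⟩ := hX.loc θ
  have h2 : ∀ᶠ θ' in 𝓝 θ, |τ θ'| < |τ θ| + 1 :=
    hτ.abs.continuousAt.eventually_lt continuousAt_const (by linarith)
  refine ⟨ρ + (|τ θ| + 1), by positivity, ?_⟩
  filter_upwards [h, h2] with θ' h3 h4
  exact N.loc_mono (by linarith) (N.α_mem_loc hρ h3 (τ θ'))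

lemma orbit {x : BoundedOp H} (hx : x ∈ 𝒮.dom) {τ : Θ → ℝ} (hτ : Continuous τ) :
    𝒮.DomFamily fun θ => N.α (τ θ) x := (const hx).α hτ

lemma exists_norm_bound (hX : 𝒮.DomFamily X) (θ : Θ) :
    ∃ C, 0 ≤ C ∧ ∀ᶠ θ' in 𝓝 θ, ‖X θ'‖ ≤ C := by
  obtain ⟨K, hK, hKx⟩ := exists_compact_mem_nhds θ
  obtain ⟨C, hC0, hC⟩ := hX.cont.exists_bound hK
  exact ⟨C, hC0, Filter.mem_of_superset hKx hC⟩

end DomFamily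

/-- Near each parameter the family is norm bounded and stays in one local algebra, so local
normality of φ turns strong continuity into continuity of the values. -/
lemma DomFamily.continuous {Θ : Type} [TopologicalSpace Θ] [WeaklyLocallyCompactSpace Θ]
    {X : Θ → BoundedOp H} (hX : 𝒮.DomFamily X) : Continuous fun θ => 𝒮.φ (X θ) := by
  refine continuous_iff_continuousAt.2 fun θ => ?_
  obtain ⟨ρ, hρ, h⟩ := hX.loc θ
  obtain ⟨C, hC0, hC⟩ := hX.exists_norm_bound θ
  exact 𝒮.φ_tendsto (𝓝 θ) ρ C X (X θ) (h.mono fun θ' h => ⟨hX.mem θ', h⟩) (hX.mem θ)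
    h.self_of_nhds hC fun ξ => (hX.cont ξ).tendsto θ

lemma SmoothCurve.domFamily {f : ℝ → BoundedOp H} (hf : 𝒮.SmoothCurve f) : 𝒮.DomFamily f := by
  obtain ⟨R, hR, h⟩ := hf.loc
  refine ⟨fun t => 𝒮.smooth_le (hf.mem t), hf.strongCont, fun t => ⟨R + (|t| + 1), by positivity, ?_⟩⟩
  have h2 : ∀ᶠ s in 𝓝 t, |s| < |t| + 1 :=
    continuous_abs.continuousAt.eventually_lt continuousAt_const (by linarith)
  filter_upwards [h2] with s hs
  exact N.loc_mono (by linarith) (h s)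

/-- `φ` is differentiable along strongly differentiable families. -/
lemma DomFamily.hasDerivAt {f : ℝ → BoundedOp H} (hf : 𝒮.DomFamily f) {f' : BoundedOp H}
    (hf' : f' ∈ 𝒮.dom) {t : ℝ} (hd : ∀ ξ, HasDerivAt (fun s => f s ξ) (f' ξ) t) :
    HasDerivAt (fun s => 𝒮.φ (f s)) (𝒮.φ f') t := by
  -- The difference quotients, completed by f' at t, are strongly continuous and hence bounded near
  -- t. Local normality then allows passage to the limit inside φ.
  have hc := strongCont_opSlope hf.cont hd
  obtain ⟨ρ, hρ, h⟩ := hf.loc t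
  obtain ⟨ρ', hρ', h'⟩ := 𝒮.exists_loc f' hf'
  obtain ⟨C, hC0, hC⟩ := hc.exists_bound (isCompact_Icc (a := t - 1) (b := t + 1))
  rw [hasDerivAt_iff_tendsto_slope]
  have key := 𝒮.φ_tendsto (𝓝[≠] t) (max ρ ρ') C (opSlope f f' t) f' ?_ hf'
    (N.loc_mono (le_max_right _ _) h') ?_ fun ξ => ?_
  · refine key.congr' ?_
    filter_upwards [self_mem_nhdsWithin] with s hs
    rw [opSlope_of_ne f f' hs, map_smul, map_sub, slope, ← Complex.ofReal_sub,
      ← Complex.ofReal_inv, Complex.coe_smul]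
    rfl
  · filter_upwards [self_mem_nhdsWithin, nhdsWithin_le_nhds h] with s hs hsρ
    rw [opSlope_of_ne f f' hs]
    exact ⟨SMulMemClass.smul_mem _ (sub_mem (hf.mem s) (hf.mem t)),
      SMulMemClass.smul_mem _ (sub_mem (N.loc_mono (le_max_left _ _) hsρ)
        (N.loc_mono (le_max_left _ _) h.self_of_nhds))⟩
  · filter_upwards [nhdsWithin_le_nhds (Icc_mem_nhds (by linarith : t - 1 < t)
      (by linarith : t < t + 1))] with s hs using hC s hs
  · have := ((hc ξ).tendsto t).mono_left (nhdsWithin_le_nhds (s := {t}ᶜ))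
    rwa [opSlope_self] at this

/-! ### Invariance of `φ` -/

variable (𝒮)

/-- For x = 1 the KMS function takes the same values on both boundary lines, so `eq_of_periodic`
applies. This is where polynomial growth in (S₂) is indispensable; later only Gaussian growth is
kept. -/
lemma φ_α (t : ℝ) {x : BoundedOp H} (hx : x ∈ 𝒮.dom) : 𝒮.φ (N.α t x) = 𝒮.φ x := by
  obtain ⟨F, hF, ⟨C, p, hb⟩, h0, h1⟩ := 𝒮.kms 1 (one_mem _) x hx
  have h := hF.eq_of_periodic (fun t => by rw [h0, h1, N.γ_one, one_mul, mul_one]) hb t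
  have h2 := h0 0
  rw [N.α_zero, Complex.ofReal_zero] at h2
  rw [h0, h2, one_mul, one_mul] at h
  exact h

lemma edgeCont_kms {x y : BoundedOp H} (hx : x ∈ 𝒮.dom) (hy : y ∈ 𝒮.dom) :
    EdgeCont (fun t => 𝒮.φ (x * N.α t y)) (fun t => 𝒮.φ (N.α t y * N.γ x)) := by
  obtain ⟨F, hF, ⟨C, p, hb⟩, h0, h1⟩ := 𝒮.kms x hx y hy
  refine ⟨F, hF, ⟨|C| * (p.factorial * Real.exp 2), 1, fun z hz => ?_⟩, h0, h1⟩
  calc ‖F z‖ ≤ C * (1 + |z.re|) ^ p := hb z hz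
    _ ≤ |C| * (p.factorial * Real.exp 2 * Real.exp (1 * z.re ^ 2)) := by
      have := one_add_pow_le_exp_sq p z.re
      have h2 := le_abs_self C
      gcongr
    _ = _ := by ring

variable {𝒮}

/-- `φ` commutes with strong integrals. -/
lemma φ_mul_sint_mul {f : ℝ → BoundedOp H} (hf : 𝒮.SmoothCurve f) {X Z : BoundedOp H}
    (hX : X ∈ 𝒮.dom) (hZ : Z ∈ 𝒮.dom) (t : ℝ) :
    𝒮.φ (X * sint f 0 t * Z) = ∫ u in (0 : ℝ)..t, 𝒮.φ (X * f u * Z) := by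
  have hd : ∀ u, HasDerivAt (fun t => 𝒮.φ (X * sint f 0 t * Z)) (𝒮.φ (X * f u * Z)) u := fun u => by
    refine (((DomFamily.const hX).mul hf.sint.domFamily).mul (DomFamily.const hZ)).hasDerivAt
      (mul_mem (mul_mem hX (𝒮.smooth_le (hf.mem u))) hZ) fun ξ => ?_
    have h := hasDerivAt_sint hf.strongCont 0 u (Z ξ)
    exact X.hasFDerivAt.restrictScalars ℝ |>.comp_hasDerivAt u h
  have hc : Continuous fun u => 𝒮.φ (X * f u * Z) :=
    (((DomFamily.const hX).mul hf.domFamily).mul (DomFamily.const hZ)).continuous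
  rw [intervalIntegral.integral_eq_sub_of_hasDerivAt (fun u _ => hd u) (hc.intervalIntegrable _ _),
    sint_same hf.strongCont, mul_zero, zero_mul, map_zero, sub_zero]

end LocalSystem

/-! ### Chosen strip continuations and rescaled times. -/

section StripExtension

open Classical in
/-- The continuation to the strip of a function on the real line (`0` if there is none). -/
def stripExt (f : ℝ → ℂ) : ℂ → ℂ :=
  if h : ∃ F, IsStripContinuation f F then h.choose else 0

lemma isStripContinuation_stripExt {f : ℝ → ℂ} (h : ∃ F, IsStripContinuation f F) :
    IsStripContinuation f (stripExt f) := by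
  rw [stripExt, dif_pos h]; exact h.choose_spec

lemma IsStripContinuation.stripExt_eq {f : ℝ → ℂ} {F : ℂ → ℂ} (h : IsStripContinuation f F) {z : ℂ}
    (hz : z ∈ closedStrip) : stripExt f z = F z :=
  (isStripContinuation_stripExt ⟨F, h⟩).eqOn h hz

/-- The truncation of a real number to `[0, 1]`. -/
def clamp (x : ℝ) : ℝ := max 0 (min x 1)

lemma continuous_clamp : Continuous clamp := by unfold clamp; fun_prop

lemma clamp_mem (x : ℝ) : clamp x ∈ Icc (0 : ℝ) 1 :=
  ⟨le_max_left _ _, max_le zero_le_one (min_le_right _ _)⟩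

lemma clamp_of_mem {x : ℝ} (hx : x ∈ Icc (0 : ℝ) 1) : clamp x = x := by
  rw [clamp, min_eq_left hx.2, max_eq_right hx.1]

lemma abs_clamp_mul_le (x t : ℝ) : |clamp x * t| ≤ |t| := by
  rw [abs_mul, abs_of_nonneg (clamp_mem x).1]
  exact mul_le_of_le_one_left (abs_nonneg t) (clamp_mem x).2

lemma clamp_mul_mem_closedStrip (x : ℝ) {z : ℂ} (hz : z ∈ closedStrip) :
    (clamp x : ℂ) * z ∈ closedStrip := by
  obtain ⟨h0, h1⟩ := clamp_mem x
  simp only [closedStrip, mem_ofPred_eq, Complex.im_ofReal_mul] at *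
  exact ⟨mul_nonneg h0 hz.1, mul_le_one₀ h1 hz.1 hz.2⟩

lemma IsStripAnalytic.comp_clamp_mul {F : ℂ → ℂ} (hF : IsStripAnalytic F) (x : ℝ) :
    IsStripAnalytic fun z => F (clamp x * z) := by
  rcases (clamp_mem x).1.eq_or_lt with h | h
  · simp only [← h, Complex.ofReal_zero, zero_mul]
    exact (differentiable_const _).isStripAnalytic
  · refine hF.comp_affine (by fun_prop) (fun z hz => clamp_mul_mem_closedStrip x hz) fun z hz => ?_
    have h1 := (clamp_mem x).2
    simp only [openStrip, mem_ofPred_eq, Complex.im_ofReal_mul] at *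
    exact ⟨mul_pos h hz.1, lt_of_le_of_lt (mul_le_of_le_one_left hz.1.le h1) hz.2⟩

lemma clamp_mul_re_sq_le (x : ℝ) (z : ℂ) : ((clamp x : ℂ) * z).re ^ 2 ≤ z.re ^ 2 := by
  rw [Complex.re_ofReal_mul, ← sq_abs, ← sq_abs z.re]
  exact pow_le_pow_left₀ (abs_nonneg _) (abs_clamp_mul_le x z.re) 2

end StripExtension

/-! ### Families whose correlation functions continue to the strip, and their stability. -/

namespace LocalSystem

variable {H : Type*} [NormedAddCommGroup H] [InnerProductSpace ℂ H] [CompleteSpace H]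
  {N : GradedNet H} (𝒮 : LocalSystem N)

/-- The analytic continuation of `t ↦ φ(Y Z(t))` to the strip. -/
def ext (Z : ℝ → BoundedOp H) (Y : BoundedOp H) : ℂ → ℂ := stripExt fun t => 𝒮.φ (Y * Z t)

/-- Families of curves `Z` in the domain of `φ` such that `t ↦ φ(Y Z(t))` has a well-behaved
continuation to the strip. -/
structure GoodFamily {Ω : Type} [TopologicalSpace Ω] (Z : Ω → ℝ → BoundedOp H) : Prop where
  fam : 𝒮.DomFamily fun p : Ω × ℝ => Z p.1 p.2
  loc : ∃ R, 0 ≤ R ∧ ∀ ω t, Z ω t ∈ N.loc (R + |t|)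
  even : ∀ ω t, N.γ (Z ω t) = Z ω t
  bdd : ∃ M, 0 ≤ M ∧ ∀ ω t, ‖Z ω t‖ ≤ M
  exists_ext : ∀ ω, ∀ Y ∈ 𝒮.dom, ∃ F, IsStripContinuation (fun t => 𝒮.φ (Y * Z ω t)) F
  bound : ∃ K Λ : ℝ, 0 ≤ K ∧ 0 ≤ Λ ∧ ∀ ω ρ, 0 ≤ ρ → ∀ Y ∈ 𝒮.dom, Y ∈ N.loc ρ → ∀ z ∈ closedStrip,
    ‖𝒮.ext (Z ω) Y z‖ ≤ K * Real.exp (Λ * ρ ^ 2) * ‖Y‖ * Real.exp (Λ * z.re ^ 2)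
  cont_I : ∀ {Θ : Type} [TopologicalSpace Θ] [LocallyCompactSpace Θ] {X : Θ → BoundedOp H}
    {ω : Θ → Ω} {τ : Θ → ℝ}, 𝒮.DomFamily X → Continuous ω → Continuous τ →
    Continuous fun θ => 𝒮.ext (Z (ω θ)) (X θ) (τ θ + Complex.I)

variable {𝒮}

/-- Gaussian bounds for the values of `φ` on two-parameter families. -/
lemma gaussBounded_φ {X : ℝ → ℝ → BoundedOp H} {R M : ℝ} (hR : 0 ≤ R)
    (hX : ∀ x y, X x y ∈ 𝒮.dom) (hloc : ∀ x y, X x y ∈ N.loc (R + |x| + |y|))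
    (hM : ∀ x y, ‖X x y‖ ≤ M) : GaussBounded fun x y => 𝒮.φ (X x y) := by
  obtain ⟨C, c, hC, hc, hb⟩ := 𝒮.φ_bound
  have hM0 : 0 ≤ M := (norm_nonneg _).trans (hM 0 0)
  refine ⟨C * Real.exp (c * (3 * R ^ 2)) * M, 3 * c, fun x y => ?_⟩
  refine (hb _ (by positivity) _ (hX x y) (hloc x y)).trans ?_
  have h1 : (R + |x| + |y|) ^ 2 ≤ 3 * R ^ 2 + 3 * (x ^ 2 + y ^ 2) := by
    nlinarith [sq_abs x, sq_abs y, sq_nonneg (R - |x|), sq_nonneg (R - |y|), sq_nonneg (|x| - |y|)]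
  calc _ ≤ C * Real.exp (c * (3 * R ^ 2 + 3 * (x ^ 2 + y ^ 2))) * M := by
        gcongr; exact hM x y
    _ = _ := by rw [mul_add, Real.exp_add]; ring_nf

namespace GoodFamily

variable {Ω : Type} [TopologicalSpace Ω] {Z : Ω → ℝ → BoundedOp H}

lemma mem (hZ : 𝒮.GoodFamily Z) (ω : Ω) (t : ℝ) : Z ω t ∈ 𝒮.dom := hZ.fam.mem (ω, t)

lemma isStripContinuation (hZ : 𝒮.GoodFamily Z) (ω : Ω) {Y : BoundedOp H} (hY : Y ∈ 𝒮.dom) :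
    IsStripContinuation (fun t => 𝒮.φ (Y * Z ω t)) (𝒮.ext (Z ω) Y) :=
  isStripContinuation_stripExt (hZ.exists_ext ω Y hY)

lemma ext_ofReal (hZ : 𝒮.GoodFamily Z) (ω : Ω) {Y : BoundedOp H} (hY : Y ∈ 𝒮.dom) (t : ℝ) :
    𝒮.ext (Z ω) Y t = 𝒮.φ (Y * Z ω t) := (hZ.isStripContinuation ω hY).2 t

lemma gaussGrowth (hZ : 𝒮.GoodFamily Z) (ω : Ω) {Y : BoundedOp H} (hY : Y ∈ 𝒮.dom) :
    GaussGrowth (𝒮.ext (Z ω) Y) := by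
  obtain ⟨K, Λ, hK, hΛ, hb⟩ := hZ.bound
  obtain ⟨ρ, hρ, hYρ⟩ := 𝒮.exists_loc Y hY
  exact ⟨_, Λ, hb ω ρ hρ Y hY hYρ⟩

/-- Joint continuity of the continuation in all parameters. -/
lemma continuous_ext (hZ : 𝒮.GoodFamily Z) {Θ : Type} [TopologicalSpace Θ] [LocallyCompactSpace Θ]
    {X : Θ → BoundedOp H} {ω : Θ → Ω} {ζ : Θ → ℂ} (hX : 𝒮.DomFamily X) (hω : Continuous ω)
    (hζ : Continuous ζ) (hs : ∀ θ, ζ θ ∈ closedStrip) :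
    Continuous fun θ => 𝒮.ext (Z (ω θ)) (X θ) (ζ θ) := by
  obtain ⟨K, Λ, hK, hΛ, hb⟩ := hZ.bound
  have h := continuousOn_strip_family (F := fun θ => 𝒮.ext (Z (ω θ)) (X θ))
    (fun θ => (hZ.isStripContinuation _ (hX.mem θ)).1) (fun θ => ?_) ?_ ?_
  · rw [← continuousOn_univ]
    exact h.comp (f := fun θ => (θ, ζ θ)) (by fun_prop) fun θ _ => ⟨mem_univ _, hs θ⟩
  · obtain ⟨ρ, hρ, h1⟩ := hX.loc θ
    obtain ⟨C, hC, h2⟩ := hX.exists_norm_bound θ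
    refine ⟨K * Real.exp (Λ * ρ ^ 2) * C, Λ, ?_⟩
    filter_upwards [h1, h2] with θ' h3 h4 z hz
    refine (hb _ ρ hρ _ (hX.mem θ') h3 z hz).trans ?_
    gcongr
  · simp only [hZ.ext_ofReal _ (hX.mem _)]
    exact ((hX.comp continuous_fst).mul
      (hZ.fam.comp (g := fun p : Θ × ℝ => (ω p.1, p.2)) (by fun_prop))).continuous
  · exact hZ.cont_I (hX.comp continuous_fst) (hω.comp continuous_fst) continuous_snd

/-- The boundary values of the continuation of `t ↦ φ(X Z(t) α_t(b))`. -/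
theorem edgeCont_mul_orbit (hZ : 𝒮.GoodFamily Z) (ω : Ω) {X b : BoundedOp H} (hX : X ∈ 𝒮.dom)
    (hb : b ∈ 𝒮.dom) : EdgeCont (fun t => 𝒮.φ (X * Z ω t * N.α t b))
      (fun t => 𝒮.ext (Z ω) (N.α t b * N.γ X) (t + Complex.I)) := by
  obtain ⟨R, hR, hloc⟩ := hZ.loc
  obtain ⟨M, hM, hbdd⟩ := hZ.bdd
  obtain ⟨K, Λ, hK, hΛ, hbound⟩ := hZ.bound
  obtain ⟨ρ₁, hρ₁, hX₁⟩ := 𝒮.exists_loc X hX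
  obtain ⟨ρ₂, hρ₂, hb₂⟩ := 𝒮.exists_loc b hb
  have hγX := 𝒮.γ_dom X hX
  have hbγ : ∀ y, N.α (-y) b * N.γ X ∈ 𝒮.dom := fun y => mul_mem (𝒮.α_dom _ _ hb) hγX
  have hbγ' : ∀ y, N.α (-y) b * N.γ X ∈ N.loc (ρ₁ + ρ₂ + |y|) := fun y => by
    have := N.α_mem_loc hρ₂ hb₂ (-y)
    rw [abs_neg] at this
    exact mul_mem (N.loc_mono (by linarith) this)
      (N.loc_mono (by linarith [abs_nonneg y]) (N.γ_mem_loc hX₁))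
  have hnbγ : ∀ y, ‖N.α (-y) b * N.γ X‖ ≤ ‖b‖ * ‖X‖ := fun y => by
    refine (norm_mul_le _ _).trans ?_
    rw [N.norm_α, N.norm_γ]
  have hZloc : ∀ x y, Z ω x ∈ N.loc (ρ₁ + ρ₂ + R + |x| + |y|) := fun x y =>
    N.loc_mono (by linarith [abs_nonneg y]) (hloc ω x)
  have famb : 𝒮.DomFamily fun q : ℝ × ℝ => N.α (-q.2) b * N.γ X :=
    (DomFamily.orbit hb (by fun_prop)).mul (DomFamily.const hγX)
  have famZ : 𝒮.DomFamily fun q : ℝ × ℝ => Z ω q.1 :=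
    hZ.fam.comp (g := fun q : ℝ × ℝ => (ω, q.1)) (by fun_prop)
  -- The three boundary functions of the tube. In x the continuation is that of Z with left factor
  -- α_{-y}(b) γ(X). In y it is the reflected KMS function of X Z(x) and b, where evenness of Z
  -- turns γ(X Z) into γ(X) Z. On x = -y the third edge gives the claim after a reflection.
  have h := edgeCont_third (g := fun x y => 𝒮.φ (N.α (-y) b * N.γ X * Z ω x))
    (A := fun x y => 𝒮.ext (Z ω) (N.α (-y) b * N.γ X) (x + Complex.I))
    (B := fun x y => 𝒮.φ (X * Z ω x * N.α (-y) b))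
    ((famb.mul famZ).continuous) (hZ.cont_I famb continuous_const continuous_fst)
    (((((DomFamily.const hX).mul famZ).mul (DomFamily.orbit hb (by fun_prop)))).continuous)
    (gaussBounded_φ (R := ρ₁ + ρ₂ + R) (M := ‖b‖ * ‖X‖ * M) (by positivity)
      (fun x y => mul_mem (hbγ y) (hZ.mem ω x))
      (fun x y => mul_mem (N.loc_mono (by linarith [abs_nonneg x]) (hbγ' y)) (hZloc x y))
      (fun x y => (norm_mul_le _ _).trans (mul_le_mul (hnbγ y) (hbdd ω x) (norm_nonneg _)
        (by positivity))))
    ?_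
    (gaussBounded_φ (R := ρ₁ + ρ₂ + R) (M := ‖X‖ * M * ‖b‖) (by positivity)
      (fun x y => mul_mem (mul_mem hX (hZ.mem ω x)) (𝒮.α_dom _ _ hb))
      (fun x y => mul_mem (mul_mem (N.loc_mono (by linarith [abs_nonneg x, abs_nonneg y]) hX₁)
        (hZloc x y)) (N.loc_mono (by rw [abs_neg]; linarith [abs_nonneg x])
          (N.α_mem_loc hρ₂ hb₂ (-y))))
      (fun x y => by
        refine (norm_mul_le _ _).trans ?_
        rw [N.norm_α]
        gcongr
        refine (norm_mul_le _ _).trans ?_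
        gcongr
        exact hbdd ω x))
    (fun y => ⟨_, (hZ.isStripContinuation ω (hbγ y)).1, hZ.gaussGrowth ω (hbγ y),
      (hZ.isStripContinuation ω (hbγ y)).2, fun _ => rfl⟩)
    (fun x => ?_)
  · have := h.reflect
    simp only [neg_neg] at this
    exact this
  · refine ⟨K * Real.exp (Λ * (2 * (ρ₁ + ρ₂) ^ 2)) * (‖b‖ * ‖X‖), 2 * Λ, fun x y => ?_⟩
    refine (hbound ω (ρ₁ + ρ₂ + |y|) (by positivity) _ (hbγ y) (hbγ' y) _
      (ofReal_add_I_mem_closedStrip x)).trans ?_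
    have e1 : (ρ₁ + ρ₂ + |y|) ^ 2 ≤ 2 * (ρ₁ + ρ₂) ^ 2 + 2 * y ^ 2 := by
      nlinarith [sq_abs y, sq_nonneg (ρ₁ + ρ₂ - |y|)]
    have e2 : ((x : ℂ) + Complex.I).re ^ 2 ≤ 2 * x ^ 2 := by
      simp only [Complex.add_re, Complex.ofReal_re, Complex.I_re, add_zero]
      nlinarith [sq_nonneg x]
    calc _ ≤ K * Real.exp (Λ * (2 * (ρ₁ + ρ₂) ^ 2 + 2 * y ^ 2)) * (‖b‖ * ‖X‖) *
          Real.exp (Λ * (2 * x ^ 2)) := by gcongr; exact hnbγ y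
      _ = K * (‖b‖ * ‖X‖) * (Real.exp (Λ * (2 * (ρ₁ + ρ₂) ^ 2 + 2 * y ^ 2)) *
          Real.exp (Λ * (2 * x ^ 2))) := by ring
      _ = K * (‖b‖ * ‖X‖) * (Real.exp (Λ * (2 * (ρ₁ + ρ₂) ^ 2)) *
          Real.exp (2 * Λ * (x ^ 2 + y ^ 2))) := by
        rw [← Real.exp_add, ← Real.exp_add]; ring_nf
      _ = _ := by ring
  · have := (𝒮.edgeCont_kms (mul_mem hX (hZ.mem ω x)) hb).reflect
    simp only [N.γ_mul, hZ.even, ← mul_assoc] at this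
    exact this

/-- Change of parameters. -/
lemma comp (hZ : 𝒮.GoodFamily Z) {Ω' : Type} [TopologicalSpace Ω'] {g : Ω' → Ω} (hg : Continuous g) :
    𝒮.GoodFamily fun ω t => Z (g ω) t := by
  obtain ⟨R, hR, hloc⟩ := hZ.loc
  obtain ⟨M, hM, hbdd⟩ := hZ.bdd
  obtain ⟨K, Λ, hK, hΛ, hbound⟩ := hZ.bound
  exact ⟨hZ.fam.comp (g := fun p : Ω' × ℝ => (g p.1, p.2)) (by fun_prop),
    ⟨R, hR, fun ω t => hloc _ t⟩, fun ω t => hZ.even _ t, ⟨M, hM, fun ω t => hbdd _ t⟩,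
    fun ω Y hY => hZ.exists_ext _ Y hY, ⟨K, Λ, hK, hΛ, fun ω => hbound (g ω)⟩,
    fun hX hω hτ => hZ.cont_I hX (hg.comp hω) hτ⟩

lemma isStripContinuation_rescale (hZ : 𝒮.GoodFamily Z) (ω : Ω) (l : ℝ) {Y : BoundedOp H}
    (hY : Y ∈ 𝒮.dom) : IsStripContinuation (fun t => 𝒮.φ (Y * Z ω (clamp l * t)))
      fun z => 𝒮.ext (Z ω) Y (clamp l * z) := by
  refine ⟨(hZ.isStripContinuation ω hY).1.comp_clamp_mul l, fun t => ?_⟩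
  have := hZ.ext_ofReal ω hY (clamp l * t)
  push_cast at this
  exact this

lemma ext_rescale (hZ : 𝒮.GoodFamily Z) (ω : Ω) (l : ℝ) {Y : BoundedOp H} (hY : Y ∈ 𝒮.dom) {z : ℂ}
    (hz : z ∈ closedStrip) :
    𝒮.ext (fun t => Z ω (clamp l * t)) Y z = 𝒮.ext (Z ω) Y (clamp l * z) :=
  (hZ.isStripContinuation_rescale ω l hY).stripExt_eq hz

/-- Rescaling of the time parameter. -/
lemma rescale (hZ : 𝒮.GoodFamily Z) :
    𝒮.GoodFamily fun (p : ℝ × Ω) t => Z p.2 (clamp p.1 * t) := by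
  obtain ⟨R, hR, hloc⟩ := hZ.loc
  obtain ⟨M, hM, hbdd⟩ := hZ.bdd
  obtain ⟨K, Λ, hK, hΛ, hbound⟩ := hZ.bound
  have hc := continuous_clamp
  refine ⟨hZ.fam.comp (g := fun p : (ℝ × Ω) × ℝ => (p.1.2, clamp p.1.1 * p.2)) (by fun_prop),
    ⟨R, hR, fun ω t => N.loc_mono (by linarith [abs_clamp_mul_le ω.1 t]) (hloc _ _)⟩,
    fun ω t => hZ.even _ _, ⟨M, hM, fun ω t => hbdd _ _⟩,
    fun ω Y hY => ⟨_, hZ.isStripContinuation_rescale ω.2 ω.1 hY⟩, ⟨K, Λ, hK, hΛ,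
    fun ω ρ hρ Y hY hYρ z hz => ?_⟩, ?_⟩
  · rw [hZ.ext_rescale _ _ hY hz]
    refine (hbound ω.2 ρ hρ Y hY hYρ _ (clamp_mul_mem_closedStrip _ hz)).trans ?_
    have := clamp_mul_re_sq_le ω.1 z
    gcongr
  · intro Θ _ _ X ω τ hX hω hτ
    have e : ∀ θ, 𝒮.ext (fun t => Z (ω θ).2 (clamp (ω θ).1 * t)) (X θ) (τ θ + Complex.I) =
        𝒮.ext (Z (ω θ).2) (X θ) (clamp (ω θ).1 * (τ θ + Complex.I)) := fun θ =>
      hZ.ext_rescale _ _ (hX.mem θ) (ofReal_add_I_mem_closedStrip _)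
    simp only [e]
    exact hZ.continuous_ext hX (by fun_prop) (by fun_prop)
      fun θ => clamp_mul_mem_closedStrip _ (ofReal_add_I_mem_closedStrip _)

variable {b : BoundedOp H}

lemma ext_mul_orbit (hZ : 𝒮.GoodFamily Z) (hb : b ∈ 𝒮.dom) (ω : Ω) {Y : BoundedOp H}
    (hY : Y ∈ 𝒮.dom) :
    IsStripAnalytic (𝒮.ext (fun t => Z ω t * N.α t b) Y) ∧
      GaussGrowth (𝒮.ext (fun t => Z ω t * N.α t b) Y) ∧
      (∀ t : ℝ, 𝒮.ext (fun t => Z ω t * N.α t b) Y t = 𝒮.φ (Y * (Z ω t * N.α t b))) ∧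
      ∀ t : ℝ, 𝒮.ext (fun t => Z ω t * N.α t b) Y (t + Complex.I) =
        𝒮.ext (Z ω) (N.α t b * N.γ Y) (t + Complex.I) := by
  obtain ⟨F, hF, ⟨K, Λ, hb⟩, h0, h1⟩ := hZ.edgeCont_mul_orbit ω hY hb
  have hc : IsStripContinuation (fun t => 𝒮.φ (Y * (Z ω t * N.α t b))) F :=
    ⟨hF, fun t => by rw [h0]; simp only [mul_assoc]⟩
  have hs := isStripContinuation_stripExt ⟨F, hc⟩
  refine ⟨hs.1, ⟨K, Λ, fun z hz => ?_⟩, hs.2, fun t => ?_⟩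
  · rw [ext, hc.stripExt_eq hz]; exact hb z hz
  · rw [ext, hc.stripExt_eq (ofReal_add_I_mem_closedStrip t), h1]

/-- Multiplication by the orbit of an even element. -/
lemma mul_orbit [LocallyCompactSpace Ω] (hZ : 𝒮.GoodFamily Z) (hb : b ∈ 𝒮.dom) (hbγ : N.γ b = b) :
    𝒮.GoodFamily fun ω t => Z ω t * N.α t b := by
  obtain ⟨R, hR, hloc⟩ := hZ.loc
  obtain ⟨M, hM, hbdd⟩ := hZ.bdd
  obtain ⟨K, Λ, hK, hΛ, hbound⟩ := hZ.bound
  obtain ⟨ρ', hρ', hbρ⟩ := 𝒮.exists_loc b hb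
  obtain ⟨C, c, hC, hc, hφ⟩ := 𝒮.φ_bound
  have hfam : 𝒮.DomFamily fun p : Ω × ℝ => Z p.1 p.2 * N.α p.2 b :=
    hZ.fam.mul (DomFamily.orbit hb continuous_snd)
  have hloc' : ∀ ω t, Z ω t * N.α t b ∈ N.loc (R + ρ' + |t|) := fun ω t =>
    mul_mem (N.loc_mono (by linarith) (hloc ω t)) (N.loc_mono (by linarith) (N.α_mem_loc hρ' hbρ t))
  have hbdd' : ∀ ω t, ‖Z ω t * N.α t b‖ ≤ M * ‖b‖ := fun ω t => by
    refine (norm_mul_le _ _).trans ?_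
    rw [N.norm_α]
    gcongr
    exact hbdd ω t
  refine ⟨hfam, ⟨R + ρ', by positivity, hloc'⟩, fun ω t => ?_, ⟨M * ‖b‖, by positivity, hbdd'⟩,
    fun ω Y hY => ⟨_, (hZ.ext_mul_orbit hb ω hY).1, (hZ.ext_mul_orbit hb ω hY).2.2.1⟩, ?_, ?_⟩
  · rw [N.γ_mul, hZ.even, N.γ_α, hbγ]
  -- Only the existence of some Gaussian bound matters here. The 3 comes from splitting the square
  -- of ρ + (R + ρ') + |t|, and c + Λ dominates the exponents on both boundary lines. A bound
  -- uniform in the number of factors is proved separately.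
  · set L := 3 * (c + Λ) with hL
    set K' := (C * Real.exp (L * (R + ρ') ^ 2) * M + K * Real.exp (L * (R + ρ') ^ 2)) * ‖b‖ with hK'
    have hL0 : 0 ≤ L := by positivity
    refine ⟨K' * Real.exp (2 * L), 2 * L, by positivity, by positivity, fun ω ρ hρ Y hY hYρ z hz => ?_⟩
    obtain ⟨f1, f2, f3, f4⟩ := hZ.ext_mul_orbit hb ω hY
    have hsq : ∀ t : ℝ, (ρ + (R + ρ') + |t|) ^ 2 ≤ 3 * ρ ^ 2 + 3 * (R + ρ') ^ 2 + 3 * t ^ 2 := fun t => by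
      nlinarith [sq_abs t, sq_nonneg (ρ - (R + ρ')), sq_nonneg (ρ - |t|), sq_nonneg (R + ρ' - |t|)]
    have hre : z.re ^ 2 ≤ z.re ^ 2 := le_rfl
    refine (f1.norm_le_exp f2 (M := K' * Real.exp (2 * L * ρ ^ 2) * ‖Y‖) (Λ := 2 * L) (by positivity)
      (fun t => ?_) (fun t => ?_) z hz).trans (le_of_eq (by ring))
    · rw [f3]
      refine (hφ (ρ + (R + ρ') + |t|) (by positivity) _
        (mul_mem hY (mul_mem (hZ.mem ω t) (𝒮.α_dom t b hb)))
        (mul_mem (N.loc_mono (by linarith [abs_nonneg t]) hYρ)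
          (N.loc_mono (by linarith) (hloc' ω t)))).trans ?_
      have e1 : c * (ρ + (R + ρ') + |t|) ^ 2 ≤
          L * (R + ρ') ^ 2 + 2 * L * ρ ^ 2 + 2 * L * t ^ 2 := by
        have := mul_le_mul_of_nonneg_left (hsq t) hc
        rw [hL]
        nlinarith [mul_nonneg hc (sq_nonneg ρ), mul_nonneg hc (sq_nonneg t),
          mul_nonneg hΛ (sq_nonneg ρ), mul_nonneg hΛ (sq_nonneg t),
          mul_nonneg hΛ (sq_nonneg (R + ρ'))]
      calc _ ≤ C * Real.exp (L * (R + ρ') ^ 2 + 2 * L * ρ ^ 2 + 2 * L * t ^ 2) *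
            (‖Y‖ * (M * ‖b‖)) := by
              gcongr
              exact (norm_mul_le _ _).trans (by gcongr; exact hbdd' ω t)
        _ = C * Real.exp (L * (R + ρ') ^ 2) * M * ‖b‖ * Real.exp (2 * L * ρ ^ 2) * ‖Y‖ *
            Real.exp (2 * L * t ^ 2) := by rw [Real.exp_add, Real.exp_add]; ring
        _ ≤ _ := by
          gcongr
          rw [hK', add_mul]
          have : 0 ≤ K * Real.exp (L * (R + ρ') ^ 2) * ‖b‖ := by positivity
          linarith
    · rw [f4]
      refine (hbound ω (ρ + (R + ρ') + |t|) (by positivity) _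
        (mul_mem (𝒮.α_dom t b hb) (𝒮.γ_dom Y hY))
        (mul_mem (N.loc_mono (by linarith) (N.α_mem_loc hρ' hbρ t))
          (N.loc_mono (by linarith [abs_nonneg t]) (N.γ_mem_loc hYρ))) _
        (ofReal_add_I_mem_closedStrip t)).trans ?_
      have e1 : Λ * (ρ + (R + ρ') + |t|) ^ 2 + Λ * t ^ 2 ≤
          L * (R + ρ') ^ 2 + 2 * L * ρ ^ 2 + 2 * L * t ^ 2 := by
        have := mul_le_mul_of_nonneg_left (hsq t) hΛ
        rw [hL]
        nlinarith [mul_nonneg hc (sq_nonneg ρ), mul_nonneg hc (sq_nonneg t),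
          mul_nonneg hΛ (sq_nonneg ρ), mul_nonneg hΛ (sq_nonneg t),
          mul_nonneg hc (sq_nonneg (R + ρ'))]
      have e2 : ((t : ℂ) + Complex.I).re = t := by simp
      rw [e2]
      calc _ ≤ K * Real.exp (Λ * (ρ + (R + ρ') + |t|) ^ 2) * (‖b‖ * ‖Y‖) *
            Real.exp (Λ * t ^ 2) := by
              gcongr
              refine (norm_mul_le _ _).trans ?_
              rw [N.norm_α, N.norm_γ]
        _ = K * (‖b‖ * ‖Y‖) * Real.exp (Λ * (ρ + (R + ρ') + |t|) ^ 2 + Λ * t ^ 2) := by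
          rw [Real.exp_add]; ring
        _ ≤ K * (‖b‖ * ‖Y‖) * Real.exp (L * (R + ρ') ^ 2 + 2 * L * ρ ^ 2 + 2 * L * t ^ 2) := by
          gcongr
        _ = K * Real.exp (L * (R + ρ') ^ 2) * ‖b‖ * Real.exp (2 * L * ρ ^ 2) * ‖Y‖ *
            Real.exp (2 * L * t ^ 2) := by rw [Real.exp_add, Real.exp_add]; ring
        _ ≤ _ := by
          gcongr
          rw [hK', add_mul]
          have : 0 ≤ C * Real.exp (L * (R + ρ') ^ 2) * M * ‖b‖ := by positivity
          linarith
  · intro Θ _ _ X ω τ hX hω hτ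
    simp only [(hZ.ext_mul_orbit hb _ (hX.mem _)).2.2.2]
    exact hZ.cont_I ((DomFamily.orbit hb hτ).mul hX.γ) hω hτ

end GoodFamily

end LocalSystem

/-! ### Simplex integrals in ratio coordinates over a fixed cube. -/

section CubeIntegral

/-- The iterated integral `∫_{[0,1]ⁿ} λ₁^{n-1} λ₂^{n-2} ⋯ λ_{n-1} f(λ) dλ`, which is the integral over
the time simplex in the coordinates of successive ratios. -/
def cubeInt : (n : ℕ) → ((Fin n → ℝ) → ℂ) → ℂ
  | 0, f => f default
  | n + 1, f => ∫ l in (0 : ℝ)..1, (l : ℂ) ^ n * cubeInt n fun v => f (Fin.cons l v)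

/-- The successive integrals of lⁿ contribute the factors 1/(n + 1), so the factorial of the simplex
volume is retained. -/
lemma norm_cubeInt_le {n : ℕ} {f : (Fin n → ℝ) → ℂ} {M : ℝ} (h : ∀ v, ‖f v‖ ≤ M) :
    ‖cubeInt n f‖ ≤ M / n.factorial := by
  induction n with
  | zero => simpa [cubeInt] using h default
  | succ n ih =>
    have hM : ∫ l in (0 : ℝ)..1, l ^ n * (M / n.factorial) = M / (n + 1).factorial := by
      rw [intervalIntegral.integral_mul_const, integral_pow, Nat.factorial_succ]
      push_cast
      field_simp
      simp
    rw [cubeInt, ← hM]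
    refine intervalIntegral.norm_integral_le_of_norm_le zero_le_one
      (Eventually.of_forall fun l hl => ?_) (Continuous.intervalIntegrable (by fun_prop) _ _)
    rw [norm_mul, norm_pow, Complex.norm_real, Real.norm_eq_abs, abs_of_pos hl.1]
    exact mul_le_mul_of_nonneg_left (ih fun v => h _) (pow_nonneg hl.1.le n)

lemma continuous_cubeInt {n : ℕ} {Θ : Type} [TopologicalSpace Θ] 
    {f : Θ → (Fin n → ℝ) → ℂ} (hf : Continuous fun p : Θ × (Fin n → ℝ) => f p.1 p.2) :
    Continuous fun θ => cubeInt n (f θ) := by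
  induction n generalizing Θ with
  | zero => exact hf.comp (f := fun θ => (θ, default)) (by fun_prop)
  | succ n ih =>
    simp only [cubeInt]
    have h := ih (Θ := Θ × ℝ) (f := fun p v => f p.1 (Fin.cons p.2 v))
      (hf.comp (f := fun p : (Θ × ℝ) × (Fin n → ℝ) => (p.1.1, (Fin.cons p.1.2 p.2 : Fin (n + 1) → ℝ)))
        ((continuous_fst.comp continuous_fst).prodMk
          (Continuous.finCons (A := fun _ => ℝ) (continuous_snd.comp continuous_fst) continuous_snd)))
    refine intervalIntegral.continuous_parametric_intervalIntegral_of_continuous' ?_ 0 1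
    exact Continuous.mul (by fun_prop) h

lemma differentiableOn_cubeInt {n : ℕ} {U : Set ℂ} (hU : IsOpen U) {f : ℂ → (Fin n → ℝ) → ℂ}
    (hc : ∀ z ∈ U, Continuous (f z)) (hd : ∀ v, DifferentiableOn ℂ (fun z => f z v) U)
    (hb : ∀ z₀ ∈ U, ∃ M : ℝ, ∃ r > 0, ∀ v, ∀ z ∈ Metric.ball z₀ r, ‖f z v‖ ≤ M) :
    DifferentiableOn ℂ (fun z => cubeInt n (f z)) U := by
  induction n with
  | zero => exact hd default
  | succ n ih =>
    simp only [cubeInt, intervalIntegral.integral_of_le zero_le_one]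
    have hcons : ∀ z ∈ U, Continuous fun p : ℝ × (Fin n → ℝ) =>
        f z (Fin.cons p.1 p.2 : Fin (n + 1) → ℝ) := fun z hz =>
      (hc z hz).comp (Continuous.finCons (A := fun _ => ℝ) continuous_fst continuous_snd)
    refine differentiableOn_integral_of_bound hU (fun z hz => ?_) (Eventually.of_forall fun l => ?_)
      fun z₀ hz₀ => ?_
    · have := continuous_cubeInt (f := fun (l : ℝ) v => f z (Fin.cons l v)) (hcons z hz)
      exact (Continuous.mul (by fun_prop) this).aestronglyMeasurable
    · refine (differentiableOn_const _).mul (ih (fun z hz => ?_) (fun v => hd _) fun z₀ hz₀ => ?_)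
      · exact (hcons z hz).comp (f := fun v => (l, v)) (by fun_prop)
      · obtain ⟨M, r, hr, h⟩ := hb z₀ hz₀
        exact ⟨M, r, hr, fun v => h _⟩
    · obtain ⟨M, r, hr, h⟩ := hb z₀ hz₀
      refine ⟨fun _ => M / n.factorial, integrable_const _, r, hr, ?_⟩
      filter_upwards [ae_restrict_mem measurableSet_Ioc] with l hl z hz
      rw [norm_mul, norm_pow, Complex.norm_real, Real.norm_eq_abs, abs_of_pos hl.1]
      have h1 := norm_cubeInt_le (f := fun v => f z (Fin.cons l v)) fun v => h (Fin.cons l v) z hz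
      calc _ ≤ 1 * (M / n.factorial) :=
            mul_le_mul (pow_le_one₀ hl.1.le hl.2) h1 (norm_nonneg _) zero_le_one
        _ = _ := one_mul _

/-- The retraction of the plane to the closed strip. -/
def stripRetract (z : ℂ) : ℂ := z.re + clamp z.im * Complex.I

lemma continuous_stripRetract : Continuous stripRetract := by
  have := continuous_clamp
  unfold stripRetract; fun_prop

lemma stripRetract_mem (z : ℂ) : stripRetract z ∈ closedStrip := by
  simpa [stripRetract, closedStrip] using clamp_mem z.im

lemma stripRetract_of_mem {z : ℂ} (hz : z ∈ closedStrip) : stripRetract z = z := by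
  rw [stripRetract, clamp_of_mem hz, Complex.re_add_im]

lemma stripRetract_re (z : ℂ) : (stripRetract z).re = z.re := by simp [stripRetract]

lemma norm_le_of_mem_closedStrip {z : ℂ} (hz : z ∈ closedStrip) : ‖z‖ ≤ |z.re| + 1 := by
  refine (Complex.norm_le_abs_re_add_abs_im z).trans ?_
  have : |z.im| ≤ 1 := abs_le.2 ⟨by linarith [hz.1], hz.2⟩
  linarith

end CubeIntegral

/-! ### Words in translates of a, and bounds that are geometric in their length. -/

namespace LocalSystem

variable {H : Type*} [NormedAddCommGroup H] [InnerProductSpace ℂ H] [CompleteSpace H]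
  {N : GradedNet H} {𝒮 : LocalSystem N}

/-- Products `α_{s₁t}(a) ⋯ α_{sₙt}(a)` with `0 ≤ s₁ ≤ ⋯ ≤ sₙ ≤ 1`, parametrized by the ratios of
successive times. -/
def word (N : GradedNet H) (a : BoundedOp H) : (n : ℕ) → (Fin n → ℝ) → ℝ → BoundedOp H
  | 0, _, _ => 1
  | n + 1, v, t => word N a n (Fin.tail v) (clamp (v 0) * t) * N.α (clamp (v 0) * t) a

/-- The exponent of the Gaussian weight of a word. -/
def wordWeight : (n : ℕ) → (Fin n → ℝ) → ℝ
  | 0, _ => 0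
  | n + 1, v => clamp (v 0) ^ 2 * (wordWeight n (Fin.tail v) + 1)

lemma wordWeight_nonneg (n : ℕ) (v : Fin n → ℝ) : 0 ≤ wordWeight n v := by
  induction n with
  | zero => exact le_rfl
  | succ n ih => exact mul_nonneg (sq_nonneg _) (by linarith [ih (Fin.tail v)])

lemma wordWeight_le (n : ℕ) (v : Fin n → ℝ) : wordWeight n v ≤ n := by
  induction n with
  | zero => simp [wordWeight]
  | succ n ih =>
    have h1 : clamp (v 0) ^ 2 ≤ 1 := pow_le_one₀ (clamp_mem _).1 (clamp_mem _).2
    have h2 := ih (Fin.tail v)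
    have h3 := wordWeight_nonneg n (Fin.tail v)
    rw [wordWeight]
    push_cast
    nlinarith

lemma norm_word_le (a : BoundedOp H) (n : ℕ) (v : Fin n → ℝ) (t : ℝ) :
    ‖word N a n v t‖ ≤ ‖a‖ ^ n := by
  induction n generalizing t with
  | zero => rw [pow_zero]; exact ContinuousLinearMap.norm_id_le
  | succ n ih =>
    rw [word, pow_succ]
    refine (norm_mul_le _ _).trans ?_
    rw [N.norm_α]
    gcongr
    exact ih _ _

/-- All times of the word lie between 0 and t, so the localization radius does not grow with n.
Without this the bound (S₆) would be useless for summing the series. -/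
lemma word_mem_loc {a : BoundedOp H} {R : ℝ} (hR : 0 ≤ R) (haR : a ∈ N.loc R) (n : ℕ)
    (v : Fin n → ℝ) (t : ℝ) : word N a n v t ∈ N.loc (R + |t|) := by
  induction n generalizing t with
  | zero => exact one_mem _
  | succ n ih =>
    have := abs_clamp_mul_le (v 0) t
    exact mul_mem (N.loc_mono (by linarith) (ih _ _))
      (N.loc_mono (by linarith) (N.α_mem_loc hR haR _))

lemma goodFamily_one : 𝒮.GoodFamily (Ω := Fin 0 → ℝ) fun _ _ => 1 := by
  have hc : ∀ Y, IsStripContinuation (fun _ => 𝒮.φ (Y * 1)) fun _ => 𝒮.φ (Y * 1) := fun Y =>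
    ⟨(differentiable_const _).isStripAnalytic, fun _ => rfl⟩
  have he : ∀ Y, ∀ z ∈ closedStrip, 𝒮.ext (fun _ => 1) Y z = 𝒮.φ Y := fun Y z hz => by
    have := (hc Y).stripExt_eq hz
    rwa [mul_one] at this
  obtain ⟨C, c, hC, hc0, hb⟩ := 𝒮.φ_bound
  refine ⟨DomFamily.const (one_mem _), ⟨0, le_rfl, fun _ _ => one_mem _⟩, fun _ _ => N.γ_one,
    ⟨1, zero_le_one, fun _ _ => ContinuousLinearMap.norm_id_le⟩, fun _ Y _ => ⟨_, hc Y⟩,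
    ⟨C, c, hC, hc0, fun _ ρ hρ Y hY hYρ z hz => ?_⟩, fun hX _ _ => ?_⟩
  · rw [he Y z hz]
    refine (hb ρ hρ Y hY hYρ).trans (le_mul_of_one_le_right (by positivity) ?_)
    exact Real.one_le_exp (by positivity)
  · simp only [he _ _ (ofReal_add_I_mem_closedStrip _)]
    exact hX.continuous

lemma goodFamily_word {a : BoundedOp H} (ha : a ∈ 𝒮.dom) (haγ : N.γ a = a) (n : ℕ) :
    𝒮.GoodFamily (word N a n) := by
  induction n with
  | zero => exact goodFamily_one
  | succ n ih =>
    exact ((ih.mul_orbit ha haγ).rescale).comp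
      (g := fun v : Fin (n + 1) → ℝ => (v 0, Fin.tail v))
      ((continuous_apply 0).prodMk (continuous_pi fun i => continuous_apply i.succ))

section Bounds

variable {a : BoundedOp H} (ha : a ∈ 𝒮.dom) (haγ : N.γ a = a) {R C c : ℝ} (hR : 0 ≤ R)
  (haR : a ∈ N.loc R) (hC : 0 ≤ C) (hc : 0 ≤ c)
  (hφ : ∀ ρ, 0 ≤ ρ → ∀ x ∈ 𝒮.dom, x ∈ N.loc ρ → ‖𝒮.φ x‖ ≤ C * Real.exp (c * ρ ^ 2) * ‖x‖)

include ha haγ hR haR hC hc hφ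

/-- Induction on the length by Phragmén–Lindelöf. On the upper line the last factor α_t(a) moves
into Y, which enlarges the radius from ρ to max(ρ, R + |t|) and costs at most e^{2cR² + 2ct²}. One
more unit of the weight e^{-2cz²} cancels e^{2ct²} and adds e^{2c} at Im z = 1. Each factor
therefore costs exactly q = ‖a‖ e^{2cR² + 2c}. The recursion for `wordWeight` adds this unit and
then rescales z by the ratio of successive times. -/
lemma norm_ext_word_mul_weight_le (n : ℕ) (v : Fin n → ℝ) {ρ : ℝ} (hρ : 0 ≤ ρ) {Y : BoundedOp H}
    (hY : Y ∈ 𝒮.dom) (hYρ : Y ∈ N.loc ρ) {z : ℂ} (hz : z ∈ closedStrip) :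
    ‖𝒮.ext (word N a n v) Y z * Complex.exp ((-(2 * c * wordWeight n v) : ℝ) * z ^ 2)‖ ≤
      C * Real.exp (c * ρ ^ 2) * ‖Y‖ * (‖a‖ * Real.exp (2 * c * R ^ 2 + 2 * c)) ^ n := by
  induction n generalizing ρ Y z with
  | zero =>
    have h : IsStripContinuation (fun t => 𝒮.φ (Y * word N a 0 v t)) fun _ => 𝒮.φ Y :=
      ⟨(differentiable_const _).isStripAnalytic, fun _ => by simp only [word, mul_one]⟩
    have h2 : 𝒮.ext (word N a 0 v) Y z = 𝒮.φ Y := h.stripExt_eq hz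
    rw [h2]
    simpa [wordWeight] using hφ ρ hρ Y hY hYρ
  | succ n ih =>
    set q := ‖a‖ * Real.exp (2 * c * R ^ 2 + 2 * c) with hq
    set s := wordWeight n (Fin.tail v) with hs
    have hs0 : 0 ≤ s := wordWeight_nonneg _ _
    have hq0 : 0 ≤ q := by positivity
    have haq : ‖a‖ * Real.exp (2 * c * R ^ 2) ≤ q := by
      rw [hq]; gcongr; linarith
    have hκq : ‖a‖ ≤ q := by
      refine le_trans ?_ haq
      exact le_mul_of_one_le_right (norm_nonneg _) (Real.one_le_exp (by positivity))
    have hW := goodFamily_word ha haγ n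
    obtain ⟨f1, f2, f3, f4⟩ := hW.ext_mul_orbit ha (Fin.tail v) hY
    have hsq : ∀ t : ℝ, c * (max ρ (R + |t|)) ^ 2 ≤ c * ρ ^ 2 + (2 * c * R ^ 2 + 2 * c * t ^ 2) := by
      intro t
      have h1 : (max ρ (R + |t|)) ^ 2 ≤ ρ ^ 2 + (2 * R ^ 2 + 2 * t ^ 2) := by
        rcases le_total ρ (R + |t|) with h | h
        · rw [max_eq_right h]
          nlinarith [sq_abs t, sq_nonneg (R - |t|), sq_nonneg ρ]
        · rw [max_eq_left h]; nlinarith [sq_nonneg R, sq_nonneg t]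
      nlinarith
    have hloc : ∀ t, N.α t a ∈ N.loc (R + |t|) := N.α_mem_loc hR haR
    have hmax : ∀ t : ℝ, 0 ≤ max ρ (R + |t|) := fun t => le_max_of_le_left hρ
    have key := (f1.mul (isStripAnalytic_exp (-(2 * c * (s + 1))))).norm_le
      (f2.mul (gaussGrowth_exp (-(2 * c * (s + 1)))))
      (M := C * Real.exp (c * ρ ^ 2) * ‖Y‖ * q ^ (n + 1)) (fun t => ?_) (fun t => ?_)
      ((clamp (v 0) : ℂ) * z) (clamp_mul_mem_closedStrip _ hz)
    · have e1 : 𝒮.ext (word N a (n + 1) v) Y z =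
          𝒮.ext (fun t => word N a n (Fin.tail v) t * N.α t a) Y (clamp (v 0) * z) :=
        (hW.mul_orbit ha haγ).ext_rescale (Fin.tail v) (v 0) hY hz
      rw [e1]
      convert key using 4
      rw [wordWeight, ← hs]
      push_cast
      ring
    -- On the real line the bound on φ applies directly; of the weight e^{-2c(s+1)t²} only the part
    -- e^{-2ct²} is needed.
    · rw [norm_mul, norm_exp_mul_sq, f3]
      have h1 := hφ _ (hmax t) _ (mul_mem hY (mul_mem (hW.mem (Fin.tail v) t) (𝒮.α_dom t a ha)))
        (mul_mem (N.loc_mono (le_max_left ρ (R + |t|)) hYρ)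
          (mul_mem (N.loc_mono (le_max_right _ _) (word_mem_loc hR haR n _ t))
            (N.loc_mono (le_max_right _ _) (hloc t))))
      have h2 : ‖Y * (word N a n (Fin.tail v) t * N.α t a)‖ ≤ ‖Y‖ * (‖a‖ ^ n * ‖a‖) := by
        refine (norm_mul_le _ _).trans (mul_le_mul_of_nonneg_left ?_ (norm_nonneg _))
        refine (norm_mul_le _ _).trans ?_
        rw [N.norm_α]
        exact mul_le_mul_of_nonneg_right (norm_word_le a n _ t) (norm_nonneg _)
      simp only [Complex.ofReal_re, Complex.ofReal_im]
      calc _ ≤ C * Real.exp (c * ρ ^ 2 + (2 * c * R ^ 2 + 2 * c * t ^ 2)) * (‖Y‖ * (‖a‖ ^ n * ‖a‖)) *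
            Real.exp (-(2 * c * t ^ 2)) := by
              refine mul_le_mul (h1.trans ?_) (Real.exp_le_exp.2 ?_) (Real.exp_pos _).le
                (by positivity)
              · gcongr; exact hsq t
              · nlinarith [mul_nonneg (mul_nonneg hc hs0) (sq_nonneg t)]
        _ = C * Real.exp (c * ρ ^ 2) * ‖Y‖ * (‖a‖ ^ n * (‖a‖ * Real.exp (2 * c * R ^ 2))) *
            (Real.exp (2 * c * t ^ 2) * Real.exp (-(2 * c * t ^ 2))) := by
              rw [Real.exp_add, Real.exp_add]; ring
        _ = C * Real.exp (c * ρ ^ 2) * ‖Y‖ * (‖a‖ ^ n * (‖a‖ * Real.exp (2 * c * R ^ 2))) := by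
              rw [← Real.exp_add, add_neg_cancel, Real.exp_zero, mul_one]
        _ ≤ _ := by
          refine mul_le_mul_of_nonneg_left ?_ (by positivity)
          rw [pow_succ q]
          exact mul_le_mul (pow_le_pow_left₀ (norm_nonneg _) hκq n) haq (by positivity) (by positivity)
    -- On the upper line the induction hypothesis is used with left factor α_t(a) γ(Y) and the
    -- radius max(ρ, R + |t|).
    · rw [norm_mul, norm_exp_mul_sq, f4]
      have h1 := ih (Fin.tail v) (hmax t) (mul_mem (𝒮.α_dom t a ha) (𝒮.γ_dom Y hY))
        (mul_mem (N.loc_mono (le_max_right ρ (R + |t|)) (hloc t))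
          (N.loc_mono (le_max_left _ _) (N.γ_mem_loc hYρ))) (ofReal_add_I_mem_closedStrip t)
      rw [norm_mul, norm_exp_mul_sq, ← hs] at h1
      have h2 : ‖N.α t a * N.γ Y‖ ≤ ‖a‖ * ‖Y‖ := by
        refine (norm_mul_le _ _).trans ?_
        rw [N.norm_α, N.norm_γ]
      simp only [Complex.add_re, Complex.ofReal_re, Complex.I_re, add_zero, Complex.add_im,
        Complex.ofReal_im, Complex.I_im, zero_add] at h1 ⊢
      set E := ‖𝒮.ext (word N a n (Fin.tail v)) (N.α t a * N.γ Y) (t + Complex.I)‖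
      calc E * Real.exp (-(2 * c * (s + 1)) * (t ^ 2 - 1 ^ 2))
          = (E * Real.exp (-(2 * c * s) * (t ^ 2 - 1 ^ 2))) * Real.exp (2 * c - 2 * c * t ^ 2) := by
            have : Real.exp (-(2 * c * (s + 1)) * (t ^ 2 - 1 ^ 2)) =
                Real.exp (-(2 * c * s) * (t ^ 2 - 1 ^ 2)) * Real.exp (2 * c - 2 * c * t ^ 2) := by
              rw [← Real.exp_add]; ring_nf
            rw [this]; ring
        _ ≤ (C * Real.exp (c * ρ ^ 2 + (2 * c * R ^ 2 + 2 * c * t ^ 2)) * (‖a‖ * ‖Y‖) * q ^ n) *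
            Real.exp (2 * c - 2 * c * t ^ 2) := by
            refine mul_le_mul_of_nonneg_right (h1.trans ?_) (Real.exp_pos _).le
            gcongr
            exact hsq t
        _ = C * (‖a‖ * ‖Y‖) * q ^ n * (Real.exp (c * ρ ^ 2 + (2 * c * R ^ 2 + 2 * c * t ^ 2)) *
            Real.exp (2 * c - 2 * c * t ^ 2)) := by ring
        _ = C * (‖a‖ * ‖Y‖) * q ^ n * (Real.exp (c * ρ ^ 2) * Real.exp (2 * c * R ^ 2 + 2 * c)) := by
            rw [← Real.exp_add, ← Real.exp_add]; ring_nf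
        _ = _ := by rw [pow_succ, hq]; ring

/-- Removing the weight costs at most e^{2cnT}, since its exponent is at most n. The bound stays
geometric in n for bounded real part. -/
lemma norm_ext_word_le (n : ℕ) (v : Fin n → ℝ) {ρ : ℝ} (hρ : 0 ≤ ρ) {Y : BoundedOp H}
    (hY : Y ∈ 𝒮.dom) (hYρ : Y ∈ N.loc ρ) {z : ℂ} (hz : z ∈ closedStrip) {T : ℝ} (hT : z.re ^ 2 ≤ T) :
    ‖𝒮.ext (word N a n v) Y z‖ ≤ C * Real.exp (c * ρ ^ 2) * ‖Y‖ *
      (‖a‖ * Real.exp (2 * c * R ^ 2 + 2 * c) * Real.exp (2 * c * T)) ^ n := by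
  have h := norm_ext_word_mul_weight_le ha haγ hR haR hC hc hφ n v hρ hY hYρ hz
  have hs0 := wordWeight_nonneg n v
  have hs1 := wordWeight_le n v
  have hT0 : 0 ≤ T := (sq_nonneg _).trans hT
  rw [norm_mul, norm_exp_mul_sq] at h
  set s := wordWeight n v
  have e : Real.exp (-(2 * c * s) * (z.re ^ 2 - z.im ^ 2)) * Real.exp (2 * c * s * (z.re ^ 2 - z.im ^ 2))
      = 1 := by rw [← Real.exp_add]; ring_nf; exact Real.exp_zero
  have h3 : Real.exp (2 * c * s * (z.re ^ 2 - z.im ^ 2)) ≤ Real.exp (2 * c * T) ^ n := by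
    rw [← Real.exp_nat_mul]
    refine Real.exp_le_exp.2 ?_
    have h4 : s * (z.re ^ 2 - z.im ^ 2) ≤ n * T := by
      calc s * (z.re ^ 2 - z.im ^ 2) ≤ s * T :=
            mul_le_mul_of_nonneg_left (by nlinarith [sq_nonneg z.im]) hs0
        _ ≤ n * T := mul_le_mul_of_nonneg_right hs1 hT0
    nlinarith
  calc ‖𝒮.ext (word N a n v) Y z‖ = ‖𝒮.ext (word N a n v) Y z‖ *
        Real.exp (-(2 * c * s) * (z.re ^ 2 - z.im ^ 2)) *
        Real.exp (2 * c * s * (z.re ^ 2 - z.im ^ 2)) := by rw [mul_assoc, e, mul_one]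
    _ ≤ (C * Real.exp (c * ρ ^ 2) * ‖Y‖ * (‖a‖ * Real.exp (2 * c * R ^ 2 + 2 * c)) ^ n) *
        Real.exp (2 * c * T) ^ n :=
        mul_le_mul h h3 (Real.exp_pos _).le (by positivity)
    _ = _ := by rw [mul_pow _ (Real.exp (2 * c * T))]; ring

end Bounds

/-- The Dyson series in terms of words. -/
lemma φ_mul_dysonW_mul {a : BoundedOp H} (ha : a ∈ 𝒮.smooth) (n : ℕ) (t : ℝ) {X Z : BoundedOp H}
    (hX : X ∈ 𝒮.dom) (hZ : Z ∈ 𝒮.dom) : 𝒮.φ (X * dysonW (fun u => N.α u a) n t * Z) =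
      (Complex.I * t) ^ n * cubeInt n fun v => 𝒮.φ (X * word N a n v t * Z) := by
  induction n generalizing t Z with
  | zero => simp [dysonW, cubeInt, word]
  | succ n ih =>
    have hs := (smoothCurve_dysonW ha n).mul (SmoothCurve.orbit ha)
    have h1 := φ_mul_sint_mul hs hX hZ t
    -- The outer integration variable u = lt is the time of the last factor; l becomes the first
    -- ratio coordinate of the word.
    have h2 := intervalIntegral.smul_integral_comp_mul_right (a := 0) (b := 1)
      (fun u => 𝒮.φ (X * (dysonW (fun u => N.α u a) n u * N.α u a) * Z)) t
    rw [zero_mul, one_mul] at h2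
    rw [dysonW, mul_smul_comm, smul_mul_assoc, map_smul, h1, ← h2, cubeInt, pow_succ', smul_eq_mul,
      ← Complex.coe_smul, smul_eq_mul, mul_assoc, mul_assoc]
    congr 2
    rw [← intervalIntegral.integral_const_mul]
    refine intervalIntegral.integral_congr fun l hl => ?_
    rw [uIcc_of_le zero_le_one] at hl
    have h3 := ih (l * t) (mul_mem (𝒮.smooth_le (𝒮.α_smooth (l * t) a ha)) hZ)
    simp only [mul_assoc] at h3 ⊢
    rw [h3]
    simp only [word, Fin.tail_cons, Fin.cons_zero, clamp_of_mem hl, mul_assoc]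
    push_cast
    ring

end LocalSystem

/-! ### Evenness of the cocycle. -/

namespace GradedNet

variable {H : Type*} [NormedAddCommGroup H] [InnerProductSpace ℂ H] [CompleteSpace H]
  {N : GradedNet H} {a : BoundedOp H}

lemma γ_dysonW (haγ : N.γ a = a) (n : ℕ) (t : ℝ) :
    N.γ (dysonW (fun u => N.α u a) n t) = dysonW (fun u => N.α u a) n t := by
  have hA := N.strongCont_orbit a
  induction n generalizing t with
  | zero => exact N.γ_one
  | succ n ih =>
    have hf := (continuous_dysonW hA n).strongCont.mul hA
    rw [dysonW, N.γ_smul, γ_eq, mul_sint hf, sint_mul (hf.const_mul _)]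
    congr 2
    ext1 u
    rw [← γ_eq, N.γ_mul, ih, N.γ_α, haγ]

lemma γ_cocycle (haγ : N.γ a = a) (t : ℝ) : N.γ (N.cocycle a t) = N.cocycle a t := by
  have h := ((N.hasSum_cocycle a t).mul_left N.Γ).mul_right N.Γ
  simp only [← γ_eq, γ_dysonW haγ] at h
  exact h.unique (N.hasSum_cocycle a t)

end GradedNet

/-! ### The continued Dyson series and its growth. -/

namespace LocalSystem

variable {H : Type*} [NormedAddCommGroup H] [InnerProductSpace ℂ H] [CompleteSpace H]
  {N : GradedNet H} {𝒮 : LocalSystem N} {a : BoundedOp H}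

/-- The terms of the series for the continuation of `t ↦ φ(X γ^a_t(1))`. -/
def cocycleTerm (𝒮 : LocalSystem N) (a : BoundedOp H) (n : ℕ) (X : BoundedOp H) (z : ℂ) : ℂ :=
  (Complex.I * z) ^ n * cubeInt n fun v => 𝒮.ext (word N a n v) X (stripRetract z)

lemma norm_cocycleTerm_le (ha : a ∈ 𝒮.dom) (haγ : N.γ a = a) {R C c : ℝ} (hR : 0 ≤ R)
    (haR : a ∈ N.loc R) (hC : 0 ≤ C) (hc : 0 ≤ c)
    (hφ : ∀ ρ, 0 ≤ ρ → ∀ x ∈ 𝒮.dom, x ∈ N.loc ρ → ‖𝒮.φ x‖ ≤ C * Real.exp (c * ρ ^ 2) * ‖x‖)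
    (n : ℕ) {ρ K S T : ℝ} (hρ : 0 ≤ ρ) {X : BoundedOp H} (hX : X ∈ 𝒮.dom) (hXρ : X ∈ N.loc ρ)
    (hXK : ‖X‖ ≤ K) {z : ℂ} (hz : ‖z‖ ≤ S) (hT : z.re ^ 2 ≤ T) :
    ‖cocycleTerm 𝒮 a n X z‖ ≤ C * Real.exp (c * ρ ^ 2) * K *
      ((S * (‖a‖ * Real.exp (2 * c * R ^ 2 + 2 * c) * Real.exp (2 * c * T))) ^ n / n.factorial) := by
  have h := norm_cubeInt_le (f := fun v => 𝒮.ext (word N a n v) X (stripRetract z)) fun v =>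
    norm_ext_word_le ha haγ hR haR hC hc hφ n v hρ hX hXρ (stripRetract_mem z) (T := T)
      (by rwa [stripRetract_re])
  have hK : 0 ≤ K := (norm_nonneg _).trans hXK
  rw [cocycleTerm, norm_mul, norm_pow, norm_mul, Complex.norm_I, one_mul]
  calc _ ≤ S ^ n * (C * Real.exp (c * ρ ^ 2) * K *
      (‖a‖ * Real.exp (2 * c * R ^ 2 + 2 * c) * Real.exp (2 * c * T)) ^ n / n.factorial) := by
        refine mul_le_mul (pow_le_pow_left₀ (norm_nonneg _) hz n) (h.trans ?_) (norm_nonneg _)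
          (pow_nonneg ((norm_nonneg _).trans hz) n)
        gcongr
    _ = _ := by rw [mul_pow]; ring

lemma continuous_cocycleTerm (ha : a ∈ 𝒮.dom) (haγ : N.γ a = a) (n : ℕ) {Θ : Type}
    [TopologicalSpace Θ] [LocallyCompactSpace Θ] {X : Θ → BoundedOp H} {ζ : Θ → ℂ}
    (hX : 𝒮.DomFamily X) (hζ : Continuous ζ) :
    Continuous fun θ => cocycleTerm 𝒮 a n (X θ) (ζ θ) := by
  refine Continuous.mul (by fun_prop) (continuous_cubeInt ?_)
  exact (goodFamily_word ha haγ n).continuous_ext (hX.comp continuous_fst) continuous_snd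
    (continuous_stripRetract.comp (hζ.comp continuous_fst)) fun _ => stripRetract_mem _

lemma differentiableOn_cocycleTerm (ha : a ∈ 𝒮.dom) (haγ : N.γ a = a) (n : ℕ) {X : BoundedOp H}
    (hX : X ∈ 𝒮.dom) : DifferentiableOn ℂ (cocycleTerm 𝒮 a n X) openStrip := by
  obtain ⟨C, c, hC, hc, hφ⟩ := 𝒮.φ_bound
  obtain ⟨R, hR, haR⟩ := 𝒮.exists_loc a ha
  obtain ⟨ρ, hρ, hXρ⟩ := 𝒮.exists_loc X hX
  have hW := goodFamily_word ha haγ n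
  refine DifferentiableOn.mul (by fun_prop) (differentiableOn_cubeInt isOpen_openStrip
    (fun z _ => ?_) (fun v => ?_) fun z₀ _ => ?_)
  · exact hW.continuous_ext (DomFamily.const hX) continuous_id continuous_const
      fun _ => stripRetract_mem _
  · exact (hW.isStripContinuation v hX).1.2.congr fun z hz => by
      rw [stripRetract_of_mem (openStrip_subset hz)]
  · refine ⟨_, 1, one_pos, fun v z hz => norm_ext_word_le ha haγ hR haR hC hc hφ n v hρ hX hXρ
      (stripRetract_mem z) (T := (|z₀.re| + 1) ^ 2) ?_⟩
    rw [stripRetract_re, ← sq_abs]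
    have h1 : |z.re - z₀.re| < 1 := by
      rw [← Complex.sub_re]
      exact lt_of_le_of_lt (Complex.abs_re_le_norm _) (by rwa [← dist_eq_norm])
    have h2 := abs_sub_abs_le_abs_sub z.re z₀.re
    exact pow_le_pow_left₀ (abs_nonneg _) (by linarith) 2

/-- The series for the continuation of `t ↦ φ(X γ^a_t(1))`. -/
def cocycleExt (𝒮 : LocalSystem N) (a : BoundedOp H) (X : BoundedOp H) (z : ℂ) : ℂ :=
  ∑' n, cocycleTerm 𝒮 a n X z

/-- Weierstrass test: the majorants are uniform for z and ‖X‖ bounded and X in a fixed local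
algebra. Continuity in X as well as in z is needed for the good-family property of the cocycle. -/
lemma continuous_cocycleExt (ha : a ∈ 𝒮.dom) (haγ : N.γ a = a) {Θ : Type}
    [TopologicalSpace Θ] [LocallyCompactSpace Θ] {X : Θ → BoundedOp H} {ζ : Θ → ℂ}
    (hX : 𝒮.DomFamily X) (hζ : Continuous ζ) :
    Continuous fun θ => cocycleExt 𝒮 a (X θ) (ζ θ) := by
  obtain ⟨C, c, hC, hc, hφ⟩ := 𝒮.φ_bound
  obtain ⟨R, hR, haR⟩ := 𝒮.exists_loc a ha
  refine continuous_iff_continuousAt.2 fun θ₀ => ?_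
  obtain ⟨ρ, hρ, h1⟩ := hX.loc θ₀
  obtain ⟨K, hK, h2⟩ := hX.exists_norm_bound θ₀
  have h3 : ∀ᶠ θ in 𝓝 θ₀, ‖ζ θ‖ < ‖ζ θ₀‖ + 1 :=
    hζ.norm.continuousAt.eventually_lt continuousAt_const (by linarith)
  set S := ‖ζ θ₀‖ + 1
  refine ContinuousOn.continuousAt (s := {θ | X θ ∈ N.loc ρ ∧ ‖X θ‖ ≤ K ∧ ‖ζ θ‖ < S}) ?_
    (by filter_upwards [h1, h2, h3] with θ h1 h2 h3 using ⟨h1, h2, h3⟩)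
  refine continuousOn_tsum (fun n => (continuous_cocycleTerm ha haγ n hX hζ).continuousOn)
    ((Real.summable_pow_div_factorial (S * (‖a‖ * Real.exp (2 * c * R ^ 2 + 2 * c) *
      Real.exp (2 * c * S ^ 2)))).mul_left (C * Real.exp (c * ρ ^ 2) * K)) fun n θ hθ => ?_
  refine norm_cocycleTerm_le ha haγ hR haR hC hc hφ n hρ (hX.mem θ) hθ.1 hθ.2.1 hθ.2.2.le ?_
  rw [← sq_abs]
  exact pow_le_pow_left₀ (abs_nonneg _) ((Complex.abs_re_le_norm _).trans hθ.2.2.le) 2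

lemma isStripAnalytic_cocycleExt (ha : a ∈ 𝒮.dom) (haγ : N.γ a = a) {X : BoundedOp H}
    (hX : X ∈ 𝒮.dom) : IsStripAnalytic (cocycleExt 𝒮 a X) := by
  refine ⟨(continuous_cocycleExt ha haγ (DomFamily.const hX) continuous_id).continuousOn,
    fun z₀ hz₀ => ?_⟩
  obtain ⟨C, c, hC, hc, hφ⟩ := 𝒮.φ_bound
  obtain ⟨R, hR, haR⟩ := 𝒮.exists_loc a ha
  obtain ⟨ρ, hρ, hXρ⟩ := 𝒮.exists_loc X hX
  set S := ‖z₀‖ + 1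
  have hU : IsOpen (openStrip ∩ Metric.ball z₀ 1) := isOpen_openStrip.inter Metric.isOpen_ball
  have h := Complex.differentiableOn_tsum_of_summable_norm (F := fun n => cocycleTerm 𝒮 a n X)
    ((Real.summable_pow_div_factorial (S * (‖a‖ * Real.exp (2 * c * R ^ 2 + 2 * c) *
      Real.exp (2 * c * S ^ 2)))).mul_left (C * Real.exp (c * ρ ^ 2) * ‖X‖))
    (fun n => (differentiableOn_cocycleTerm ha haγ n hX).mono inter_subset_left) hU
    fun n z hz => ?_
  · exact (h.differentiableAt (hU.mem_nhds ⟨hz₀, Metric.mem_ball_self one_pos⟩)).differentiableWithinAt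
  · have h1 : ‖z‖ ≤ S := by
      have := Metric.mem_ball.1 hz.2
      rw [dist_eq_norm] at this
      linarith [norm_sub_norm_le z z₀]
    refine norm_cocycleTerm_le ha haγ hR haR hC hc hφ n hρ hX hXρ le_rfl h1 ?_
    rw [← sq_abs]
    exact pow_le_pow_left₀ (abs_nonneg _) ((Complex.abs_re_le_norm _).trans h1) 2

/-- At real t the terms are φ(X W_n(t)). The Dyson series converges in norm inside one local
algebra, so local normality sums them to φ(X W_t). -/
lemma isStripContinuation_cocycleExt (ha : a ∈ 𝒮.smooth) (haγ : N.γ a = a) {X : BoundedOp H}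
    (hX : X ∈ 𝒮.dom) :
    IsStripContinuation (fun t => 𝒮.φ (X * N.cocycle a t)) (cocycleExt 𝒮 a X) := by
  have ha' := 𝒮.smooth_le ha
  refine ⟨isStripAnalytic_cocycleExt ha' haγ hX, fun t => ?_⟩
  obtain ⟨C, c, hC, hc, hφ⟩ := 𝒮.φ_bound
  obtain ⟨R, hR, haR⟩ := 𝒮.exists_loc a ha'
  obtain ⟨ρ, hρ, hXρ⟩ := 𝒮.exists_loc X hX
  have hterm : ∀ n, cocycleTerm 𝒮 a n X t = 𝒮.φ (X * dysonW (fun u => N.α u a) n t) := fun n => by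
    have h := φ_mul_dysonW_mul ha n t hX (one_mem _)
    simp only [mul_one] at h
    rw [h, cocycleTerm]
    congr 2
    ext1 v
    rw [stripRetract_of_mem (ofReal_mem_closedStrip t), (goodFamily_word ha' haγ n).ext_ofReal v hX]
  have hsum : Summable fun n => cocycleTerm 𝒮 a n X t :=
    Summable.of_norm_bounded ((Real.summable_pow_div_factorial _).mul_left _) fun n =>
      norm_cocycleTerm_le ha' haγ hR haR hC hc hφ n hρ hX hXρ le_rfl le_rfl le_rfl
  have hop := (N.hasSum_cocycle a t).mul_left X
  have hl1 : 0 ≤ max ρ (R + |t|) := le_max_of_le_left hρ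
  have hlim := hop.tendsto_sum_nat
  have h2 := 𝒮.φ_tendsto atTop (max ρ (R + |t|)) (‖X * N.cocycle a t‖ + 1) _ _
    (Eventually.of_forall fun n => ⟨sum_mem fun k _ => mul_mem hX
        (𝒮.smooth_le ((smoothCurve_dysonW ha k).mem t)),
      sum_mem fun k _ => mul_mem (N.loc_mono (le_max_left _ _) hXρ)
        (N.loc_mono (le_max_right _ _) (dysonW_mem_loc ha hR haR k t))⟩)
    (mul_mem hX (𝒮.smooth_le ((smoothCurve_cocycle ha).mem t)))
    (mul_mem (N.loc_mono (le_max_left _ _) hXρ)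
      (N.loc_mono (le_max_right _ _) (cocycle_mem_loc ha hR haR t)))
    ((hlim.norm.eventually_lt_const (by linarith)).mono fun _ h => h.le)
    fun ξ => ((ContinuousLinearMap.apply ℂ H ξ).continuous.tendsto _).comp hlim
  simp only [map_sum, ← hterm] at h2
  exact tendsto_nhds_unique hsum.hasSum.tendsto_sum_nat h2

variable (ha : a ∈ 𝒮.smooth) (haγ : N.γ a = a) 

include ha haγ

lemma ext_cocycle_eq {X : BoundedOp H} (hX : X ∈ 𝒮.dom) {z : ℂ} (hz : z ∈ closedStrip) :
    𝒮.ext (N.cocycle a) X z = cocycleExt 𝒮 a X z :=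
  (isStripContinuation_cocycleExt ha haγ hX).stripExt_eq hz

lemma isStripContinuation_ext_cocycle {X : BoundedOp H} (hX : X ∈ 𝒮.dom) :
    IsStripContinuation (fun t => 𝒮.φ (X * N.cocycle a t)) (𝒮.ext (N.cocycle a) X) :=
  isStripContinuation_stripExt ⟨_, isStripContinuation_cocycleExt ha haγ hX⟩

/-- On the imaginary segment one may take T = 0, so the Gaussian weights disappear and the series
sums to an exponential. The bound depends on a only through A and R, which later gives uniformity in
the coupling. -/
lemma norm_ext_cocycle_le_of_re_eq_zero {R C c A : ℝ} (hR : 0 ≤ R)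
    (haR : a ∈ N.loc R) (hC : 0 ≤ C) (hc : 0 ≤ c)
    (hφ : ∀ ρ, 0 ≤ ρ → ∀ x ∈ 𝒮.dom, x ∈ N.loc ρ → ‖𝒮.φ x‖ ≤ C * Real.exp (c * ρ ^ 2) * ‖x‖)
    (hA : ‖a‖ ≤ A) {ρ K : ℝ} (hρ : 0 ≤ ρ) {X : BoundedOp H} (hX : X ∈ 𝒮.dom) (hXρ : X ∈ N.loc ρ)
    (hXK : ‖X‖ ≤ K) {z : ℂ} (hz : z ∈ closedStrip) (hz0 : z.re = 0) :
    ‖𝒮.ext (N.cocycle a) X z‖ ≤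
      C * Real.exp (c * ρ ^ 2) * K * Real.exp (A * Real.exp (2 * c * R ^ 2 + 2 * c)) := by
  have hz1 : ‖z‖ ≤ 1 := by
    have := norm_le_of_mem_closedStrip hz
    rwa [hz0, abs_zero, zero_add] at this
  have h := fun n => norm_cocycleTerm_le (𝒮.smooth_le ha) haγ hR haR hC hc hφ n hρ hX hXρ hXK hz1
    (T := 0) (by simp [hz0])
  simp only [mul_zero, Real.exp_zero, mul_one, one_mul] at h
  rw [ext_cocycle_eq ha haγ hX hz]
  have hK : 0 ≤ K := (norm_nonneg _).trans hXK
  have hexp := NormedSpace.expSeries_div_hasSum_exp (𝔸 := ℝ) (‖a‖ * Real.exp (2 * c * R ^ 2 + 2 * c))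
  rw [← Real.exp_eq_exp_ℝ] at hexp
  refine (tsum_of_norm_bounded (hexp.mul_left _) h).trans ?_
  gcongr

variable (hsa : IsSelfAdjoint a)

include hsa

/-- Translation of the continuation. -/
lemma ext_cocycle_add {X : BoundedOp H} (hX : X ∈ 𝒮.dom) (t : ℝ) {z : ℂ} (hz : z ∈ closedStrip) :
    𝒮.ext (N.cocycle a) X (t + z) = 𝒮.ext (N.cocycle a) (N.α (-t) (X * N.cocycle a t)) z := by
  have hW : ∀ t, N.cocycle a t ∈ 𝒮.dom := fun t => 𝒮.smooth_le ((smoothCurve_cocycle ha).mem t)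
  have h1 := isStripContinuation_ext_cocycle ha haγ hX
  have h2 := isStripContinuation_ext_cocycle ha haγ (𝒮.α_dom (-t) _ (mul_mem hX (hW t)))
  refine IsStripAnalytic.eqOn (F := fun z => 𝒮.ext (N.cocycle a) X (t + z))
    (h1.1.comp_affine (by fun_prop) (fun z hz => ?_) fun z hz => ?_) h2.1 (fun s => ?_) hz
  · simpa [closedStrip] using hz
  · simpa [openStrip] using hz
  · have h3 := h1.2 (t + s)
    push_cast at h3
    rw [h3, h2.2, N.cocycle_add hsa, ← 𝒮.φ_α (-t) (mul_mem hX (mul_mem (hW t) (𝒮.α_dom t _ (hW s)))),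
      N.α_mul, N.α_mul, N.α_α, N.α_mul, neg_add_cancel, N.α_zero]
    simp only [mul_assoc]

/-- Summing the series at real part t directly gives a double-exponential bound. Instead
`ext_cocycle_add` translates z to the imaginary segment; the left factor becomes α_{-t}(X W_t),
whose norm is at most ‖X‖ and whose radius is ρ + R + 2|t|. The growth is then Gaussian. Equal
coefficients 12 for ρ² and t² are chosen because `GoodFamily.bound` has a single exponent. -/
lemma norm_ext_cocycle_le {R C c A : ℝ} (hR : 0 ≤ R)
    (haR : a ∈ N.loc R) (hC : 0 ≤ C) (hc : 0 ≤ c)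
    (hφ : ∀ ρ, 0 ≤ ρ → ∀ x ∈ 𝒮.dom, x ∈ N.loc ρ → ‖𝒮.φ x‖ ≤ C * Real.exp (c * ρ ^ 2) * ‖x‖)
    (hA : ‖a‖ ≤ A) {ρ : ℝ} (hρ : 0 ≤ ρ) {X : BoundedOp H} (hX : X ∈ 𝒮.dom) (hXρ : X ∈ N.loc ρ)
    {z : ℂ} (hz : z ∈ closedStrip) :
    ‖𝒮.ext (N.cocycle a) X z‖ ≤ C * Real.exp (A * Real.exp (2 * c * R ^ 2 + 2 * c)) *
      Real.exp (3 * c * R ^ 2) * Real.exp (12 * c * ρ ^ 2) * ‖X‖ * Real.exp (12 * c * z.re ^ 2) := by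
  have hW : N.cocycle a z.re ∈ 𝒮.dom := 𝒮.smooth_le ((smoothCurve_cocycle ha).mem _)
  set t := z.re
  have hz' : z - t ∈ closedStrip := by simpa [closedStrip] using hz
  have hXW : X * N.cocycle a t ∈ N.loc (ρ + R + |t|) :=
    mul_mem (N.loc_mono (by linarith [abs_nonneg t]) hXρ)
      (N.loc_mono (by linarith) (cocycle_mem_loc ha hR haR t))
  have hloc := N.α_mem_loc (by positivity) hXW (-t)
  rw [abs_neg] at hloc
  have hn : ‖N.α (-t) (X * N.cocycle a t)‖ ≤ ‖X‖ := by
    rw [N.norm_α]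
    exact (norm_mul_le _ _).trans (mul_le_of_le_one_right (norm_nonneg _) (N.norm_cocycle_le hsa t))
  have h := norm_ext_cocycle_le_of_re_eq_zero ha haγ hR haR hC hc hφ hA (by positivity)
    (𝒮.α_dom (-t) _ (mul_mem hX hW)) hloc hn hz' (by simp [t])
  rw [← ext_cocycle_add ha haγ hsa hX t hz', add_sub_cancel] at h
  refine h.trans ?_
  have hsq : (ρ + R + |t| + |t|) ^ 2 ≤ 3 * R ^ 2 + 12 * ρ ^ 2 + 12 * t ^ 2 := by
    nlinarith [sq_abs t, sq_nonneg (ρ - R), sq_nonneg (ρ - 2 * |t|), sq_nonneg (R - 2 * |t|),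
      sq_nonneg ρ]
  calc _ ≤ C * Real.exp (c * (3 * R ^ 2 + 12 * ρ ^ 2 + 12 * t ^ 2)) * ‖X‖ *
      Real.exp (A * Real.exp (2 * c * R ^ 2 + 2 * c)) := by gcongr
    _ = _ := by
      rw [mul_add, mul_add, Real.exp_add, Real.exp_add]
      ring_nf

/-- The perturbed cocycle has the continuity properties of the words. -/
theorem goodFamily_cocycle : 𝒮.GoodFamily fun _ : Unit => N.cocycle a := by
  obtain ⟨C, c, hC, hc, hφ⟩ := 𝒮.φ_bound
  obtain ⟨R, hR, haR⟩ := 𝒮.exists_loc a (𝒮.smooth_le ha)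
  refine ⟨(smoothCurve_cocycle ha).domFamily.comp continuous_snd,
    ⟨R, hR, fun _ => cocycle_mem_loc ha hR haR⟩, fun _ => N.γ_cocycle haγ,
    ⟨1, zero_le_one, fun _ => N.norm_cocycle_le hsa⟩,
    fun _ X hX => ⟨_, isStripContinuation_ext_cocycle ha haγ hX⟩,
    ⟨C * Real.exp (‖a‖ * Real.exp (2 * c * R ^ 2 + 2 * c)) * Real.exp (3 * c * R ^ 2), 12 * c,
      by positivity, by positivity, fun _ ρ hρ Y hY hYρ z hz =>
      norm_ext_cocycle_le ha haγ hsa hR haR hC hc hφ le_rfl hρ hY hYρ hz⟩, fun hX _ hτ => ?_⟩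
  simp only [ext_cocycle_eq ha haγ (hX.mem _) (ofReal_add_I_mem_closedStrip _)]
  exact continuous_cocycleExt (𝒮.smooth_le ha) haγ hX (by fun_prop)

end LocalSystem

lemma IsStripAnalytic.conj {F : ℂ → ℂ} (hF : IsStripAnalytic F) :
    IsStripAnalytic fun z => star (F (-star z)) := by
  refine ⟨continuous_star.comp_continuousOn (hF.1.comp (by fun_prop) fun z hz => ?_), fun z hz => ?_⟩
  · simpa [closedStrip] using hz
  · have hz' : -star z ∈ openStrip := by simpa [openStrip] using hz
    have h := hF.2.differentiableAt (isOpen_openStrip.mem_nhds hz')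
    have h2 : DifferentiableAt ℂ (fun w => F (-w)) (star z) :=
      h.comp (star z) differentiable_neg.differentiableAt
    have h3 := h2.star_star
    rw [star_star] at h3
    exact h3.differentiableWithinAt

/-! ### The perturbed flow in terms of the cocycle. -/

namespace GradedNet

variable {H : Type*} [NormedAddCommGroup H] [InnerProductSpace ℂ H] [CompleteSpace H]
  (N : GradedNet H)

/-- The flow `x ↦ γ^a_t(1) α_t(x) γ^a_t(1)^*`. -/
def flow (a : BoundedOp H) (t : ℝ) (x : BoundedOp H) : BoundedOp H :=
  N.cocycle a t * N.α t x * star (N.cocycle a t)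

variable {N} {a : BoundedOp H} (hsa : IsSelfAdjoint a)

include hsa

lemma flow_eq (t : ℝ) (x : BoundedOp H) :
    N.flow a t x = N.cocycle a t * N.α t (x * N.cocycle a (-t)) := by
  rw [flow, N.star_cocycle_eq hsa, N.α_mul, mul_assoc]

/-- A factor W on the right cancels the W^* of the flow. The KMS argument can then regard the same
expression both as W after a flow and as an orbit after W. -/
lemma flow_mul_cocycle (t s : ℝ) (x : BoundedOp H) :
    N.flow a t x * N.cocycle a (s + t) = N.cocycle a t * N.α t (x * N.cocycle a s) := by
  rw [flow, add_comm s t, N.cocycle_add hsa, N.α_mul]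
  calc _ = N.cocycle a t * N.α t x * (star (N.cocycle a t) * N.cocycle a t) *
      N.α t (N.cocycle a s) := by simp only [mul_assoc]
    _ = _ := by rw [N.star_mul_cocycle hsa, mul_one, mul_assoc]

lemma flow_flow (t s : ℝ) (x : BoundedOp H) : N.flow a t (N.flow a s x) = N.flow a (t + s) x := by
  simp only [flow, N.cocycle_add hsa t s, N.α_mul, star_mul, N.α_star, N.α_α, mul_assoc]

omit hsa

lemma flow_zero (x : BoundedOp H) : N.flow a 0 x = x := by
  rw [flow, cocycle_zero, star_one, N.α_zero, one_mul, mul_one]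

lemma flow_smul (t : ℝ) (c : ℂ) (x : BoundedOp H) : N.flow a t (c • x) = c • N.flow a t x := by
  simp only [flow, N.α_smul, mul_smul_comm, smul_mul_assoc]

end GradedNet

/-! ### The perturbed functional: linearity, KMS property and hermiticity. -/

namespace LocalSystem

variable {H : Type*} [NormedAddCommGroup H] [InnerProductSpace ℂ H] [CompleteSpace H]
  {N : GradedNet H} {𝒮 : LocalSystem N}

namespace GoodFamily

variable {Ω : Type} [TopologicalSpace Ω] {Z : Ω → ℝ → BoundedOp H} (hZ : 𝒮.GoodFamily Z)

include hZ

lemma ext_add (ω : Ω) {X Y : BoundedOp H} (hX : X ∈ 𝒮.dom) (hY : Y ∈ 𝒮.dom) {z : ℂ}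
    (hz : z ∈ closedStrip) : 𝒮.ext (Z ω) (X + Y) z = 𝒮.ext (Z ω) X z + 𝒮.ext (Z ω) Y z := by
  have h1 := hZ.isStripContinuation ω hX
  have h2 := hZ.isStripContinuation ω hY
  refine IsStripContinuation.stripExt_eq ⟨h1.1.add h2.1, fun t => ?_⟩ hz
  rw [h1.2, h2.2, add_mul, map_add]

lemma ext_smul (ω : Ω) (c : ℂ) {X : BoundedOp H} (hX : X ∈ 𝒮.dom) {z : ℂ}
    (hz : z ∈ closedStrip) : 𝒮.ext (Z ω) (c • X) z = c * 𝒮.ext (Z ω) X z := by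
  have h1 := hZ.isStripContinuation ω hX
  refine IsStripContinuation.stripExt_eq ⟨h1.1.const_mul c, fun t => ?_⟩ hz
  rw [h1.2, smul_mul_assoc, map_smul, smul_eq_mul]

lemma gaussGrowth_shift (ω : Ω) {Y : BoundedOp H} (hY : Y ∈ 𝒮.dom) (y : ℝ) :
    GaussGrowth fun z => 𝒮.ext (Z ω) Y (z + y) := by
  obtain ⟨K, Λ, hK, hΛ, hb⟩ := hZ.bound
  obtain ⟨ρ, hρ, hYρ⟩ := 𝒮.exists_loc Y hY
  refine ⟨K * Real.exp (Λ * ρ ^ 2) * ‖Y‖ * Real.exp (2 * Λ * y ^ 2), 2 * Λ, fun z hz => ?_⟩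
  refine (hb ω ρ hρ Y hY hYρ (z + y) (by simpa [closedStrip] using hz)).trans ?_
  rw [mul_assoc _ (Real.exp _) (Real.exp _), ← Real.exp_add]
  refine mul_le_mul_of_nonneg_left (Real.exp_le_exp.2 ?_) (by positivity)
  simp only [Complex.add_re, Complex.ofReal_re]
  nlinarith [mul_nonneg hΛ (sq_nonneg (z.re - y))]

lemma edgeCont_shift (ω : Ω) {Y : BoundedOp H} (hY : Y ∈ 𝒮.dom) (y : ℝ) :
    EdgeCont (fun x => 𝒮.φ (Y * Z ω (x + y))) fun x => 𝒮.ext (Z ω) Y (x + y + Complex.I) := by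
  refine ⟨_, (hZ.isStripContinuation ω hY).1.comp_affine (ψ := fun z => z + y) (by fun_prop)
    (fun z hz => by simpa [closedStrip] using hz) (fun z hz => by simpa [openStrip] using hz),
    hZ.gaussGrowth_shift ω hY y, fun x => ?_, fun x => ?_⟩
  · have := hZ.ext_ofReal ω hY (x + y)
    push_cast at this
    exact this
  · beta_reduce; congr 1; ring

lemma gaussBounded_ext (ω : Ω) {X : ℝ → ℝ → BoundedOp H} {R M : ℝ} (hR : 0 ≤ R)
    (hX : ∀ x y, X x y ∈ 𝒮.dom) (hloc : ∀ x y, X x y ∈ N.loc (R + |x| + |y|))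
    (hM : ∀ x y, ‖X x y‖ ≤ M) {τ : ℝ → ℝ → ℝ} (hτ : ∀ x y, |τ x y| ≤ |x| + |y|) :
    GaussBounded fun x y => 𝒮.ext (Z ω) (X x y) (τ x y + Complex.I) := by
  obtain ⟨K, Λ, hK, hΛ, hb⟩ := hZ.bound
  have hM0 : 0 ≤ M := (norm_nonneg _).trans (hM 0 0)
  refine ⟨K * Real.exp (Λ * (3 * R ^ 2)) * M, 5 * Λ, fun x y => ?_⟩
  refine (hb ω _ (by positivity) _ (hX x y) (hloc x y) _ (ofReal_add_I_mem_closedStrip _)).trans ?_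
  have h1 : (R + |x| + |y|) ^ 2 ≤ 3 * R ^ 2 + 3 * (x ^ 2 + y ^ 2) := by
    nlinarith [sq_abs x, sq_abs y, sq_nonneg (R - |x|), sq_nonneg (R - |y|), sq_nonneg (|x| - |y|)]
  have h2 : (τ x y) ^ 2 ≤ 2 * (x ^ 2 + y ^ 2) := by
    rw [← sq_abs]
    have := pow_le_pow_left₀ (abs_nonneg _) (hτ x y) 2
    nlinarith [sq_abs x, sq_abs y, sq_nonneg (|x| - |y|)]
  have e : ((τ x y : ℂ) + Complex.I).re = τ x y := by simp
  rw [e]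
  calc _ ≤ K * Real.exp (Λ * (3 * R ^ 2 + 3 * (x ^ 2 + y ^ 2))) * M *
        Real.exp (Λ * (2 * (x ^ 2 + y ^ 2))) := by gcongr; exact hM x y
    _ = _ := by
      rw [mul_add, Real.exp_add]
      have : Real.exp (5 * Λ * (x ^ 2 + y ^ 2)) = Real.exp (Λ * (3 * (x ^ 2 + y ^ 2))) *
          Real.exp (Λ * (2 * (x ^ 2 + y ^ 2))) := by rw [← Real.exp_add]; ring_nf
      rw [this]; ring

end GoodFamily

/-- The perturbed functional `φ^a(X)`, the value at `i` of the continuation of `φ(X γ^a_t(1))`. -/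
def pert (𝒮 : LocalSystem N) (a X : BoundedOp H) : ℂ := 𝒮.ext (N.cocycle a) X Complex.I

/-- Even selfadjoint smooth elements. -/
structure EvenPerturbation (𝒮 : LocalSystem N) (a : BoundedOp H) : Prop where
  smooth : a ∈ 𝒮.smooth
  even : N.γ a = a
  sa : IsSelfAdjoint a

namespace EvenPerturbation

variable {a : BoundedOp H} (hp : 𝒮.EvenPerturbation a)

include hp

lemma goodFamily : 𝒮.GoodFamily fun _ : Unit => N.cocycle a :=
  goodFamily_cocycle hp.smooth hp.even hp.sa

lemma cocycle_smooth (t : ℝ) : N.cocycle a t ∈ 𝒮.smooth := (smoothCurve_cocycle hp.smooth).mem t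

lemma cocycle_dom (t : ℝ) : N.cocycle a t ∈ 𝒮.dom := 𝒮.smooth_le (hp.cocycle_smooth t)

lemma exists_loc : ∃ R, 0 ≤ R ∧ a ∈ N.loc R := 𝒮.exists_loc a (𝒮.smooth_le hp.smooth)

lemma flow_smooth (t : ℝ) {x : BoundedOp H} (hx : x ∈ 𝒮.smooth) : N.flow a t x ∈ 𝒮.smooth :=
  mul_mem (mul_mem (hp.cocycle_smooth t) (𝒮.α_smooth t x hx)) (star_mem (hp.cocycle_smooth t))

lemma flow_dom (t : ℝ) {x : BoundedOp H} (hx : x ∈ 𝒮.dom) : N.flow a t x ∈ 𝒮.dom :=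
  mul_mem (mul_mem (hp.cocycle_dom t) (𝒮.α_dom t x hx)) (star_mem (hp.cocycle_dom t))

lemma flow_mem_loc {R ρ : ℝ} (hR : 0 ≤ R) (haR : a ∈ N.loc R) (hρ : 0 ≤ ρ) {x : BoundedOp H}
    (hx : x ∈ N.loc ρ) (t : ℝ) : N.flow a t x ∈ N.loc (max R ρ + |t|) := by
  have h1 : N.cocycle a t ∈ N.loc (max R ρ + |t|) :=
    N.loc_mono (by linarith [le_max_left R ρ]) (cocycle_mem_loc hp.smooth hR haR t)
  exact mul_mem (mul_mem h1 (N.loc_mono (by linarith [le_max_right R ρ]) (N.α_mem_loc hρ hx t)))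
    (star_mem h1)

lemma norm_flow_le (t : ℝ) (x : BoundedOp H) : ‖N.flow a t x‖ ≤ ‖x‖ := by
  have h := N.norm_cocycle_le hp.sa t
  calc ‖N.flow a t x‖ ≤ ‖N.cocycle a t‖ * ‖N.α t x‖ * ‖star (N.cocycle a t)‖ :=
        (norm_mul_le _ _).trans (by gcongr; exact norm_mul_le _ _)
    _ ≤ 1 * ‖x‖ * 1 := by rw [norm_star, N.norm_α]; gcongr
    _ = ‖x‖ := by ring

section Families

variable {Θ : Type} [TopologicalSpace Θ] [LocallyCompactSpace Θ] {X : Θ → BoundedOp H} {τ : Θ → ℝ}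

lemma domFamily_cocycle (hτ : Continuous τ) : 𝒮.DomFamily fun θ => N.cocycle a (τ θ) :=
  (smoothCurve_cocycle hp.smooth).domFamily.comp hτ

lemma domFamily_star_cocycle (hτ : Continuous τ) : 𝒮.DomFamily fun θ => star (N.cocycle a (τ θ)) := by
  simp only [N.star_cocycle_eq hp.sa]
  exact (hp.domFamily_cocycle hτ.neg).α hτ

lemma domFamily_flow (hX : 𝒮.DomFamily X) (hτ : Continuous τ) :
    𝒮.DomFamily fun θ => N.flow a (τ θ) (X θ) :=
  ((hp.domFamily_cocycle hτ).mul (hX.α hτ)).mul (hp.domFamily_star_cocycle hτ)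

lemma continuous_pert (hX : 𝒮.DomFamily X) : Continuous fun θ => 𝒮.pert a (X θ) :=
  hp.goodFamily.continuous_ext (ω := fun _ => ()) hX continuous_const continuous_const
    fun _ => I_mem_closedStrip

end Families

lemma pert_add {X Y : BoundedOp H} (hX : X ∈ 𝒮.dom) (hY : Y ∈ 𝒮.dom) :
    𝒮.pert a (X + Y) = 𝒮.pert a X + 𝒮.pert a Y :=
  hp.goodFamily.ext_add () hX hY I_mem_closedStrip

lemma pert_smul (c : ℂ) {X : BoundedOp H} (hX : X ∈ 𝒮.dom) :
    𝒮.pert a (c • X) = c * 𝒮.pert a X :=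
  hp.goodFamily.ext_smul () c hX I_mem_closedStrip

lemma pert_sub {X Y : BoundedOp H} (hX : X ∈ 𝒮.dom) (hY : Y ∈ 𝒮.dom) :
    𝒮.pert a (X - Y) = 𝒮.pert a X - 𝒮.pert a Y := by
  have := hp.pert_add (sub_mem hX hY) hY
  rw [sub_add_cancel] at this
  rw [this, add_sub_cancel_right]

lemma ext_add_I {X : BoundedOp H} (hX : X ∈ 𝒮.dom) (t : ℝ) :
    𝒮.ext (N.cocycle a) X (t + Complex.I) = 𝒮.pert a (N.α (-t) (X * N.cocycle a t)) :=
  ext_cocycle_add hp.smooth hp.even hp.sa hX t I_mem_closedStrip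

/-- The boundary values of the continuation of `t ↦ φ(X γ^a_t(1) α_t(Y))`. -/
theorem edgeCont_pert {X Y : BoundedOp H} (hX : X ∈ 𝒮.dom) (hY : Y ∈ 𝒮.dom) :
    EdgeCont (fun t => 𝒮.φ (X * N.cocycle a t * N.α t Y))
      fun t => 𝒮.pert a (N.cocycle a t * N.α t Y * N.γ X) := by
  obtain ⟨F, hF, hFg, h0, -⟩ := hp.goodFamily.edgeCont_mul_orbit () hX hY
  refine ⟨F, hF, hFg, h0, fun s => ?_⟩
  have hY' : N.cocycle a s * N.α s Y ∈ 𝒮.dom := mul_mem (hp.cocycle_dom s) (𝒮.α_dom s Y hY)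
  obtain ⟨F', hF', -, h0', h1'⟩ := hp.goodFamily.edgeCont_mul_orbit () hX hY'
  -- By the cocycle identity, translating F by s gives the continuation for the same X with Y
  -- replaced by W_s α_s(Y). So the boundary value at s + i is a value at i, which is by definition
  -- one of the perturbed functional.
  have h := IsStripAnalytic.eqOn (F := fun z => F (s + z)) (hF.comp_affine (by fun_prop)
    (fun z hz => by simpa [closedStrip] using hz) fun z hz => by simpa [openStrip] using hz) hF'
    (fun t => ?_) I_mem_closedStrip
  · have h2 := h1' 0
    simp only [Complex.ofReal_zero, zero_add, N.α_zero] at h2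
    exact h.trans h2
  · have h3 := h0 (s + t)
    push_cast at h3
    rw [h3, h0', add_comm s t]
    beta_reduce
    rw [N.cocycle_add hp.sa, N.α_mul, N.α_α]
    simp only [mul_assoc]

/-- Continuing to i moves Y cyclically to the front. The lemma evaluates at i functions in which the
cocycle is not the last factor. -/
lemma exists_pert_continuation {X Y : BoundedOp H} (hX : X ∈ 𝒮.dom) (hY : Y ∈ 𝒮.dom) :
    ∃ F, IsStripContinuation (fun t => 𝒮.φ (X * N.cocycle a t * N.α t Y)) F ∧
      F Complex.I = 𝒮.pert a (Y * N.γ X) := by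
  obtain ⟨F, hF, -, h0, h1⟩ := hp.edgeCont_pert hX hY
  refine ⟨F, ⟨hF, h0⟩, ?_⟩
  have := h1 0
  simpa [N.cocycle_zero, N.α_zero] using this

/-- The super-KMS property of the perturbed functional. -/
theorem edgeCont_flow {X Y : BoundedOp H} (hX : X ∈ 𝒮.dom) (hY : Y ∈ 𝒮.dom) :
    EdgeCont (fun t => 𝒮.pert a (X * N.flow a t Y)) fun t => 𝒮.pert a (N.flow a t Y * N.γ X) := by
  obtain ⟨R, hR, haR⟩ := hp.exists_loc
  obtain ⟨ρ₁, hρ₁, hXρ⟩ := 𝒮.exists_loc X hX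
  obtain ⟨ρ₂, hρ₂, hYρ⟩ := 𝒮.exists_loc Y hY
  set ρ := R + ρ₁ + ρ₂ with hρdef
  have hρ : 0 ≤ ρ := by positivity
  have hXl : ∀ x y : ℝ, X ∈ N.loc (ρ + |x| + |y|) := fun x y =>
    N.loc_mono (by linarith [abs_nonneg x, abs_nonneg y]) hXρ
  have hfl : ∀ x y : ℝ, N.flow a y Y ∈ N.loc (ρ + |x| + |y|) := fun x y =>
    N.loc_mono (by
      have : max R ρ₂ ≤ R + ρ₂ := max_le_add_of_nonneg hR hρ₂
      linarith [abs_nonneg x]) (hp.flow_mem_loc hR haR hρ₂ hYρ y)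
  have hW : ∀ s, N.cocycle a s ∈ N.loc (R + |s|) := cocycle_mem_loc hp.smooth hR haR
  have hWl : ∀ x y : ℝ, N.cocycle a (x + y) ∈ N.loc (ρ + |x| + |y|) := fun x y =>
    N.loc_mono (by linarith [abs_add_le x y]) (hW _)
  have hdom : ∀ y, X * N.flow a y Y ∈ 𝒮.dom := fun y => mul_mem hX (hp.flow_dom y hY)
  have hXY : ∀ y, ‖X * N.flow a y Y‖ ≤ ‖X‖ * ‖Y‖ := fun y =>
    (norm_mul_le _ _).trans (by gcongr; exact hp.norm_flow_le y Y)
  have famF : 𝒮.DomFamily fun q : ℝ × ℝ => X * N.flow a q.2 Y :=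
    (DomFamily.const hX).mul (hp.domFamily_flow (DomFamily.const hY) continuous_snd)
  have famW : 𝒮.DomFamily fun q : ℝ × ℝ => N.cocycle a q.1 := hp.domFamily_cocycle continuous_fst
  have famW2 : 𝒮.DomFamily fun q : ℝ × ℝ => N.cocycle a q.2 := hp.domFamily_cocycle continuous_snd
  have famB : 𝒮.DomFamily fun q : ℝ × ℝ =>
      N.cocycle a q.2 * N.α q.2 (Y * N.cocycle a q.1) * N.γ X :=
    (famW2.mul (((DomFamily.const hY).mul famW).α continuous_snd)).mul
      (DomFamily.const (𝒮.γ_dom X hX))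
  have hZ := hp.goodFamily
  -- In x one continues the trailing cocycle. In y one uses flow_y(Y) W_{x+y} = W_y α_y(Y W_x) and
  -- `edgeCont_pert` with Y W_x in place of Y. On x = -y the two upper boundary functions are the
  -- required KMS boundary values.
  have h := edgeCont_third (g := fun x y => 𝒮.φ (X * N.flow a y Y * N.cocycle a (x + y)))
    (A := fun x y => 𝒮.ext (N.cocycle a) (X * N.flow a y Y) ((x + y : ℝ) + Complex.I))
    (B := fun x y => 𝒮.pert a (N.cocycle a y * N.α y (Y * N.cocycle a x) * N.γ X))
    (famF.mul (hp.domFamily_cocycle (by fun_prop))).continuous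
    (hZ.cont_I (ω := fun _ => ()) famF continuous_const (by fun_prop)) (hp.continuous_pert famB)
    (gaussBounded_φ (M := ‖X‖ * ‖Y‖) hρ
      (fun x y => mul_mem (hdom y) (hp.cocycle_dom _))
      (fun x y => mul_mem (mul_mem (hXl x y) (hfl x y)) (hWl x y))
      (fun x y => (norm_mul_le _ _).trans ((mul_le_of_le_one_right (norm_nonneg _)
        (N.norm_cocycle_le hp.sa _)).trans (hXY y))))
    (hZ.gaussBounded_ext () (τ := fun x y => x + y) hρ (fun x y => hdom y)
      (fun x y => mul_mem (hXl x y) (hfl x y)) (fun x y => hXY y) abs_add_le) ?_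
    (fun y => ?_) (fun x => ?_)
  · have e1 : ∀ t : ℝ, 𝒮.ext (N.cocycle a) (X * N.flow a t Y) (((-t + t : ℝ) : ℂ) + Complex.I) =
        𝒮.pert a (X * N.flow a t Y) := fun t => by simp [pert]
    simpa only [e1, ← GradedNet.flow_eq hp.sa] using h
  · have := hZ.gaussBounded_ext () (M := ‖Y‖ * ‖X‖) (τ := fun _ _ => 0) hρ
      (fun x y => famB.mem (x, y)) (fun x y => ?_) (fun x y => ?_) (fun x y => by simp; positivity)
    · simpa [pert] using this
    · refine mul_mem (mul_mem (N.loc_mono ?_ (hW y)) (N.loc_mono (le_of_eq ?_)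
        (N.α_mem_loc (ρ := ρ + |x|) (by positivity) (mul_mem (N.loc_mono ?_ hYρ)
          (N.loc_mono ?_ (hW x))) y))) (N.γ_mem_loc (hXl x y))
      · linarith [abs_nonneg x]
      · ring
      · linarith [abs_nonneg x]
      · linarith
    · refine (norm_mul_le _ _).trans ?_
      rw [N.norm_γ]
      gcongr
      refine (norm_mul_le _ _).trans ((mul_le_of_le_one_left (norm_nonneg _)
        (N.norm_cocycle_le hp.sa _)).trans ?_)
      rw [N.norm_α]
      exact (norm_mul_le _ _).trans (mul_le_of_le_one_right (norm_nonneg _)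
        (N.norm_cocycle_le hp.sa _))
  · have := hZ.edgeCont_shift () (hdom y) y
    simpa using this
  · have := hp.edgeCont_pert hX (mul_mem hY (hp.cocycle_dom x))
    simpa only [mul_assoc, ← GradedNet.flow_mul_cocycle hp.sa] using this

/-- The perturbed functional is Hermitian. -/
theorem pert_star {X : BoundedOp H} (hX : X ∈ 𝒮.dom) : 𝒮.pert a (star X) = star (𝒮.pert a X) := by
  obtain ⟨F, ⟨hF, h0⟩, h1⟩ := hp.exists_pert_continuation (one_mem _) hX
  -- F continues t ↦ φ(W_t α_t(X)). The reflection z ↦ -z̄ followed by conjugation turns it, by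
  -- invariance and hermiticity of φ, into the continuation of t ↦ φ(X^* W_t), and it fixes the
  -- point i.
  have hc : IsStripContinuation (fun t => 𝒮.φ (star X * N.cocycle a t)) fun z => star (F (-star z)) := by
    refine ⟨hF.conj, fun t => ?_⟩
    have e : -star (t : ℂ) = ((-t : ℝ) : ℂ) := by simp
    have h2 : N.α t (N.cocycle a (-t) * N.α (-t) X) = star (star X * N.cocycle a t) := by
      rw [N.α_mul, N.α_α, add_neg_cancel, N.α_zero, star_mul, star_star, N.star_cocycle_eq hp.sa]
    beta_reduce
    rw [e, h0]
    beta_reduce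
    rw [one_mul, ← 𝒮.φ_α t (mul_mem (hp.cocycle_dom _) (𝒮.α_dom _ _ hX)), h2, 𝒮.φ_star _
      (mul_mem (star_mem hX) (hp.cocycle_dom t)), star_star]
  have h3 : 𝒮.pert a (star X) = star (F (-star Complex.I)) := hc.stripExt_eq I_mem_closedStrip
  rw [h3]
  simp only [RCLike.star_def, Complex.conj_I, neg_neg]
  rw [h1, N.γ_one, mul_one]

end EvenPerturbation

end LocalSystem

/-- Integrals of strip-analytic functions over compact intervals are strip-analytic. -/
lemma isStripAnalytic_intervalIntegral {G : ℝ → ℂ → ℂ}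
    (hc : Continuous fun p : ℝ × ℂ => G p.1 (stripRetract p.2))
    (hd : ∀ t, DifferentiableOn ℂ (G t) openStrip) (a b : ℝ) :
    IsStripAnalytic fun z => ∫ t in a..b, G t z := by
  constructor
  · have h : Continuous fun z => ∫ t in a..b, G t (stripRetract z) :=
      intervalIntegral.continuous_parametric_intervalIntegral_of_continuous'
        (f := fun z t => G t (stripRetract z)) (hc.comp (continuous_swap)) a b
    exact h.continuousOn.congr fun z hz => by beta_reduce; rw [stripRetract_of_mem hz]
  · have key : ∀ a b, DifferentiableOn ℂ (fun z => ∫ t in Ioc a b, G t z) openStrip := by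
      intro a b
      have hcz : ∀ z ∈ openStrip, Continuous fun t => G t z := fun z hz => by
        have := hc.comp (f := fun t : ℝ => (t, z)) (by fun_prop)
        simpa [Function.comp_def, stripRetract_of_mem (openStrip_subset hz)] using this
      refine differentiableOn_integral_of_bound isOpen_openStrip
        (fun z hz => (hcz z hz).aestronglyMeasurable) (Eventually.of_forall hd) fun z₀ hz₀ => ?_
      obtain ⟨r, hr, hball⟩ := Metric.isOpen_iff.1 isOpen_openStrip z₀ hz₀
      obtain ⟨M, hM⟩ := (isCompact_Icc.prod (isCompact_closedBall z₀ r)).exists_bound_of_continuousOn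
        (s := Icc a b ×ˢ Metric.closedBall z₀ r) hc.continuousOn
      refine ⟨fun _ => M, integrable_const _, r, hr, ?_⟩
      filter_upwards [ae_restrict_mem measurableSet_Ioc] with t ht z hz
      have := hM (t, z) ⟨⟨ht.1.le, ht.2⟩, Metric.ball_subset_closedBall hz⟩
      rwa [stripRetract_of_mem (openStrip_subset (hball hz))] at this
    simp only [intervalIntegral]
    exact (key a b).sub (key b a)

section

variable {H : Type*} [NormedAddCommGroup H] [InnerProductSpace ℂ H] [CompleteSpace H]

/-- Product rule for an operator family vanishing at the base point. -/
lemma StrongCont.hasDerivAt_apply_of_eq_zero {f : ℝ → BoundedOp H} (hf : StrongCont f)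
    {f' : BoundedOp H} {t : ℝ} (h0 : f t = 0) (hd : ∀ ξ, HasDerivAt (fun s => f s ξ) (f' ξ) t)
    {v : ℝ → H} (hv : ContinuousAt v t) : HasDerivAt (fun s => f s (v s)) (f' (v t)) t := by
  rw [hasDerivAt_iff_tendsto_slope]
  have h := (strongCont_opSlope hf hd).tendsto_apply (nhdsWithin_le_nhds (s := {t}ᶜ))
    (hv.tendsto.mono_left nhdsWithin_le_nhds)
  rw [opSlope_self] at h
  refine h.congr' ?_
  filter_upwards [self_mem_nhdsWithin] with s hs
  rw [opSlope_of_ne f f' hs, slope, h0, smul_apply, zero_apply, vsub_eq_sub, sub_zero, sub_zero,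
    ← Complex.ofReal_sub, ← Complex.ofReal_inv, Complex.coe_smul]

end

/-! ### Generator of the perturbed flow and weak supersymmetry. -/

namespace LocalSystem

variable {H : Type*} [NormedAddCommGroup H] [InnerProductSpace ℂ H] [CompleteSpace H]
  {N : GradedNet H} {𝒮 : LocalSystem N}

/-- The generator `y ↦ δ²(y) + [a, y]` of the perturbed flow. -/
def gen (𝒮 : LocalSystem N) (a y : BoundedOp H) : BoundedOp H := 𝒮.δ (𝒮.δ y) + (a * y - y * a)

namespace EvenPerturbation

variable {a : BoundedOp H} (hp : 𝒮.EvenPerturbation a)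

include hp

/-- Derivatives of `φ` along a family, perturbed by the cocycle, are inherited by the perturbed
functional. -/
theorem hasDerivAt_pert {f g : ℝ → BoundedOp H} (hf : ∀ t, f t ∈ 𝒮.dom) (hg : 𝒮.DomFamily g)
    (h : ∀ s t, HasDerivAt (fun t => 𝒮.φ (f t * N.cocycle a s)) (𝒮.φ (g t * N.cocycle a s)) t)
    (t : ℝ) : HasDerivAt (fun t => 𝒮.pert a (f t)) (𝒮.pert a (g t)) t := by
  have hgc := hp.continuous_pert hg
  -- Derivatives cannot be continued pointwise, but the integrated identity can: for real s it holds
  -- with W_s inserted, both sides are strip analytic in s, and at i it becomes the fundamental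
  -- theorem of calculus for the perturbed functional.
  have key : ∀ T, 𝒮.pert a (f T) = 𝒮.pert a (f 0) + ∫ t in (0 : ℝ)..T, 𝒮.pert a (g t) := by
    intro T
    rw [← sub_eq_iff_eq_add']
    have h1 := hp.goodFamily.isStripContinuation () (hf T)
    have h2 := hp.goodFamily.isStripContinuation () (hf 0)
    have h3 := isStripAnalytic_intervalIntegral (G := fun t z => 𝒮.ext (N.cocycle a) (g t) z)
      (hp.goodFamily.continuous_ext (ω := fun _ => ()) (hg.comp continuous_fst) continuous_const
        (continuous_stripRetract.comp continuous_snd) fun _ => stripRetract_mem _)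
      (fun t => (hp.goodFamily.isStripContinuation () (hg.mem t)).1.2) 0 T
    refine (h1.1.sub h2.1).eqOn h3 (fun s => ?_) I_mem_closedStrip
    have hc : Continuous fun t => 𝒮.φ (g t * N.cocycle a s) :=
      (hg.mul (DomFamily.const (hp.cocycle_dom s))).continuous
    have h4 := intervalIntegral.integral_eq_sub_of_hasDerivAt (fun t _ => h s t)
      (hc.intervalIntegrable 0 T)
    rw [h1.2, h2.2, ← h4]
    refine intervalIntegral.integral_congr fun t _ => ?_
    exact ((hp.goodFamily.ext_ofReal () (hg.mem t) s)).symm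
  have h5 := ((hgc.integral_hasStrictDerivAt 0 t).hasDerivAt).const_add (𝒮.pert a (f 0))
  exact h5.congr_of_eventuallyEq (Eventually.of_forall key)

/-- Split W α_t(y) W^* into (W - 1) α_t(y) W^*, α_t(y)(W^* - 1) and α_t(y). The first two are
strongly differentiable at 0 since one factor vanishes there, although the orbit of y need not be.
For the third only the weak statement (S₅) is available. -/
lemma hasDerivAt_φ_flow_zero {X Z y : BoundedOp H} (hX : X ∈ 𝒮.dom) (hZ : Z ∈ 𝒮.dom)
    (hy : y ∈ 𝒮.smooth) : HasDerivAt (fun t => 𝒮.φ (X * N.flow a t y * Z))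
      (𝒮.φ (X * (Complex.I • 𝒮.gen a y) * Z)) 0 := by
  have hyd := 𝒮.smooth_le hy
  have had := 𝒮.smooth_le hp.smooth
  have fX : 𝒮.DomFamily fun _ : ℝ => X := DomFamily.const hX
  have fZ : 𝒮.DomFamily fun _ : ℝ => Z := DomFamily.const hZ
  have f1 : 𝒮.DomFamily fun _ : ℝ => (1 : BoundedOp H) := DomFamily.const (one_mem _)
  have fW : 𝒮.DomFamily fun t : ℝ => N.cocycle a t := hp.domFamily_cocycle continuous_id
  have fV : 𝒮.DomFamily fun t : ℝ => star (N.cocycle a t) := hp.domFamily_star_cocycle continuous_id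
  have fy : 𝒮.DomFamily fun t => N.α t y := DomFamily.orbit hyd continuous_id
  have dW : ∀ ξ, HasDerivAt (fun t => (N.cocycle a t - 1) ξ) ((Complex.I • a) ξ) 0 := fun ξ => by
    have := (hasDerivAt_dysonSeries (N.strongCont_orbit a) (N.norm_orbit_le a) 0 ξ).sub_const ξ
    rw [← GradedNet.cocycle, N.cocycle_zero, N.α_zero] at this
    exact this
  have dV : ∀ ξ, HasDerivAt (fun t => (star (N.cocycle a t) - 1) ξ) ((-Complex.I • a) ξ) 0 := fun ξ => by
    have := (N.hasDerivAt_star_cocycle hp.sa 0 ξ).sub_const ξ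
    rw [N.cocycle_zero, N.α_zero, star_one] at this
    exact this
  have h1 : HasDerivAt (fun t => 𝒮.φ (X * ((N.cocycle a t - 1) * (N.α t y * star (N.cocycle a t))) * Z))
      (𝒮.φ (X * (Complex.I • (a * y)) * Z)) 0 := by
    refine ((fX.mul ((fW.sub f1).mul (fy.mul fV))).mul fZ).hasDerivAt
      (mul_mem (mul_mem hX (SMulMemClass.smul_mem _ (mul_mem had hyd))) hZ) fun ξ => ?_
    have := (fW.sub f1).cont.hasDerivAt_apply_of_eq_zero (t := 0)
      (by simp [N.cocycle_zero]) dW ((fy.mul fV).cont (Z ξ)).continuousAt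
    rw [N.α_zero, N.cocycle_zero, star_one, mul_one] at this
    exact X.hasFDerivAt.restrictScalars ℝ |>.comp_hasDerivAt 0 this
  have h2 : HasDerivAt (fun t => 𝒮.φ (X * (N.α t y * (star (N.cocycle a t) - 1)) * Z))
      (𝒮.φ (X * (-Complex.I • (y * a)) * Z)) 0 := by
    refine ((fX.mul (fy.mul (fV.sub f1))).mul fZ).hasDerivAt
      (mul_mem (mul_mem hX (SMulMemClass.smul_mem _ (mul_mem hyd had))) hZ) fun ξ => ?_
    have := fy.cont.hasDerivAt_apply (t := 0) (w := 0) (dV (Z ξ))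
      (by simpa [N.cocycle_zero] using hasDerivAt_const (0 : ℝ) (0 : H))
    rw [N.α_zero, zero_add] at this
    have h := X.hasFDerivAt.restrictScalars ℝ |>.comp_hasDerivAt 0 this
    refine h.congr_deriv ?_
    change X (y ((-Complex.I • a) (Z ξ))) = X ((-Complex.I • (y * a)) (Z ξ))
    simp
  have h3 := 𝒮.susy X hX Z hZ y hy
  refine ((h1.add h2).add h3).congr_of_eventuallyEq (Eventually.of_forall fun t => ?_) |>.congr_deriv ?_
  · simp only [Pi.add_apply]
    rw [← map_add, ← map_add]
    congr 1
    rw [GradedNet.flow]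
    noncomm_ring
  · rw [← smul_eq_mul Complex.I, ← map_smul, ← map_add, ← map_add]
    congr 1
    simp only [gen, smul_add, smul_sub, mul_add, add_mul, mul_sub, sub_mul, neg_smul, mul_neg,
      neg_mul, mul_smul_comm, smul_mul_assoc]
    abel

/-- Weak supersymmetry for the perturbed flow and the unperturbed functional. -/
theorem hasDerivAt_φ_flow {X Z y : BoundedOp H} (hX : X ∈ 𝒮.dom) (hZ : Z ∈ 𝒮.dom)
    (hy : y ∈ 𝒮.smooth) (t : ℝ) : HasDerivAt (fun t => 𝒮.φ (X * N.flow a t y * Z))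
      (𝒮.φ (X * (Complex.I • N.flow a t (𝒮.gen a y)) * Z)) t := by
  have hW := hp.cocycle_dom t
  -- Invariance of φ under α and the group law of the flow move the base point t to 0, with
  -- conjugated outer factors.
  set X' := N.α (-t) (X * N.cocycle a t) with hX'
  set Z' := N.α (-t) (star (N.cocycle a t) * Z) with hZ'
  have hX'd : X' ∈ 𝒮.dom := 𝒮.α_dom _ _ (mul_mem hX hW)
  have hZ'd : Z' ∈ 𝒮.dom := 𝒮.α_dom _ _ (mul_mem (star_mem hW) hZ)
  have hgen : 𝒮.gen a y ∈ 𝒮.smooth := add_mem (𝒮.δ_smooth _ (𝒮.δ_smooth y hy))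
    (sub_mem (mul_mem hp.smooth hy) (mul_mem hy hp.smooth))
  have e : ∀ x, x ∈ 𝒮.dom → 𝒮.φ (X' * x * Z') = 𝒮.φ (X * N.flow a t x * Z) := fun x hx => by
    rw [← 𝒮.φ_α t (mul_mem (mul_mem hX'd hx) hZ'd), hX', hZ', N.α_mul, N.α_mul, N.α_α, N.α_α,
      add_neg_cancel, N.α_zero, N.α_zero, GradedNet.flow]
    simp only [mul_assoc]
  have h := hp.hasDerivAt_φ_flow_zero hX'd hZ'd hy
  rw [← sub_self t] at h
  have h2 := h.comp_sub_const t t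
  rw [e _ (SMulMemClass.smul_mem _ (𝒮.smooth_le hgen)), GradedNet.flow_smul] at h2
  refine h2.congr_of_eventuallyEq (Eventually.of_forall fun s => ?_)
  beta_reduce
  rw [e _ (hp.flow_dom _ (𝒮.smooth_le hy)), GradedNet.flow_flow hp.sa, add_sub_cancel]

lemma gen_smooth {y : BoundedOp H} (hy : y ∈ 𝒮.smooth) : 𝒮.gen a y ∈ 𝒮.smooth :=
  add_mem (𝒮.δ_smooth _ (𝒮.δ_smooth y hy)) (sub_mem (mul_mem hp.smooth hy) (mul_mem hy hp.smooth))

/-- Weak supersymmetry for the perturbed flow and the perturbed functional. -/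
theorem hasDerivAt_pert_flow {X Z y : BoundedOp H} (hX : X ∈ 𝒮.dom) (hZ : Z ∈ 𝒮.dom)
    (hy : y ∈ 𝒮.smooth) (t : ℝ) : HasDerivAt (fun t => 𝒮.pert a (X * N.flow a t y * Z))
      (Complex.I * 𝒮.pert a (X * N.flow a t (𝒮.gen a y) * Z)) t := by
  have hg := 𝒮.smooth_le (hp.gen_smooth hy)
  have fam : ∀ y ∈ 𝒮.dom, 𝒮.DomFamily fun t => X * N.flow a t y * Z := fun y hy =>
    ((DomFamily.const hX).mul (hp.domFamily_flow (DomFamily.const hy) continuous_id)).mul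
      (DomFamily.const hZ)
  have h := hp.hasDerivAt_pert (f := fun t => X * N.flow a t y * Z)
    (g := fun t => Complex.I • (X * N.flow a t (𝒮.gen a y) * Z))
    (fam y (𝒮.smooth_le hy)).mem ((fam _ hg).smul continuous_const) (fun s t => ?_) t
  · rwa [hp.pert_smul _ ((fam _ hg).mem t)] at h
  · have := hp.hasDerivAt_φ_flow hX (mul_mem hZ (hp.cocycle_dom s)) hy t
    simpa only [mul_assoc, mul_smul_comm, smul_mul_assoc] using this

end EvenPerturbation

end LocalSystem

/-! ### Odd perturbations: invariance under the perturbed superderivation. -/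

namespace LocalSystem

variable {H : Type*} [NormedAddCommGroup H] [InnerProductSpace ℂ H] [CompleteSpace H]
  {N : GradedNet H} {𝒮 : LocalSystem N}

/-- The perturbing element `r δ(Q) + r² Q²`. -/
def pertElement (𝒮 : LocalSystem N) (Q : BoundedOp H) (r : ℝ) : BoundedOp H :=
  (r : ℂ) • 𝒮.δ Q + ((r : ℂ) ^ 2) • (Q * Q)

/-- The perturbed superderivation `x ↦ δ(x) + r (Q x - γ(x) Q)`. -/
def pertδ (𝒮 : LocalSystem N) (Q : BoundedOp H) (r : ℝ) (x : BoundedOp H) : BoundedOp H :=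
  𝒮.δ x + (r : ℂ) • (Q * x - N.γ x * Q)

/-- Odd selfadjoint smooth elements with selfadjoint derivative. -/
structure OddPerturbation (𝒮 : LocalSystem N) (Q : BoundedOp H) : Prop where
  smooth : Q ∈ 𝒮.smooth
  odd : N.γ Q = -Q
  sa : IsSelfAdjoint Q
  δ_sa : IsSelfAdjoint (𝒮.δ Q)

namespace OddPerturbation

variable {Q : BoundedOp H} (hQ : 𝒮.OddPerturbation Q) (r : ℝ)

include hQ

lemma γ_δ : N.γ (𝒮.δ Q) = 𝒮.δ Q := by
  have h := 𝒮.δ_γ Q hQ.smooth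
  rwa [hQ.odd, map_neg, neg_inj, eq_comm] at h

lemma evenPerturbation : 𝒮.EvenPerturbation (𝒮.pertElement Q r) where
  smooth := add_mem (SMulMemClass.smul_mem _ (𝒮.δ_smooth Q hQ.smooth))
    (SMulMemClass.smul_mem _ (mul_mem hQ.smooth hQ.smooth))
  even := by
    rw [pertElement, N.γ_add, N.γ_smul, N.γ_smul, N.γ_mul, hQ.odd, hQ.γ_δ, neg_mul_neg]
  sa := by
    rw [pertElement, ← Complex.ofReal_pow]
    refine IsSelfAdjoint.add ?_ ?_
    · exact IsSelfAdjoint.smul (by simp [IsSelfAdjoint]) hQ.δ_sa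
    · refine IsSelfAdjoint.smul (by simp [IsSelfAdjoint]) ?_
      rw [IsSelfAdjoint, star_mul, hQ.sa.star_eq]

lemma δ_mul_self : 𝒮.δ (Q * Q) = 𝒮.δ Q * Q - Q * 𝒮.δ Q := by
  rw [𝒮.leibniz Q hQ.smooth Q hQ.smooth, hQ.odd, neg_mul, sub_eq_add_neg]

/-- Both sides equal r δ²(Q) + r² (δ(Q) Q - Q δ(Q)), since Q commutes with Q² and δ(Q²) is this
commutator. It makes the flow-derivative of r Q agree with the derivative of δ(W) W^*. -/
lemma δ_pertElement : 𝒮.δ (𝒮.pertElement Q r) = (r : ℂ) • 𝒮.gen (𝒮.pertElement Q r) Q := by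
  rw [gen]
  simp only [pertElement, map_add, map_smul, hQ.δ_mul_self, add_mul, mul_add, smul_mul_assoc,
    mul_smul_comm, mul_assoc]
  module

lemma pertδ_smooth {x : BoundedOp H} (hx : x ∈ 𝒮.smooth) : 𝒮.pertδ Q r x ∈ 𝒮.smooth :=
  add_mem (𝒮.δ_smooth x hx) (SMulMemClass.smul_mem _ (sub_mem (mul_mem hQ.smooth hx)
    (mul_mem (𝒮.γ_smooth x hx) hQ.smooth)))

/-- The square of the perturbed superderivation. -/
lemma pertδ_pertδ {x : BoundedOp H} (hx : x ∈ 𝒮.smooth) :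
    𝒮.pertδ Q r (𝒮.pertδ Q r x) = 𝒮.gen (𝒮.pertElement Q r) x := by
  have h1 := 𝒮.leibniz Q hQ.smooth x hx
  have h2 := 𝒮.leibniz _ (𝒮.γ_smooth x hx) Q hQ.smooth
  rw [hQ.odd] at h1
  rw [N.γ_γ, 𝒮.δ_γ x hx] at h2
  simp only [pertδ, gen, pertElement, map_add, map_sub, map_smul, h1, h2, N.γ_add, N.γ_sub,
    N.γ_smul, N.γ_mul, N.γ_γ, hQ.odd, add_mul, mul_add, mul_sub, sub_mul, neg_mul, mul_neg,
    smul_mul_assoc, mul_smul_comm, mul_assoc]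
  module

lemma hasDerivAt_φ_δ_cocycle {X Z : BoundedOp H} (hX : X ∈ 𝒮.dom) (hZ : Z ∈ 𝒮.dom) (t : ℝ) :
    HasDerivAt (fun t => 𝒮.φ (X * (𝒮.δ (N.cocycle (𝒮.pertElement Q r) t) *
      star (N.cocycle (𝒮.pertElement Q r) t)) * Z))
      (𝒮.φ (X * (Complex.I • N.flow (𝒮.pertElement Q r) t (𝒮.δ (𝒮.pertElement Q r))) * Z)) t := by
  have hp := hQ.evenPerturbation r
  set a := 𝒮.pertElement Q r with ha
  have hδa := 𝒮.δ_smooth a hp.smooth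
  have hW := smoothCurve_cocycle hp.smooth
  have fV : 𝒮.DomFamily fun t : ℝ => star (N.cocycle a t) := hp.domFamily_star_cocycle continuous_id
  refine (((DomFamily.const hX).mul (hW.δ.domFamily.mul fV)).mul (DomFamily.const hZ)).hasDerivAt
    (mul_mem (mul_mem hX (SMulMemClass.smul_mem _ (𝒮.smooth_le (hp.flow_smooth t hδa)))) hZ)
    fun ξ => ?_
  have h := hW.δ.strongCont.hasDerivAt_apply (N.hasDerivAt_star_cocycle hp.sa t (Z ξ))
    (hasDerivAt_δ_cocycle hp.smooth t (star (N.cocycle a t) (Z ξ)))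
  have h2 := X.hasFDerivAt.restrictScalars ℝ |>.comp_hasDerivAt t h
  refine h2.congr_deriv ?_
  rw [𝒮.leibniz _ (hW.mem t) _ (𝒮.α_smooth t a hp.smooth), N.γ_cocycle hp.even, 𝒮.δ_α t a hp.smooth]
  have e : Complex.I • (𝒮.δ (N.cocycle a t) * N.α t a + N.cocycle a t * N.α t (𝒮.δ a)) *
      star (N.cocycle a t) + 𝒮.δ (N.cocycle a t) * (-Complex.I • (N.α t a * star (N.cocycle a t))) =
      Complex.I • N.flow a t (𝒮.δ a) := by
    simp only [GradedNet.flow, smul_add, add_mul, smul_mul_assoc, mul_smul_comm, mul_assoc]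
    module
  exact congrArg (fun T : BoundedOp H => X (T (Z ξ))) e

/-- The derivation of the cocycle, weakly. -/
theorem φ_mul_δ_cocycle_mul {X Z : BoundedOp H} (hX : X ∈ 𝒮.dom) (hZ : Z ∈ 𝒮.dom) (t : ℝ) :
    𝒮.φ (X * 𝒮.δ (N.cocycle (𝒮.pertElement Q r) t) * Z) =
      r * 𝒮.φ (X * N.cocycle (𝒮.pertElement Q r) t * N.α t Q * Z) -
        r * 𝒮.φ (X * Q * N.cocycle (𝒮.pertElement Q r) t * Z) := by
  have hp := hQ.evenPerturbation r
  have hδ := hQ.δ_pertElement r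
  have hd := fun (Z : BoundedOp H) hZ => hQ.hasDerivAt_φ_δ_cocycle r hX (Z := Z) hZ
  set a := 𝒮.pertElement Q r with ha
  have hZ' := mul_mem (hp.cocycle_dom t) hZ
  -- The right factor is frozen at time t while s varies, so that W_s^* cancels against it at s = t.
  set Z' := N.cocycle a t * Z with hZ'def
  -- δ(W_s) W_s^* and r times the flow of Q have the same weak derivative, so their difference keeps
  -- its value -r Q from s = 0. The argument is weak because the flow of Q is only weakly
  -- differentiable.
  have hderiv : ∀ s, HasDerivAt (fun s => 𝒮.φ (X * (𝒮.δ (N.cocycle a s) * star (N.cocycle a s)) * Z') -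
      r * 𝒮.φ (X * N.flow a s Q * Z')) 0 s := fun s => by
    refine ((hd Z' hZ' s).sub ((hp.hasDerivAt_φ_flow hX hZ' hQ.smooth s).const_mul (r : ℂ))).congr_deriv ?_
    rw [hδ, GradedNet.flow_smul, ← smul_eq_mul (r : ℂ), ← map_smul, ← map_sub, ← map_zero 𝒮.φ]
    congr 1
    simp only [mul_smul_comm, smul_mul_assoc]
    module
  have hconst := is_const_of_deriv_eq_zero (fun s => (hderiv s).differentiableAt)
    (fun s => (hderiv s).deriv) t 0
  simp only [N.cocycle_zero, δ_one, zero_mul, mul_zero, map_zero, GradedNet.flow_zero, zero_sub] at hconst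
  have e : ∀ x : BoundedOp H, X * (x * star (N.cocycle a t)) * Z' = X * x * Z := fun x => by
    rw [hZ'def]
    calc _ = X * x * (star (N.cocycle a t) * N.cocycle a t) * Z := by simp only [mul_assoc]
      _ = _ := by rw [N.star_mul_cocycle hp.sa, mul_one]
  have e2 : X * N.flow a t Q * Z' = X * N.cocycle a t * N.α t Q * Z := by
    rw [GradedNet.flow, e]; simp only [mul_assoc]
  rw [e, e2, hZ'def] at hconst
  simp only [mul_assoc] at hconst ⊢
  linear_combination hconst

/-- The perturbed functional is invariant under the perturbed superderivation. -/
theorem pert_pertδ {x : BoundedOp H} (hx : x ∈ 𝒮.smooth) :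
    𝒮.pert (𝒮.pertElement Q r) (𝒮.pertδ Q r x) = 0 := by
  have hp := hQ.evenPerturbation r
  have hxd := 𝒮.smooth_le hx
  have hQd := 𝒮.smooth_le hQ.smooth
  have hδd := 𝒮.smooth_le (𝒮.δ_smooth x hx)
  have hγd := 𝒮.γ_dom x hxd
  have key := hQ.φ_mul_δ_cocycle_mul r hγd (one_mem _)
  simp only [mul_one] at key
  rw [pertδ]
  set a := 𝒮.pertElement Q r with ha
  have h1 := hp.goodFamily.isStripContinuation () hδd
  have h2 := hp.goodFamily.isStripContinuation () (mul_mem hγd hQd)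
  obtain ⟨F, ⟨hF, hF0⟩, hF1⟩ := hp.exists_pert_continuation hγd hQd
  -- On the real line φ(δ(x W_t)) = 0 and the weak formula for δ(W_t) give φ(δ(x) W_t) = r φ(γ(x) Q
  -- W_t) - r φ(γ(x) W_t α_t(Q)). At i the last term becomes the perturbed functional of Q x, and
  -- the identity is the claim.
  have h := h1.1.eqOn ((h2.1.const_mul (r : ℂ)).sub (hF.const_mul (r : ℂ))) (fun t => ?_)
    I_mem_closedStrip
  · beta_reduce at h
    rw [hF1, N.γ_γ] at h
    rw [hp.pert_add hδd (SMulMemClass.smul_mem _ (sub_mem (mul_mem hQd hxd) (mul_mem hγd hQd))),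
      hp.pert_smul _ (sub_mem (mul_mem hQd hxd) (mul_mem hγd hQd)),
      hp.pert_sub (mul_mem hQd hxd) (mul_mem hγd hQd), pert, h]
    simp only [pert]
    ring
  · rw [h1.2, h2.2, hF0]
    have h3 := 𝒮.φ_δ _ (mul_mem hx (hp.cocycle_smooth t))
    rw [𝒮.leibniz x hx _ (hp.cocycle_smooth t), map_add, key t] at h3
    linear_combination h3

/-- The perturbed functional is invariant under the perturbed flow. -/
theorem pert_flow {y : BoundedOp H} (hy : y ∈ 𝒮.smooth) (t : ℝ) :
    𝒮.pert (𝒮.pertElement Q r) (N.flow (𝒮.pertElement Q r) t y) = 𝒮.pert (𝒮.pertElement Q r) y := by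
  have hp := hQ.evenPerturbation r
  have hd : ∀ s, HasDerivAt (fun s => 𝒮.pert (𝒮.pertElement Q r) (N.flow (𝒮.pertElement Q r) s y)) 0 s := by
    intro s
    have hys := hp.flow_smooth s hy
    have h := hp.hasDerivAt_pert_flow (one_mem _) (one_mem _) hys 0
    simp only [one_mul, mul_one, GradedNet.flow_zero, GradedNet.flow_flow hp.sa] at h
    -- The generator of the flow is the square of the perturbed superderivation, so the derivative
    -- vanishes by `pert_pertδ`.
    rw [← hQ.pertδ_pertδ r hys, hQ.pert_pertδ r (hQ.pertδ_smooth r hys), mul_zero, ← sub_self s] at h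
    have h2 := h.comp_sub_const s s
    simpa using h2
  have := is_const_of_deriv_eq_zero (fun s => (hd s).differentiableAt) (fun s => (hd s).deriv) t 0
  rwa [GradedNet.flow_zero] at this

end OddPerturbation

end LocalSystem

/-- A function with quadratic modulus of continuity is constant. -/
lemma eq_of_norm_sub_le_sq {f : ℝ → ℂ} {C a b : ℝ} (hab : a ≤ b)
    (h : ∀ x ∈ Icc a b, ∀ y ∈ Icc a b, ‖f x - f y‖ ≤ C * |x - y| ^ 2) : f b = f a := by
  have hC : ∀ x ∈ Icc a b, HasDerivWithinAt f 0 (Icc a b) x := fun x hx => by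
    rw [hasDerivWithinAt_iff_isLittleO]
    have h1 : (fun y => f y - f x - (y - x) • (0 : ℂ)) =O[𝓝[Icc a b] x] fun y => (y - x) ^ 2 := by
      refine Asymptotics.IsBigO.of_bound C ?_
      filter_upwards [self_mem_nhdsWithin] with y hy
      have := h y hy x hx
      simpa using this
    refine h1.trans_isLittleO ?_
    have h2 : (fun y : ℝ => (y - x) ^ 2) =o[𝓝 x] fun y => y - x := by
      have := (Asymptotics.isLittleO_pow_id (𝕜 := ℝ) one_lt_two).comp_tendsto
        (show Tendsto (fun y : ℝ => y - x) (𝓝 x) (𝓝 0) by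
          simpa using (continuous_sub_right x).tendsto x)
      exact this
    exact h2.mono nhdsWithin_le_nhds
  refine constant_of_has_deriv_right_zero (fun x hx => (hC x hx).continuousWithinAt)
    (fun x hx => ?_) b (right_mem_Icc.2 hab)
  exact (hC x ⟨hx.1, hx.2.le⟩).mono_of_mem_nhdsWithin
    (mem_of_superset (Icc_mem_nhdsGE hx.2) (Icc_subset_Icc_left hx.1))

/-! ### Comparison of two perturbations and normalization. -/

namespace LocalSystem

variable {H : Type*} [NormedAddCommGroup H] [InnerProductSpace ℂ H] [CompleteSpace H]
  {N : GradedNet H} {𝒮 : LocalSystem N}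

namespace EvenPerturbation

variable {a a' : BoundedOp H} (hp : 𝒮.EvenPerturbation a) (hp' : 𝒮.EvenPerturbation a')

include hp hp'

/-- Comparison of two cocycles. -/
lemma hasDerivAt_cocycle_mul_star (u : ℝ) (ξ : H) :
    HasDerivAt (fun u => N.cocycle a' u (star (N.cocycle a u) ξ))
      ((Complex.I • (N.cocycle a' u * N.α u (a' - a) * star (N.cocycle a u))) ξ) u := by
  have h := (N.continuous_cocycle a').strongCont.hasDerivAt_apply
    (N.hasDerivAt_star_cocycle hp.sa u ξ)
    (hasDerivAt_dysonSeries (N.strongCont_orbit a') (N.norm_orbit_le a') u (star (N.cocycle a u) ξ))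
  refine h.congr_deriv ?_
  have e : Complex.I • (N.cocycle a' u * (N.α u a' * star (N.cocycle a u))) +
      N.cocycle a' u * (-Complex.I • (N.α u a * star (N.cocycle a u))) =
      Complex.I • (N.cocycle a' u * N.α u (a' - a) * star (N.cocycle a u)) := by
    simp only [N.α_sub, mul_sub, sub_mul, smul_sub, mul_smul_comm, mul_assoc, neg_smul, mul_neg]
    abel
  exact congrArg (fun T : BoundedOp H => T ξ) e

/-- The mean value inequality for u ↦ W'_u W_u^* applied to the vector W_t ξ. -/
lemma norm_cocycle_sub_le (t : ℝ) : ‖N.cocycle a' t - N.cocycle a t‖ ≤ |t| * ‖a' - a‖ := by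
  refine ContinuousLinearMap.opNorm_le_bound _ (by positivity) fun ξ => ?_
  have h := Convex.norm_image_sub_le_of_norm_hasDerivWithin_le (s := univ) (x := 0) (y := t)
    (C := ‖a' - a‖ * ‖ξ‖)
    (fun u _ => (hp.hasDerivAt_cocycle_mul_star hp' u (N.cocycle a t ξ)).hasDerivWithinAt)
    (fun u _ => ?_) convex_univ (mem_univ _) (mem_univ _)
  · have e1 : star (N.cocycle a t) (N.cocycle a t ξ) = ξ :=
      congrArg (fun T : BoundedOp H => T ξ) (N.star_mul_cocycle hp.sa t)
    rw [e1, N.cocycle_zero, N.cocycle_zero, star_one] at h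
    rw [sub_apply]
    refine h.trans (le_of_eq ?_)
    rw [sub_zero, Real.norm_eq_abs]; ring
  · rw [smul_apply, norm_smul, Complex.norm_I, one_mul]
    refine (ContinuousLinearMap.le_of_opNorm_le _ (c := ‖a' - a‖) ?_ _).trans ?_
    · calc _ ≤ ‖N.cocycle a' u‖ * ‖N.α u (a' - a)‖ * ‖star (N.cocycle a u)‖ :=
            (norm_mul_le _ _).trans (by gcongr; exact norm_mul_le _ _)
        _ ≤ 1 * ‖a' - a‖ * 1 := by
            rw [norm_star, N.norm_α]
            have h1 := N.norm_cocycle_le hp.sa u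
            have h2 := N.norm_cocycle_le hp'.sa u
            gcongr
        _ = _ := by ring
    · gcongr
      refine ((N.cocycle a t).le_of_opNorm_le (N.norm_cocycle_le hp.sa t) ξ).trans (one_mul _).le

/-- Duhamel's formula. -/
lemma φ_cocycle_sub (t : ℝ) : 𝒮.φ (N.cocycle a' t) - 𝒮.φ (N.cocycle a t) =
    Complex.I * t * ∫ l in (0 : ℝ)..1,
      𝒮.φ (N.cocycle a' (l * t) * N.α (l * t) ((a' - a) * N.cocycle a (t - l * t))) := by
  have hd : a' - a ∈ 𝒮.dom := sub_mem (𝒮.smooth_le hp'.smooth) (𝒮.smooth_le hp.smooth)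
  have fW' : 𝒮.DomFamily fun u : ℝ => N.cocycle a' u := hp'.domFamily_cocycle continuous_id
  have fV : 𝒮.DomFamily fun u : ℝ => star (N.cocycle a u) := hp.domFamily_star_cocycle continuous_id
  have fW : 𝒮.DomFamily fun _ : ℝ => N.cocycle a t := DomFamily.const (hp.cocycle_dom t)
  have fM : 𝒮.DomFamily fun u : ℝ => N.cocycle a' u * N.α u ((a' - a) * N.cocycle a (t - u)) :=
    fW'.mul (((DomFamily.const hd).mul (hp.domFamily_cocycle (by fun_prop))).α continuous_id)
  -- As W_u^* W_t = α_u(W_{t-u}), the Duhamel integrand is a function of the pair (u, t - u). This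
  -- allows it to be continued in two variables.
  have e : ∀ u, N.cocycle a' u * N.α u (a' - a) * star (N.cocycle a u) * N.cocycle a t =
      N.cocycle a' u * N.α u ((a' - a) * N.cocycle a (t - u)) := fun u => by
    have h := N.cocycle_add hp.sa u (t - u)
    rw [add_sub_cancel] at h
    rw [N.α_mul, h]
    calc _ = N.cocycle a' u * N.α u (a' - a) * (star (N.cocycle a u) * N.cocycle a u) *
        N.α u (N.cocycle a (t - u)) := by simp only [mul_assoc]
      _ = _ := by rw [N.star_mul_cocycle hp.sa, mul_one, mul_assoc]
  have hderiv : ∀ u, HasDerivAt (fun u => 𝒮.φ (N.cocycle a' u * star (N.cocycle a u) * N.cocycle a t))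
      (Complex.I * 𝒮.φ (N.cocycle a' u * N.α u ((a' - a) * N.cocycle a (t - u)))) u := fun u => by
    have h := ((fW'.mul fV).mul fW).hasDerivAt (SMulMemClass.smul_mem Complex.I (fM.mem u)) (t := u)
      fun ξ => (hp.hasDerivAt_cocycle_mul_star hp' u (N.cocycle a t ξ)).congr_deriv ?_
    · rwa [map_smul, smul_eq_mul] at h
    · rw [← e]; rfl
  have h1 := intervalIntegral.integral_eq_sub_of_hasDerivAt (a := 0) (b := t) (fun u _ => hderiv u)
    ((continuous_const.mul fM.continuous).intervalIntegrable _ _)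
  rw [mul_assoc, N.star_mul_cocycle hp.sa, mul_one, N.cocycle_zero, N.cocycle_zero, star_one,
    one_mul, one_mul, intervalIntegral.integral_const_mul] at h1
  have h2 := intervalIntegral.smul_integral_comp_mul_right (a := 0) (b := 1)
    (fun u => 𝒮.φ (N.cocycle a' u * N.α u ((a' - a) * N.cocycle a (t - u)))) t
  rw [zero_mul, one_mul] at h2
  rw [← h1, ← h2, ← Complex.coe_smul, smul_eq_mul, mul_assoc]

/-- The interpolating function between two perturbations. -/
lemma exists_tube_interpolation : ∃ G : ℂ × ℂ → ℂ, IsTubeFunction G ∧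
    (∀ x y : ℝ, G (x, y) = 𝒮.φ (N.cocycle a' x * N.α x ((a' - a) * N.cocycle a y))) ∧
    (∀ x y : ℝ, G (x + Complex.I, y) =
      𝒮.pert a' (N.cocycle a' x * N.α x ((a' - a) * N.cocycle a y))) ∧
    ∀ x y : ℝ, G (x, y + Complex.I) =
      𝒮.ext (N.cocycle a) (N.α (-x) (N.cocycle a' x) * (a' - a)) (y + Complex.I) := by
  have hd : a' - a ∈ 𝒮.dom := sub_mem (𝒮.smooth_le hp'.smooth) (𝒮.smooth_le hp.smooth)
  obtain ⟨R₁, hR₁, haR₁⟩ := hp.exists_loc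
  obtain ⟨R₂, hR₂, haR₂⟩ := hp'.exists_loc
  set R := R₁ + R₂ with hR
  have hR0 : 0 ≤ R := by positivity
  have haR : a ∈ N.loc R := N.loc_mono (by linarith) haR₁
  have haR' : a' ∈ N.loc R := N.loc_mono (by linarith) haR₂
  have hl := fun y => cocycle_mem_loc hp.smooth hR0 haR y
  have hl' := fun y => cocycle_mem_loc hp'.smooth hR0 haR' y
  have fW' : 𝒮.DomFamily fun q : ℝ × ℝ => N.cocycle a' q.1 := hp'.domFamily_cocycle continuous_fst
  have fW : 𝒮.DomFamily fun q : ℝ × ℝ => N.cocycle a q.2 := hp.domFamily_cocycle continuous_snd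
  have fb : 𝒮.DomFamily fun _ : ℝ × ℝ => a' - a := DomFamily.const hd
  have fM : 𝒮.DomFamily fun q : ℝ × ℝ => N.cocycle a' q.1 * N.α q.1 ((a' - a) * N.cocycle a q.2) :=
    fW'.mul ((fb.mul fW).α continuous_fst)
  have fB : 𝒮.DomFamily fun q : ℝ × ℝ => N.α (-q.1) (N.cocycle a' q.1) * (a' - a) :=
    (fW'.α (by fun_prop)).mul fb
  have hMl : ∀ x y, N.cocycle a' x * N.α x ((a' - a) * N.cocycle a y) ∈ N.loc (R + |x| + |y|) :=
    fun x y => by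
      refine mul_mem (N.loc_mono (by linarith [abs_nonneg y]) (hl' x)) ?_
      have := N.α_mem_loc (ρ := R + |y|) (by positivity) (mul_mem (N.loc_mono
        (by linarith [abs_nonneg y]) (sub_mem haR' haR)) (hl y)) x
      exact N.loc_mono (by linarith) this
  have hBl : ∀ x y : ℝ, N.α (-x) (N.cocycle a' x) * (a' - a) ∈ N.loc (R + |2 * x| + |y|) :=
    fun x y => by
      have := N.α_mem_loc (by positivity) (hl' x) (-x)
      rw [abs_neg] at this
      refine mul_mem (N.loc_mono ?_ this) (N.loc_mono ?_ (sub_mem haR' haR))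
      · rw [abs_mul, abs_two]; linarith [abs_nonneg y]
      · linarith [abs_nonneg (2 * x), abs_nonneg y]
  have hMn : ∀ x y, ‖N.cocycle a' x * N.α x ((a' - a) * N.cocycle a y)‖ ≤ ‖a' - a‖ := fun x y => by
    refine (norm_mul_le _ _).trans ((mul_le_of_le_one_left (norm_nonneg _)
      (N.norm_cocycle_le hp'.sa x)).trans ?_)
    rw [N.norm_α]
    exact (norm_mul_le _ _).trans (mul_le_of_le_one_right (norm_nonneg _) (N.norm_cocycle_le hp.sa y))
  have hBn : ∀ x, ‖N.α (-x) (N.cocycle a' x) * (a' - a)‖ ≤ ‖a' - a‖ := fun x => by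
    refine (norm_mul_le _ _).trans (mul_le_of_le_one_left (norm_nonneg _) ?_)
    rw [N.norm_α]
    exact N.norm_cocycle_le hp'.sa x
  -- The x-continuation is `edgeCont_pert` with left factor 1. For y, translation invariance
  -- rewrites the function as φ(α_{-x}(W'_x)(a' - a) W_y), where the cocycle W_y stands last.
  refine exists_isTubeFunction fM.continuous (hp'.continuous_pert fM)
    (hp.goodFamily.cont_I (ω := fun _ => ()) fB continuous_const continuous_snd)
    (gaussBounded_φ hR0 (fun x y => fM.mem (x, y)) hMl hMn) ?_ ?_ (fun y => ?_) (fun x => ?_)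
  · have := hp'.goodFamily.gaussBounded_ext () (τ := fun _ _ => 0) hR0 (fun x y => fM.mem (x, y))
      hMl hMn (fun x y => by simp; positivity)
    simpa [pert] using this
  -- α_{-x}(W'_x) has radius R + 2|x|, twice what the Gaussian bound lemma allows, so it is applied
  -- with x/2 and the result is rescaled; this is the source of the 4.
  · obtain ⟨M, Λ, hb⟩ := hp.goodFamily.gaussBounded_ext ()
      (X := fun x _ => N.α (-(x / 2)) (N.cocycle a' (x / 2)) * (a' - a)) (τ := fun _ y => y) hR0
      (fun x y => fB.mem (x / 2, y)) (fun x y => by simpa [mul_div_cancel₀] using hBl (x / 2) y)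
      (fun x y => hBn (x / 2)) (fun x y => by linarith [abs_nonneg x])
    have hM : 0 ≤ M := by simpa using (norm_nonneg _).trans (hb 0 0)
    refine ⟨M, 4 * |Λ|, fun x y => ?_⟩
    have h := hb (2 * x) y
    beta_reduce at h
    rw [mul_div_cancel_left₀ _ two_ne_zero] at h
    refine h.trans (mul_le_mul_of_nonneg_left (Real.exp_le_exp.2 ?_) hM)
    calc Λ * ((2 * x) ^ 2 + y ^ 2) ≤ |Λ| * ((2 * x) ^ 2 + y ^ 2) := by gcongr; exact le_abs_self Λ
      _ ≤ 4 * |Λ| * (x ^ 2 + y ^ 2) := by nlinarith [mul_nonneg (abs_nonneg Λ) (sq_nonneg y)]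
  · have := hp'.edgeCont_pert (one_mem _) (mul_mem hd (hp.cocycle_dom y))
    simpa only [one_mul, N.γ_one, mul_one] using this
  · have := hp.goodFamily.edgeCont_shift () (fB.mem (x, 0)) 0
    simp only [add_zero, Complex.ofReal_zero] at this
    have e : ∀ y, 𝒮.φ (N.cocycle a' x * N.α x ((a' - a) * N.cocycle a y)) =
        𝒮.φ (N.α (-x) (N.cocycle a' x) * (a' - a) * N.cocycle a y) := fun y => by
      have := 𝒮.φ_α (-x) (fM.mem (x, y))
      simpa only [N.α_mul, N.α_α, neg_add_cancel, N.α_zero, mul_assoc] using this.symm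
    simp only [e]
    exact this

/-- Duhamel's formula at real t is i t times the integral over l of G(lt, (1 - l)t). Continued to t
= i, its arguments (li, (1 - l)i) lie on the third edge of the triangle. There Phragmén–Lindelöf
needs only the bounds on the two lines over the imaginary vertices, which are the hypotheses. -/
lemma norm_pert_one_sub_le {M Λ : ℝ} (hΛ : 0 ≤ Λ)
    (hA : ∀ t, ‖𝒮.pert a' (N.cocycle a' (-t) * N.α (-t) ((a' - a) * N.cocycle a t))‖ ≤
      M * Real.exp (Λ * t ^ 2))
    (hB : ∀ t : ℝ, ‖𝒮.ext (N.cocycle a) (N.α t (N.cocycle a' (-t)) * (a' - a)) (t + Complex.I)‖ ≤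
      M * Real.exp (Λ * t ^ 2)) :
    ‖𝒮.pert a' 1 - 𝒮.pert a 1‖ ≤ M * Real.exp Λ := by
  obtain ⟨G, hG, G0, G1, G2⟩ := hp.exists_tube_interpolation hp'
  have hmem : ∀ (l : ℝ), ∀ z ∈ closedStrip,
      ((clamp l : ℂ) * z, ((1 - clamp l : ℝ) : ℂ) * z) ∈ triTube := fun l z hz => by
    obtain ⟨h0, h1⟩ := clamp_mem l
    refine ⟨?_, ?_, ?_⟩ <;> simp only [Complex.im_ofReal_mul]
    · exact mul_nonneg h0 hz.1
    · exact mul_nonneg (by linarith) hz.1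
    · nlinarith [hz.2]
  have hint := isStripAnalytic_intervalIntegral
    (G := fun l z => G ((clamp l : ℂ) * z, ((1 - clamp l : ℝ) : ℂ) * z)) ?_ (fun l => ?_) 0 1
  · have h1 := hp.goodFamily.isStripContinuation () (one_mem 𝒮.dom)
    have h2 := hp'.goodFamily.isStripContinuation () (one_mem 𝒮.dom)
    have hz : IsStripAnalytic fun z => Complex.I * z :=
      Differentiable.isStripAnalytic (by fun_prop)
    have key := (h2.1.sub h1.1).eqOn (hz.mul hint) (fun t => ?_) I_mem_closedStrip
    · change 𝒮.pert a' 1 - 𝒮.pert a 1 = _ at key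
      rw [key, norm_mul, norm_mul, Complex.norm_I, one_mul, one_mul]
      refine (intervalIntegral.norm_integral_le_of_norm_le_const (C := M * Real.exp Λ)
        fun l _ => ?_).trans (by simp)
      have h3 := hG.third_edge.1.norm_le_exp hG.third_edge.2 hΛ (M := M) (fun t => ?_) (fun t => ?_)
        (((1 - clamp l : ℝ) : ℂ) * Complex.I) ?_
      · have e : Complex.I - ((1 - clamp l : ℝ) : ℂ) * Complex.I = clamp l * Complex.I := by
          push_cast; ring
        rw [e] at h3
        refine h3.trans (le_of_eq ?_)
        simp
      · have := G1 (-t) t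
        have e : Complex.I - (t : ℂ) = ((-t : ℝ) : ℂ) + Complex.I := by push_cast; ring
        rw [e, this]
        exact hA t
      · have := G2 (-t) t
        have e : Complex.I - ((t : ℂ) + Complex.I) = ((-t : ℝ) : ℂ) := by push_cast; ring
        rw [e, this, neg_neg]
        exact hB t
      · obtain ⟨h0, h1⟩ := clamp_mem l
        simp only [closedStrip, mem_ofPred_eq, Complex.im_ofReal_mul, Complex.I_im, mul_one]
        constructor <;> linarith
    · rw [h2.2, h1.2]
      beta_reduce
      rw [one_mul, one_mul, hp.φ_cocycle_sub hp']
      congr 1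
      refine intervalIntegral.integral_congr fun l hl => ?_
      rw [uIcc_of_le zero_le_one] at hl
      have := G0 (l * t) (t - l * t)
      rw [← this, clamp_of_mem hl]
      congr 2 <;> push_cast <;> ring
  · have hc := continuous_clamp
    have hr := continuous_stripRetract
    exact hG.cont.comp_continuous (by fun_prop) fun p => hmem p.1 _ (stripRetract_mem _)
  · have := hG.diff 0 ((clamp l : ℂ), ((1 - clamp l : ℝ) : ℂ)) openStrip isOpen_openStrip
      fun z hz => by simpa [mul_comm] using hmem l z (openStrip_subset hz)
    simpa [mul_comm] using this

end EvenPerturbation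

namespace OddPerturbation

variable {Q : BoundedOp H} (hQ : 𝒮.OddPerturbation Q)

include hQ

/-- The perturbed functionals are normalized. -/
theorem pert_one {r : ℝ} (hr : r ∈ Icc (0 : ℝ) 1) : 𝒮.pert (𝒮.pertElement Q r) 1 = 1 := by
  obtain ⟨C, c, hC, hc, hφ⟩ := 𝒮.φ_bound
  obtain ⟨R, hR, hQR⟩ := 𝒮.exists_loc Q (𝒮.smooth_le hQ.smooth)
  have hδR := 𝒮.δ_loc R Q hQ.smooth hQR
  have hQQd := mul_mem (𝒮.smooth_le hQ.smooth) (𝒮.smooth_le hQ.smooth)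
  have hQQR := mul_mem hQR hQR
  set A := ‖𝒮.δ Q‖ + ‖Q * Q‖ with hA
  have haR : ∀ s, 𝒮.pertElement Q s ∈ N.loc R := fun s =>
    add_mem (SMulMemClass.smul_mem _ hδR) (SMulMemClass.smul_mem _ hQQR)
  have haA : ∀ s ∈ Icc (0 : ℝ) 1, ‖𝒮.pertElement Q s‖ ≤ A := fun s hs => by
    refine (norm_add_le _ _).trans (add_le_add ?_ ?_)
    · rw [norm_smul, Complex.norm_real, Real.norm_eq_abs, abs_of_nonneg hs.1]
      exact mul_le_of_le_one_left (norm_nonneg _) hs.2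
    · rw [norm_smul, norm_pow, Complex.norm_real, Real.norm_eq_abs, abs_of_nonneg hs.1]
      exact mul_le_of_le_one_left (norm_nonneg _) (pow_le_one₀ hs.1 hs.2)
  have hdiff : ∀ s s', 𝒮.pertElement Q s' - 𝒮.pertElement Q s =
      ((s' - s : ℝ) : ℂ) • (𝒮.δ Q + ((s' + s : ℝ) : ℂ) • (Q * Q)) := fun s s' => by
    simp only [pertElement]; push_cast; module
  have hnb : ∀ s ∈ Icc (0 : ℝ) 1, ∀ s' ∈ Icc (0 : ℝ) 1,
      ‖𝒮.pertElement Q s' - 𝒮.pertElement Q s‖ ≤ 2 * A * |s' - s| := fun s hs s' hs' => by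
    rw [hdiff, norm_smul, Complex.norm_real, Real.norm_eq_abs, mul_comm]
    gcongr
    refine (norm_add_le _ _).trans ?_
    rw [norm_smul, Complex.norm_real, Real.norm_eq_abs, abs_of_nonneg (by linarith [hs.1, hs'.1])]
    have : (s' + s) * ‖Q * Q‖ ≤ 2 * ‖Q * Q‖ := by gcongr; linarith [hs.2, hs'.2]
    linarith [norm_nonneg (𝒮.δ Q)]
  set K := C * Real.exp (A * Real.exp (2 * c * R ^ 2 + 2 * c)) * Real.exp (3 * c * R ^ 2) with hK
  set L := K * Real.exp (24 * c * R ^ 2) with hL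
  -- 96c arises from the radius R + 2|t| in e^{12cρ²}, 12c from the real part of z, and 1 from |t| ≤
  -- e^{t²}.
  set Λ := 108 * c + 1 with hΛ
  have hK0 : 0 ≤ K := by positivity
  have hL0 : 0 ≤ L := by positivity
  have hb : ∀ s ∈ Icc (0 : ℝ) 1, ∀ X ∈ 𝒮.dom, ∀ E t : ℝ, 0 ≤ E → X ∈ N.loc (R + 2 * |t|) →
      ‖X‖ ≤ E * |t| → ∀ z ∈ closedStrip, z.re ^ 2 ≤ t ^ 2 →
      ‖𝒮.ext (N.cocycle (𝒮.pertElement Q s)) X z‖ ≤ L * E * Real.exp (Λ * t ^ 2) := by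
    intro s hs X hX E t hE hXR hXE z hz hzt
    have hp := hQ.evenPerturbation s
    refine (norm_ext_cocycle_le hp.smooth hp.even hp.sa hR (haR s) hC hc hφ (haA s hs) (by positivity)
      hX hXR hz).trans ?_
    rw [← hK]
    have h1 : (R + 2 * |t|) ^ 2 ≤ 2 * R ^ 2 + 8 * t ^ 2 := by
      nlinarith [sq_abs t, sq_nonneg (R - 2 * |t|)]
    have h2 : |t| ≤ Real.exp (t ^ 2) := by
      refine le_trans ?_ (Real.add_one_le_exp _)
      nlinarith [sq_abs t, sq_nonneg (|t| - 1), sq_nonneg t]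
    calc _ ≤ K * Real.exp (12 * c * (2 * R ^ 2 + 8 * t ^ 2)) * (E * Real.exp (t ^ 2)) *
          Real.exp (12 * c * t ^ 2) := by gcongr; exact hXE.trans (by gcongr)
      _ = _ := by
        have e1 : Real.exp (Λ * t ^ 2) = Real.exp (96 * c * t ^ 2) * Real.exp (t ^ 2) *
            Real.exp (12 * c * t ^ 2) := by
          rw [← Real.exp_add, ← Real.exp_add, hΛ]; ring_nf
        have e2 : Real.exp (12 * c * (2 * R ^ 2 + 8 * t ^ 2)) =
            Real.exp (24 * c * R ^ 2) * Real.exp (96 * c * t ^ 2) := by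
          rw [← Real.exp_add]; ring_nf
        rw [e1, e2, hL]; ring
  have hQQ : ∀ s ∈ Icc (0 : ℝ) 1, ‖𝒮.pert (𝒮.pertElement Q s) (Q * Q)‖ ≤
      L * ‖Q * Q‖ * Real.exp (Λ * 1 ^ 2) := fun s hs =>
    hb s hs _ hQQd _ 1 (norm_nonneg _) (N.loc_mono (by simp) hQQR) (by simp) _ I_mem_closedStrip
      (by simp)
  set D := L * ‖Q * Q‖ * Real.exp (Λ * 1 ^ 2) with hD
  have hD0 : 0 ≤ D := by positivity
  set M := D + L * (2 * A) ^ 2 with hM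
  -- As δ_r(Q) = δ(Q) + 2r Q², one has a_{s'} - a_s = (s' - s)(δ_r(Q) + (s' + s - 2r) Q²), and the
  -- perturbed functional kills δ_r(Q). For r = s or r = s' the remainder is quadratic in s' - s.
  have hpb : ∀ s s' r, 𝒮.pert (𝒮.pertElement Q r)
      (𝒮.pertElement Q s' - 𝒮.pertElement Q s) = ((s' - s : ℝ) : ℂ) * (s' + s - 2 * r : ℝ) *
        𝒮.pert (𝒮.pertElement Q r) (Q * Q) := fun s s' r => by
    have hp := hQ.evenPerturbation r
    have hd := 𝒮.smooth_le (hQ.pertδ_smooth r hQ.smooth)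
    have e : 𝒮.pertElement Q s' - 𝒮.pertElement Q s = ((s' - s : ℝ) : ℂ) •
        (𝒮.pertδ Q r Q + ((s' + s - 2 * r : ℝ) : ℂ) • (Q * Q)) := by
      rw [hdiff, pertδ, hQ.odd, neg_mul]; push_cast; module
    rw [e, hp.pert_smul _ (add_mem hd (SMulMemClass.smul_mem _ hQQd)),
      hp.pert_add hd (SMulMemClass.smul_mem _ hQQd), hp.pert_smul _ hQQd,
      hQ.pert_pertδ r hQ.smooth, zero_add, mul_assoc]
  have hquad : ∀ s ∈ Icc (0 : ℝ) 1, ∀ s' ∈ Icc (0 : ℝ) 1,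
      ‖𝒮.pert (𝒮.pertElement Q s') 1 - 𝒮.pert (𝒮.pertElement Q s) 1‖ ≤
        M * Real.exp Λ * |s' - s| ^ 2 := by
    intro s hs s' hs'
    have hp := hQ.evenPerturbation s
    have hp' := hQ.evenPerturbation s'
    have hn := hnb s hs s' hs'
    have hbd : 𝒮.pertElement Q s' - 𝒮.pertElement Q s ∈ 𝒮.smooth := sub_mem hp'.smooth hp.smooth
    have hbR : 𝒮.pertElement Q s' - 𝒮.pertElement Q s ∈ N.loc R := sub_mem (haR s') (haR s)
    have hsub := hp.norm_cocycle_sub_le hp'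
    have hWR := cocycle_mem_loc hp.smooth hR (haR s)
    have hWR' := cocycle_mem_loc hp'.smooth hR (haR s')
    have hflow := hQ.pert_flow s hbd
    have hflow' := hQ.pert_flow s' hbd
    have hpb1 := hpb s s' s
    have hpb2 := hpb s s' s'
    have hQQ1 := hQQ s hs
    have hQQ2 := hQQ s' hs'
    have hb1 := hb s hs
    have hb2 := hb s' hs'
    set a := 𝒮.pertElement Q s
    set a' := 𝒮.pertElement Q s'
    set b := a' - a with hbdef
    set E := (2 * A * |s' - s|) ^ 2 with hE
    have hE0 : 0 ≤ E := by positivity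
    have hb2E : ‖b‖ ^ 2 ≤ E := pow_le_pow_left₀ (norm_nonneg _) hn 2
    have hfin : ∀ t : ℝ, |s' - s| ^ 2 * D + L * E * Real.exp (Λ * t ^ 2) ≤
        M * |s' - s| ^ 2 * Real.exp (Λ * t ^ 2) := fun t => by
      have h1 : 1 ≤ Real.exp (Λ * t ^ 2) := Real.one_le_exp (by positivity)
      have h2 : |s' - s| ^ 2 * D ≤ |s' - s| ^ 2 * D * Real.exp (Λ * t ^ 2) :=
        le_mul_of_one_le_right (by positivity) h1
      calc _ ≤ |s' - s| ^ 2 * D * Real.exp (Λ * t ^ 2) + L * E * Real.exp (Λ * t ^ 2) := by gcongr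
        _ = _ := by rw [hM, hE]; ring
    have hsq : |s' - s| * |s' - s| = |s' - s| ^ 2 := (sq _).symm
    refine (hp.norm_pert_one_sub_le hp' (M := M * |s' - s| ^ 2) (Λ := Λ) (by positivity)
      (fun t => ?_) (fun t => ?_)).trans (le_of_eq (by ring))
    · have hXd : N.cocycle a' (-t) * N.α (-t) (b * (N.cocycle a' t - N.cocycle a t)) ∈ 𝒮.dom :=
        mul_mem (hp'.cocycle_dom _) (𝒮.α_dom _ _ (mul_mem (𝒮.smooth_le hbd)
          (sub_mem (hp'.cocycle_dom t) (hp.cocycle_dom t))))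
      -- Replacing W_t by W'_t creates the flow of b, on which the functional has the quadratically
      -- small value at b itself. The error has norm at most |t| ‖b‖², which is again quadratic.
      have e : N.cocycle a' (-t) * N.α (-t) (b * N.cocycle a t) = N.flow a' (-t) b -
          N.cocycle a' (-t) * N.α (-t) (b * (N.cocycle a' t - N.cocycle a t)) := by
        rw [GradedNet.flow_eq hp'.sa, neg_neg, mul_sub, N.α_sub, mul_sub, sub_sub_cancel]
      rw [e, hp'.pert_sub (𝒮.smooth_le (hp'.flow_smooth _ hbd)) hXd, hflow', hpb2]
      refine (norm_sub_le _ _).trans ((add_le_add ?_ ?_).trans (hfin t))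
      · rw [norm_mul, norm_mul, Complex.norm_real, Complex.norm_real, Real.norm_eq_abs,
          Real.norm_eq_abs, show s' + s - 2 * s' = -(s' - s) by ring, abs_neg, hsq]
        gcongr
      · refine hb2 _ hXd E t hE0 ?_ ?_ _ I_mem_closedStrip (by simpa using sq_nonneg t)
        · have h1 := hWR' (-t)
          have h2 := N.α_mem_loc (by positivity) (mul_mem (N.loc_mono (by linarith [abs_nonneg t]) hbR)
            (sub_mem (hWR' t) (hWR t))) (-t)
          rw [abs_neg] at h1 h2
          exact mul_mem (N.loc_mono (by linarith [abs_nonneg t]) h1) (N.loc_mono (by linarith) h2)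
        · refine (norm_mul_le _ _).trans ((mul_le_of_le_one_left (norm_nonneg _)
            (N.norm_cocycle_le hp'.sa _)).trans ?_)
          rw [N.norm_α]
          calc _ ≤ ‖b‖ * (|t| * ‖b‖) := (norm_mul_le _ _).trans (by gcongr; exact hsub t)
            _ = ‖b‖ ^ 2 * |t| := by ring
            _ ≤ _ := by gcongr
    · have hXd : N.α t (N.cocycle a' (-t) - N.cocycle a (-t)) * b ∈ 𝒮.dom :=
        mul_mem (𝒮.α_dom _ _ (sub_mem (hp'.cocycle_dom _) (hp.cocycle_dom _))) (𝒮.smooth_le hbd)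
      have hYd : N.α t (N.cocycle a (-t)) * b ∈ 𝒮.dom :=
        mul_mem (𝒮.α_dom _ _ (hp.cocycle_dom _)) (𝒮.smooth_le hbd)
      -- Here W' is replaced by W instead. Translating the main term to i turns it into the
      -- unperturbed-index flow of b, and the error again contains two small factors.
      have e : N.α t (N.cocycle a' (-t)) * b = N.α t (N.cocycle a (-t)) * b +
          N.α t (N.cocycle a' (-t) - N.cocycle a (-t)) * b := by
        rw [N.α_sub, sub_mul, add_sub_cancel]
      have e2 : N.α (-t) (N.α t (N.cocycle a (-t)) * b * N.cocycle a t) = N.flow a (-t) b := by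
        rw [GradedNet.flow_eq hp.sa, mul_assoc, N.α_mul, N.α_α, neg_add_cancel, N.α_zero, neg_neg]
      have e3 := hp.goodFamily.ext_add () hYd hXd (ofReal_add_I_mem_closedStrip t)
      rw [e, e3, hp.ext_add_I hYd, e2, hflow, hpb1]
      refine (norm_add_le _ _).trans ((add_le_add ?_ ?_).trans (hfin t))
      · rw [norm_mul, norm_mul, Complex.norm_real, Complex.norm_real, Real.norm_eq_abs,
          Real.norm_eq_abs, show s' + s - 2 * s = s' - s by ring, hsq]
        gcongr
      · refine hb1 _ hXd E t hE0 ?_ ?_ _ (ofReal_add_I_mem_closedStrip t) (by simp)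
        · have h1 := hWR' (-t)
          have h2 := hWR (-t)
          rw [abs_neg] at h1 h2
          have h3 := N.α_mem_loc (by positivity) (sub_mem h1 h2) t
          exact mul_mem (N.loc_mono (by linarith) h3) (N.loc_mono (by linarith [abs_nonneg t]) hbR)
        · refine (norm_mul_le _ _).trans ?_
          rw [N.norm_α]
          have h1 := hsub (-t)
          rw [abs_neg] at h1
          calc _ ≤ (|t| * ‖b‖) * ‖b‖ := by gcongr
            _ = ‖b‖ ^ 2 * |t| := by ring
            _ ≤ _ := by gcongr
  -- At coupling 0 the cocycle is identically 1 and the continuation is the constant φ(1).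
  have h0 : 𝒮.pert (𝒮.pertElement Q 0) 1 = 1 := by
    have hp := hQ.evenPerturbation 0
    have e : 𝒮.pertElement Q 0 = 0 := by simp [pertElement]
    have hW : ∀ t, N.cocycle (0 : BoundedOp H) t = 1 := fun t => by
      have hz : 𝒮.EvenPerturbation (0 : BoundedOp H) := e ▸ hp
      have h := dysonSeries_eq (N.strongCont_orbit (0 : BoundedOp H)) (N.norm_orbit_le 0) t
      have h2 : ∀ u, N.α u (0 : BoundedOp H) = 0 := fun u => by simp [N.α_eq]
      simp only [h2, mul_zero] at h
      have h3 : sint (fun _ : ℝ => (0 : BoundedOp H)) 0 t = 0 := by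
        ext ξ
        rw [sint_apply (strongCont_const 0)]
        simp
      rw [h3, smul_zero, add_zero] at h
      simpa [GradedNet.cocycle, h2] using h
    have hc : IsStripContinuation (fun t => 𝒮.φ (1 * N.cocycle (0 : BoundedOp H) t)) fun _ => 1 :=
      ⟨(differentiable_const _).isStripAnalytic, fun t => by simp only [hW, mul_one, 𝒮.φ_one]⟩
    rw [e]
    exact hc.stripExt_eq I_mem_closedStrip
  rw [← h0]
  exact eq_of_norm_sub_le_sq (f := fun s => 𝒮.pert (𝒮.pertElement Q s) 1) hr.1
    fun x hx y hy => hquad y ⟨hy.1, hy.2.trans hr.2⟩ x ⟨hx.1, hx.2.trans hr.2⟩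

end OddPerturbation

end LocalSystem

/-! ### Partially defined maps and domains of their powers. -/

section PartialMaps

variable {V W : Type*} [AddCommGroup V] [Module ℂ V] [AddCommGroup W] [Module ℂ W]

lemma pval_of_mem (f : V →ₗ.[ℂ] W) {x : V} (hx : x ∈ f.domain) : pval f x = f ⟨x, hx⟩ := dif_pos hx

lemma pval_add (f : V →ₗ.[ℂ] W) {x y : V} (hx : x ∈ f.domain) (hy : y ∈ f.domain) :
    pval f (x + y) = pval f x + pval f y := by
  rw [pval_of_mem f hx, pval_of_mem f hy, pval_of_mem f (add_mem hx hy), ← LinearPMap.map_add]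
  rfl

lemma pval_smul (f : V →ₗ.[ℂ] W) (c : ℂ) {x : V} (hx : x ∈ f.domain) :
    pval f (c • x) = c • pval f x := by
  rw [pval_of_mem f hx, pval_of_mem f (f.domain.smul_mem c hx), ← LinearPMap.map_smul]
  rfl

/-- An algebraic extension to the whole space, with no continuity. It allows the local data to use
total linear maps; values off the domain play no role. -/
lemma exists_linearMap_extending (f : V →ₗ.[ℂ] W) : ∃ g : V →ₗ[ℂ] W, ∀ x ∈ f.domain, g x = pval f x := by
  obtain ⟨g, hg⟩ := LinearMap.exists_extend f.toFun
  refine ⟨g, fun x hx => ?_⟩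
  rw [pval_of_mem f hx]
  exact LinearMap.congr_fun hg ⟨x, hx⟩

variable (f : V →ₗ.[ℂ] V)

lemma powDomain_succ_subset (n : ℕ) : powDomain f (n + 1) ⊆ powDomain f n := by
  induction n with
  | zero => exact fun _ _ => trivial
  | succ n ih => exact fun x hx => ⟨hx.1, ih hx.2⟩

lemma add_mem_powDomain {n : ℕ} {x y : V} (hx : x ∈ powDomain f n) (hy : y ∈ powDomain f n) :
    x + y ∈ powDomain f n := by
  induction n generalizing x y with
  | zero => trivial
  | succ n ih =>
    refine ⟨add_mem hx.1 hy.1, ?_⟩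
    rw [pval_add f hx.1 hy.1]
    exact ih hx.2 hy.2

lemma smul_mem_powDomain {n : ℕ} (c : ℂ) {x : V} (hx : x ∈ powDomain f n) :
    c • x ∈ powDomain f n := by
  induction n generalizing x with
  | zero => trivial
  | succ n ih =>
    refine ⟨f.domain.smul_mem c hx.1, ?_⟩
    rw [pval_smul f c hx.1]
    exact ih hx.2

lemma neg_mem_powDomain {n : ℕ} {x : V} (hx : x ∈ powDomain f n) : -x ∈ powDomain f n := by
  rw [← neg_one_smul ℂ]; exact smul_mem_powDomain f _ hx

lemma zero_mem_powDomain (n : ℕ) : (0 : V) ∈ powDomain f n := by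
  induction n with
  | zero => trivial
  | succ n ih =>
    refine ⟨zero_mem _, ?_⟩
    have := pval_smul f 0 (zero_mem f.domain)
    rw [zero_smul, zero_smul] at this
    rwa [this]

variable {f}

lemma mem_domain_of_mem_smoothDomain {x : V} (hx : x ∈ smoothDomain f) : x ∈ f.domain := (hx 1).1

lemma pval_mem_smoothDomain {x : V} (hx : x ∈ smoothDomain f) : pval f x ∈ smoothDomain f :=
  fun n => (hx (n + 1)).2

end PartialMaps

lemma isClosed_mem_of_tendsto_prod {X : Type*} (T : TopologicalSpace X) {s : Set (X × X)}
    (hs : IsClosed s) {u v : ℕ → X} {x y : X} (hu : Tendsto u atTop (𝓝 x))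
    (hv : Tendsto v atTop (𝓝 y)) (h : ∀ n, (u n, v n) ∈ s) : (x, y) ∈ s :=
  hs.mem_of_tendsto (hu.prodMk_nhds hv) (Eventually.of_forall h)

lemma BddInterval.size_symm_le {ρ : ℝ} (hρ : 0 ≤ ρ) : (BddInterval.symm ρ).size ^ 2 ≤ 2 + 2 * ρ ^ 2 := by
  have h1 : (BddInterval.symm ρ).size ≤ 1 + ρ := by
    refine Real.sSup_le ?_ (by positivity)
    rintro _ ⟨x, hx, rfl⟩
    simp only [BddInterval.toSet, BddInterval.symm, max_eq_left hρ] at hx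
    exact abs_le.2 ⟨hx.1.le, hx.2.le⟩
  have h0 : 0 ≤ (BddInterval.symm ρ).size := by
    refine Real.sSup_nonneg ?_
    rintro _ ⟨x, -, rfl⟩
    exact abs_nonneg x
  nlinarith [sq_nonneg (ρ - 1)]

/-! ### Algebra and closedness of the smooth elements. -/

namespace GradedNet

variable {H : Type*} [NormedAddCommGroup H] [InnerProductSpace ℂ H] [CompleteSpace H]
  (N : GradedNet H)

/-- The union of the local algebras as a `*`-algebra. -/
def localAlgebra : StarSubalgebra ℂ (BoundedOp H) where
  carrier := N.localPart
  mul_mem' hx hy := by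
    rw [mem_localPart_iff] at *
    obtain ⟨ρ, hρ, hx⟩ := hx
    obtain ⟨ρ', -, hy⟩ := hy
    exact ⟨max ρ ρ', le_max_of_le_left hρ, mul_mem (N.loc_mono (le_max_left _ _) hx)
      (N.loc_mono (le_max_right _ _) hy)⟩
  add_mem' hx hy := by
    rw [mem_localPart_iff] at *
    obtain ⟨ρ, hρ, hx⟩ := hx
    obtain ⟨ρ', -, hy⟩ := hy
    exact ⟨max ρ ρ', le_max_of_le_left hρ, add_mem (N.loc_mono (le_max_left _ _) hx)
      (N.loc_mono (le_max_right _ _) hy)⟩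
  algebraMap_mem' c := N.mem_localPart_iff.2 ⟨0, le_rfl, algebraMap_mem _ c⟩
  star_mem' hx := by
    rw [mem_localPart_iff] at *
    obtain ⟨ρ, hρ, hx⟩ := hx
    exact ⟨ρ, hρ, star_mem hx⟩

variable {N}

lemma α_mem_localAlgebra {x : BoundedOp H} (hx : x ∈ N.localAlgebra) (t : ℝ) :
    N.α t x ∈ N.localAlgebra := by
  obtain ⟨ρ, hρ, hx⟩ := N.mem_localPart_iff.1 hx
  exact N.mem_localPart_iff.2 ⟨_, by positivity, N.α_mem_loc hρ hx t⟩

lemma γ_mem_localAlgebra {x : BoundedOp H} (hx : x ∈ N.localAlgebra) : N.γ x ∈ N.localAlgebra := by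
  obtain ⟨ρ, hρ, hx⟩ := N.mem_localPart_iff.1 hx
  exact N.mem_localPart_iff.2 ⟨ρ, hρ, N.γ_mem_loc hx⟩

lemma mem_localAlgebra_of_mem {I : BddInterval} {x : BoundedOp H} (hx : x ∈ N.alg I) :
    x ∈ N.localAlgebra := mem_iUnion.2 ⟨I, hx⟩

namespace IsSuperderivation

variable {δ : BoundedOp H →ₗ.[ℂ] BoundedOp H} (hδ : N.IsSuperderivation δ)

include hδ

lemma α_mem_domain (t : ℝ) {x : BoundedOp H} (hx : x ∈ δ.domain) : N.α t x ∈ δ.domain := by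
  have := hδ.domain_α t
  rw [← SetLike.mem_coe, ← this]
  exact ⟨x, hx, rfl⟩

lemma γ_mem_domain {x : BoundedOp H} (hx : x ∈ δ.domain) : N.γ x ∈ δ.domain := by
  have := hδ.domain_γ
  rw [← SetLike.mem_coe, ← this]
  exact ⟨x, hx, rfl⟩

lemma pval_γ {x : BoundedOp H} (hx : x ∈ δ.domain) : pval δ (N.γ x) = -N.γ (pval δ x) := by
  rw [hδ.comm_γ x hx, neg_neg]

lemma pval_one : pval δ 1 = 0 := by
  have h1 := hδ.domain_algebra.one_mem
  have := hδ.leibniz 1 h1 1 h1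
  rw [N.γ_one, one_mul, mul_one, one_mul] at this
  exact left_eq_add.1 this

lemma γ_mem_powDomain {n : ℕ} {x : BoundedOp H} (hx : x ∈ powDomain δ n) : N.γ x ∈ powDomain δ n := by
  induction n generalizing x with
  | zero => trivial
  | succ n ih =>
    refine ⟨hδ.γ_mem_domain hx.1, ?_⟩
    rw [hδ.pval_γ hx.1]
    exact neg_mem_powDomain δ (ih hx.2)

lemma α_mem_powDomain (t : ℝ) {n : ℕ} {x : BoundedOp H} (hx : x ∈ powDomain δ n) :
    N.α t x ∈ powDomain δ n := by
  induction n generalizing x with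
  | zero => trivial
  | succ n ih =>
    refine ⟨hδ.α_mem_domain t hx.1, ?_⟩
    rw [← hδ.comm_α t x hx.1]
    exact ih hx.2

lemma star_mem_powDomain {n : ℕ} {x : BoundedOp H} (hx : x ∈ powDomain δ n) :
    star x ∈ powDomain δ n := by
  induction n generalizing x with
  | zero => trivial
  | succ n ih =>
    refine ⟨hδ.domain_algebra.star_mem x hx.1, ?_⟩
    rw [hδ.map_star x hx.1]
    exact hδ.γ_mem_powDomain (ih hx.2)

lemma mul_mem_powDomain {n : ℕ} {x y : BoundedOp H} (hx : x ∈ powDomain δ n)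
    (hy : y ∈ powDomain δ n) : x * y ∈ powDomain δ n := by
  induction n generalizing x y with
  | zero => trivial
  | succ n ih =>
    refine ⟨hδ.domain_algebra.mul_mem x hx.1 y hy.1, ?_⟩
    rw [hδ.leibniz x hx.1 y hy.1]
    exact add_mem_powDomain δ (ih hx.2 (powDomain_succ_subset δ n hy))
      (ih (hδ.γ_mem_powDomain (powDomain_succ_subset δ n hx)) hy.2)

lemma one_mem_powDomain (n : ℕ) : (1 : BoundedOp H) ∈ powDomain δ n := by
  cases n with
  | zero => trivial
  | succ n =>
    refine ⟨hδ.domain_algebra.one_mem, ?_⟩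
    rw [hδ.pval_one]
    exact zero_mem_powDomain δ n

/-- Strong bounded convergence is σ-weak convergence, so closedness of the graph applies to each
consecutive pair of levels m and m + 1. Membership in all powers then follows by chaining the
levels. -/
lemma mem_powDomain_of_closed {ρ : ℝ} {x : ℕ → ℕ → BoundedOp H} {y : ℕ → BoundedOp H}
    (hx : ∀ m n, x m n ∈ δ.domain ∧ x m n ∈ N.loc ρ) (hδx : ∀ m n, x (m + 1) n = pval δ (x m n))
    (hb : ∀ m, ∃ C, ∀ n, ‖x m n‖ ≤ C) (hy : ∀ m ξ, Tendsto (fun n => x m n ξ) atTop (𝓝 (y m ξ)))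
    (m : ℕ) : y m ∈ smoothDomain δ ∧ y m ∈ N.loc ρ ∧ y (m + 1) = pval δ (y m) := by
  have hσ : ∀ m, Tendsto (x m) atTop (@nhds _ (sigmaWeak H) (y m)) := fun m => by
    obtain ⟨C, hC⟩ := hb m
    exact tendsto_sigmaWeak (Eventually.of_forall hC) (hy m)
  have key : ∀ m, y m ∈ δ.domain ∧ y m ∈ N.loc ρ ∧ y (m + 1) = pval δ (y m) := fun m => by
    have h := hδ.closed (BddInterval.symm ρ)
    exact isClosed_mem_of_tendsto_prod (sigmaWeak H) h (hσ m) (hσ (m + 1))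
      fun n => ⟨(hx m n).1, (hx m n).2, hδx m n⟩
  refine ⟨fun k => ?_, (key m).2⟩
  induction k generalizing m with
  | zero => trivial
  | succ k ih => exact ⟨(key m).1, (key m).2.2 ▸ ih (m + 1)⟩

end IsSuperderivation

end GradedNet

lemma tendsto_of_continuous_induced {A X ι : Type*} (T : TopologicalSpace X) {j : A → X} {ω : A → ℂ}
    (hω : @Continuous _ _ (T.induced j) inferInstance ω) {l : Filter ι} {u : ι → A} {a : A}
    (h : Tendsto (fun i => j (u i)) l (𝓝 (j a))) : Tendsto (fun i => ω (u i)) l (𝓝 (ω a)) := by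
  let _ : TopologicalSpace A := T.induced j
  refine (hω.tendsto a).comp ?_
  rw [nhds_induced, tendsto_comap_iff]
  exact h

/-! ### The local data obtained from the hypotheses. -/

namespace GradedNet

variable {H : Type*} [NormedAddCommGroup H] [InnerProductSpace ℂ H] [CompleteSpace H]
  {N : GradedNet H} {δ : BoundedOp H →ₗ.[ℂ] BoundedOp H} {φ : BoundedOp H →ₗ.[ℂ] ℂ}

/-- The localized domain of a functional as a `*`-algebra. -/
def localDomain (N : GradedNet H) (φ : BoundedOp H →ₗ.[ℂ] ℂ) (h : IsUnitalStarDomain φ.domain) :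
    StarSubalgebra ℂ (BoundedOp H) where
  carrier := φ.domain ∩ N.localPart
  mul_mem' hx hy := ⟨h.mul_mem _ hx.1 _ hy.1, N.localAlgebra.mul_mem' hx.2 hy.2⟩
  add_mem' hx hy := ⟨add_mem hx.1 hy.1, N.localAlgebra.add_mem' hx.2 hy.2⟩
  algebraMap_mem' c := ⟨by
    rw [Algebra.algebraMap_eq_smul_one]
    exact φ.domain.smul_mem c h.one_mem, algebraMap_mem N.localAlgebra c⟩
  star_mem' hx := ⟨h.star_mem _ hx.1, N.localAlgebra.star_mem' hx.2⟩

/-- The localized smooth elements of a superderivation as a `*`-algebra. -/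
def smoothAlgebra (hδ : N.IsSuperderivation δ) : StarSubalgebra ℂ (BoundedOp H) where
  carrier := N.smoothLocal δ
  mul_mem' hx hy := ⟨fun n => hδ.mul_mem_powDomain (hx.1 n) (hy.1 n),
    N.localAlgebra.mul_mem' hx.2 hy.2⟩
  add_mem' hx hy := ⟨fun n => add_mem_powDomain δ (hx.1 n) (hy.1 n),
    N.localAlgebra.add_mem' hx.2 hy.2⟩
  algebraMap_mem' c := ⟨fun n => by
    rw [Algebra.algebraMap_eq_smul_one]
    exact smul_mem_powDomain δ c (hδ.one_mem_powDomain n), algebraMap_mem N.localAlgebra c⟩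
  star_mem' hx := ⟨fun n => hδ.star_mem_powDomain (hx.1 n), N.localAlgebra.star_mem' hx.2⟩

lemma IsSuperderivation.pval_mem_smoothLocal (hδ : N.IsSuperderivation δ) {x : BoundedOp H}
    (hx : x ∈ N.smoothLocal δ) : pval δ x ∈ N.smoothLocal δ := by
  refine ⟨pval_mem_smoothDomain hx.1, ?_⟩
  obtain ⟨I, hI⟩ := mem_iUnion.1 hx.2
  exact mem_iUnion.2 ⟨I, hδ.map_local I x (mem_domain_of_mem_smoothDomain hx.1) hI⟩

lemma LocallyNormal.tendsto (h : N.LocallyNormal φ) {ι : Type*} {l : Filter ι} {ρ C : ℝ}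
    {x : ι → BoundedOp H} {y : BoundedOp H} (hx : ∀ᶠ i in l, x i ∈ φ.domain ∧ x i ∈ N.loc ρ)
    (hy : y ∈ φ.domain) (hyρ : y ∈ N.loc ρ) (hC : ∀ᶠ i in l, ‖x i‖ ≤ C)
    (hxy : ∀ ξ, Tendsto (fun i => x i ξ) l (𝓝 (y ξ))) :
    Tendsto (fun i => pval φ (x i)) l (𝓝 (pval φ y)) := by
  classical
  obtain ⟨ω, hω, hωφ⟩ := h.2 (BddInterval.symm ρ)
  -- Indices at which x i is not yet localized receive the default value y. They do not affect the
  -- limit.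
  let u : ι → (N.alg (BddInterval.symm ρ)).toStarSubalgebra := fun i =>
    if h : x i ∈ N.loc ρ then ⟨x i, h⟩ else ⟨y, hyρ⟩
  have hu : ∀ᶠ i in l, (u i : BoundedOp H) = x i := by
    filter_upwards [hx] with i hi
    simp only [u, dif_pos hi.2]
  have h1 := tendsto_sigmaWeak hC hxy
  have h2 := tendsto_of_continuous_induced (sigmaWeak H) hω (u := u) (a := ⟨y, hyρ⟩) (l := l)
    (h1.congr' (hu.mono fun i hi => hi.symm))
  rw [hωφ _ hy] at h2
  refine h2.congr' ?_
  filter_upwards [hu, hx] with i hi hxi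
  rw [hωφ _ (by rw [hi]; exact hxi.1), hi]

/-- The local data of a locally exponentially bounded super-KMS functional. -/
lemma IsSKMS.exists_localSystem (hδ : N.IsSuperderivation δ) (hφ : N.IsSKMS δ φ)
    (hexp : N.LocallyExpBounded φ) : ∃ 𝒮 : LocalSystem N,
      (𝒮.dom : Set (BoundedOp H)) = (φ.domain : Set (BoundedOp H)) ∩ N.localPart ∧
      (𝒮.smooth : Set (BoundedOp H)) = N.smoothLocal δ ∧
      (∀ x ∈ φ.domain, 𝒮.φ x = pval φ x) ∧ ∀ x ∈ δ.domain, 𝒮.δ x = pval δ x := by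
  obtain ⟨f, hf⟩ := exists_linearMap_extending φ
  obtain ⟨d, hd⟩ := exists_linearMap_extending δ
  have hdom := hφ.domainProperties
  have hα : ∀ t, ∀ x ∈ φ.domain, N.α t x ∈ φ.domain := fun t x hx => by
    have := hdom.domain_flow t
    rw [← SetLike.mem_coe, ← this]
    exact ⟨x, hx, rfl⟩
  have hγ : ∀ x ∈ φ.domain, N.γ x ∈ φ.domain := fun x hx => by
    have := hdom.domain_γ
    rw [← SetLike.mem_coe, ← this]
    exact ⟨x, hx, rfl⟩
  have hmul := hdom.domain_algebra.mul_mem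
  have hs : ∀ x ∈ N.smoothLocal δ, x ∈ δ.domain := fun x hx => mem_domain_of_mem_smoothDomain hx.1
  have hsd : ∀ x ∈ N.smoothLocal δ, d x ∈ N.smoothLocal δ := fun x hx => by
    rw [hd x (hs x hx)]
    exact hδ.pval_mem_smoothLocal hx
  have hsφ := hφ.weakSupersymmetry.1
  have hpow : ∀ x ∈ N.smoothLocal δ, ∀ m, (d ^ m) x ∈ N.smoothLocal δ := fun x hx m => by
    induction m with
    | zero => exact hx
    | succ m ih => rw [pow_succ', Module.End.mul_apply]; exact hsd _ ih
  refine ⟨{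
    dom := N.localDomain φ hdom.domain_algebra
    smooth := smoothAlgebra hδ
    φ := f
    δ := d
    smooth_le := fun x hx => ⟨hsφ hx, hx.2⟩
    exists_loc := fun x hx => N.mem_localPart_iff.1 hx.2
    α_dom := fun t x hx => ⟨hα t x hx.1, α_mem_localAlgebra hx.2 t⟩
    γ_dom := fun x hx => ⟨hγ x hx.1, γ_mem_localAlgebra hx.2⟩
    α_smooth := fun t x hx => ⟨fun n => hδ.α_mem_powDomain t (hx.1 n), α_mem_localAlgebra hx.2 t⟩
    γ_smooth := fun x hx => ⟨fun n => hδ.γ_mem_powDomain (hx.1 n), γ_mem_localAlgebra hx.2⟩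
    δ_smooth := hsd
    δ_loc := fun ρ x hx hxρ => by
      rw [hd x (hs x hx)]
      exact hδ.map_local _ x (hs x hx) hxρ
    leibniz := fun x hx y hy => by
      rw [hd x (hs x hx), hd y (hs y hy), hd _ (hδ.domain_algebra.mul_mem x (hs x hx) y (hs y hy)),
        hδ.leibniz x (hs x hx) y (hs y hy)]
    δ_α := fun t x hx => by
      rw [hd x (hs x hx), hd _ (hδ.α_mem_domain t (hs x hx)), hδ.comm_α t x (hs x hx)]
    δ_γ := fun x hx => by
      rw [hd x (hs x hx), hd _ (hδ.γ_mem_domain (hs x hx)), hδ.pval_γ (hs x hx)]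
    closed := ?_
    φ_bound := ?_
    φ_tendsto := ?_
    φ_star := fun x hx => by
      rw [hf x hx.1, hf _ (hdom.domain_algebra.star_mem x hx.1), hdom.hermitian x hx.1]
    φ_one := by rw [hf 1 hdom.domain_algebra.one_mem, hφ.normalized]
    kms := ?_
    φ_δ := fun x hx => by
      rw [hd x (hs x hx), hf _ (hsφ (hδ.pval_mem_smoothLocal hx)), hφ.derivationInvariant.2 x hx]
    susy := ?_ }, rfl, rfl, hf, hd⟩
  · intro ρ x y hx hb hy
    have hloc : ∀ m n, (d ^ m) (x n) ∈ N.loc ρ := fun m n => by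
      induction m with
      | zero => exact (hx n).2
      | succ m ih =>
        have h := hs _ (hpow _ (hx n).1 m)
        rw [pow_succ', Module.End.mul_apply, hd _ h]
        exact hδ.map_local _ _ h ih
    have key := hδ.mem_powDomain_of_closed (x := fun m n => (d ^ m) (x n))
      (fun m n => ⟨hs _ (hpow _ (hx n).1 m), hloc m n⟩)
      (fun m n => by rw [pow_succ', Module.End.mul_apply, hd _ (hs _ (hpow _ (hx n).1 m))]) hb hy
    refine ⟨⟨(key 0).1, mem_localAlgebra_of_mem (key 0).2.1⟩, fun m => ?_⟩
    induction m with
    | zero => rfl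
    | succ m ih =>
      rw [pow_succ', Module.End.mul_apply, ih, hd _ (mem_domain_of_mem_smoothDomain (key m).1),
        (key m).2.2]
  · obtain ⟨C₁, hC₁, C₂, hC₂, h⟩ := hexp
    -- The interval of radius 1 + ρ satisfies |I|² ≤ 2 + 2ρ², whence the constants.
    refine ⟨C₁ * Real.exp (2 * C₂), 2 * C₂, by positivity, by positivity, fun ρ hρ x hx hxρ => ?_⟩
    rw [hf x hx.1, mul_assoc C₁, ← Real.exp_add]
    refine (h _ x hx.1 hxρ).trans ?_
    gcongr
    nlinarith [BddInterval.size_symm_le hρ]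
  · intro ι l ρ C x y hx hy hyρ hC hxy
    have h := hφ.locallyNormal.tendsto (hx.mono fun i hi => ⟨hi.1.1, hi.2⟩) hy.1 hyρ hC hxy
    rw [hf y hy.1]
    refine h.congr' ?_
    filter_upwards [hx] with i hi
    exact (hf _ hi.1.1).symm
  · intro x hx y hy
    obtain ⟨F, ⟨hF, h0, h1⟩, C, -, p, -, hb⟩ := hφ.superKMS x hx.1 y hy.1
    refine ⟨F, hF, ⟨C, p, hb⟩, fun t => ?_, fun t => ?_⟩
    · rw [h0, hf _ (hmul _ hx.1 _ (hα t y hy.1))]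
    · rw [h1, hf _ (hmul _ (hα t y hy.1) _ (hγ x hx.1))]
  · intro x hx z hz y hy
    have hdy := hδ.pval_mem_smoothLocal hy
    have h := hφ.weakSupersymmetry.2 x hx z hz y hy
    rw [hd y (hs y hy), hd _ (hs _ hdy),
      hf _ (hmul _ (hmul _ hx.1 _ (hsφ (hδ.pval_mem_smoothLocal hdy))) _ hz.1)]
    refine h.congr_of_eventuallyEq (Eventually.of_forall fun t => ?_)
    exact hf _ (hmul _ (hmul _ hx.1 _ (hα t y (hsφ hy))) _ hz.1)

end GradedNet

/-! ### The perturbed superderivation and its smooth domain. -/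

namespace GradedNet

variable {H : Type*} [NormedAddCommGroup H] [InnerProductSpace ℂ H] [CompleteSpace H]
  {N : GradedNet H} {δ : BoundedOp H →ₗ.[ℂ] BoundedOp H} {φ : BoundedOp H →ₗ.[ℂ] ℂ}
  {Q : BoundedOp H} {r : ℝ}

lemma gradedComm_of_odd (hQ : N.γ Q = -Q) (x : BoundedOp H) :
    N.gradedComm Q x = Q * x - N.γ x * Q := by
  have hQ' : N.Γ * Q * N.Γ = -Q := hQ
  rw [gradedComm, gradedCommutator, hQ', γ]
  simp only [sub_neg_eq_add, add_neg_cancel, mul_zero, smul_zero, sub_mul, add_mul, mul_add]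
  module

section PerturbedDerivation

lemma pval_perturbedDerivation (hQ : N.γ Q = -Q) {x : BoundedOp H} (hx : x ∈ δ.domain) :
    pval (N.perturbedDerivation δ Q r) x = pval δ x + (r : ℂ) • (Q * x - N.γ x * Q) := by
  rw [pval_of_mem δ hx, pval_of_mem (N.perturbedDerivation δ Q r) (x := x) hx,
    ← gradedComm_of_odd hQ]
  rfl

variable (hδ : N.IsSuperderivation δ) (hQ : Q ∈ smoothDomain δ) (hQ_odd : N.γ Q = -Q)

include hδ hQ hQ_odd

/-- Q is smooth and the domains of powers are algebras stable under γ, so x ↦ r(Qx - γ(x)Q)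
preserves each of them. The two superderivations thus have the same iterated domains, by induction.
-/
lemma powDomain_perturbedDerivation (n : ℕ) :
    powDomain (N.perturbedDerivation δ Q r) n = powDomain δ n := by
  induction n with
  | zero => rfl
  | succ n ih =>
    have hc : ∀ x ∈ powDomain δ n, (r : ℂ) • (Q * x - N.γ x * Q) ∈ powDomain δ n := fun x hx =>
      smul_mem_powDomain δ _ (sub_eq_add_neg (Q * x) _ ▸ add_mem_powDomain δ
        (hδ.mul_mem_powDomain (hQ n) hx)
        (neg_mem_powDomain δ (hδ.mul_mem_powDomain (hδ.γ_mem_powDomain hx) (hQ n))))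
    ext x
    constructor
    · rintro ⟨h1, h2⟩
      change x ∈ δ.domain at h1
      rw [ih, pval_perturbedDerivation hQ_odd h1] at h2
      refine ⟨h1, ?_⟩
      have hx : x ∈ powDomain δ n := by
        rw [← ih]
        exact powDomain_succ_subset _ n ⟨h1, by rwa [ih, pval_perturbedDerivation hQ_odd h1]⟩
      have := add_mem_powDomain δ h2 (neg_mem_powDomain δ (hc x hx))
      rwa [add_neg_cancel_right] at this
    · intro h
      refine ⟨h.1, ?_⟩
      rw [ih, pval_perturbedDerivation hQ_odd h.1]
      exact add_mem_powDomain δ h.2 (hc x (powDomain_succ_subset δ n h))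

lemma smoothLocal_perturbedDerivation :
    N.smoothLocal (N.perturbedDerivation δ Q r) = N.smoothLocal δ := by
  have : smoothDomain (N.perturbedDerivation δ Q r) = smoothDomain δ := by
    ext x
    simp only [smoothDomain, powDomain_perturbedDerivation hδ hQ hQ_odd]
  rw [smoothLocal, smoothLocal, this]

end PerturbedDerivation

end GradedNet

/-! ### Translation between the local data and the partially defined maps. -/

/-- The local data of a functional and a superderivation, and a perturbation. -/
structure LocalSystem.Represents {H : Type*} [NormedAddCommGroup H] [InnerProductSpace ℂ H]
    [CompleteSpace H] {N : GradedNet H} (𝒮 : LocalSystem N) (δ : BoundedOp H →ₗ.[ℂ] BoundedOp H)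
    (φ : BoundedOp H →ₗ.[ℂ] ℂ) : Prop where
  dom : (𝒮.dom : Set (BoundedOp H)) = (φ.domain : Set (BoundedOp H)) ∩ N.localPart
  smooth : (𝒮.smooth : Set (BoundedOp H)) = N.smoothLocal δ
  map_φ : ∀ x ∈ φ.domain, 𝒮.φ x = pval φ x
  map_δ : ∀ x ∈ δ.domain, 𝒮.δ x = pval δ x

namespace LocalSystem.Represents

variable {H : Type*} [NormedAddCommGroup H] [InnerProductSpace ℂ H] [CompleteSpace H]
  {N : GradedNet H} {𝒮 : LocalSystem N} {δ : BoundedOp H →ₗ.[ℂ] BoundedOp H}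
  {φ φr : BoundedOp H →ₗ.[ℂ] ℂ} {Q : BoundedOp H} {r : ℝ} (h𝒮 : 𝒮.Represents δ φ)

include h𝒮

lemma mem_dom {x : BoundedOp H} : x ∈ 𝒮.dom ↔ x ∈ φ.domain ∧ x ∈ N.localPart := by
  rw [← SetLike.mem_coe, h𝒮.dom]; rfl

lemma mem_smooth {x : BoundedOp H} : x ∈ 𝒮.smooth ↔ x ∈ N.smoothLocal δ := by
  rw [← SetLike.mem_coe, h𝒮.smooth]

lemma mem_domain_of_mem_smooth {x : BoundedOp H} (hx : x ∈ 𝒮.smooth) : x ∈ δ.domain :=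
  mem_domain_of_mem_smoothDomain (h𝒮.mem_smooth.1 hx).1

lemma perturbingElement_eq (hQ : Q ∈ 𝒮.smooth) : perturbingElement δ Q r = 𝒮.pertElement Q r := by
  rw [perturbingElement, pertElement, h𝒮.map_δ Q (h𝒮.mem_domain_of_mem_smooth hQ)]

lemma oddPerturbation (hδ : N.IsSuperderivation δ) (hQ : Q ∈ N.smoothLocal δ)
    (hQ_odd : N.γ Q = -Q) (hQ_sa : IsSelfAdjoint Q) : 𝒮.OddPerturbation Q where
  smooth := h𝒮.mem_smooth.2 hQ
  odd := hQ_odd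
  sa := hQ_sa
  δ_sa := by
    have hQd : Q ∈ δ.domain := mem_domain_of_mem_smoothDomain hQ.1
    have h1 := hδ.map_star Q hQd
    have h2 := 𝒮.δ_γ Q (h𝒮.mem_smooth.2 hQ)
    rw [hQ_odd, map_neg, neg_inj, h𝒮.map_δ Q hQd] at h2
    rw [hQ_sa.star_eq, N.γ_star, ← h2] at h1
    rw [h𝒮.map_δ Q hQd]
    exact h1.symm

variable (hQ : 𝒮.OddPerturbation Q)

include hQ

lemma γr_one (t : ℝ) : N.γr δ Q r t 1 = N.cocycle (𝒮.pertElement Q r) t := by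
  rw [GradedNet.γr, h𝒮.perturbingElement_eq hQ.smooth, N.perturbedCocycle_eq, N.α_one, mul_one]

lemma αr_eq (t : ℝ) (x : BoundedOp H) : N.αr δ Q r t x = N.flow (𝒮.pertElement Q r) t x := by
  rw [GradedNet.αr, h𝒮.perturbingElement_eq hQ.smooth,
    N.perturbedFlow_eq (hQ.evenPerturbation r).sa]
  rfl

lemma mul_γr_mem {x : BoundedOp H} (hx : x ∈ 𝒮.dom) (t : ℝ) : x * N.γr δ Q r t 1 ∈ φ.domain := by
  rw [h𝒮.γr_one hQ]
  exact (h𝒮.mem_dom.1 (mul_mem hx ((hQ.evenPerturbation r).cocycle_dom t))).1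

lemma isStripContinuation {x : BoundedOp H} (hx : x ∈ 𝒮.dom) :
    IsStripContinuation (fun t => pval φ (x * N.γr δ Q r t 1))
      (𝒮.ext (N.cocycle (𝒮.pertElement Q r)) x) := by
  have h := (hQ.evenPerturbation r).goodFamily.isStripContinuation () hx
  refine ⟨h.1, fun t => ?_⟩
  rw [h.2]
  beta_reduce
  rw [← h𝒮.γr_one hQ, h𝒮.map_φ _ (h𝒮.mul_γr_mem hQ hx t)]

lemma existsUnique_isPerturbedFunctional :
    ∃! φr : BoundedOp H →ₗ.[ℂ] ℂ, N.IsPerturbedFunctional δ φ Q r φr := by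
  have hp := hQ.evenPerturbation r
  refine ⟨{
    domain := 𝒮.dom.toSubalgebra.toSubmodule
    toFun :=
      { toFun := fun x => 𝒮.pert (𝒮.pertElement Q r) x
        map_add' := fun x y => hp.pert_add x.2 y.2
        map_smul' := fun c x => hp.pert_smul c x.2 } }, ⟨h𝒮.dom, fun x hx =>
      ⟨_, h𝒮.isStripContinuation hQ hx, pval_of_mem _ hx⟩⟩, fun ψ hψ => ?_⟩
  have hdom : ψ.domain = 𝒮.dom.toSubalgebra.toSubmodule :=
    SetLike.coe_injective (hψ.1.trans h𝒮.dom.symm)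
  refine LinearPMap.ext hdom fun x h1 h2 => ?_
  obtain ⟨F, hF, hFI⟩ := hψ.2 x h1
  rw [← pval_of_mem ψ h1, hFI]
  exact hF.eqOn (h𝒮.isStripContinuation hQ h2) I_mem_closedStrip

variable (hφr : N.IsPerturbedFunctional δ φ Q r φr)

include hφr

lemma mem_perturbed_domain {x : BoundedOp H} : x ∈ φr.domain ↔ x ∈ 𝒮.dom := by
  rw [← SetLike.mem_coe, hφr.1, ← h𝒮.dom, SetLike.mem_coe]

lemma pval_perturbed {x : BoundedOp H} (hx : x ∈ 𝒮.dom) :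
    pval φr x = 𝒮.pert (𝒮.pertElement Q r) x := by
  obtain ⟨F, hF, hFI⟩ := hφr.2 x ((h𝒮.mem_perturbed_domain hQ hφr).2 hx)
  rw [hFI]
  exact hF.eqOn (h𝒮.isStripContinuation hQ hx) I_mem_closedStrip

lemma locallyBounded_perturbed : N.LocallyBounded φr := by
  intro I
  obtain ⟨ρ, hρ, hI⟩ := N.exists_alg_subset_loc I
  obtain ⟨K, Λ, -, -, hb⟩ := (hQ.evenPerturbation r).goodFamily.bound
  refine ⟨K * Real.exp (Λ * ρ ^ 2), fun x hx hxI => ?_⟩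
  have hx' := (h𝒮.mem_perturbed_domain hQ hφr).1 hx
  have := hb () ρ hρ x hx' (hI x hxI) _ I_mem_closedStrip
  rw [h𝒮.pval_perturbed hQ hφr hx']
  simpa [pert] using this

lemma domainProperties_perturbed (hφ : N.DomainProperties N.α φ) :
    N.DomainProperties (N.αr δ Q r) φr := by
  have hp := hQ.evenPerturbation r
  have hm : ∀ {x}, x ∈ φr.domain ↔ x ∈ 𝒮.dom := h𝒮.mem_perturbed_domain hQ hφr
  refine ⟨fun x hx => subset_closure (h𝒮.mem_dom.1 (hm.1 hx)).2,
    ⟨hm.2 (one_mem _), fun x hx y hy => hm.2 (mul_mem (hm.1 hx) (hm.1 hy)),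
      fun x hx => hm.2 (star_mem (hm.1 hx))⟩, fun x hx => ?_, fun I => ?_, fun t => ?_, ?_⟩
  · rw [h𝒮.pval_perturbed hQ hφr (hm.1 hx), h𝒮.pval_perturbed hQ hφr (star_mem (hm.1 hx)),
      hp.pert_star (hm.1 hx)]
  -- Localization changes nothing inside a single local algebra, so density is inherited from φ.
  · have : (φr.domain : Set (BoundedOp H)) ∩ N.alg I = (φ.domain : Set (BoundedOp H)) ∩ N.alg I := by
      have hI : (N.alg I : Set (BoundedOp H)) ⊆ N.localPart := fun x hx => mem_iUnion.2 ⟨I, hx⟩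
      rw [hφr.1, inter_assoc, inter_eq_self_of_subset_right hI]
    rw [this]
    exact hφ.domain_dense I
  · refine Subset.antisymm ?_ fun x hx => ⟨N.flow (𝒮.pertElement Q r) (-t) x,
      hm.2 (hp.flow_dom _ (hm.1 hx)), ?_⟩
    · rintro _ ⟨x, hx, rfl⟩
      rw [h𝒮.αr_eq hQ]
      exact hm.2 (hp.flow_dom t (hm.1 hx))
    · rw [h𝒮.αr_eq hQ, GradedNet.flow_flow hp.sa, add_neg_cancel, GradedNet.flow_zero]
  · refine Subset.antisymm ?_ fun x hx => ⟨N.γ x, hm.2 (𝒮.γ_dom x (hm.1 hx)), N.γ_γ x⟩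
    rintro _ ⟨x, hx, rfl⟩
    exact hm.2 (𝒮.γ_dom x (hm.1 hx))

lemma superKMS_perturbed : N.SuperKMSWithoutGrowth (N.αr δ Q r) φr := by
  have hp := hQ.evenPerturbation r
  intro x hx y hy
  rw [h𝒮.mem_perturbed_domain hQ hφr] at hx hy
  obtain ⟨F, hF, -, h0, h1⟩ := hp.edgeCont_flow hx hy
  refine ⟨F, hF, fun t => ?_, fun t => ?_⟩
  · rw [h0, h𝒮.αr_eq hQ, h𝒮.pval_perturbed hQ hφr (mul_mem hx (hp.flow_dom t hy))]
  · rw [h1, h𝒮.αr_eq hQ, h𝒮.pval_perturbed hQ hφr (mul_mem (hp.flow_dom t hy) (𝒮.γ_dom x hx))]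

lemma perturbedDerivation_local (hφ : N.DerivationInvariant δ φ)
    {I : BddInterval} (hQI : Q ∈ N.alg I) {x : BoundedOp H} (hx : x ∈ δ.domain) (hxI : x ∈ N.alg I)
    (hxr : x ∈ φr.domain) : pval (N.perturbedDerivation δ Q r) x ∈ φr.domain ∧
      pval (N.perturbedDerivation δ Q r) x ∈ N.alg I := by
  rw [h𝒮.mem_perturbed_domain hQ hφr] at hxr ⊢
  have hδx := hφ.1 I x hx hxI
  have hQd := 𝒮.smooth_le hQ.smooth
  rw [GradedNet.pval_perturbedDerivation hQ.odd hx]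
  refine ⟨add_mem (h𝒮.mem_dom.2 ⟨hδx.1, mem_iUnion.2 ⟨I, hδx.2⟩⟩)
    (SMulMemClass.smul_mem _ (sub_mem (mul_mem hQd hxr) (mul_mem (𝒮.γ_dom x hxr) hQd))),
    add_mem (S := StarSubalgebra ℂ (BoundedOp H)) (s := (N.alg I).toStarSubalgebra) hδx.2
      (SMulMemClass.smul_mem _ (sub_mem (mul_mem hQI hxI) (mul_mem (N.γ_mem_alg hxI) hQI)))⟩

omit hφr in
lemma pval_perturbedDerivation {x : BoundedOp H} (hx : x ∈ 𝒮.smooth) :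
    pval (N.perturbedDerivation δ Q r) x = 𝒮.pertδ Q r x := by
  have hxd := h𝒮.mem_domain_of_mem_smooth hx
  rw [GradedNet.pval_perturbedDerivation hQ.odd hxd, pertδ, h𝒮.map_δ x hxd]

omit hφr in
lemma smoothLocal_perturbedDerivation (hδ : N.IsSuperderivation δ) {x : BoundedOp H} :
    x ∈ N.smoothLocal (N.perturbedDerivation δ Q r) ↔ x ∈ 𝒮.smooth := by
  rw [GradedNet.smoothLocal_perturbedDerivation hδ (h𝒮.mem_smooth.1 hQ.smooth).1 hQ.odd,
    h𝒮.mem_smooth]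

lemma vanishesOnDerivatives_perturbed (hδ : N.IsSuperderivation δ) :
    N.VanishesOnDerivatives (N.perturbedDerivation δ Q r) φr := by
  intro x hx
  rw [h𝒮.smoothLocal_perturbedDerivation hQ hδ] at hx
  rw [h𝒮.pval_perturbedDerivation hQ hx,
    h𝒮.pval_perturbed hQ hφr (𝒮.smooth_le (hQ.pertδ_smooth r hx)), hQ.pert_pertδ r hx]

lemma weakSupersymmetry_perturbed (hδ : N.IsSuperderivation δ) :
    N.WeakSupersymmetry (N.αr δ Q r) (N.perturbedDerivation δ Q r) φr := by
  have hp := hQ.evenPerturbation r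
  have hm : ∀ {x}, x ∈ φr.domain ↔ x ∈ 𝒮.dom := h𝒮.mem_perturbed_domain hQ hφr
  refine ⟨fun y hy => hm.2 (𝒮.smooth_le ((h𝒮.smoothLocal_perturbedDerivation hQ hδ).1 hy)), ?_⟩
  intro x hx z hz y hy
  have hx := hm.1 hx.1
  have hz := hm.1 hz.1
  rw [h𝒮.smoothLocal_perturbedDerivation hQ hδ] at hy
  have hg := hp.gen_smooth hy
  rw [h𝒮.pval_perturbedDerivation hQ hy, h𝒮.pval_perturbedDerivation hQ (hQ.pertδ_smooth r hy),
    hQ.pertδ_pertδ r hy, h𝒮.pval_perturbed hQ hφr (mul_mem (mul_mem hx (𝒮.smooth_le hg)) hz)]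
  have h := hp.hasDerivAt_pert_flow hx hz hy 0
  rw [GradedNet.flow_zero] at h
  refine h.congr_of_eventuallyEq (Eventually.of_forall fun t => ?_)
  beta_reduce
  rw [h𝒮.αr_eq hQ, h𝒮.pval_perturbed hQ hφr
    (mul_mem (mul_mem hx (hp.flow_dom t (𝒮.smooth_le hy))) hz)]

end LocalSystem.Represents

end

/-! ### The proposition. -/

theorem proposition4p5 {H : Type*} [NormedAddCommGroup H] [InnerProductSpace ℂ H] [CompleteSpace H]
    [TopologicalSpace.SeparableSpace H] (hH : ¬ FiniteDimensional ℂ H)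
    (N : GradedNet H)
    (δ : BoundedOp H →ₗ.[ℂ] BoundedOp H) (hδ : N.IsSuperderivation δ)
    (φ : BoundedOp H →ₗ.[ℂ] ℂ) (hφ : N.IsSKMS δ φ) (hφ_exp : N.LocallyExpBounded φ)
    (Q : BoundedOp H) (hQ : Q ∈ N.smoothLocal δ) (hQ_odd : N.γ Q = -Q) (hQ_sa : IsSelfAdjoint Q)
    (r : ℝ) (hr : r ∈ Set.Icc (0 : ℝ) 1) :
    -- the series defining the perturbed groups converge
    (∀ x ∈ (φ.domain : Set (BoundedOp H)) ∩ N.localPart, ∀ t : ℝ,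
      DysonConverges (fun y z => y * z - z * y) N.α (perturbingElement δ Q r) t x ∧
      DysonConverges (fun y z => y * z) N.α (perturbingElement δ Q r) t x) ∧
    -- the function to be continued is defined, and has exactly one continuation to the strip
    (∀ x ∈ (φ.domain : Set (BoundedOp H)) ∩ N.localPart,
      (∀ t : ℝ, x * N.γr δ Q r t 1 ∈ φ.domain) ∧
      (∃ F : ℂ → ℂ, IsStripContinuation (fun t => pval φ (x * N.γr δ Q r t 1)) F) ∧
      ∀ F G : ℂ → ℂ, IsStripContinuation (fun t => pval φ (x * N.γr δ Q r t 1)) F →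
        IsStripContinuation (fun t => pval φ (x * N.γr δ Q r t 1)) G →
        Set.EqOn F G closedStrip) ∧
    -- the perturbed functional is well defined, as a linear functional on its domain
    (∃! φr : BoundedOp H →ₗ.[ℂ] ℂ, N.IsPerturbedFunctional δ φ Q r φr) ∧
    -- and it has the properties of a super-KMS functional for the perturbed system
    ∀ φr : BoundedOp H →ₗ.[ℂ] ℂ, N.IsPerturbedFunctional δ φ Q r φr →
      N.LocallyBounded φr ∧
      N.DomainProperties (N.αr δ Q r) φr ∧
      N.SuperKMSWithoutGrowth (N.αr δ Q r) φr ∧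
      pval φr 1 = 1 ∧
      (∀ I, Q ∈ N.alg I →
        ∀ x ∈ (N.perturbedDerivation δ Q r).domain, x ∈ N.alg I → x ∈ φr.domain →
          pval (N.perturbedDerivation δ Q r) x ∈ φr.domain ∧
          pval (N.perturbedDerivation δ Q r) x ∈ N.alg I) ∧
      N.VanishesOnDerivatives (N.perturbedDerivation δ Q r) φr ∧
      N.WeakSupersymmetry (N.αr δ Q r) (N.perturbedDerivation δ Q r) φr := by
  obtain ⟨𝒮, h1, h2, h3, h4⟩ := hφ.exists_localSystem hδ hφ_exp
  have h𝒮 : 𝒮.Represents δ φ := ⟨h1, h2, h3, h4⟩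
  have hp := h𝒮.oddPerturbation hδ hQ hQ_odd hQ_sa
  refine ⟨fun x _ t => ?_, fun x hx => ?_, h𝒮.existsUnique_isPerturbedFunctional hp, fun φr hφr => ?_⟩
  · rw [h𝒮.perturbingElement_eq hp.smooth]
    exact ⟨N.dysonConverges_ad (hp.evenPerturbation r).sa t x, N.dysonConverges_mul _ t x⟩
  · have hx' : x ∈ 𝒮.dom := h𝒮.mem_dom.2 hx
    exact ⟨h𝒮.mul_γr_mem hp hx', ⟨_, h𝒮.isStripContinuation hp hx'⟩, fun F G hF hG => hF.eqOn hG⟩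
  · exact ⟨h𝒮.locallyBounded_perturbed hp hφr,
      h𝒮.domainProperties_perturbed hp hφr hφ.domainProperties,
      h𝒮.superKMS_perturbed hp hφr,
      by rw [h𝒮.pval_perturbed hp hφr (one_mem _), hp.pert_one hr],
      fun I hQI x hx hxI hxr =>
        h𝒮.perturbedDerivation_local hp hφr hφ.derivationInvariant hQI hx hxI hxr,
      h𝒮.vanishesOnDerivatives_perturbed hp hφr hδ,
      h𝒮.weakSupersymmetry_perturbed hp hφr hδ⟩
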